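/- Let $f(x,y)$ be real-analytic near the origin of $\mathbb{R}^2$, $f(0,0)=0$, with a hyperbolic Morse critical point (saddle) at the origin, and let $P(x,y,\varepsilon)$, $Q(x,y,\varepsilon)$ be real-analytic near the origin of $\mathbb{R}^3$. For small real $\varepsilon$ let $\mathcal{F}_\varepsilon$ be the (complexified) foliation $df+\varepsilon(P\,dx+Q\,dy)=0$ near $0\in\mathbb{C}^2$. Assume that coordinates have been chosen so that for all small $\varepsilon$ the two separatrices of $\mathcal{F}_\varepsilon$ are the axes $\{x=0\}$ and $\{y=0\}$, and that $f>0$ in the open first quadrant near the origin. Then for all sufficiently small $x_0,y_0>0$ the following holds. Let $\sigma$ and $\tau$ be complex analytic discs through $(0,y_0)$ and $(x_0,0)$ respectively, invariant under $(x,y)\mapsto(\bar x,\bar y)$, transversal to the separatrices and parameterized by $z=f|_\sigma$ and $z=f|_\tau$. For small real $z>0$ let $d_\varepsilon(z)$ be the parameter of the intersection with $\tau$ of the real orbit of $\mathcal{F}_\varepsilon$ in the first quadrant through the point $z\in\sigma$ (the Dulac map); denote its analytic continuation also by $d_\varepsilon$. Let $\delta(t)\subset\{f=t\}$ be the family of loops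 vanishing at the saddle as $t\to 0$, represented by loops based on $\tau$ that tend, as $t\to0$, to the circle $\{|x|=x_0,\ y=0\}$ run once counter-clockwise in the $x$-plane. Let $h^\varepsilon_\delta$ be the holonomy map of $\mathcal{F}_\varepsilon$ on $\tau$ along $\delta$ (it is well defined for $(\varepsilon,z)$ near $(0,0)$), and let $d\ge 1$ and $M_d$ be such that, for each fixed $z$ near $0$, $$h^\varepsilon_\delta(z)=z+\varepsilon^dM_d(z)+O(\varepsilon^{d+1}),\qquad \varepsilon\to0$$ (if $h^\varepsilon_\delta\not\equiv \mathrm{id}$, one may take the first $d$ for which $M_d\not\equiv0$; $M_d$ is then the Poincar\'e--Pontryagin function of $h_\delta^\varepsilon$). Then there are $\varepsilon_0,r>0$, a continuous function $\rho:\mathbb{R}\to(0,r]$ and a real-valued real-analytic function $R(u,\varepsilon)$ on $(-r,r)\times(-\varepsilon_0,\varepsilon_0)$ such that for all real $|\varepsilon|<\varepsilon_0$: the Dulac map $d_\varepsilon$ is defined on $(0,\rho(0))$ and continues analytically to $\{se^{i\varphi}: 0\le\varphi<3\pi/2,\ 0<s<\rho(\varphi)\}$; the function $$V(u,\varepsilon)=\frac{\varepsilon^d}{2i}M_d(u)+\varepsilon^{d+1}R(u,\varepsilon)$$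 is real-valued and real-analytic on $(-r,r)\times(-\varepsilon_0,\varepsilon_0)$, with $V(0,\varepsilon)=0$; and, with $\mathcal{D}=\{se^{i\varphi}:0<\varphi<3\pi/2,\ 0<s<\rho(\varphi)\}$, $$\{z\in\mathcal{D}:\operatorname{Im}d_\varepsilon(z)=0\}=\{z=u+iv\in\mathcal{D}: u<0,\ v=V(u,\varepsilon)\}.$$ In particular this zero locus is a smooth real-analytic curve. -/

import Mathlib

open Filter Topology Set Asymptotics ComplexConjugate

noncomputable section

namespace Saddle

/-- The anti-holomorphic involution `(x, y) ↦ (x̄, ȳ)` of `ℂ²`. -/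
def conj2 (p : ℂ × ℂ) : ℂ × ℂ := (conj p.1, conj p.2)

/-- `∂g/∂x`. -/
def dX (g : ℂ × ℂ → ℂ) (p : ℂ × ℂ) : ℂ := fderiv ℂ g p (1, 0)

/-- `∂g/∂y`. -/
def dY (g : ℂ × ℂ → ℂ) (p : ℂ × ℂ) : ℂ := fderiv ℂ g p (0, 1)

/-- `f` is (the complexification of) a real-analytic function near the origin of the plane, with a
hyperbolic Morse critical point of critical value `0` there: its real Hessian determinant is
negative. -/
structure IsHyperbolicMorse (f : ℂ × ℂ → ℂ) : Prop where
  analytic : AnalyticAt ℂ f 0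
  real : ∀ᶠ p in 𝓝 (0 : ℂ × ℂ), f (conj2 p) = conj (f p)
  zero : f 0 = 0
  critical : dX f 0 = 0 ∧ dY f 0 = 0
  hyperbolic : (dX (dX f) 0 * dY (dY f) 0 - dX (dY f) 0 * dY (dX f) 0).re < 0

/-- `P(x, y, ε)` is (the complexification of) a real-analytic function near the origin. -/
structure IsRealAnalytic (P : ℂ × ℂ × ℂ → ℂ) : Prop where
  analytic : AnalyticAt ℂ P 0
  real : ∀ᶠ p in 𝓝 (0 : ℂ × ℂ × ℂ), P (conj p.1, conj p.2.1, conj p.2.2) = conj (P p)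

/-- The coefficient of `dx` in the one-form `df + ε (P dx + Q dy)`. -/
def coeffX (f : ℂ × ℂ → ℂ) (P : ℂ × ℂ × ℂ → ℂ) (ε : ℝ) (p : ℂ × ℂ) : ℂ :=
  dX f p + ε * P (p.1, p.2, (ε : ℂ))

/-- The coefficient of `dy` in the one-form `df + ε (P dx + Q dy)`. -/
def coeffY (f : ℂ × ℂ → ℂ) (Q : ℂ × ℂ × ℂ → ℂ) (ε : ℝ) (p : ℂ × ℂ) : ℂ :=
  dY f p + ε * Q (p.1, p.2, (ε : ℂ))

/-- For all small `ε` the two separatrices of `df + ε (P dx + Q dy) = 0` are the axes: the one-form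
vanishes on the tangent vectors of `{x = 0}` and of `{y = 0}`. -/
def AxesAreSeparatrices (f : ℂ × ℂ → ℂ) (P Q : ℂ × ℂ × ℂ → ℂ) : Prop :=
  ∀ᶠ q in 𝓝 (0 : ℝ × ℂ), coeffY f Q q.1 (0, q.2) = 0 ∧ coeffX f P q.1 (q.2, 0) = 0

/-- `f` is positive in the open real first quadrant, near the origin. -/
def PositiveOnFirstQuadrant (f : ℂ × ℂ → ℂ) : Prop :=
  ∀ᶠ q in 𝓝 (0 : ℝ × ℝ), 0 < q.1 → 0 < q.2 → 0 < (f ((q.1 : ℂ), (q.2 : ℂ))).re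

/-- `σ` is a (germ of a) real complex-analytic disc through `p`, parameterized by the restriction
`z = f|_σ`. The condition `f (σ z) = z` makes it transversal to the level sets of `f`. -/
structure IsCrossSection (f : ℂ × ℂ → ℂ) (p : ℂ × ℂ) (σ : ℂ → ℂ × ℂ) : Prop where
  analytic : AnalyticAt ℂ σ 0
  base : σ 0 = p
  real : ∀ᶠ z in 𝓝 (0 : ℂ), σ (conj z) = conj2 (σ z)
  param : ∀ᶠ z in 𝓝 (0 : ℂ), f (σ z) = z

/-- `γ : [0, 1] → ℂ²` is a `C¹` path tangent to the foliation `df + ε (P dx + Q dy) = 0`. -/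
structure IsLeafPath (f : ℂ × ℂ → ℂ) (P Q : ℂ × ℂ × ℂ → ℂ) (ε : ℝ) (γ : ℝ → ℂ × ℂ) : Prop where
  contDiffOn : ContDiffOn ℝ 1 γ (Icc 0 1)
  tangent : ∀ s ∈ Icc (0 : ℝ) 1,
    coeffX f P ε (γ s) * (derivWithin γ (Icc 0 1) s).1
      + coeffY f Q ε (γ s) * (derivWithin γ (Icc 0 1) s).2 = 0

/-- The points of the open square `(0, a)²` of the real first quadrant. -/
def quadrant (a : ℝ) : Set (ℂ × ℂ) :=
  {p | ∃ x y : ℝ, x ∈ Ioo 0 a ∧ y ∈ Ioo 0 a ∧ p = ((x : ℂ), (y : ℂ))}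

/-- `p` and `q` lie on one real orbit of the foliation in the square `(0, a)²`. -/
def OnSameRealOrbit (f : ℂ × ℂ → ℂ) (P Q : ℂ × ℂ × ℂ → ℂ) (a ε : ℝ) (p q : ℂ × ℂ) : Prop :=
  ∃ γ : ℝ → ℂ × ℂ, IsLeafPath f P Q ε γ ∧ γ 0 = p ∧ γ 1 = q ∧ ∀ s ∈ Icc (0 : ℝ) 1, γ s ∈ quadrant a

/-- `{ s e^{iφ} : φ ∈ J, 0 < s < ρ(φ) }`. -/
def sector (ρ : ℝ → ℝ) (J : Set ℝ) : Set ℂ :=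
  {z | ∃ s φ : ℝ, φ ∈ J ∧ 0 < s ∧ s < ρ φ ∧ z = s * Complex.exp (φ * Complex.I)}

/-- `D` is the complexified Dulac map from `σ` to `τ`, on `0 ≤ φ < 3π/2`, `0 < |z| < ρ(φ)`:
for real `0 < x < ρ(0)`, the value `D x` is the unique real parameter in `(0, r)` of an intersection
point with `τ` of the real orbit through `σ x`, and `D` is the analytic continuation to the
(connected) sector of this function of `x`. -/
structure IsDulacMap (f : ℂ × ℂ → ℂ) (P Q : ℂ × ℂ × ℂ → ℂ) (a ε : ℝ) (σ τ : ℂ → ℂ × ℂ)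
    (r : ℝ) (ρ : ℝ → ℝ) (D : ℂ → ℂ) : Prop where
  analytic : AnalyticOnNhd ℂ D (sector ρ (Ico 0 (3 * Real.pi / 2)))
  transition : ∀ x : ℝ, x ∈ Ioo 0 (ρ 0) → ∃ y ∈ Ioo 0 r, D x = (y : ℂ) ∧
    ∀ y' ∈ Ioo 0 r, OnSameRealOrbit f P Q a ε (σ x) (τ y') ↔ y' = y

/-- `h ε z` is the holonomy on `τ` (a cross-section at `(x₀, 0)`) of the foliation
`df + ε (P dx + Q dy) = 0` along the loop `δ`, as a germ at `(ε, z) = (0, 0)`. Here `δ` is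
represented by the loops in the level sets of `f`, based on `τ`, that tend to the circle
`s ↦ (x₀ e^{2πis}, 0)` in the separatrix `{y = 0}`. The holonomy sends `z` to `z'` if a leaf path
that stays close to this circle joins `τ z` to `τ z'`. -/
def IsHolonomy (f : ℂ × ℂ → ℂ) (P Q : ℂ × ℂ × ℂ → ℂ) (x₀ : ℝ) (τ : ℂ → ℂ × ℂ)
    (h : ℝ → ℂ → ℂ) : Prop :=
  ∀ η : ℝ, 0 < η → ∀ᶠ q in 𝓝 (0 : ℝ × ℂ), ‖h q.1 q.2‖ < η ∧
    ∃ γ : ℝ → ℂ × ℂ, IsLeafPath f P Q q.1 γ ∧ γ 0 = τ q.2 ∧ γ 1 = τ (h q.1 q.2) ∧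
      ∀ s ∈ Icc (0 : ℝ) 1,
        ‖γ s - ((x₀ : ℂ) * Complex.exp (2 * Real.pi * s * Complex.I), 0)‖ < η

/-- `h^ε(z) = z + ε^d M(z) + O(ε^{d+1})` as `ε → 0`, for every fixed `z` near `0`. -/
def HasPoincarePontryagin (h : ℝ → ℂ → ℂ) (d : ℕ) (M : ℂ → ℂ) : Prop :=
  ∀ᶠ z in 𝓝 (0 : ℂ),
    (fun ε : ℝ => h ε z - z - (ε : ℂ) ^ d * M z) =O[𝓝 0] (fun ε : ℝ => ε ^ (d + 1))

end Saddle

end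

/-! The axes are leaves, so the one-form is `y a dx + x b dy` with `a(0) = b(0) > 0`
(`exists_isFactored`), and the leaves satisfy `dy/y = -c dx/x` with `c = a/b` close to `1`. In the
time `log x` this equation can be solved along arbitrarily long segments: `y` decays like `1/x`, and
this decay makes the Picard operator a contraction uniformly in the length of the segment
(`IsSlope.norm_picard_sub_le`). Following a leaf to the section `log x = X` gives a multivalued
first integral, holomorphic in `(log x, y, ε)`. Changing the branch of `log x` by `2πi` acts on it
by a fixed self-map of that section (`IsSlope.firstInt_translate`).

Equating the values of the first integral on `σ` and on `τ` produces, by holomorphic fixed points, a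
lift `D` of the Dulac map, `d_ε(exp ζ) = exp D(ζ, ε)` (`IsScale.exists_lift`); equating its values
on `τ` for two consecutive branches produces the holonomy `H` (`IsScale.exists_holonomy`).
Everything afterwards uses only the properties in `IsDulacLift`: `D` is Lipschitz-close to the
identity, commutes with conjugation, is the identity for `ε = 0`, and satisfies `exp D(ζ - 2πi) =
H(exp D(ζ))`. The last relation says that one clockwise turn of `z` changes the Dulac map by the
holonomy.

Let `k = d⁻¹ ∘ h ∘ d`. Its lift `ℓ` solves `D(ℓ(ζ)) = D(ζ - 2πi) + 2πi`. Injectivity of the holonomy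
makes `ℓ` commute with `2πi` (`IsReturnLift.add_period`), so that `k` is a single-valued function of
`z`, although `d` is not. Moreover `k = z + ε^d n(z, ε)` with `n` analytic at the origin, also
across `z = 0` and `ε = 0`, and `n(z, 0) = M_d(z)`, since conjugation by maps tending to the
identity does not change the leading coefficient (`IsDulacLift.exists_isDisplacement`).

Because `D` is real on the real axis, `d_ε(z)` is real at `z = exp ζ` in the sector exactly when `Im
D(ζ) = π`, that is, `D(ζ) = D(ζ̄) + 2πi` (`IsDulacLift.im_exp_eq_zero_iff`). By the definition of
`ℓ` this means `k(z̄) = z` with `Re z < 0` (`IsReturnLift.eq_iff`). For `z = u + iv` and `v = ε^d ν`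
it becomes `n(u - i ε^d ν, ε) = 2iν`, which has a unique small holomorphic solution `ν(u, ε)`
(`IsDisplacement.exists_isCurve`), with `ν(u, 0) = M_d(u)/(2i)`. The symmetry `k(conj(k(w))) = conj
w` (`IsReturnLift.returnMap_conj`) and uniqueness make `ν` real, so `V = ε^d ν` is the required
function.

Finally `D` and `H` are matched with the geometric definitions: equality of first integrals is
equivalent to lying on one real orbit (`IsScale.onSameRealOrbit_iff`), and every leaf path close to
the circle carries one branch of the first integral to the next
(`IsScale.eventually_eq_of_isHolonomy`). -/

namespace Saddle

/-! ### Holomorphy of limits and of integrals depending on parameters -/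

section Holomorphic

variable {E : Type*} [NormedAddCommGroup E] [NormedSpace ℂ E]

/-- Cauchy's estimate for the derivative of a function holomorphic and bounded on a ball. -/
theorem norm_fderiv_le_of_norm_le {f : E → ℂ} {p : E} {R C : ℝ} (hR : 0 < R)
    (hf : DifferentiableOn ℂ f (Metric.ball p R)) (hC : ∀ q ∈ Metric.ball p R, ‖f q‖ ≤ C) :
    ‖fderiv ℂ f p‖ ≤ 2 * C / R := by
  refine Complex.norm_fderiv_le_div_of_mapsTo_ball hf (fun q hq => ?_) hR
  rw [mem_closedBall_iff_norm]
  have := hC q hq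
  have := hC p (Metric.mem_ball_self hR)
  have := norm_sub_le (f q) (f p)
  linarith

/-- A limit, at a locally uniform geometric rate, of holomorphic functions on an open subset of a
normed space is holomorphic. -/
theorem differentiableOn_of_norm_sub_le_geometric {F : ℕ → E → ℂ} {f : E → ℂ} {U : Set E}
    {C : E → ℝ} (hU : IsOpen U) (hF : ∀ n, DifferentiableOn ℂ (F n) U) (hC : ContinuousOn C U)
    (h : ∀ n, ∀ p ∈ U, ‖F n p - f p‖ ≤ C p * (1 / 2) ^ n) : DifferentiableOn ℂ f U := by
  intro p hp
  have hev : ∀ᶠ q in 𝓝 p, q ∈ U ∧ C q < C p + 1 :=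
    (hU.eventually_mem hp).and
      ((hC.continuousAt (hU.mem_nhds hp)).eventually (gt_mem_nhds (lt_add_one _)))
  obtain ⟨R₀, hR₀, hball⟩ := Metric.eventually_nhds_iff_ball.1 hev
  set M := C p + 1
  set R := R₀ / 2 with hRdef
  have hR : 0 < R := by positivity
  have hsub : ∀ q ∈ Metric.ball p R, Metric.ball q R ⊆ Metric.ball p R₀ := fun q hq =>
    Metric.ball_subset_ball' (by have := Metric.mem_ball.1 hq; linarith)
  have hmem : ∀ q ∈ Metric.ball p R₀, q ∈ U := fun q hq => (hball q hq).1
  have hle : ∀ n, ∀ q ∈ Metric.ball p R₀, ‖F n q - f q‖ ≤ M * (1 / 2) ^ n := fun n q hq =>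
    (h n q (hball q hq).1).trans (by have := (hball q hq).2; gcongr)
  -- Each `q` in the half-radius ball is the centre of a ball of radius `R` inside the large one, so
  -- Cauchy's estimate turns the rate of convergence of the functions into a uniform Cauchy property
  -- of their derivatives.
  have hdist : ∀ n m, ∀ q ∈ Metric.ball p R,
      ‖fderiv ℂ (F n) q - fderiv ℂ (F m) q‖ ≤ 2 * (M * (1 / 2) ^ n + M * (1 / 2) ^ m) / R := by
    intro n m q hq
    have hqU : U ∈ 𝓝 q := hU.mem_nhds (hmem q (hsub q hq (Metric.mem_ball_self hR)))
    rw [← fderiv_sub ((hF n).differentiableAt hqU) ((hF m).differentiableAt hqU)]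
    refine norm_fderiv_le_of_norm_le hR ?_ ?_
    · exact ((hF n).sub (hF m)).mono fun w hw => hmem w (hsub q hq hw)
    · intro w hw
      have h1 := hle n w (hsub q hq hw)
      have h2 := hle m w (hsub q hq hw)
      calc ‖(F n - F m) w‖ = ‖(F n w - f w) - (F m w - f w)‖ := by
            simp only [Pi.sub_apply]; ring_nf
        _ ≤ _ := (norm_sub_le _ _).trans (add_le_add h1 h2)
  have hlim : Tendsto (fun n : ℕ => 2 * (M * (1 / 2 : ℝ) ^ n + M * (1 / 2) ^ n) / R) atTop (𝓝 0) := by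
    have h0 : Tendsto (fun n : ℕ => (1 / 2 : ℝ) ^ n) atTop (𝓝 0) :=
      tendsto_pow_atTop_nhds_zero_of_lt_one (by norm_num) (by norm_num)
    have := ((((h0.const_mul M).add (h0.const_mul M)).const_mul 2).div_const R)
    simpa using this
  have hM : 0 ≤ M := by
    have := (norm_nonneg _).trans (hle 0 p (Metric.mem_ball_self hR₀))
    simpa using this
  have hcauchy : ∀ q ∈ Metric.ball p R, CauchySeq fun n => fderiv ℂ (F n) q := by
    intro q hq
    refine cauchySeq_of_le_tendsto_0 _ (fun n m N hn hm => ?_) hlim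
    rw [dist_eq_norm]
    refine (hdist n m q hq).trans ?_
    have e1 : (1 / 2 : ℝ) ^ n ≤ (1 / 2) ^ N := pow_le_pow_of_le_one (by norm_num) (by norm_num) hn
    have e2 : (1 / 2 : ℝ) ^ m ≤ (1 / 2) ^ N := pow_le_pow_of_le_one (by norm_num) (by norm_num) hm
    gcongr
  choose! g' hg' using fun q (hq : q ∈ Metric.ball p R) => cauchySeq_tendsto_of_complete (hcauchy q hq)
  have hunif : TendstoUniformlyOn (fun n => fderiv ℂ (F n)) g' atTop (Metric.ball p R) := by
    rw [Metric.tendstoUniformlyOn_iff]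
    intro δ hδ
    have h0 : Tendsto (fun n : ℕ => 2 * (M * (1 / 2 : ℝ) ^ n + M * (1 / 2) ^ n) / R) atTop (𝓝 0) :=
      hlim
    filter_upwards [h0.eventually (gt_mem_nhds hδ)] with n hn q hq
    refine lt_of_le_of_lt ?_ hn
    refine le_of_tendsto ((hg' q hq).dist tendsto_const_nhds) ?_
    filter_upwards [eventually_ge_atTop n] with m hm
    rw [dist_eq_norm]
    refine (hdist m n q hq).trans ?_
    have e2 : (1 / 2 : ℝ) ^ m ≤ (1 / 2) ^ n := pow_le_pow_of_le_one (by norm_num) (by norm_num) hm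
    gcongr
  have hpt : ∀ q ∈ Metric.ball p R, Tendsto (fun n => F n q) atTop (𝓝 (f q)) := by
    intro q hq
    rw [tendsto_iff_norm_sub_tendsto_zero]
    have h0 : Tendsto (fun n : ℕ => M * (1 / 2 : ℝ) ^ n) atTop (𝓝 0) := by
      simpa using (tendsto_pow_atTop_nhds_zero_of_lt_one (r := (1 / 2 : ℝ))
        (by norm_num) (by norm_num)).const_mul M
    exact squeeze_zero (fun n => norm_nonneg _)
      (fun n => hle n q (Metric.ball_subset_ball (by linarith) hq)) h0
  have := hasFDerivAt_of_tendstoUniformlyOn Metric.isOpen_ball hunif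
    (fun n q hq => ((hF n).differentiableAt
      (hU.mem_nhds (hmem q (Metric.ball_subset_ball (by linarith) hq)))).hasFDerivAt)
    hpt (Metric.mem_ball_self hR)
  exact this.differentiableAt.differentiableWithinAt

/-- Joint continuity of `(p, t) ↦ ∫₀ᵗ Φ p s ds`. -/
theorem continuousOn_integral_param {E : Type*} [NormedAddCommGroup E] {Φ : E → ℝ → ℂ} {U : Set E}
    (hΦ : ContinuousOn (Function.uncurry Φ) (U ×ˢ Icc 0 1)) :
    ContinuousOn (fun q : E × ℝ => ∫ s in (0 : ℝ)..q.2, Φ q.1 s) (U ×ˢ Icc 0 1) := by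
  -- Clamping the time to `[0, 1]` makes the integrand continuous on all of `U × ℝ` without changing
  -- the integrals in question.
  let g : U → ℝ → ℂ := fun p s => Φ p (projIcc 0 1 zero_le_one s)
  have hg : Continuous g.uncurry := by
    refine hΦ.comp_continuous (f := fun q : U × ℝ => ((q.1 : E), (projIcc 0 1 zero_le_one q.2 : ℝ)))
      ?_ fun q => ⟨q.1.2, (projIcc 0 1 zero_le_one q.2).2⟩
    exact (continuous_subtype_val.comp continuous_fst).prodMk
      (continuous_subtype_val.comp (continuous_projIcc.comp continuous_snd))
  have hG := intervalIntegral.continuous_parametric_primitive_of_continuous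
    (μ := MeasureTheory.volume) (a₀ := 0) hg
  rw [continuousOn_iff_continuous_domRestrict]
  have := hG.comp (f := fun q : ↥(U ×ˢ Icc (0 : ℝ) 1) => ((⟨q.1.1, q.2.1⟩ : U), q.1.2))
    (by fun_prop)
  refine this.congr fun q => intervalIntegral.integral_congr fun s hs => ?_
  simp only at hs
  rw [uIcc_of_le q.2.2.1] at hs
  have : s ∈ Icc (0 : ℝ) 1 := ⟨hs.1, hs.2.trans q.2.2.2⟩
  simp only [projIcc_of_mem zero_le_one this]

/-- `p ↦ ∫₀ᵗ Φ p s ds` is holomorphic if `Φ` is continuous, and holomorphic in `p`. -/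
theorem differentiableOn_integral_param [ProperSpace E] {Φ : E → ℝ → ℂ} {U : Set E} (hU : IsOpen U)
    (hΦ : ContinuousOn (Function.uncurry Φ) (U ×ˢ Icc 0 1))
    (hd : ∀ s ∈ Icc (0 : ℝ) 1, DifferentiableOn ℂ (fun p => Φ p s) U) {t : ℝ}
    (ht : t ∈ Icc (0 : ℝ) 1) : DifferentiableOn ℂ (fun p => ∫ s in (0 : ℝ)..t, Φ p s) U := by
  intro p hp
  obtain ⟨R₀, hR₀, hball⟩ := Metric.nhds_basis_closedBall.mem_iff.1 (hU.mem_nhds hp)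
  set R := R₀ / 2 with hRdef
  have hR : 0 < R := by positivity
  have hK : IsCompact (Metric.closedBall p R₀ ×ˢ Icc (0 : ℝ) 1) :=
    (isCompact_closedBall p R₀).prod isCompact_Icc
  have hΦK := hΦ.mono (prod_mono_left hball)
  obtain ⟨M, hM⟩ := hK.exists_bound_of_continuousOn hΦK
  have huc := hK.uniformContinuousOn_of_continuous hΦK
  have hsub : ∀ q ∈ Metric.ball p R, Metric.ball q R ⊆ Metric.closedBall p R₀ := fun q hq =>
    (Metric.ball_subset_ball' (by have := Metric.mem_ball.1 hq; linarith)).trans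
      Metric.ball_subset_closedBall
  have hslice : ∀ q ∈ U, ContinuousOn (Φ q) (Icc 0 1) := fun q hq =>
    hΦ.comp (f := fun s => (q, s)) (by fun_prop) fun s hs => ⟨hq, hs⟩
  have hIoc : uIoc 0 t ⊆ Icc (0 : ℝ) 1 := by
    rw [uIoc_of_le ht.1]
    exact fun s hs => ⟨hs.1.le, hs.2.trans ht.2⟩
  -- Measurability of the derivative in `s` is obtained from continuity: `Φ(·, s') - Φ(·, s)` is
  -- uniformly small on a ball by uniform continuity on a compact set, and Cauchy's estimate passes
  -- the smallness on to the derivative.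
  have hF' : ContinuousOn (fun s => fderiv ℂ (fun q => Φ q s) p) (Icc 0 1) := by
    rw [Metric.continuousOn_iff]
    intro s hs δ hδ
    rw [Metric.uniformContinuousOn_iff] at huc
    obtain ⟨η, hη, h⟩ := huc (δ * R / 4) (by positivity)
    refine ⟨η, hη, fun s' hs' hss => ?_⟩
    rw [dist_eq_norm, ← fderiv_fun_sub ((hd s' hs').differentiableAt (hU.mem_nhds hp))
      ((hd s hs).differentiableAt (hU.mem_nhds hp))]
    refine (norm_fderiv_le_of_norm_le (C := δ * R / 4) hR ?_ ?_).trans_lt ?_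
    · exact ((hd s' hs').sub (hd s hs)).mono
        ((hsub p (Metric.mem_ball_self hR)).trans hball)
    · intro q hq
      have hq' := hsub p (Metric.mem_ball_self hR) hq
      have := h (q, s') ⟨hq', hs'⟩ (q, s) ⟨hq', hs⟩ (by simpa [Prod.dist_eq] using hss)
      rw [dist_eq_norm] at this
      exact this.le
    · field_simp
      linarith
  have := intervalIntegral.hasFDerivAt_integral_of_dominated_of_fderiv_le (𝕜 := ℂ)
    (μ := MeasureTheory.volume) (a := 0) (b := t) (F := Φ) (s := Metric.ball p R)
    (F' := fun q s => fderiv ℂ (fun q => Φ q s) q) (bound := fun _ => 2 * M / R) (x₀ := p)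
    (Metric.ball_mem_nhds p hR) ?_ ?_ ?_ ?_ ?_ ?_
  · exact this.differentiableAt.differentiableWithinAt
  · filter_upwards [hU.mem_nhds hp] with q hq
    exact ((hslice q hq).mono hIoc).aestronglyMeasurable measurableSet_uIoc
  · refine ContinuousOn.intervalIntegrable ?_
    rw [uIcc_of_le ht.1]
    exact (hslice p hp).mono (Icc_subset_Icc_right ht.2)
  · exact (hF'.mono hIoc).aestronglyMeasurable measurableSet_uIoc
  · refine Eventually.of_forall fun s hs q hq => norm_fderiv_le_of_norm_le hR ?_ ?_
    · exact (hd s (hIoc hs)).mono ((hsub q hq).trans hball)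
    · exact fun w hw => hM (w, s) ⟨hsub q hq hw, hIoc hs⟩
  · exact intervalIntegrable_const
  · refine Eventually.of_forall fun s hs q hq => ?_
    exact ((hd s (hIoc hs)).differentiableAt (hU.mem_nhds (hball (hsub q hq
      (Metric.mem_ball_self hR))))).hasFDerivAt

end Holomorphic
end Saddle

/-! ### Holomorphic fixed points; Cauchy's formula on a bidisc -/

namespace Saddle

/-- The fixed point of a contraction of closed unit balls that depends holomorphically on a parameter
is holomorphic in the parameter. -/
theorem exists_holomorphic_fixedPoint {E : Type*} [NormedAddCommGroup E] [NormedSpace ℂ E]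
    {U : Set E} (hU : IsOpen U) {T : E → ℂ → ℂ} {m : E → ℂ} (hm : DifferentiableOn ℂ m U)
    (hmaps : ∀ p ∈ U, ∀ v, ‖v - m p‖ ≤ 1 → ‖T p v - m p‖ ≤ 1)
    (hlip : ∀ p ∈ U, ∀ v v', ‖v - m p‖ ≤ 1 → ‖v' - m p‖ ≤ 1 → ‖T p v - T p v'‖ ≤ 1 / 2 * ‖v - v'‖)
    (hdiff : ∀ g : E → ℂ, DifferentiableOn ℂ g U → (∀ p ∈ U, ‖g p - m p‖ ≤ 1) →
      DifferentiableOn ℂ (fun p => T p (g p)) U) :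
    ∃ g : E → ℂ, DifferentiableOn ℂ g U ∧ ∀ p ∈ U, ‖g p - m p‖ ≤ 1 ∧ T p (g p) = g p := by
  let F : ℕ → E → ℂ := fun n => Nat.rec m (fun _ g p => T p (g p)) n
  have hF : ∀ n p, F (n + 1) p = T p (F n p) := fun n p => rfl
  have hb : ∀ n, ∀ p ∈ U, ‖F n p - m p‖ ≤ 1 := by
    intro n
    induction n with
    | zero => intro p _; simp [F]
    | succ n ih => exact fun p hp => hmaps p hp _ (ih p hp)
  have hd : ∀ n, DifferentiableOn ℂ (F n) U := by
    intro n
    induction n with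
    | zero => exact hm
    | succ n ih => exact hdiff _ ih (hb n)
  -- The iteration starts at `m`, so `hmaps` bounds its first step by `1`; later steps halve.
  have hstep : ∀ p ∈ U, ∀ n, dist (F n p) (F (n + 1) p) ≤ 1 * (1 / 2) ^ n := by
    intro p hp n
    induction n with
    | zero => rw [dist_comm, dist_eq_norm, pow_zero, one_mul]; exact hb 1 p hp
    | succ n ih =>
      rw [hF n, hF (n + 1), dist_eq_norm]
      refine (hlip p hp _ _ (hb n p hp) (hb (n + 1) p hp)).trans ?_
      rw [dist_eq_norm] at ih
      rw [pow_succ]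
      linarith
  choose! g hg using fun p (hp : p ∈ U) =>
    cauchySeq_tendsto_of_complete (cauchySeq_of_le_geometric (1 / 2) 1 (by norm_num) (hstep p hp))
  have hgb : ∀ p ∈ U, ‖g p - m p‖ ≤ 1 := fun p hp =>
    le_of_tendsto ((hg p hp).sub_const _).norm (Eventually.of_forall fun n => hb n p hp)
  have hrate : ∀ n, ∀ p ∈ U, ‖F n p - g p‖ ≤ 2 * (1 / 2) ^ n := by
    intro n p hp
    have := dist_le_of_le_geometric_of_tendsto (1 / 2) 1 (by norm_num) (hstep p hp) (hg p hp) n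
    rw [dist_eq_norm] at this
    refine this.trans_eq ?_
    ring
  refine ⟨g, differentiableOn_of_norm_sub_le_geometric hU hd continuousOn_const hrate,
    fun p hp => ⟨hgb p hp, ?_⟩⟩
  have h1 : Tendsto (fun n => F (n + 1) p) atTop (𝓝 (T p (g p))) := by
    rw [tendsto_iff_norm_sub_tendsto_zero]
    refine squeeze_zero (fun _ => norm_nonneg _)
      (fun n => hlip p hp _ _ (hb n p hp) (hgb p hp)) ?_
    have := (tendsto_iff_norm_sub_tendsto_zero.1 (hg p hp)).const_mul (1 / 2)
    rwa [mul_zero] at this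
  exact tendsto_nhds_unique h1 ((hg p hp).comp (tendsto_add_atTop_nat 1))

open BoundedContinuousFunction in
/-- Integration over the square `[0, 2π]²`. -/
noncomputable def torusIntegralCLM : ((ℝ × ℝ) →ᵇ ℂ) →L[ℂ] ℂ :=
  LinearMap.mkContinuous
    { toFun := fun φ => ∫ s in (0 : ℝ)..2 * Real.pi, ∫ t in (0 : ℝ)..2 * Real.pi, φ (s, t)
      map_add' := fun φ ψ => by
        have h : ∀ φ : (ℝ × ℝ) →ᵇ ℂ, Continuous fun s => ∫ t in (0 : ℝ)..2 * Real.pi, φ (s, t) :=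
          fun φ => intervalIntegral.continuous_parametric_intervalIntegral_of_continuous'
            (by exact φ.continuous) _ _
        rw [← intervalIntegral.integral_add ((h φ).intervalIntegrable _ _)
          ((h ψ).intervalIntegrable _ _)]
        refine intervalIntegral.integral_congr fun s _ => ?_
        have hc : ∀ φ : (ℝ × ℝ) →ᵇ ℂ, Continuous fun t => φ (s, t) := fun φ =>
          φ.continuous.comp (by fun_prop)
        simp only [coe_add, Pi.add_apply]
        exact intervalIntegral.integral_add ((hc φ).intervalIntegrable _ _)
          ((hc ψ).intervalIntegrable _ _)
      map_smul' := fun c φ => by simp }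
    ((2 * Real.pi) * (2 * Real.pi)) fun φ => by
      have hpi : |2 * Real.pi - 0| = 2 * Real.pi := by rw [sub_zero, abs_of_pos Real.two_pi_pos]
      have : ∀ s, ‖∫ t in (0 : ℝ)..2 * Real.pi, φ (s, t)‖ ≤ ‖φ‖ * (2 * Real.pi) := fun s => by
        have := intervalIntegral.norm_integral_le_of_norm_le_const (a := 0) (b := 2 * Real.pi)
          (f := fun t => φ (s, t)) (C := ‖φ‖) fun t _ => φ.norm_coe_le_norm _
        rwa [hpi] at this
      have := intervalIntegral.norm_integral_le_of_norm_le_const (a := 0) (b := 2 * Real.pi)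
          (f := fun s => ∫ t in (0 : ℝ)..2 * Real.pi, φ (s, t)) fun s _ => this s
      rw [hpi] at this
      simp only [LinearMap.coe_mk, AddHom.coe_mk]
      linarith

/-- Cauchy's formula on a punctured disc, for a bounded function. -/
theorem circleIntegral_of_punctured {g : ℂ → ℂ} {r r' C : ℝ} (hr' : r < r')
    (hg : DifferentiableOn ℂ g (Metric.ball 0 r' \ {0}))
    (hC : ∀ z ∈ Metric.ball 0 r' \ {0}, ‖g z‖ ≤ C) {z : ℂ} (hz : z ∈ Metric.ball 0 r \ {0}) :
    ((2 * Real.pi * Complex.I : ℂ)⁻¹ * ∮ ζ in C(0, r), (ζ - z)⁻¹ * g ζ) = g z := by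
  have hr : 0 < r := Metric.pos_of_mem_ball hz.1
  have hd := Complex.differentiableOn_update_limUnder_of_bddAbove
    (Metric.ball_mem_nhds (0 : ℂ) (hr.trans hr')) hg
    ⟨C, by rintro _ ⟨w, hw, rfl⟩; exact hC w hw⟩
  set g' := Function.update g 0 (limUnder (𝓝[≠] 0) g)
  have hne : ∀ w, w ≠ 0 → g' w = g w := fun w hw => Function.update_of_ne hw _ _
  have hsub : Metric.closedBall (0 : ℂ) r ⊆ Metric.ball 0 r' := Metric.closedBall_subset_ball hr'
  have := Complex.two_pi_I_inv_smul_circleIntegral_sub_inv_smul_of_differentiable_on_off_countable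
    (s := ∅) countable_empty hz.1 (hd.continuousOn.mono hsub)
    fun x hx => hd.differentiableAt (Metric.isOpen_ball.mem_nhds
      (Metric.ball_subset_ball hr'.le hx.1))
  rw [hne z hz.2] at this
  rw [← this, smul_eq_mul]
  congr 1
  refine circleIntegral.integral_congr hr.le fun ζ hζ => ?_
  have : ζ ≠ 0 := by
    rintro rfl
    simp at hζ
    exact hr.ne hζ
  simp [hne ζ this]

open BoundedContinuousFunction in
/-- A function that is separately holomorphic and bounded on punctured discs, and continuous on a
torus, extends to a function of two variables that is analytic at the origin. -/
theorem exists_analyticOnNhd_of_separately {G : ℂ → ℂ → ℂ} {r r' ρ ρ' : ℝ} (hr : 0 < r) (hr' : r < r')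
    (hρ : 0 < ρ) (hρ' : ρ < ρ')
    (hc : ContinuousOn (Function.uncurry G) (Metric.sphere 0 r ×ˢ Metric.sphere 0 ρ))
    (h₁ : ∀ η ∈ Metric.sphere (0 : ℂ) ρ, DifferentiableOn ℂ (fun z => G z η) (Metric.ball 0 r' \ {0}))
    (h₁b : ∀ η ∈ Metric.sphere (0 : ℂ) ρ, ∃ C, ∀ z ∈ Metric.ball (0 : ℂ) r' \ {0}, ‖G z η‖ ≤ C)
    (h₂ : ∀ z ∈ Metric.ball (0 : ℂ) r \ {0}, DifferentiableOn ℂ (G z) (Metric.ball 0 ρ' \ {0}))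
    (h₂b : ∀ z ∈ Metric.ball (0 : ℂ) r \ {0}, ∃ C, ∀ η ∈ Metric.ball (0 : ℂ) ρ' \ {0}, ‖G z η‖ ≤ C) :
    ∃ F : ℂ × ℂ → ℂ, AnalyticOnNhd ℂ F (Metric.ball 0 r ×ˢ Metric.ball 0 ρ) ∧
      ∀ z ∈ Metric.ball (0 : ℂ) r \ {0}, ∀ η ∈ Metric.ball (0 : ℂ) ρ \ {0}, F (z, η) = G z η := by
  have hcm : ∀ {R : ℝ}, 0 < R → ∀ t, circleMap 0 R t ∈ Metric.sphere (0 : ℂ) R := fun h t =>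
    circleMap_mem_sphere 0 h.le t
  have hcm0 : ∀ {R : ℝ}, 0 < R → ∀ t, circleMap 0 R t ≠ 0 := fun h t =>
    circleMap_ne_center h.ne'
  obtain ⟨C, hC⟩ := ((isCompact_sphere (0 : ℂ) r).prod
    (isCompact_sphere (0 : ℂ) ρ)).exists_bound_of_continuousOn hc
  let g : (ℝ × ℝ) →ᵇ ℂ := BoundedContinuousFunction.ofNormedAddCommGroup
    (fun q => G (circleMap 0 r q.2) (circleMap 0 ρ q.1))
    (hc.comp_continuous (f := fun q : ℝ × ℝ => (circleMap 0 r q.2, circleMap 0 ρ q.1))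
      (by fun_prop) fun q => ⟨hcm hr _, hcm hρ _⟩) C
    fun q => hC (circleMap 0 r q.2, circleMap 0 ρ q.1) ⟨hcm hr _, hcm hρ _⟩
  -- The Cauchy kernel is `ζ⁻¹ (1 - z ζ⁻¹)⁻¹`. Reading `ζ⁻¹` as an element `i₁` of the Banach
  -- algebra of bounded continuous functions on the parameter plane, joint analyticity of the double
  -- Cauchy integral follows from analyticity of inversion in that algebra and from continuity of
  -- the integral.
  let i₁ : (ℝ × ℝ) →ᵇ ℂ := BoundedContinuousFunction.ofNormedAddCommGroup
    (fun q => (circleMap 0 r q.2)⁻¹)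
    (Continuous.inv₀ (by fun_prop) fun q => hcm0 hr _) r⁻¹ fun q => by simp [abs_of_pos hr]
  let i₂ : (ℝ × ℝ) →ᵇ ℂ := BoundedContinuousFunction.ofNormedAddCommGroup
    (fun q => (circleMap 0 ρ q.1)⁻¹)
    (Continuous.inv₀ (by fun_prop) fun q => hcm0 hρ _) ρ⁻¹ fun q => by simp [abs_of_pos hρ]
  have hi₁ : ‖i₁‖ ≤ r⁻¹ := BoundedContinuousFunction.norm_ofNormedAddCommGroup_le _ (by positivity) _
  have hi₂ : ‖i₂‖ ≤ ρ⁻¹ := BoundedContinuousFunction.norm_ofNormedAddCommGroup_le _ (by positivity) _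
  have hunit : ∀ {R : ℝ} (_ : 0 < R) (i : (ℝ × ℝ) →ᵇ ℂ) (_ : ‖i‖ ≤ R⁻¹) (z : ℂ)
      (_ : z ∈ Metric.ball (0 : ℂ) R), IsUnit (1 - z • i) := by
    intro R hR i hi z hz
    have : ‖z • i‖ < 1 := by
      rw [norm_smul]
      have hz' : ‖z‖ < R := by simpa using hz
      calc ‖z‖ * ‖i‖ ≤ ‖z‖ * R⁻¹ := by gcongr
        _ < R * R⁻¹ := by gcongr
        _ = 1 := mul_inv_cancel₀ hR.ne'
    exact (Units.oneSub _ this).isUnit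
  have hinv : ∀ u : (ℝ × ℝ) →ᵇ ℂ, IsUnit u → ∀ q, Ring.inverse u q = (u q)⁻¹ := by
    intro u hu q
    have := Ring.mul_inverse_cancel u hu
    have h1 := congrArg (fun v : (ℝ × ℝ) →ᵇ ℂ => v q) this
    simp only [mul_apply] at h1
    exact eq_inv_of_mul_eq_one_right h1
  refine ⟨fun p => (2 * Real.pi : ℂ)⁻¹ * ((2 * Real.pi : ℂ)⁻¹ *
    torusIntegralCLM (g * Ring.inverse (1 - p.1 • i₁) * Ring.inverse (1 - p.2 • i₂))), ?_, ?_⟩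
  · rintro ⟨z, η⟩ ⟨hz, hη⟩
    have a₁ : AnalyticAt ℂ (fun p : ℂ × ℂ => Ring.inverse (1 - p.1 • i₁)) (z, η) := by
      obtain ⟨u, hu⟩ := hunit hr i₁ hi₁ z hz
      refine AnalyticAt.comp (g := Ring.inverse) (f := fun p : ℂ × ℂ => 1 - p.1 • i₁) ?_ ?_
      · simp only [← hu]
        exact analyticAt_inverse u
      · exact analyticAt_const.sub (analyticAt_fst.smul analyticAt_const)
    have a₂ : AnalyticAt ℂ (fun p : ℂ × ℂ => Ring.inverse (1 - p.2 • i₂)) (z, η) := by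
      obtain ⟨u, hu⟩ := hunit hρ i₂ hi₂ η hη
      refine AnalyticAt.comp (g := Ring.inverse) (f := fun p : ℂ × ℂ => 1 - p.2 • i₂) ?_ ?_
      · simp only [← hu]
        exact analyticAt_inverse u
      · exact analyticAt_const.sub (analyticAt_snd.smul analyticAt_const)
    exact analyticAt_const.mul (analyticAt_const.mul
      ((torusIntegralCLM.analyticAt _).comp ((analyticAt_const.mul a₁).mul a₂)))
  · intro z hz η hη
    obtain ⟨C₂, hC₂⟩ := h₂b z hz
    rw [← circleIntegral_of_punctured hρ' (h₂ z hz) hC₂ hη]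
    have hIne : (2 * Real.pi : ℂ) ≠ 0 := by exact_mod_cast Real.two_pi_pos.ne'
    -- Cauchy's formula in `z` with the second variable on its circle; the formula in `η` has been
    -- inserted already. The punctures are harmless because the function is bounded in each variable
    -- separately.
    have inner : ∀ s : ℝ, (2 * Real.pi : ℂ)⁻¹ * (∫ t in (0 : ℝ)..2 * Real.pi,
        (g * Ring.inverse (1 - z • i₁) * Ring.inverse (1 - η • i₂)) (s, t)) =
        (circleMap 0 ρ s * (circleMap 0 ρ s - η)⁻¹) * G z (circleMap 0 ρ s) := by
      intro s
      obtain ⟨C₁, hC₁⟩ := h₁b _ (hcm hρ s)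
      rw [← circleIntegral_of_punctured hr' (h₁ _ (hcm hρ s)) hC₁ hz, circleIntegral]
      simp only [mul_apply, hinv _ (hunit hr i₁ hi₁ z hz.1), hinv _ (hunit hρ i₂ hi₂ η hη.1),
        deriv_circleMap, smul_eq_mul, ← intervalIntegral.integral_const_mul, mul_inv]
      refine intervalIntegral.integral_congr fun t _ => ?_
      have n1 := hcm0 hr t
      have n2 := hcm0 hρ s
      have m1 : circleMap 0 r t - z ≠ 0 := by
        rw [sub_ne_zero]; rintro rfl
        have := hz.1; simp [abs_of_pos hr] at this
      have m2 : circleMap 0 ρ s - η ≠ 0 := by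
        rw [sub_ne_zero]; rintro rfl
        have := hη.1; simp [abs_of_pos hρ] at this
      have e1 : (1 - z • i₁ : (ℝ × ℝ) →ᵇ ℂ) (s, t) = (circleMap 0 r t - z) / circleMap 0 r t := by
        change (1 : ℂ) - z * (circleMap 0 r t)⁻¹ = _
        field_simp
      have e2 : (1 - η • i₂ : (ℝ × ℝ) →ᵇ ℂ) (s, t) = (circleMap 0 ρ s - η) / circleMap 0 ρ s := by
        change (1 : ℂ) - η * (circleMap 0 ρ s)⁻¹ = _
        field_simp
      have e3 : g (s, t) = G (circleMap 0 r t) (circleMap 0 ρ s) := rfl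
      simp only [e1, e2, e3]
      field_simp
    have outer : (2 * Real.pi : ℂ)⁻¹ * torusIntegralCLM
        (g * Ring.inverse (1 - z • i₁) * Ring.inverse (1 - η • i₂)) =
        ∫ s in (0 : ℝ)..2 * Real.pi,
          (circleMap 0 ρ s * (circleMap 0 ρ s - η)⁻¹) * G z (circleMap 0 ρ s) := by
      refine (intervalIntegral.integral_const_mul (2 * Real.pi : ℂ)⁻¹ _).symm.trans ?_
      exact intervalIntegral.integral_congr fun s _ => inner s
    dsimp only
    rw [outer]
    simp only [circleIntegral, deriv_circleMap, smul_eq_mul, mul_inv,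
      ← intervalIntegral.integral_const_mul]
    refine intervalIntegral.integral_congr fun s _ => ?_
    have hI := Complex.I_ne_zero
    field_simp

/-- A function of two complex variables that is holomorphic near the origin is analytic there. -/
theorem analyticAt_zero_of_differentiableOn {F : ℂ × ℂ → ℂ} {U : Set (ℂ × ℂ)} (hU : U ∈ 𝓝 0)
    (hF : DifferentiableOn ℂ F U) : AnalyticAt ℂ F 0 := by
  obtain ⟨R, hR, hball⟩ := Metric.nhds_basis_ball.mem_iff.1 hU
  have hFR := hF.mono hball
  have hmem : ∀ {z η : ℂ}, ‖z‖ < R → ‖η‖ < R → ((z, η) : ℂ × ℂ) ∈ Metric.ball (0 : ℂ × ℂ) R :=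
    fun hz hη => by simpa [Prod.norm_def] using ⟨hz, hη⟩
  have hb : ∃ C, ∀ p ∈ Metric.closedBall (0 : ℂ × ℂ) (R / 2), ‖F p‖ ≤ C :=
    (isCompact_closedBall _ _).exists_bound_of_continuousOn
      (hFR.continuousOn.mono (Metric.closedBall_subset_ball (by linarith)))
  obtain ⟨C, hC⟩ := hb
  have hC' : ∀ z η : ℂ, ‖z‖ ≤ R / 2 → ‖η‖ ≤ R / 2 → ‖F (z, η)‖ ≤ C := fun z η hz hη =>
    hC _ (by simpa [Prod.norm_def] using ⟨hz, hη⟩)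
  obtain ⟨F', hF', heq⟩ := exists_analyticOnNhd_of_separately (G := fun z η => F (z, η))
    (r := R / 4) (r' := R / 2) (ρ := R / 4) (ρ' := R / 2) (by positivity) (by linarith)
    (by positivity) (by linarith)
    (hFR.continuousOn.mono fun p hp => by
      have h1 : ‖p.1‖ = R / 4 := by simpa using hp.1
      have h2 : ‖p.2‖ = R / 4 := by simpa using hp.2
      exact hmem (by linarith) (by linarith))
    (fun η hη => hFR.comp (by fun_prop) fun z hz => by
      have h1 : ‖z‖ < R / 2 := by simpa using hz.1
      have h2 : ‖η‖ = R / 4 := by simpa using hη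
      exact hmem (by linarith) (by linarith))
    (fun η hη => ⟨C, fun z hz => by
      have h1 : ‖z‖ < R / 2 := by simpa using hz.1
      have h2 : ‖η‖ = R / 4 := by simpa using hη
      exact hC' _ _ (by linarith) (by linarith)⟩)
    (fun z hz => hFR.comp (f := fun η => (z, η)) (by fun_prop) fun η hη => by
      have h1 : ‖z‖ < R / 4 := by simpa using hz.1
      have h2 : ‖η‖ < R / 2 := by simpa using hη.1
      exact hmem (by linarith) (by linarith))
    (fun z hz => ⟨C, fun η hη => by
      have h1 : ‖z‖ < R / 4 := by simpa using hz.1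
      have h2 : ‖η‖ < R / 2 := by simpa using hη.1
      exact hC' _ _ (by linarith) (by linarith)⟩)
  set W := Metric.ball (0 : ℂ) (R / 4) ×ˢ Metric.ball (0 : ℂ) (R / 4)
  have hW : IsOpen W := Metric.isOpen_ball.prod Metric.isOpen_ball
  have hdense : Dense (({0}ᶜ : Set ℂ) ×ˢ ({0}ᶜ : Set ℂ)) :=
    (dense_compl_singleton 0).prod (dense_compl_singleton 0)
  -- The formula gives equality off the axes; density and continuity give the rest.
  have hEq : EqOn F' F W := by
    refine EqOn.of_subset_closure (s := W ∩ ({0}ᶜ : Set ℂ) ×ˢ ({0}ᶜ : Set ℂ)) ?_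
      hF'.continuousOn (hFR.continuousOn.mono fun p hp => ?_) inter_subset_left
      (hdense.open_subset_closure_inter hW)
    · rintro ⟨z, η⟩ ⟨⟨hz, hη⟩, hz0, hη0⟩
      exact heq z ⟨hz, hz0⟩ η ⟨hη, hη0⟩
    · have h1 : ‖p.1‖ < R / 4 := by simpa using hp.1
      have h2 : ‖p.2‖ < R / 4 := by simpa using hp.2
      exact hmem (by linarith) (by linarith)
  have h0 : (0 : ℂ × ℂ) ∈ W := ⟨by simpa using hR, by simpa using hR⟩
  exact (hF' 0 h0).congr (hEq.eventuallyEq_of_mem (hW.mem_nhds h0))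

end Saddle

/-! ### The equation of the leaves in logarithmic time: estimates uniform in the length of the
segment -/

namespace Saddle

/-- The slope `c` of the equation `dy / y = -c(x, y, ε) dx / x` is holomorphic on the polydisc of
radius `R`, close to `1`, and real; `B` bounds the imaginary part of the logarithmic time `log x`
and `r` the variable `y`, in terms of which the equation is solved. -/
structure IsSlope (c : ℂ × ℂ × ℂ → ℂ) (R κ K B r : ℝ) : Prop where
  R_pos : 0 < R
  r_pos : 0 < r
  κ_nonneg : 0 ≤ κ
  K_nonneg : 0 ≤ K
  one_le_B : 1 ≤ B
  diff : DifferentiableOn ℂ c (Metric.ball 0 R)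
  near_one : ∀ p ∈ Metric.ball (0 : ℂ × ℂ × ℂ) R, ‖c p - 1‖ ≤ κ
  lip : ∀ x y x' y' ε : ℂ, (x, y, ε) ∈ Metric.ball (0 : ℂ × ℂ × ℂ) R →
    (x', y', ε) ∈ Metric.ball (0 : ℂ × ℂ × ℂ) R →
    ‖c (x, y, ε) - c (x', y', ε)‖ ≤ K * (‖x - x'‖ + ‖y - y'‖)
  real : ∀ p ∈ Metric.ball (0 : ℂ × ℂ × ℂ) R, c (conj p.1, conj p.2.1, conj p.2.2) = conj (c p)
  κ_mul_le : κ * (1 + B) ≤ 1 / 2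
  r_le : 5 * r ≤ R
  K_mul_le : K * (5 * (1 + B)) * r ≤ 1 / 2

/-- The set of `(ξ, Δ, y, ε)` for which the solution with initial value `y` is continued along the
segment from `ξ` to `ξ + Δ` of the `log x`-plane. -/
def flowDomain (R B r : ℝ) : Set (ℂ × ℂ × ℂ × ℂ) :=
  {p | p.1.re < Real.log R ∧ (p.1 + p.2.1).re < Real.log R ∧ -1 < p.2.1.re ∧ |p.2.1.im| < B ∧
    ‖p.2.2.1‖ < r ∧ ‖p.2.2.2‖ < R}

theorem isOpen_flowDomain (R B r : ℝ) : IsOpen (flowDomain R B r) := by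
  have h1 : Continuous fun p : ℂ × ℂ × ℂ × ℂ => p.1.re := by fun_prop
  have h2 : Continuous fun p : ℂ × ℂ × ℂ × ℂ => (p.1 + p.2.1).re := by fun_prop
  have h3 : Continuous fun p : ℂ × ℂ × ℂ × ℂ => p.2.1.re := by fun_prop
  have h4 : Continuous fun p : ℂ × ℂ × ℂ × ℂ => |p.2.1.im| := by fun_prop
  have h5 : Continuous fun p : ℂ × ℂ × ℂ × ℂ => ‖p.2.2.1‖ := by fun_prop
  have h6 : Continuous fun p : ℂ × ℂ × ℂ × ℂ => ‖p.2.2.2‖ := by fun_prop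
  exact (isOpen_lt h1 continuous_const).inter ((isOpen_lt h2 continuous_const).inter
    ((isOpen_lt continuous_const h3).inter ((isOpen_lt h4 continuous_const).inter
    ((isOpen_lt h5 continuous_const).inter (isOpen_lt h6 continuous_const)))))

/-- The point `(x, y, ε)` at time `t`, where `y` deviates by the factor `exp v` from the solution of
`dy / y = - dx / x`. -/
noncomputable def flowPoint (p : ℂ × ℂ × ℂ × ℂ) (t : ℝ) (v : ℂ) : ℂ × ℂ × ℂ :=
  (Complex.exp (p.1 + t * p.2.1), p.2.2.1 * Complex.exp (-(t * p.2.1) + v), p.2.2.2)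

/-- The Picard operator of the equation for `v`. -/
noncomputable def picard (c : ℂ × ℂ × ℂ → ℂ) (p : ℂ × ℂ × ℂ × ℂ) (v : ℝ → ℂ) (t : ℝ) : ℂ :=
  -p.2.1 * ∫ s in (0 : ℝ)..t, (c (flowPoint p s (v s)) - 1)

/-- Bound for `|y|` along the flow, relative to the initial value. -/
noncomputable def flowWeight (κ : ℝ) (p : ℂ × ℂ × ℂ × ℂ) (t : ℝ) : ℝ :=
  Real.exp (t * (-p.2.1.re + κ * ‖p.2.1‖))

/-- Mean value inequality on the convex half-plane `Re z ≤ M`, where the derivative of `exp` is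
bounded by `exp M`. -/
theorem norm_exp_sub_exp_le {a b : ℂ} {M : ℝ} (ha : a.re ≤ M) (hb : b.re ≤ M) :
    ‖Complex.exp a - Complex.exp b‖ ≤ Real.exp M * ‖a - b‖ := by
  have hconv : Convex ℝ {z : ℂ | z.re ≤ M} := convex_halfSpace_re_le M
  refine hconv.norm_image_sub_le_of_norm_hasDerivWithin_le (f := Complex.exp) (f' := Complex.exp)
    (fun z _ => (Complex.hasDerivAt_exp z).hasDerivWithinAt) (fun z hz => ?_) hb ha
  rw [Complex.norm_exp]
  exact Real.exp_le_exp.2 hz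

variable {c : ℂ × ℂ × ℂ → ℂ} {R κ K B r : ℝ}

namespace IsSlope

/-- All estimates split at `Re Δ = 1`. On long segments the bound `B` on the imaginary part makes
`‖Δ‖` comparable with `Re Δ`, so decay in `Re Δ` can absorb factors `‖Δ‖`; short segments have
bounded length. -/
theorem norm_le_mul_re (h : IsSlope c R κ K B r) {p : ℂ × ℂ × ℂ × ℂ} (hp : p ∈ flowDomain R B r)
    (h1 : 1 ≤ p.2.1.re) : ‖p.2.1‖ ≤ (1 + B) * p.2.1.re := by
  have := Complex.norm_le_abs_re_add_abs_im p.2.1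
  rw [abs_of_pos (by linarith : 0 < p.2.1.re)] at this
  have h4 := hp.2.2.2.1
  have hB := h.one_le_B
  nlinarith

theorem norm_le_of_re_lt {p : ℂ × ℂ × ℂ × ℂ} (hp : p ∈ flowDomain R B r)
    (h1 : p.2.1.re < 1) : ‖p.2.1‖ ≤ 1 + B := by
  have := Complex.norm_le_abs_re_add_abs_im p.2.1
  have h3 : |p.2.1.re| < 1 := abs_lt.2 ⟨hp.2.2.1, h1⟩
  have h4 := hp.2.2.2.1
  linarith

/-- The condition `κ_mul_le` lets the deviation `v` consume at most half of the decay rate `Re Δ` of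
`y`. -/
theorem flowWeight_le_exp (h : IsSlope c R κ K B r) {p : ℂ × ℂ × ℂ × ℂ}
    (hp : p ∈ flowDomain R B r) (h1 : 1 ≤ p.2.1.re) {t : ℝ} (ht : 0 ≤ t) :
    flowWeight κ p t ≤ Real.exp (-(p.2.1.re / 2) * t) := by
  refine Real.exp_le_exp.2 ?_
  have h2 := h.norm_le_mul_re hp h1
  have h3 : κ * ‖p.2.1‖ ≤ p.2.1.re / 2 := by
    calc κ * ‖p.2.1‖ ≤ κ * ((1 + B) * p.2.1.re) := mul_le_mul_of_nonneg_left h2 h.κ_nonneg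
      _ = κ * (1 + B) * p.2.1.re := by ring
      _ ≤ 1 / 2 * p.2.1.re := mul_le_mul_of_nonneg_right h.κ_mul_le (by linarith)
      _ = _ := by ring
  nlinarith

/-- On short segments `-Re Δ < 1` and `κ ‖Δ‖ ≤ 1/2`, so the weight is at most `exp (3/2)`, which is
below `5`. On long segments the weight is at most `1`. -/
theorem flowWeight_le (h : IsSlope c R κ K B r) {p : ℂ × ℂ × ℂ × ℂ}
    (hp : p ∈ flowDomain R B r) {t : ℝ} (ht : t ∈ Icc (0 : ℝ) 1) : flowWeight κ p t ≤ 5 := by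
  rcases le_or_gt 1 p.2.1.re with h1 | h1
  · refine (h.flowWeight_le_exp hp h1 ht.1).trans ?_
    have : Real.exp (-(p.2.1.re / 2) * t) ≤ 1 := Real.exp_le_one_iff.2 (by nlinarith [ht.1])
    linarith
  · have h2 := norm_le_of_re_lt hp h1
    have h3 : κ * ‖p.2.1‖ ≤ 1 / 2 :=
      (mul_le_mul_of_nonneg_left h2 h.κ_nonneg).trans h.κ_mul_le
    have h4 := hp.2.2.1
    have h5 : 0 ≤ κ * ‖p.2.1‖ := mul_nonneg h.κ_nonneg (norm_nonneg _)
    have : t * (-p.2.1.re + κ * ‖p.2.1‖) ≤ 3 / 2 := by nlinarith [ht.1, ht.2]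
    have h6 : Real.exp (3 / 2 : ℝ) ≤ 5 := by
      have e1 := Real.exp_one_lt_d9
      have e2 : Real.exp (3 / 2 : ℝ) * Real.exp (3 / 2 : ℝ) =
          Real.exp 1 * Real.exp 1 * Real.exp 1 := by
        rw [← Real.exp_add, ← Real.exp_add, ← Real.exp_add]; norm_num
      have e3 := Real.exp_pos (3 / 2 : ℝ)
      have e4 := Real.exp_pos (1 : ℝ)
      have e5 : Real.exp 1 * Real.exp 1 ≤ 7.4 := by nlinarith
      nlinarith
    exact (Real.exp_le_exp.2 this).trans h6

theorem continuous_flowWeight (κ : ℝ) (p : ℂ × ℂ × ℂ × ℂ) : Continuous (flowWeight κ p) := by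
  unfold flowWeight
  fun_prop

/-- The integral of the decaying weight is at most `2 / Re Δ`, which compensates the factor `‖Δ‖`.
This bound, independent of `Re Δ`, is what allows the flow to start arbitrarily close to `x = 0`. -/
theorem integral_flowWeight_le (h : IsSlope c R κ K B r) {p : ℂ × ℂ × ℂ × ℂ}
    (hp : p ∈ flowDomain R B r) {t : ℝ} (ht : t ∈ Icc (0 : ℝ) 1) :
    ‖p.2.1‖ * ∫ s in (0 : ℝ)..t, flowWeight κ p s ≤ 5 * (1 + B) := by
  have hB := h.one_le_B
  have hI : 0 ≤ ∫ s in (0 : ℝ)..t, flowWeight κ p s :=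
    intervalIntegral.integral_nonneg ht.1 fun s _ => (Real.exp_pos _).le
  rcases le_or_gt 1 p.2.1.re with h1 | h1
  · have hpos : 0 < p.2.1.re := by linarith
    have : ∫ s in (0 : ℝ)..t, flowWeight κ p s ≤ 2 / p.2.1.re := by
      calc ∫ s in (0 : ℝ)..t, flowWeight κ p s
          ≤ ∫ s in (0 : ℝ)..t, Real.exp (-(p.2.1.re / 2) * s) := by
            refine intervalIntegral.integral_mono_on ht.1
              ((continuous_flowWeight κ p).intervalIntegrable _ _)
              (Continuous.intervalIntegrable (by fun_prop) _ _)
              fun s hs => h.flowWeight_le_exp hp h1 hs.1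
        _ = (1 - Real.exp (-(p.2.1.re / 2) * t)) * (2 / p.2.1.re) := by
            rw [intervalIntegral.integral_comp_mul_left (fun s => Real.exp s)
              (by linarith : -(p.2.1.re / 2) ≠ 0), integral_exp]
            simp
            field_simp
            ring
        _ ≤ 1 * (2 / p.2.1.re) := by
            have := Real.exp_pos (-(p.2.1.re / 2) * t)
            gcongr
            linarith
        _ = _ := one_mul _
    calc ‖p.2.1‖ * ∫ s in (0 : ℝ)..t, flowWeight κ p s
        ≤ ((1 + B) * p.2.1.re) * (2 / p.2.1.re) := by
          exact mul_le_mul (h.norm_le_mul_re hp h1) this hI (by positivity)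
      _ = 2 * (1 + B) := by field_simp
      _ ≤ _ := by linarith
  · have : ∫ s in (0 : ℝ)..t, flowWeight κ p s ≤ 5 := by
      calc ∫ s in (0 : ℝ)..t, flowWeight κ p s ≤ ∫ s in (0 : ℝ)..t, (5 : ℝ) := by
            refine intervalIntegral.integral_mono_on ht.1
              ((continuous_flowWeight κ p).intervalIntegrable _ _) intervalIntegrable_const
              fun s hs => h.flowWeight_le hp ⟨hs.1, hs.2.trans ht.2⟩
        _ ≤ 5 := by simp; linarith [ht.2]
    have h2 := norm_le_of_re_lt hp h1
    calc ‖p.2.1‖ * ∫ s in (0 : ℝ)..t, flowWeight κ p s ≤ (1 + B) * 5 := by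
          exact mul_le_mul h2 this hI (by linarith)
      _ = _ := by ring

theorem norm_flowPoint_snd_le {p : ℂ × ℂ × ℂ × ℂ} {t : ℝ} {v : ℂ} (hv : ‖v‖ ≤ κ * ‖p.2.1‖ * t) :
    ‖(flowPoint p t v).2.1‖ ≤ ‖p.2.2.1‖ * flowWeight κ p t := by
  simp only [flowPoint, flowWeight, norm_mul, Complex.norm_exp]
  gcongr
  have := (Complex.re_le_norm v).trans hv
  simp
  linarith

/-- The segment stays in the half-plane `Re < log R` by convexity, and `|y|` grows at most by the
factor `5`, which `r_le` permits. -/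
theorem flowPoint_mem_ball (h : IsSlope c R κ K B r) {p : ℂ × ℂ × ℂ × ℂ}
    (hp : p ∈ flowDomain R B r) {t : ℝ} (ht : t ∈ Icc (0 : ℝ) 1) {v : ℂ}
    (hv : ‖v‖ ≤ κ * ‖p.2.1‖ * t) : flowPoint p t v ∈ Metric.ball (0 : ℂ × ℂ × ℂ) R := by
  have h1 : ‖(flowPoint p t v).1‖ < R := by
    simp only [flowPoint, Complex.norm_exp]
    rw [← Real.lt_log_iff_exp_lt h.R_pos]
    have e1 := hp.1
    have e2 := hp.2.1
    simp at e2 ⊢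
    rcases eq_or_lt_of_le ht.2 with rfl | h1
    · linarith
    · nlinarith [ht.1, ht.2]
  have h2 : ‖(flowPoint p t v).2.1‖ < R := by
    have e1 := norm_flowPoint_snd_le hv
    have e2 := h.flowWeight_le hp ht
    have e3 := hp.2.2.2.2.1
    have e4 := h.r_le
    have e5 : ‖p.2.2.1‖ * flowWeight κ p t ≤ ‖p.2.2.1‖ * 5 := by gcongr
    linarith
  have h3 : ‖(flowPoint p t v).2.2‖ < R := hp.2.2.2.2.2
  rw [mem_ball_zero_iff, Prod.norm_def, Prod.norm_def]
  exact max_lt h1 (max_lt h2 h3)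

/-- Only the `y`-coordinate depends on `v`. Its sensitivity to `v` is `|y|` itself, hence carries
the decaying weight. -/
theorem norm_slope_sub_le (h : IsSlope c R κ K B r) {p : ℂ × ℂ × ℂ × ℂ}
    (hp : p ∈ flowDomain R B r) {t : ℝ} (ht : t ∈ Icc (0 : ℝ) 1) {v v' : ℂ}
    (hv : ‖v‖ ≤ κ * ‖p.2.1‖ * t) (hv' : ‖v'‖ ≤ κ * ‖p.2.1‖ * t) :
    ‖c (flowPoint p t v) - c (flowPoint p t v')‖ ≤
      K * r * flowWeight κ p t * ‖v - v'‖ := by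
  have h1 := h.lip _ _ _ _ _ (h.flowPoint_mem_ball hp ht hv) (h.flowPoint_mem_ball hp ht hv')
  refine h1.trans ?_
  have h2 : ‖Complex.exp (-(t * p.2.1) + v) - Complex.exp (-(t * p.2.1) + v')‖ ≤
      flowWeight κ p t * ‖v - v'‖ := by
    have e1 := (Complex.re_le_norm v).trans hv
    have e2 := (Complex.re_le_norm v').trans hv'
    have := norm_exp_sub_exp_le (a := -(t * p.2.1) + v) (b := -(t * p.2.1) + v')
      (M := t * (-p.2.1.re + κ * ‖p.2.1‖)) (by simp; linarith) (by simp; linarith)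
    rwa [add_sub_add_left_eq_sub] at this
  have h3 := hp.2.2.2.2.1
  have hw : 0 ≤ flowWeight κ p t := (Real.exp_pos _).le
  rw [sub_self, norm_zero, zero_add, ← mul_sub, norm_mul]
  calc K * (‖p.2.2.1‖ * _) ≤ K * (r * (flowWeight κ p t * ‖v - v'‖)) := by
        have := h.K_nonneg
        have := h.r_pos
        gcongr
    _ = _ := by ring

/-- The functions of time among which the equation is solved. -/
def _root_.Saddle.Admissible (κ : ℝ) (p : ℂ × ℂ × ℂ × ℂ) (v : ℝ → ℂ) : Prop :=
  ContinuousOn v (Icc 0 1) ∧ ∀ t ∈ Icc (0 : ℝ) 1, ‖v t‖ ≤ κ * ‖p.2.1‖ * t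

theorem continuousOn_slope (h : IsSlope c R κ K B r) {p : ℂ × ℂ × ℂ × ℂ}
    (hp : p ∈ flowDomain R B r) {v : ℝ → ℂ} (hv : Admissible κ p v) :
    ContinuousOn (fun s => c (flowPoint p s (v s)) - 1) (Icc 0 1) := by
  refine (h.diff.continuousOn.comp ?_ fun s hs => h.flowPoint_mem_ball hp hs (hv.2 s hs)).sub
    continuousOn_const
  have := hv.1
  unfold flowPoint
  fun_prop

theorem intervalIntegrable_slope (h : IsSlope c R κ K B r) {p : ℂ × ℂ × ℂ × ℂ}
    (hp : p ∈ flowDomain R B r) {v : ℝ → ℂ} (hv : Admissible κ p v) {a b : ℝ}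
    (ha : a ∈ Icc (0 : ℝ) 1) (hb : b ∈ Icc (0 : ℝ) 1) :
    IntervalIntegrable (fun s => c (flowPoint p s (v s)) - 1) MeasureTheory.volume a b :=
  ((h.continuousOn_slope hp hv).mono (uIcc_subset_Icc ha hb)).intervalIntegrable

theorem norm_integral_slope_le (h : IsSlope c R κ K B r) {p : ℂ × ℂ × ℂ × ℂ}
    (hp : p ∈ flowDomain R B r) {v : ℝ → ℂ} (hv : Admissible κ p v) {a b : ℝ}
    (ha : a ∈ Icc (0 : ℝ) 1) (hb : b ∈ Icc (0 : ℝ) 1) (hab : a ≤ b) :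
    ‖-p.2.1 * ∫ s in a..b, (c (flowPoint p s (v s)) - 1)‖ ≤ κ * ‖p.2.1‖ * (b - a) := by
  have := intervalIntegral.norm_integral_le_of_norm_le_const (a := a) (b := b)
    (f := fun s => c (flowPoint p s (v s)) - 1) (C := κ) fun s hs => by
      rw [uIoc_of_le hab] at hs
      have hs' : s ∈ Icc (0 : ℝ) 1 := ⟨ha.1.trans hs.1.le, hs.2.trans hb.2⟩
      exact h.near_one _ (h.flowPoint_mem_ball hp hs' (hv.2 s hs'))
  rw [abs_of_nonneg (by linarith)] at this
  rw [norm_mul, norm_neg]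
  calc ‖p.2.1‖ * _ ≤ ‖p.2.1‖ * (κ * (b - a)) := by gcongr
    _ = _ := by ring

theorem admissible_picard (h : IsSlope c R κ K B r) {p : ℂ × ℂ × ℂ × ℂ}
    (hp : p ∈ flowDomain R B r) {v : ℝ → ℂ} (hv : Admissible κ p v) :
    Admissible κ p (picard c p v) := by
  constructor
  · unfold picard
    refine continuousOn_const.mul ?_
    have := intervalIntegral.continuousOn_primitive_interval (a := (0 : ℝ)) (b := 1)
      (f := fun s => c (flowPoint p s (v s)) - 1) (μ := MeasureTheory.volume)
      (by rw [uIcc_of_le zero_le_one]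
          exact (h.continuousOn_slope hp hv).integrableOn_Icc)
    rwa [uIcc_of_le zero_le_one] at this
  · intro t ht
    have := h.norm_integral_slope_le hp hv (left_mem_Icc.2 zero_le_one) ht ht.1
    rwa [sub_zero] at this

/-- Integrating the weight in `norm_slope_sub_le` gives the factor `K · 5(1 + B) · r ≤ 1/2` for the
sup norm on all of `[0, 1]`, however long the segment is. A Grönwall argument would lose a factor
exponential in `‖Δ‖`. -/
theorem norm_picard_sub_le (h : IsSlope c R κ K B r) {p : ℂ × ℂ × ℂ × ℂ}
    (hp : p ∈ flowDomain R B r) {v v' : ℝ → ℂ} (hv : Admissible κ p v) (hv' : Admissible κ p v')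
    {δ : ℝ} (hδ : ∀ t ∈ Icc (0 : ℝ) 1, ‖v t - v' t‖ ≤ δ) {t : ℝ} (ht : t ∈ Icc (0 : ℝ) 1) :
    ‖picard c p v t - picard c p v' t‖ ≤ 1 / 2 * δ := by
  have h0 : (0 : ℝ) ∈ Icc (0 : ℝ) 1 := left_mem_Icc.2 zero_le_one
  have hδ0 : 0 ≤ δ := (norm_nonneg _).trans (hδ 0 h0)
  have hr := h.r_pos
  have hK := h.K_nonneg
  simp only [picard]
  rw [← mul_sub, ← intervalIntegral.integral_sub (h.intervalIntegrable_slope hp hv h0 ht)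
    (h.intervalIntegrable_slope hp hv' h0 ht), norm_mul, norm_neg]
  have h1 : ‖∫ s in (0 : ℝ)..t, ((c (flowPoint p s (v s)) - 1) - (c (flowPoint p s (v' s)) - 1))‖ ≤
      ∫ s in (0 : ℝ)..t, K * r * δ * flowWeight κ p s := by
    refine intervalIntegral.norm_integral_le_of_norm_le ht.1 (Eventually.of_forall fun s hs => ?_)
      (((continuous_flowWeight κ p).intervalIntegrable _ _).const_mul _)
    have hs' : s ∈ Icc (0 : ℝ) 1 := ⟨hs.1.le, hs.2.trans ht.2⟩
    rw [sub_sub_sub_cancel_right]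
    refine (h.norm_slope_sub_le hp hs' (hv.2 s hs') (hv'.2 s hs')).trans ?_
    have := hδ s hs'
    have hw : 0 ≤ flowWeight κ p s := (Real.exp_pos _).le
    calc K * r * flowWeight κ p s * ‖v s - v' s‖ ≤ K * r * flowWeight κ p s * δ := by gcongr
      _ = _ := by ring
  rw [intervalIntegral.integral_const_mul] at h1
  calc ‖p.2.1‖ * _ ≤ ‖p.2.1‖ * (K * r * δ * ∫ s in (0 : ℝ)..t, flowWeight κ p s) := by gcongr
    _ = K * r * δ * (‖p.2.1‖ * ∫ s in (0 : ℝ)..t, flowWeight κ p s) := by ring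
    _ ≤ K * r * δ * (5 * (1 + B)) :=
        mul_le_mul_of_nonneg_left (h.integral_flowWeight_le hp ht) (by positivity)
    _ = K * (5 * (1 + B)) * r * δ := by ring
    _ ≤ 1 / 2 * δ := mul_le_mul_of_nonneg_right h.K_mul_le hδ0

end IsSlope

end Saddle

/-! ### The solution: existence, uniqueness, holomorphy and symmetries -/

namespace Saddle

variable {c : ℂ × ℂ × ℂ → ℂ} {R κ K B r : ℝ}

namespace IsSlope

theorem eqOn_of_picard_eq (h : IsSlope c R κ K B r) {p : ℂ × ℂ × ℂ × ℂ}
    (hp : p ∈ flowDomain R B r) {v v' : ℝ → ℂ} (hv : Admissible κ p v) (hv' : Admissible κ p v')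
    (e : ∀ t ∈ Icc (0 : ℝ) 1, picard c p v t = v t)
    (e' : ∀ t ∈ Icc (0 : ℝ) 1, picard c p v' t = v' t) : EqOn v v' (Icc 0 1) := by
  have key : ∀ n : ℕ, ∀ t ∈ Icc (0 : ℝ) 1, ‖v t - v' t‖ ≤ 2 * κ * ‖p.2.1‖ * (1 / 2) ^ n := by
    intro n
    induction n with
    | zero =>
      intro t ht
      have h1 := hv.2 t ht
      have h2 := hv'.2 t ht
      have h3 := norm_sub_le (v t) (v' t)
      have h4 : κ * ‖p.2.1‖ * t ≤ κ * ‖p.2.1‖ :=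
        mul_le_of_le_one_right (mul_nonneg h.κ_nonneg (norm_nonneg _)) ht.2
      simp only [pow_zero, mul_one]
      linarith
    | succ n ih =>
      intro t ht
      rw [← e t ht, ← e' t ht]
      refine (h.norm_picard_sub_le hp hv hv' ih ht).trans_eq ?_
      rw [pow_succ]
      ring
  intro t ht
  have hlim : Tendsto (fun n : ℕ => 2 * κ * ‖p.2.1‖ * (1 / 2 : ℝ) ^ n) atTop (𝓝 0) := by
    simpa using (tendsto_pow_atTop_nhds_zero_of_lt_one (r := (1 / 2 : ℝ))
        (by norm_num) (by norm_num)).const_mul (2 * κ * ‖p.2.1‖)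
  have := ge_of_tendsto' hlim fun n => key n t ht
  exact sub_eq_zero.1 (norm_le_zero_iff.1 this)

/-- The equation has a solution that depends holomorphically on the initial data. -/
theorem exists_solution (h : IsSlope c R κ K B r) : ∃ v : ℂ × ℂ × ℂ × ℂ → ℝ → ℂ,
    (∀ p ∈ flowDomain R B r, Admissible κ p (v p)) ∧
    (∀ p ∈ flowDomain R B r, ∀ t ∈ Icc (0 : ℝ) 1, picard c p (v p) t = v p t) ∧
    ∀ t ∈ Icc (0 : ℝ) 1, DifferentiableOn ℂ (fun p => v p t) (flowDomain R B r) := by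
  have hU := isOpen_flowDomain R B r
  let F : ℕ → (ℂ × ℂ × ℂ × ℂ) → ℝ → ℂ := fun n => Nat.rec (fun _ _ => 0) (fun _ v p => picard c p (v p)) n
  have hF : ∀ n p, F (n + 1) p = picard c p (F n p) := fun n p => rfl
  have hadm : ∀ n, ∀ p ∈ flowDomain R B r, Admissible κ p (F n p) := by
    intro n
    induction n with
    | zero =>
      exact fun p _ => ⟨continuousOn_const, fun t ht => by
        simpa [F] using mul_nonneg (mul_nonneg h.κ_nonneg (norm_nonneg p.2.1)) ht.1⟩
    | succ n ih => exact fun p hp => h.admissible_picard hp (ih p hp)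
  -- Joint continuity in the data and the time is carried along with holomorphy, since holomorphy of
  -- the next iterate is that of an integral with parameters.
  have hreg : ∀ n, ContinuousOn (Function.uncurry (F n)) (flowDomain R B r ×ˢ Icc 0 1) ∧
      ∀ t ∈ Icc (0 : ℝ) 1, DifferentiableOn ℂ (fun p => F n p t) (flowDomain R B r) := by
    intro n
    induction n with
    | zero => exact ⟨continuousOn_const, fun t _ => differentiableOn_const _⟩
    | succ n ih =>
      have hc : ContinuousOn (Function.uncurry fun p s => c (flowPoint p s (F n p s)) - 1)
          (flowDomain R B r ×ˢ Icc 0 1) := by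
        refine (h.diff.continuousOn.comp (f := fun q : (ℂ × ℂ × ℂ × ℂ) × ℝ =>
          flowPoint q.1 q.2 (F n q.1 q.2)) ?_ fun q hq => ?_).sub continuousOn_const
        · have := ih.1
          simp only [Function.uncurry_def] at this
          unfold flowPoint
          fun_prop
        · exact h.flowPoint_mem_ball hq.1 hq.2 ((hadm n q.1 hq.1).2 q.2 hq.2)
      have hd : ∀ s ∈ Icc (0 : ℝ) 1, DifferentiableOn ℂ
          (fun p => c (flowPoint p s (F n p s)) - 1) (flowDomain R B r) := by
        intro s hs
        refine (h.diff.comp ?_ fun p hp =>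
          h.flowPoint_mem_ball hp hs ((hadm n p hp).2 s hs)).sub_const _
        have := ih.2 s hs
        unfold flowPoint
        fun_prop
      constructor
      · have := continuousOn_integral_param hc
        change ContinuousOn (fun q : (ℂ × ℂ × ℂ × ℂ) × ℝ => -q.1.2.1 * ∫ s in (0 : ℝ)..q.2, _) _
        exact ContinuousOn.mul (by fun_prop) this
      · intro t ht
        have := differentiableOn_integral_param hU hc hd ht
        change DifferentiableOn ℂ (fun p : ℂ × ℂ × ℂ × ℂ => -p.2.1 * ∫ s in (0 : ℝ)..t, _) _
        exact DifferentiableOn.mul (by fun_prop) this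
  have hstep : ∀ p ∈ flowDomain R B r, ∀ n, ∀ t ∈ Icc (0 : ℝ) 1,
      dist (F n p t) (F (n + 1) p t) ≤ (κ * ‖p.2.1‖) * (1 / 2) ^ n := by
    intro p hp n
    induction n with
    | zero =>
      intro t ht
      have h1 := (hadm 1 p hp).2 t ht
      have h4 : κ * ‖p.2.1‖ * t ≤ κ * ‖p.2.1‖ :=
        mul_le_of_le_one_right (mul_nonneg h.κ_nonneg (norm_nonneg _)) ht.2
      rw [dist_comm, dist_eq_norm, pow_zero, mul_one]
      refine le_trans (le_of_eq ?_) (h1.trans h4)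
      exact congrArg _ (sub_zero _)
    | succ n ih =>
      intro t ht
      rw [dist_eq_norm]
      refine (h.norm_picard_sub_le hp (hadm n p hp) (hadm (n + 1) p hp)
        (fun s hs => by rw [← dist_eq_norm]; exact ih s hs) ht).trans_eq ?_
      rw [pow_succ]
      ring
  choose! v hv using fun p (hp : p ∈ flowDomain R B r) t (ht : t ∈ Icc (0 : ℝ) 1) =>
    cauchySeq_tendsto_of_complete
      (cauchySeq_of_le_geometric (1 / 2) _ (by norm_num) fun n => hstep p hp n t ht)
  have hrate : ∀ p ∈ flowDomain R B r, ∀ t ∈ Icc (0 : ℝ) 1, ∀ n,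
      ‖F n p t - v p t‖ ≤ 2 * (κ * ‖p.2.1‖) * (1 / 2) ^ n := by
    intro p hp t ht n
    have := dist_le_of_le_geometric_of_tendsto (1 / 2) _ (by norm_num)
      (fun n => hstep p hp n t ht) (hv p hp t ht) n
    rw [dist_eq_norm] at this
    refine this.trans_eq ?_
    ring
  have hvadm : ∀ p ∈ flowDomain R B r, Admissible κ p (v p) := by
    intro p hp
    constructor
    · have hu : TendstoUniformlyOn (fun n => F n p) (v p) atTop (Icc 0 1) := by
        rw [Metric.tendstoUniformlyOn_iff]
        intro δ hδ
        have hlim : Tendsto (fun n : ℕ => 2 * (κ * ‖p.2.1‖) * (1 / 2 : ℝ) ^ n) atTop (𝓝 0) := by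
          simpa using (tendsto_pow_atTop_nhds_zero_of_lt_one (r := (1 / 2 : ℝ))
            (by norm_num) (by norm_num)).const_mul (2 * (κ * ‖p.2.1‖))
        filter_upwards [hlim.eventually (gt_mem_nhds hδ)] with n hn t ht
        rw [dist_comm, dist_eq_norm]
        exact (hrate p hp t ht n).trans_lt hn
      exact hu.continuousOn (Frequently.of_forall fun n => (hadm n p hp).1)
    · exact fun t ht => le_of_tendsto (hv p hp t ht).norm
        (Eventually.of_forall fun n => (hadm n p hp).2 t ht)
  refine ⟨v, hvadm, fun p hp t ht => ?_, fun t ht => ?_⟩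
  · have h1 : Tendsto (fun n => F (n + 1) p t) atTop (𝓝 (picard c p (v p) t)) := by
      rw [tendsto_iff_norm_sub_tendsto_zero]
      refine squeeze_zero (fun _ => norm_nonneg _) (fun n => h.norm_picard_sub_le hp (hadm n p hp)
        (hvadm p hp) (fun s hs => hrate p hp s hs n) ht) ?_
      have := ((tendsto_pow_atTop_nhds_zero_of_lt_one (r := (1 / 2 : ℝ))
            (by norm_num) (by norm_num)).const_mul (2 * (κ * ‖p.2.1‖))).const_mul (1 / 2)
      simpa using this
    exact tendsto_nhds_unique h1 ((hv p hp t ht).comp (tendsto_add_atTop_nat 1))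
  -- The constant in the rate grows with `‖Δ‖`, which is unbounded on `flowDomain`; it is only
  -- locally bounded, being continuous.
  · refine differentiableOn_of_norm_sub_le_geometric (F := fun n p => F n p t)
      (C := fun p => 2 * (κ * ‖p.2.1‖)) hU (fun n => (hreg n).2 t ht) ?_
      fun n p hp => hrate p hp t ht n
    fun_prop

/-- The solution of the equation, as a function of the initial data and of time. -/
noncomputable def sol (h : IsSlope c R κ K B r) : ℂ × ℂ × ℂ × ℂ → ℝ → ℂ :=
  h.exists_solution.choose

variable {p : ℂ × ℂ × ℂ × ℂ}

theorem admissible_sol (h : IsSlope c R κ K B r) (hp : p ∈ flowDomain R B r) : Admissible κ p (h.sol p) :=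
  h.exists_solution.choose_spec.1 p hp

theorem picard_sol (h : IsSlope c R κ K B r) (hp : p ∈ flowDomain R B r) {t : ℝ} (ht : t ∈ Icc (0 : ℝ) 1) :
    picard c p (h.sol p) t = h.sol p t :=
  h.exists_solution.choose_spec.2.1 p hp t ht

theorem differentiableOn_sol (h : IsSlope c R κ K B r) {t : ℝ} (ht : t ∈ Icc (0 : ℝ) 1) :
    DifferentiableOn ℂ (fun p => h.sol p t) (flowDomain R B r) :=
  h.exists_solution.choose_spec.2.2 t ht

theorem sol_eq (h : IsSlope c R κ K B r) (hp : p ∈ flowDomain R B r) {v : ℝ → ℂ} (hv : Admissible κ p v)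
    (e : ∀ t ∈ Icc (0 : ℝ) 1, picard c p v t = v t) {t : ℝ} (ht : t ∈ Icc (0 : ℝ) 1) :
    h.sol p t = v t :=
  h.eqOn_of_picard_eq hp (h.admissible_sol hp) hv (fun _ ht => h.picard_sol hp ht) e ht

theorem sol_zero (h : IsSlope c R κ K B r) (hp : p ∈ flowDomain R B r) : h.sol p 0 = 0 := by
  rw [← h.picard_sol hp (left_mem_Icc.2 zero_le_one)]
  simp [picard]

theorem sol_sub (h : IsSlope c R κ K B r) (hp : p ∈ flowDomain R B r) {s t : ℝ} (hs : s ∈ Icc (0 : ℝ) 1)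
    (ht : t ∈ Icc (0 : ℝ) 1) :
    h.sol p t - h.sol p s = -p.2.1 * ∫ τ in s..t, (c (flowPoint p τ (h.sol p τ)) - 1) := by
  have h0 : (0 : ℝ) ∈ Icc (0 : ℝ) 1 := left_mem_Icc.2 zero_le_one
  have hi := fun {a b : ℝ} (ha : a ∈ Icc (0 : ℝ) 1) (hb : b ∈ Icc (0 : ℝ) 1) =>
    h.intervalIntegrable_slope hp (h.admissible_sol hp) ha hb
  rw [← h.picard_sol hp ht, ← h.picard_sol hp hs, picard, picard, ← mul_sub,
    intervalIntegral.integral_interval_sub_left (hi h0 ht) (hi h0 hs)]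

theorem hasDerivWithinAt_sol (h : IsSlope c R κ K B r) (hp : p ∈ flowDomain R B r) {t : ℝ} (ht : t ∈ Icc (0 : ℝ) 1) :
    HasDerivWithinAt (h.sol p) (-p.2.1 * (c (flowPoint p t (h.sol p t)) - 1)) (Icc 0 1) t := by
  have hc := h.continuousOn_slope hp (h.admissible_sol hp)
  have key : HasDerivWithinAt (fun u => ∫ s in (0 : ℝ)..u, (c (flowPoint p s (h.sol p s)) - 1))
      (c (flowPoint p t (h.sol p t)) - 1) (Icc 0 1) t := by
    have : Fact (t ∈ Icc (0 : ℝ) 1) := ⟨ht⟩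
    exact intervalIntegral.integral_hasDerivWithinAt_right
      (h.intervalIntegrable_slope hp (h.admissible_sol hp) (left_mem_Icc.2 zero_le_one) ht)
      (hc.stronglyMeasurableAtFilter_nhdsWithin measurableSet_Icc t) (hc t ht)
  exact (key.const_mul (-p.2.1)).congr_of_mem (fun s hs => (h.picard_sol hp hs).symm) ht

/-- Complex conjugation of `(ξ, Δ, y, ε)`. -/
theorem conj_mem_flowDomain (hp : p ∈ flowDomain R B r) :
    ((conj p.1, conj p.2.1, conj p.2.2.1, conj p.2.2.2) : ℂ × ℂ × ℂ × ℂ) ∈ flowDomain R B r := by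
  obtain ⟨h1, h2, h3, h4, h5, h6⟩ := hp
  refine ⟨by simpa using h1, by simpa using h2, by simpa using h3, by simpa using h4,
    by simpa using h5, by simpa using h6⟩

/-- The slope `c` is real, so the conjugate of a solution solves the equation with conjugate data;
uniqueness concludes. -/
theorem sol_conj (h : IsSlope c R κ K B r) (hp : p ∈ flowDomain R B r) {t : ℝ} (ht : t ∈ Icc (0 : ℝ) 1) :
    h.sol (conj p.1, conj p.2.1, conj p.2.2.1, conj p.2.2.2) t = conj (h.sol p t) := by
  have hadm := h.admissible_sol hp
  refine h.sol_eq (v := fun t => conj (h.sol p t)) (conj_mem_flowDomain hp)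
    ⟨Complex.continuous_conj.comp_continuousOn hadm.1, fun s hs => by
      simpa using hadm.2 s hs⟩ (fun s hs => ?_) ht
  rw [← h.picard_sol hp hs, picard, picard, map_mul, map_neg]
  congr 1
  have := ContinuousLinearMap.intervalIntegral_comp_comm
    (Complex.conjCLE : ℂ →L[ℝ] ℂ) (h.intervalIntegrable_slope hp hadm (left_mem_Icc.2 zero_le_one) hs)
  refine Eq.trans (intervalIntegral.integral_congr fun τ hτ => ?_) this
  rw [uIcc_of_le hs.1] at hτ
  have hτ' : τ ∈ Icc (0 : ℝ) 1 := ⟨hτ.1, hτ.2.trans hs.2⟩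
  have hreal := h.real _ (h.flowPoint_mem_ball hp hτ' (hadm.2 τ hτ'))
  simp only [ContinuousLinearEquiv.coe_coe, Complex.conjCLE_apply, map_sub, map_one, ← hreal]
  simp [flowPoint, ← Complex.exp_conj]

/-- Semigroup property: the tail of a solution after time `s`, rescaled to `[0, 1]` and with its
value at `s` subtracted, is an admissible fixed point of the Picard operator of the remaining
segment. Smallness of `y` at time `s` has to be assumed, because `|y|` may have grown along the way.
-/
theorem sol_tail (h : IsSlope c R κ K B r) (hp : p ∈ flowDomain R B r) {s : ℝ} (hs : s ∈ Icc (0 : ℝ) 1)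
    (hy : ‖(flowPoint p s (h.sol p s)).2.1‖ < r) :
    ((p.1 + s * p.2.1, (1 - s) * p.2.1, (flowPoint p s (h.sol p s)).2.1, p.2.2.2) :
      ℂ × ℂ × ℂ × ℂ) ∈ flowDomain R B r ∧
    h.sol (p.1 + s * p.2.1, (1 - s) * p.2.1, (flowPoint p s (h.sol p s)).2.1, p.2.2.2) 1 =
      h.sol p 1 - h.sol p s := by
  have hadm := h.admissible_sol hp
  set y' := (flowPoint p s (h.sol p s)).2.1 with hy'
  have hmem : ((p.1 + s * p.2.1, (1 - s) * p.2.1, y', p.2.2.2) :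
      ℂ × ℂ × ℂ × ℂ) ∈ flowDomain R B r := by
    obtain ⟨h1, h2, h3, h4, h5, h6⟩ := hp
    have e : (((1 : ℂ) - s) * p.2.1).re = (1 - s) * p.2.1.re := by
      simp
    have e' : (((1 : ℂ) - s) * p.2.1).im = (1 - s) * p.2.1.im := by
      simp
    refine ⟨?_, ?_, ?_, ?_, hy, h6⟩
    · simp at h2 ⊢
      rcases eq_or_lt_of_le hs.2 with rfl | h1
      · linarith
      · nlinarith [hs.1, hs.2]
    · have : p.1 + s * p.2.1 + (1 - s) * p.2.1 = p.1 + p.2.1 := by ring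
      simpa only [this] using h2
    · simp only [e]
      rcases le_total 0 p.2.1.re with h0 | h0 <;> nlinarith [hs.1, hs.2]
    · simp only [e', abs_mul, abs_of_nonneg (sub_nonneg.2 hs.2)]
      nlinarith [hs.1, hs.2, abs_nonneg p.2.1.im]
  refine ⟨hmem, ?_⟩
  have hτ : ∀ t ∈ Icc (0 : ℝ) 1, s + (1 - s) * t ∈ Icc (0 : ℝ) 1 := fun t ht =>
    ⟨by nlinarith [hs.1, hs.2, ht.1], by nlinarith [hs.1, hs.2, ht.2]⟩
  have hle : ∀ t ∈ Icc (0 : ℝ) 1, s ≤ s + (1 - s) * t := fun t ht => by nlinarith [hs.2, ht.1]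
  have := h.sol_eq (v := fun t => h.sol p (s + (1 - s) * t) - h.sol p s) hmem
    ⟨(hadm.1.comp (by fun_prop) hτ).sub continuousOn_const, fun t ht => ?_⟩ (fun t ht => ?_)
    (right_mem_Icc.2 zero_le_one)
  · rw [this]
    simp
  · change ‖h.sol p (s + (1 - s) * t) - h.sol p s‖ ≤ _
    rw [h.sol_sub hp hs (hτ t ht)]
    refine (h.norm_integral_slope_le hp hadm hs (hτ t ht) (hle t ht)).trans_eq ?_
    have : ‖((1 : ℂ) - s)‖ = 1 - s := by
      rw [← Complex.ofReal_one, ← Complex.ofReal_sub, Complex.norm_real, Real.norm_eq_abs,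
        abs_of_nonneg (sub_nonneg.2 hs.2)]
    simp only [norm_mul, this]
    ring
  · rw [h.sol_sub hp hs (hτ t ht), picard]
    have hsub := intervalIntegral.smul_integral_comp_add_mul (a := 0) (b := t)
      (fun τ => c (flowPoint p τ (h.sol p τ)) - 1) (1 - s) s
    rw [mul_zero, add_zero] at hsub
    rw [← hsub, Complex.real_smul]
    push_cast
    rw [← mul_assoc]
    congr 1
    · ring
    · refine intervalIntegral.integral_congr fun τ _ => ?_
      have : flowPoint (p.1 + s * p.2.1, (1 - s) * p.2.1, y', p.2.2.2) τ
          (h.sol p (s + (1 - s) * τ) - h.sol p s) =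
          flowPoint p (s + (1 - s) * τ) (h.sol p (s + (1 - s) * τ)) := by
        simp only [flowPoint, hy', mul_assoc, ← Complex.exp_add]
        push_cast
        refine Prod.ext ?_ (Prod.ext ?_ rfl) <;> ring_nf
      simp only [this]

end IsSlope

end Saddle

/-! ### The multivalued first integral with values in the section `log x = X` -/

namespace Saddle

variable {c : ℂ × ℂ × ℂ → ℂ} {R κ K B r X : ℝ}

/-- The set of `(ξ, y, ε)` on which the first integral with values in the section `log x = X` is
defined. -/
def intDomain (X B r R : ℝ) : Set (ℂ × ℂ × ℂ) :=
  {q | q.1.re < X + 1 ∧ |q.1.im| < B ∧ ‖q.2.1‖ < r ∧ ‖q.2.2‖ < R}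

theorem isOpen_intDomain (X B r R : ℝ) : IsOpen (intDomain X B r R) := by
  have h1 : Continuous fun q : ℂ × ℂ × ℂ => q.1.re := by fun_prop
  have h2 : Continuous fun q : ℂ × ℂ × ℂ => |q.1.im| := by fun_prop
  have h3 : Continuous fun q : ℂ × ℂ × ℂ => ‖q.2.1‖ := by fun_prop
  have h4 : Continuous fun q : ℂ × ℂ × ℂ => ‖q.2.2‖ := by fun_prop
  exact (isOpen_lt h1 continuous_const).inter ((isOpen_lt h2 continuous_const).inter
    ((isOpen_lt h3 continuous_const).inter (isOpen_lt h4 continuous_const)))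

/-- The data of the solution from `(ξ, y, ε)` to the section `log x = X`. -/
def toSection (X : ℝ) (q : ℂ × ℂ × ℂ) : ℂ × ℂ × ℂ × ℂ := (q.1, X - q.1, q.2.1, q.2.2)

theorem toSection_mem (hX : X + 1 ≤ Real.log R) {q : ℂ × ℂ × ℂ} (hq : q ∈ intDomain X B r R) :
    toSection X q ∈ flowDomain R B r := by
  obtain ⟨h1, h2, h3, h4⟩ := hq
  refine ⟨h1.trans_le hX, ?_, ?_, ?_, h3, h4⟩
  · simp [toSection]; linarith
  · simp [toSection]; linarith
  · simpa [toSection] using h2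

namespace IsSlope

/-- The `y`-coordinate of the solution. -/
noncomputable def flowY (h : IsSlope c R κ K B r) (p : ℂ × ℂ × ℂ × ℂ) (s : ℝ) : ℂ :=
  p.2.2.1 * Complex.exp (-(s * p.2.1) + h.sol p s)

theorem flowPoint_eq (h : IsSlope c R κ K B r) (p : ℂ × ℂ × ℂ × ℂ) (s : ℝ) :
    flowPoint p s (h.sol p s) = (Complex.exp (p.1 + s * p.2.1), h.flowY p s, p.2.2.2) := rfl

theorem flowY_zero (h : IsSlope c R κ K B r) {p : ℂ × ℂ × ℂ × ℂ} (hp : p ∈ flowDomain R B r) :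
    h.flowY p 0 = p.2.2.1 := by
  simp [flowY, h.sol_zero hp]

theorem norm_flowY_le (h : IsSlope c R κ K B r) {p : ℂ × ℂ × ℂ × ℂ} (hp : p ∈ flowDomain R B r)
    {s : ℝ} (hs : s ∈ Icc (0 : ℝ) 1) : ‖h.flowY p s‖ ≤ 5 * ‖p.2.2.1‖ := by
  have h1 := norm_flowPoint_snd_le ((h.admissible_sol hp).2 s hs)
  have h2 := h.flowWeight_le hp hs
  calc ‖h.flowY p s‖ ≤ ‖p.2.2.1‖ * flowWeight κ p s := h1
    _ ≤ ‖p.2.2.1‖ * 5 := by gcongr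
    _ = _ := mul_comm _ _

theorem hasDerivWithinAt_flowY (h : IsSlope c R κ K B r) {p : ℂ × ℂ × ℂ × ℂ}
    (hp : p ∈ flowDomain R B r) {s : ℝ} (hs : s ∈ Icc (0 : ℝ) 1) :
    HasDerivWithinAt (h.flowY p)
      (-(h.flowY p s * c (Complex.exp (p.1 + s * p.2.1), h.flowY p s, p.2.2.2) * p.2.1))
      (Icc 0 1) s := by
  have h1 : HasDerivWithinAt (fun s : ℝ => -((s : ℂ) * p.2.1) + h.sol p s)
      (-(1 * p.2.1) + -p.2.1 * (c (flowPoint p s (h.sol p s)) - 1)) (Icc 0 1) s :=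
    ((Complex.ofRealCLM.hasDerivAt (x := s)).hasDerivWithinAt.mul_const p.2.1).neg.add
      (h.hasDerivWithinAt_sol hp hs)
  have h2 := (h1.cexp).const_mul p.2.2.1
  refine h2.congr_deriv ?_
  rw [flowPoint_eq, flowY]
  ring

/-- Logarithm of the deviation of the first integral from `y exp (ξ - X)`. -/
noncomputable def dev (h : IsSlope c R κ K B r) (X : ℝ) (q : ℂ × ℂ × ℂ) : ℂ :=
  h.sol (toSection X q) 1

/-- The first integral: the `y`-coordinate at which the leaf through `(exp ξ, y)` meets the section
`log x = X`. -/
noncomputable def firstInt (h : IsSlope c R κ K B r) (X : ℝ) (q : ℂ × ℂ × ℂ) : ℂ :=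
  q.2.1 * Complex.exp (-(X - q.1) + h.dev X q)

theorem firstInt_eq_flowY (h : IsSlope c R κ K B r) (q : ℂ × ℂ × ℂ) :
    h.firstInt X q = h.flowY (toSection X q) 1 := by
  simp [firstInt, flowY, toSection, dev]

theorem differentiableOn_dev (h : IsSlope c R κ K B r) (hX : X + 1 ≤ Real.log R) :
    DifferentiableOn ℂ (h.dev X) (intDomain X B r R) := by
  refine (h.differentiableOn_sol (right_mem_Icc.2 zero_le_one)).comp (f := toSection X) ?_
    fun q hq => toSection_mem hX hq
  unfold toSection
  fun_prop

theorem differentiableOn_firstInt (h : IsSlope c R κ K B r) (hX : X + 1 ≤ Real.log R) :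
    DifferentiableOn ℂ (h.firstInt X) (intDomain X B r R) := by
  have := h.differentiableOn_dev hX
  unfold firstInt
  fun_prop

theorem dev_conj (h : IsSlope c R κ K B r) (hX : X + 1 ≤ Real.log R) {q : ℂ × ℂ × ℂ}
    (hq : q ∈ intDomain X B r R) :
    h.dev X (conj q.1, conj q.2.1, conj q.2.2) = conj (h.dev X q) := by
  have := h.sol_conj (toSection_mem hX hq) (right_mem_Icc.2 zero_le_one)
  rw [dev, dev, ← this]
  simp [toSection]

/-- A start further along the same solution has the same end on the section, by `sol_tail`. -/
theorem firstInt_flow (h : IsSlope c R κ K B r) (hX : X + 1 ≤ Real.log R) {q : ℂ × ℂ × ℂ}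
    (hq : q ∈ intDomain X B r R) {s : ℝ} (hs : s ∈ Icc (0 : ℝ) 1)
    (hy : ‖h.flowY (toSection X q) s‖ < r) :
    h.firstInt X (q.1 + s * (X - q.1), h.flowY (toSection X q) s, q.2.2) = h.firstInt X q := by
  have h1 := (h.sol_tail (toSection_mem hX hq) hs hy).2
  have h2 : toSection X (q.1 + s * (X - q.1), h.flowY (toSection X q) s, q.2.2) =
      ((toSection X q).1 + s * (toSection X q).2.1, (1 - s) * (toSection X q).2.1,
        (flowPoint (toSection X q) s (h.sol (toSection X q) s)).2.1, (toSection X q).2.2.2) := by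
    simp only [toSection, flowPoint_eq]
    refine Prod.ext rfl (Prod.ext ?_ rfl)
    ring_nf
  rw [firstInt, firstInt, dev, h2, h1, dev]
  simp only [flowY, toSection, mul_assoc, ← Complex.exp_add]
  congr 2
  ring

/-- Infinitesimal form of `firstInt_flow`, obtained by differentiating at `s = 0`. The velocity
there is `X - ξ` times the direction of the leaf, so points of the section itself have to be
excluded in order to divide. -/
theorem fderiv_firstInt (h : IsSlope c R κ K B r) (hX : X + 1 ≤ Real.log R) {q : ℂ × ℂ × ℂ}
    (hq : q ∈ intDomain X B r R) (hne : q.1 ≠ X) :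
    fderiv ℂ (h.firstInt X) q (1, -(q.2.1 * c (Complex.exp q.1, q.2.1, q.2.2)), 0) = 0 := by
  have hp := toSection_mem hX hq
  set p := toSection X q with hpdef
  have h0 : (0 : ℝ) ∈ Icc (0 : ℝ) 1 := left_mem_Icc.2 zero_le_one
  have hd : HasFDerivAt (h.firstInt X) (fderiv ℂ (h.firstInt X) q) q :=
    ((h.differentiableOn_firstInt hX).differentiableAt
      ((isOpen_intDomain X B r R).mem_nhds hq)).hasFDerivAt
  have hY := h.hasDerivWithinAt_flowY hp h0
  let g : ℝ → ℂ × ℂ × ℂ := fun s => (q.1 + s * (X - q.1), h.flowY p s, q.2.2)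
  have hg0 : g 0 = q := by
    simp only [g, h.flowY_zero hp]
    simp [hpdef, toSection]
  have hg : HasDerivWithinAt g ((X - q.1), -(q.2.1 * c (Complex.exp q.1, q.2.1, q.2.2) * (X - q.1)), 0)
      (Icc 0 1) 0 := by
    refine HasDerivWithinAt.prodMk ?_ (HasDerivWithinAt.prodMk ?_ (hasDerivWithinAt_const _ _ _))
    · have := ((Complex.ofRealCLM.hasDerivAt (x := (0 : ℝ))).hasDerivWithinAt
        (s := Icc 0 1)).mul_const ((X : ℂ) - q.1)
      simpa using this.const_add q.1
    · rw [h.flowY_zero hp] at hY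
      simpa [hpdef, toSection] using hY
  have hcomp : HasDerivWithinAt (fun s => h.firstInt X (g s))
      (fderiv ℂ (h.firstInt X) q
        ((X - q.1), -(q.2.1 * c (Complex.exp q.1, q.2.1, q.2.2) * (X - q.1)), 0)) (Icc 0 1) 0 := by
    have h1 : HasFDerivAt (h.firstInt X) ((fderiv ℂ (h.firstInt X) q).restrictScalars ℝ) (g 0) := by
      rw [hg0]
      exact hd.restrictScalars ℝ
    exact h1.comp_hasDerivWithinAt (0 : ℝ) hg
  have hev : (fun s => h.firstInt X (g s)) =ᶠ[𝓝[Icc 0 1] 0] fun _ => h.firstInt X q := by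
    have hcont : ContinuousWithinAt (fun s => ‖h.flowY p s‖) (Icc 0 1) 0 :=
      hY.continuousWithinAt.norm
    have hlt : ‖h.flowY p 0‖ < r := by
      rw [h.flowY_zero hp]
      exact hq.2.2.1
    filter_upwards [hcont.eventually (gt_mem_nhds hlt), self_mem_nhdsWithin] with s hs hs'
    exact h.firstInt_flow hX hq hs' hs
  have hconst : HasDerivWithinAt (fun s => h.firstInt X (g s)) 0 (Icc 0 1) 0 :=
    (hasDerivWithinAt_const _ _ _).congr_of_eventuallyEq hev (by simp [hg0])
  have hzero := (uniqueDiffOn_Icc zero_lt_one 0 h0).eq_deriv _ hcomp hconst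
  have hsmul : (((X : ℂ) - q.1), -(q.2.1 * c (Complex.exp q.1, q.2.1, q.2.2) * (X - q.1)), (0 : ℂ)) =
      ((X : ℂ) - q.1) • ((1 : ℂ), -(q.2.1 * c (Complex.exp q.1, q.2.1, q.2.2)), (0 : ℂ)) := by
    simp [Prod.ext_iff]
    ring
  rw [hsmul, map_smul, smul_eq_mul] at hzero
  exact (mul_eq_zero.1 hzero).resolve_left (sub_ne_zero.2 hne.symm)

/-- The first integral is constant along the leaves. -/
theorem firstInt_eq_of_leaf (h : IsSlope c R κ K B r) (hX : X + 1 ≤ Real.log R) {ξ y ξ' : ℝ → ℂ}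
    {ε : ℂ} (hmem : ∀ s ∈ Icc (0 : ℝ) 1, (ξ s, y s, ε) ∈ intDomain X B r R)
    (hne : ∀ s ∈ Icc (0 : ℝ) 1, ξ s ≠ X)
    (hξ : ∀ s ∈ Icc (0 : ℝ) 1, HasDerivWithinAt ξ (ξ' s) (Icc 0 1) s)
    (hy : ∀ s ∈ Icc (0 : ℝ) 1, HasDerivWithinAt y
      (-(y s * c (Complex.exp (ξ s), y s, ε) * ξ' s)) (Icc 0 1) s) :
    h.firstInt X (ξ 1, y 1, ε) = h.firstInt X (ξ 0, y 0, ε) := by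
  have hder : ∀ s ∈ Icc (0 : ℝ) 1,
      HasDerivWithinAt (fun s => h.firstInt X (ξ s, y s, ε)) 0 (Icc 0 1) s := by
    intro s hs
    have hd : HasFDerivAt (h.firstInt X)
        ((fderiv ℂ (h.firstInt X) (ξ s, y s, ε)).restrictScalars ℝ) (ξ s, y s, ε) :=
      ((h.differentiableOn_firstInt hX).differentiableAt
        ((isOpen_intDomain X B r R).mem_nhds (hmem s hs))).hasFDerivAt.restrictScalars ℝ
    have hg : HasDerivWithinAt (fun s => (ξ s, y s, ε))
        (ξ' s, -(y s * c (Complex.exp (ξ s), y s, ε) * ξ' s), 0) (Icc 0 1) s :=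
      (hξ s hs).prodMk ((hy s hs).prodMk (hasDerivWithinAt_const _ _ _))
    have := hd.comp_hasDerivWithinAt s hg
    refine this.congr_deriv ?_
    have hsmul : (ξ' s, -(y s * c (Complex.exp (ξ s), y s, ε) * ξ' s), (0 : ℂ)) =
        ξ' s • ((1 : ℂ), -(y s * c (Complex.exp (ξ s), y s, ε)), (0 : ℂ)) := by
      simp [Prod.ext_iff]
      ring
    rw [hsmul, ContinuousLinearMap.coe_restrictScalars', map_smul,
      h.fderiv_firstInt hX (hmem s hs) (hne s hs), smul_zero]
  refine constant_of_derivWithin_zero (f := fun s => h.firstInt X (ξ s, y s, ε))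
    (fun s hs => (hder s hs).differentiableWithinAt) (fun s hs => ?_) 1 (right_mem_Icc.2 zero_le_one)
  have hs' := Ico_subset_Icc_self hs
  exact (hder s hs').derivWithin (uniqueDiffOn_Icc zero_lt_one s hs')

/-- The slope depends on `ξ` only through `exp ξ`, so the solution from `ξ` to `X`, translated by
`2πi`, is again a leaf, but ends above `X + 2πi`. Thus a change of the branch of `log x` acts on the
values of the first integral by one self-map of the section, the same for all starting points. This
is the source of both the holonomy and the monodromy of the Dulac map. -/
theorem firstInt_translate (h : IsSlope c R κ K B r) (hX : X + 1 ≤ Real.log R) {q : ℂ × ℂ × ℂ}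
    (hq : q ∈ intDomain X B r R) (hre : q.1.re < X) (hy : 5 * ‖q.2.1‖ < r)
    (hB : 2 * Real.pi < B) (him : |q.1.im + 2 * Real.pi| < B) :
    h.firstInt X (q.1 + 2 * Real.pi * Complex.I, q.2.1, q.2.2) =
      h.firstInt X (X + 2 * Real.pi * Complex.I, h.firstInt X q, q.2.2) := by
  have hp := toSection_mem hX hq
  have := h.firstInt_eq_of_leaf hX (ξ := fun s : ℝ => q.1 + 2 * Real.pi * Complex.I + s * (X - q.1))
    (ξ' := fun _ => X - q.1) (y := h.flowY (toSection X q)) (ε := q.2.2) ?_ ?_ ?_ ?_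
  · rw [h.flowY_zero hp, ← h.firstInt_eq_flowY] at this
    simp only [Complex.ofReal_one, one_mul, Complex.ofReal_zero, zero_mul, add_zero] at this
    rw [show q.1 + 2 * Real.pi * Complex.I + (X - q.1) = X + 2 * Real.pi * Complex.I by ring] at this
    exact this.symm
  · intro s hs
    refine ⟨?_, ?_, (h.norm_flowY_le hp hs).trans_lt hy, hq.2.2.2⟩
    · simp
      nlinarith [hs.1, hs.2]
    · simp
      have e : q.1.im + 2 * Real.pi + -(s * q.1.im) =
          (1 - s) * (q.1.im + 2 * Real.pi) + s * (2 * Real.pi) := by ring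
      rw [e]
      have e1 := abs_add_le ((1 - s) * (q.1.im + 2 * Real.pi)) (s * (2 * Real.pi))
      rw [abs_mul, abs_mul, abs_of_nonneg hs.1, abs_of_nonneg (sub_nonneg.2 hs.2),
        abs_of_pos Real.two_pi_pos] at e1
      rcases eq_or_lt_of_le hs.1 with rfl | h1
      · simpa using him
      · nlinarith [hs.1, hs.2]
  -- By real parts, the translated segment could meet `X` only at `s = 1`, where its imaginary part
  -- is `2π`.
  · intro s hs heq
    have e1 := congrArg Complex.re heq
    have e2 := congrArg Complex.im heq
    simp at e1 e2
    have hs1 : s = 1 := by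
      have : (1 - s) * (X - q.1.re) = 0 := by linarith
      rcases mul_eq_zero.1 this with h1 | h1 <;> linarith
    rw [hs1] at e2
    linarith [Real.two_pi_pos]
  · intro s _
    have := ((Complex.ofRealCLM.hasDerivAt (x := s)).hasDerivWithinAt
        (s := Icc 0 1)).mul_const ((X : ℂ) - q.1)
    simpa using this.const_add (q.1 + 2 * Real.pi * Complex.I)
  · intro s hs
    have := h.hasDerivWithinAt_flowY hp hs
    refine this.congr_deriv ?_
    simp only [toSection]
    rw [show q.1 + 2 * Real.pi * Complex.I + s * (X - q.1) =
      q.1 + s * (X - q.1) + 2 * Real.pi * Complex.I by ring, Complex.exp_periodic]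

/-- With the slope frozen at `x = y = 0` the deviation is linear in `X - ξ`. The error is the
integral of `K (|x| + |y|)` along the segment. There `|x|` decays exponentially away from the
section and `|y|` away from the starting point, so the error is bounded uniformly in `ξ`. -/
theorem norm_dev_add_le (h : IsSlope c R κ K B r) (hX : X + 1 ≤ Real.log R) {q : ℂ × ℂ × ℂ}
    (hq : q ∈ intDomain X B r R) (hre : q.1.re ≤ X - 1) :
    ‖h.dev X q + (c (0, 0, q.2.2) - 1) * (X - q.1)‖ ≤ K * (1 + B) * (Real.exp X + 5 * r) := by
  have hp := toSection_mem hX hq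
  have hadm := h.admissible_sol hp
  have h1I : (1 : ℝ) ∈ Icc (0 : ℝ) 1 := right_mem_Icc.2 zero_le_one
  have h0I : (0 : ℝ) ∈ Icc (0 : ℝ) 1 := left_mem_Icc.2 zero_le_one
  have hK := h.K_nonneg
  have hB := h.one_le_B
  set p := toSection X q with hpdef
  have hΔ : p.2.1 = X - q.1 := rfl
  have hΔre : p.2.1.re = X - q.1.re := by simp [hΔ]
  have hre1 : 1 ≤ p.2.1.re := by rw [hΔre]; linarith
  have e1 : h.dev X q + (c (0, 0, q.2.2) - 1) * (X - q.1) =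
      -p.2.1 * ∫ s in (0 : ℝ)..1, (c (flowPoint p s (h.sol p s)) - c (0, 0, q.2.2)) := by
    have e2 : ∫ s in (0 : ℝ)..1, (c (flowPoint p s (h.sol p s)) - c (0, 0, q.2.2)) =
        (∫ s in (0 : ℝ)..1, (c (flowPoint p s (h.sol p s)) - 1)) - (c (0, 0, q.2.2) - 1) := by
      have e3 : (c (0, 0, q.2.2) - 1) = ∫ s in (0 : ℝ)..1, (c (0, 0, q.2.2) - 1) := by simp
      rw [e3, ← intervalIntegral.integral_sub (h.intervalIntegrable_slope hp hadm h0I h1I)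
        intervalIntegrable_const]
      simp only [sub_sub_sub_cancel_right]
    rw [e2, mul_sub, dev, ← hpdef, ← h.picard_sol hp h1I, picard, hΔ]
    ring
  rw [e1, norm_mul, norm_neg]
  have hx : ∀ s : ℝ, ‖(flowPoint p s (h.sol p s)).1‖ = Real.exp (q.1.re + p.2.1.re * s) := by
    intro s
    simp only [flowPoint, Complex.norm_exp]
    simp [hpdef, toSection]
    ring
  have hbound : ‖∫ s in (0 : ℝ)..1, (c (flowPoint p s (h.sol p s)) - c (0, 0, q.2.2))‖ ≤
      ∫ s in (0 : ℝ)..1, (K * Real.exp (q.1.re + p.2.1.re * s) + K * r * flowWeight κ p s) := by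
    have hw := continuous_flowWeight κ p
    refine intervalIntegral.norm_integral_le_of_norm_le zero_le_one
      (Eventually.of_forall fun s hs => ?_) (Continuous.intervalIntegrable (by fun_prop) _ _)
    have hs' : s ∈ Icc (0 : ℝ) 1 := Ioc_subset_Icc_self hs
    have hball := h.flowPoint_mem_ball hp hs' (hadm.2 s hs')
    have h0b : ((0 : ℂ), (0 : ℂ), q.2.2) ∈ Metric.ball (0 : ℂ × ℂ × ℂ) R := by
      have := hq.2.2.2
      simpa [Prod.norm_def, h.R_pos] using this
    refine (h.lip _ _ _ _ _ hball h0b).trans ?_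
    rw [sub_zero, sub_zero, mul_add]
    have hyb := norm_flowPoint_snd_le (hadm.2 s hs')
    have hwn : 0 ≤ flowWeight κ p s := (Real.exp_pos _).le
    have hqr : ‖p.2.2.1‖ ≤ r := hq.2.2.1.le
    refine add_le_add (mul_le_mul_of_nonneg_left (hx s).le hK) ?_
    calc K * ‖(flowPoint p s (h.sol p s)).2.1‖ ≤ K * (r * flowWeight κ p s) := by
          gcongr
          exact hyb.trans (by gcongr)
      _ = _ := by ring
  have hpos : 0 < p.2.1.re := by linarith
  have hint1 : ∫ s in (0 : ℝ)..1, Real.exp (q.1.re + p.2.1.re * s) ≤ Real.exp X / p.2.1.re := by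
    rw [intervalIntegral.integral_comp_add_mul (fun s => Real.exp s) hpos.ne', integral_exp]
    rw [mul_one, mul_zero, add_zero, hΔre, smul_eq_mul, div_eq_inv_mul]
    have := Real.exp_pos q.1.re
    rw [show q.1.re + (X - q.1.re) = X by ring]
    have : 0 ≤ (X - q.1.re)⁻¹ := by rw [← hΔre]; positivity
    gcongr
    linarith
  have hw := continuous_flowWeight κ p
  rw [intervalIntegral.integral_add (Continuous.intervalIntegrable (by fun_prop) _ _)
    (Continuous.intervalIntegrable (by fun_prop) _ _), intervalIntegral.integral_const_mul,
    intervalIntegral.integral_const_mul] at hbound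
  have h2 := h.integral_flowWeight_le hp h1I
  have h3 := h.norm_le_mul_re hp hre1
  have hr := h.r_pos
  calc ‖p.2.1‖ * _ ≤ ‖p.2.1‖ * (K * (∫ s in (0 : ℝ)..1, Real.exp (q.1.re + p.2.1.re * s)) +
        K * r * ∫ s in (0 : ℝ)..1, flowWeight κ p s) := by gcongr
    _ = K * (‖p.2.1‖ * ∫ s in (0 : ℝ)..1, Real.exp (q.1.re + p.2.1.re * s)) +
        K * r * (‖p.2.1‖ * ∫ s in (0 : ℝ)..1, flowWeight κ p s) := by ring
    _ ≤ K * (((1 + B) * p.2.1.re) * (Real.exp X / p.2.1.re)) + K * r * (5 * (1 + B)) := by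
        refine add_le_add (mul_le_mul_of_nonneg_left (mul_le_mul h3 hint1 ?_ (by positivity)) hK)
          (mul_le_mul_of_nonneg_left h2 (by positivity))
        exact intervalIntegral.integral_nonneg zero_le_one fun s _ => (Real.exp_pos _).le
    _ = _ := by field_simp

/-- The deviation oscillates by at most `2β` on a ball of radius `r/2`, so a Schwarz-type estimate
makes it Lipschitz in `y` with a small constant. Equality of the first integrals then gives `‖y₁ -
y₂‖ ≤ 2β ‖y₁ - y₂‖` with `2β ≤ 1/4`. -/
theorem firstInt_injective (h : IsSlope c R κ K B r) (hX : X + 1 ≤ Real.log R)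
    (hβ : K * (1 + B) * (Real.exp X + 5 * r) ≤ 1 / 8) {ξ y₁ y₂ ε : ℂ} (hre : ξ.re ≤ X - 1)
    (him : |ξ.im| < B) (hε : ‖ε‖ < R) (h₁ : 4 * ‖y₁‖ < r) (h₂ : 4 * ‖y₂‖ < r)
    (heq : h.firstInt X (ξ, y₁, ε) = h.firstInt X (ξ, y₂, ε)) : y₁ = y₂ := by
  have hr := h.r_pos
  set β := K * (1 + B) * (Real.exp X + 5 * r)
  have hmem : ∀ y : ℂ, ‖y‖ < r → (ξ, y, ε) ∈ intDomain X B r R := fun y hy =>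
    ⟨by simp only; linarith, him, hy, hε⟩
  have hsub : ∀ y ∈ Metric.ball y₂ (r / 2), ‖y‖ < r := by
    intro y hy
    have := norm_add_le (y - y₂) y₂
    rw [sub_add_cancel] at this
    rw [mem_ball_iff_norm] at hy
    linarith
  have hb : ∀ y : ℂ, ‖y‖ < r →
      ‖h.dev X (ξ, y, ε) + (c (0, 0, ε) - 1) * (X - ξ)‖ ≤ β := fun y hy =>
    h.norm_dev_add_le hX (hmem y hy) hre
  have hdist : ∀ y y' : ℂ, ‖y‖ < r → ‖y'‖ < r →
      ‖h.dev X (ξ, y, ε) - h.dev X (ξ, y', ε)‖ ≤ 2 * β := by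
    intro y y' hy hy'
    have := norm_sub_le (h.dev X (ξ, y, ε) + (c (0, 0, ε) - 1) * (X - ξ))
      (h.dev X (ξ, y', ε) + (c (0, 0, ε) - 1) * (X - ξ))
    rw [add_sub_add_right_eq_sub] at this
    linarith [hb y hy, hb y' hy']
  have hL : ‖h.dev X (ξ, y₁, ε) - h.dev X (ξ, y₂, ε)‖ ≤ 2 * β / (r / 2) * ‖y₁ - y₂‖ := by
    have := Complex.dist_le_div_mul_dist_of_mapsTo_ball (f := fun y => h.dev X (ξ, y, ε)) (c := y₂)
      (z := y₁) (R₁ := r / 2) (R₂ := 2 * β)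
      ((h.differentiableOn_dev hX).comp (by fun_prop) fun y hy => hmem y (hsub y hy))
      (fun y hy => by
        rw [mem_closedBall_iff_norm]
        exact hdist y y₂ (hsub y hy) (by linarith [norm_nonneg y₂]))
      (by
        rw [mem_ball_iff_norm]
        have := norm_sub_le y₁ y₂
        linarith)
    simpa [dist_eq_norm] using this
  by_contra hne
  have hpos : 0 < ‖y₁ - y₂‖ := norm_pos_iff.2 (sub_ne_zero.2 hne)
  set d₁ := h.dev X (ξ, y₁, ε)
  set d₂ := h.dev X (ξ, y₂, ε)
  have hd : ‖d₁ - d₂‖ ≤ 2 * β := hdist _ _ (by linarith [norm_nonneg y₁]) (by linarith [norm_nonneg y₂])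
  have hy : y₁ = y₂ * Complex.exp (d₂ - d₁) := by
    have : y₁ * Complex.exp (-(X - ξ) + d₁) = y₂ * Complex.exp (-(X - ξ) + d₂) := heq
    rw [Complex.exp_sub, mul_div_assoc', eq_div_iff (Complex.exp_ne_zero _)]
    rw [Complex.exp_add, Complex.exp_add] at this
    have hE := Complex.exp_ne_zero (-((X : ℂ) - ξ))
    have h3 : Complex.exp (-((X : ℂ) - ξ)) * (y₁ * Complex.exp d₁) =
      Complex.exp (-((X : ℂ) - ξ)) * (y₂ * Complex.exp d₂) := by linear_combination this
    exact mul_left_cancel₀ hE h3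
  have h4 : ‖y₁ - y₂‖ ≤ ‖y₂‖ * (2 * ‖d₁ - d₂‖) := by
    have e : y₁ - y₂ = y₂ * (Complex.exp (d₂ - d₁) - 1) := by
      rw [mul_sub, mul_one, ← hy]
    have hle : ‖d₂ - d₁‖ ≤ 1 := by rw [norm_sub_rev]; linarith
    have := Complex.norm_exp_sub_one_le hle
    rw [e, norm_mul, norm_sub_rev d₁ d₂]
    gcongr
  have h5 : ‖y₂‖ * (2 * ‖d₁ - d₂‖) ≤ r / 4 * (2 * (2 * β / (r / 2) * ‖y₁ - y₂‖)) := by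
    gcongr
    linarith
  have h6 : r / 4 * (2 * (2 * β / (r / 2) * ‖y₁ - y₂‖)) = 2 * β * ‖y₁ - y₂‖ := by
    field_simp
    ring
  nlinarith

end IsSlope

end Saddle

/-! ### Factoring the coefficients of the one-form by `y` and by `x` -/

namespace Saddle

theorem mem_ball_prod_iff {R : ℝ} {x y ε : ℂ} :
    (x, y, ε) ∈ Metric.ball (0 : ℂ × ℂ × ℂ) R ↔ ‖x‖ < R ∧ ‖y‖ < R ∧ ‖ε‖ < R := by
  simp [Prod.norm_def]

/-- A real-analytic function that vanishes on `{y = 0}`, for all small real `ε`, is divisible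
by `y`. -/
theorem exists_eq_snd_mul {A : ℂ × ℂ × ℂ → ℂ} (hA : AnalyticAt ℂ A 0)
    (hzero : ∀ᶠ q in 𝓝 (0 : ℝ × ℂ), A (q.2, 0, (q.1 : ℂ)) = 0)
    (hreal : ∀ᶠ p in 𝓝 (0 : ℂ × ℂ × ℂ), A (conj p.1, conj p.2.1, conj p.2.2) = conj (A p)) :
    ∃ R : ℝ, 0 < R ∧ ∃ a : ℂ × ℂ × ℂ → ℂ, DifferentiableOn ℂ a (Metric.ball 0 R) ∧
      (∀ p ∈ Metric.ball (0 : ℂ × ℂ × ℂ) R, A p = p.2.1 * a p) ∧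
      (∀ p ∈ Metric.ball (0 : ℂ × ℂ × ℂ) R, a (conj p.1, conj p.2.1, conj p.2.2) = conj (a p)) ∧
      a 0 = fderiv ℂ A 0 (0, 1, 0) := by
  obtain ⟨R₁, hR₁, h₁⟩ := Metric.eventually_nhds_iff_ball.1 (hA.eventually_analyticAt.and hreal)
  obtain ⟨R₂, hR₂, h₂⟩ := Metric.eventually_nhds_iff_ball.1 hzero
  set R := min R₁ R₂
  have hR : 0 < R := lt_min hR₁ hR₂
  have hA' : AnalyticOnNhd ℂ A (Metric.ball 0 R) := fun p hp =>
    (h₁ p (Metric.ball_subset_ball (min_le_left _ _) hp)).1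
  -- The vanishing is given for real `ε` only; the identity theorem in `ε` extends it to complex
  -- parameters.
  have hzero' : ∀ x ε : ℂ, ‖x‖ < R → ‖ε‖ < R → A (x, 0, ε) = 0 := by
    intro x ε hx hε
    have han : AnalyticOnNhd ℂ (fun ε => A (x, 0, ε)) (Metric.ball 0 R) := by
      refine DifferentiableOn.analyticOnNhd ?_ Metric.isOpen_ball
      refine hA'.differentiableOn.comp (f := fun ε => (x, 0, ε)) (by fun_prop) fun η hη => ?_
      exact mem_ball_prod_iff.2 ⟨hx, by simpa using hR, by simpa using hη⟩
    have hfreq : ∃ᶠ η in 𝓝[≠] (0 : ℂ), A (x, 0, η) = 0 := by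
      have ht : Tendsto (fun t : ℝ => (t : ℂ)) (𝓝[≠] 0) (𝓝[≠] 0) := by
        refine tendsto_nhdsWithin_of_tendsto_nhds_of_eventually_within _ ?_ ?_
        · exact (Complex.continuous_ofReal.tendsto' 0 0 (by simp)).mono_left nhdsWithin_le_nhds
        · filter_upwards [self_mem_nhdsWithin] with t ht
          simpa using ht
      refine ht.frequently (Eventually.frequently ?_)
      filter_upwards [nhdsWithin_le_nhds (Metric.ball_mem_nhds (0 : ℝ) hR)] with t ht
      refine h₂ (t, x) ?_
      have ht' : ‖t‖ < R₂ := (by simpa using ht : ‖t‖ < R).trans_le (min_le_right _ _)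
      simpa [Prod.norm_def] using ⟨ht', hx.trans_le (min_le_right _ _)⟩
    exact han.eqOn_zero_of_preconnected_of_frequently_eq_zero
      (convex_ball (0 : ℂ) R).isPreconnected (Metric.mem_ball_self hR) hfreq
      (by simpa using hε)
  have hscale : ∀ p ∈ Metric.ball (0 : ℂ × ℂ × ℂ) R, ∀ s ∈ Icc (0 : ℝ) 1,
      (p.1, (s : ℂ) * p.2.1, p.2.2) ∈ Metric.ball (0 : ℂ × ℂ × ℂ) R := by
    rintro ⟨x, y, ε⟩ hp s hs
    rw [mem_ball_prod_iff] at hp ⊢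
    refine ⟨hp.1, ?_, hp.2.2⟩
    rw [norm_mul, Complex.norm_real, Real.norm_eq_abs, abs_of_nonneg hs.1]
    exact (mul_le_of_le_one_left (norm_nonneg _) hs.2).trans_lt hp.2.1
  have hAd : AnalyticOnNhd ℂ (fun p => fderiv ℂ A p (0, 1, 0)) (Metric.ball 0 R) := fun p hp =>
    ((ContinuousLinearMap.apply ℂ ℂ ((0 : ℂ), (1 : ℂ), (0 : ℂ))).analyticAt _).comp (hA' p hp).fderiv
  -- Hadamard's quotient: the mean of `∂A/∂y` over the segment from `(x, 0, ε)` to `(x, y, ε)`.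
  set a : ℂ × ℂ × ℂ → ℂ := fun p =>
    ∫ s in (0 : ℝ)..1, fderiv ℂ A (p.1, (s : ℂ) * p.2.1, p.2.2) (0, 1, 0) with ha
  have hcont : ContinuousOn (Function.uncurry fun (p : ℂ × ℂ × ℂ) (s : ℝ) =>
      fderiv ℂ A (p.1, (s : ℂ) * p.2.1, p.2.2) (0, 1, 0)) (Metric.ball 0 R ×ˢ Icc 0 1) :=
    hAd.continuousOn.comp (f := fun q : (ℂ × ℂ × ℂ) × ℝ => (q.1.1, (q.2 : ℂ) * q.1.2.1, q.1.2.2))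
      (by fun_prop) fun q hq => hscale q.1 hq.1 q.2 hq.2
  have had : DifferentiableOn ℂ a (Metric.ball 0 R) := by
    refine differentiableOn_integral_param Metric.isOpen_ball hcont (fun s hs => ?_)
      (right_mem_Icc.2 zero_le_one)
    exact hAd.differentiableOn.comp (f := fun p : ℂ × ℂ × ℂ => (p.1, (s : ℂ) * p.2.1, p.2.2))
      (by fun_prop) fun p hp => hscale p hp s hs
  have hmul : ∀ p ∈ Metric.ball (0 : ℂ × ℂ × ℂ) R, A p = p.2.1 * a p := by
    intro p hp
    have hderiv : ∀ s ∈ uIcc (0 : ℝ) 1, HasDerivAt (fun s : ℝ => A (p.1, (s : ℂ) * p.2.1, p.2.2))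
        (p.2.1 * fderiv ℂ A (p.1, (s : ℂ) * p.2.1, p.2.2) (0, 1, 0)) s := by
      intro s hs
      rw [uIcc_of_le zero_le_one] at hs
      have h1 : HasDerivAt (fun s : ℝ => (p.1, (s : ℂ) * p.2.1, p.2.2)) (0, p.2.1, 0) s := by
        refine (hasDerivAt_const _ _).prodMk (HasDerivAt.prodMk ?_ (hasDerivAt_const _ _))
        simpa using (Complex.ofRealCLM.hasDerivAt (x := s)).mul_const p.2.1
      have h2 := (hA' _ (hscale p hp s hs)).differentiableAt.hasFDerivAt.restrictScalars ℝ
      refine (h2.comp_hasDerivAt s h1).congr_deriv ?_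
      have : ((0 : ℂ), p.2.1, (0 : ℂ)) = p.2.1 • ((0 : ℂ), (1 : ℂ), (0 : ℂ)) := by simp
      rw [this, ContinuousLinearMap.coe_restrictScalars', map_smul, smul_eq_mul]
    have hslice : ContinuousOn (fun s : ℝ => fderiv ℂ A (p.1, (s : ℂ) * p.2.1, p.2.2) (0, 1, 0))
        (Icc 0 1) :=
      hcont.comp (f := fun s => (p, s)) (by fun_prop) fun s hs => ⟨hp, hs⟩
    have := intervalIntegral.integral_eq_sub_of_hasDerivAt hderiv (by
      refine ContinuousOn.intervalIntegrable ?_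
      rw [uIcc_of_le zero_le_one]
      exact continuousOn_const.mul hslice)
    rw [intervalIntegral.integral_const_mul] at this
    rw [ha]
    simp only
    rw [this]
    obtain ⟨hx, -, hε⟩ := mem_ball_prod_iff.1 hp
    simp [hzero' p.1 p.2.2 hx hε]
  have hconj : ∀ p ∈ Metric.ball (0 : ℂ × ℂ × ℂ) R,
      ((conj p.1, conj p.2.1, conj p.2.2) : ℂ × ℂ × ℂ) ∈ Metric.ball (0 : ℂ × ℂ × ℂ) R := by
    rintro ⟨x, y, ε⟩ hp
    rw [mem_ball_prod_iff] at hp ⊢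
    simpa using hp
  refine ⟨R, hR, a, had, hmul, ?_, ?_⟩
  -- Off `{y = 0}` the reality of `A` can be divided by the conjugate of `y`; density and continuity
  -- extend the result.
  · have hdense : Dense ((univ : Set ℂ) ×ˢ ({0}ᶜ : Set ℂ) ×ˢ (univ : Set ℂ)) :=
      dense_univ.prod ((dense_compl_singleton 0).prod dense_univ)
    refine EqOn.of_subset_closure
      (s := Metric.ball 0 R ∩ (univ : Set ℂ) ×ˢ ({0}ᶜ : Set ℂ) ×ˢ (univ : Set ℂ)) ?_
      (had.continuousOn.comp (by fun_prop) hconj)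
      (Complex.continuous_conj.comp_continuousOn had.continuousOn) inter_subset_left
      (hdense.open_subset_closure_inter Metric.isOpen_ball)
    rintro ⟨x, y, ε⟩ ⟨hp, -, hy, -⟩
    have h3 := (h₁ _ (Metric.ball_subset_ball (min_le_left _ _) hp)).2
    rw [hmul _ hp, hmul _ (hconj _ hp), map_mul] at h3
    exact mul_left_cancel₀ (by simpa using hy) h3
  · simp [ha]
    rfl

/-- The data extracted from the hypotheses on the foliation: the coefficients of the one-form are
`y a(x, y, ε)` and `x b(x, y, ε)` with functions `a`, `b` whose real parts are positive near the
origin. -/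
structure IsFactored (f : ℂ × ℂ → ℂ) (P Q : ℂ × ℂ × ℂ → ℂ) (a b : ℂ × ℂ × ℂ → ℂ) (R : ℝ) :
    Prop where
  R_pos : 0 < R
  f_analytic : AnalyticOnNhd ℂ f (Metric.ball 0 R)
  a_diff : DifferentiableOn ℂ a (Metric.ball 0 R)
  b_diff : DifferentiableOn ℂ b (Metric.ball 0 R)
  a_re : ∀ p ∈ Metric.ball (0 : ℂ × ℂ × ℂ) R, 0 < (a p).re
  b_re : ∀ p ∈ Metric.ball (0 : ℂ × ℂ × ℂ) R, 0 < (b p).re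
  a_real : ∀ p ∈ Metric.ball (0 : ℂ × ℂ × ℂ) R, a (conj p.1, conj p.2.1, conj p.2.2) = conj (a p)
  b_real : ∀ p ∈ Metric.ball (0 : ℂ × ℂ × ℂ) R, b (conj p.1, conj p.2.1, conj p.2.2) = conj (b p)
  coeffX_eq : ∀ (ε : ℝ) (x y : ℂ), (x, y, (ε : ℂ)) ∈ Metric.ball (0 : ℂ × ℂ × ℂ) R →
    coeffX f P ε (x, y) = y * a (x, y, ε)
  coeffY_eq : ∀ (ε : ℝ) (x y : ℂ), (x, y, (ε : ℂ)) ∈ Metric.ball (0 : ℂ × ℂ × ℂ) R →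
    coeffY f Q ε (x, y) = x * b (x, y, ε)
  eq_zero : a 0 = b 0

theorem dX_eq_deriv {f : ℂ × ℂ → ℂ} {p : ℂ × ℂ} (hf : DifferentiableAt ℂ f p) :
    HasDerivAt (fun t => f (t, p.2)) (dX f p) p.1 := by
  have h1 : HasDerivAt (fun t : ℂ => (t, p.2)) (1, 0) p.1 :=
    (hasDerivAt_id _).prodMk (hasDerivAt_const _ _)
  exact hf.hasFDerivAt.comp_hasDerivAt p.1 h1

theorem dY_eq_deriv {f : ℂ × ℂ → ℂ} {p : ℂ × ℂ} (hf : DifferentiableAt ℂ f p) :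
    HasDerivAt (fun t => f (p.1, t)) (dY f p) p.2 := by
  have h1 : HasDerivAt (fun t : ℂ => (p.1, t)) (0, 1) p.2 :=
    (hasDerivAt_const _ _).prodMk (hasDerivAt_id _)
  exact hf.hasFDerivAt.comp_hasDerivAt p.2 h1

theorem analyticAt_dX {f : ℂ × ℂ → ℂ} {p : ℂ × ℂ} (hf : AnalyticAt ℂ f p) :
    AnalyticAt ℂ (dX f) p :=
  ((ContinuousLinearMap.apply ℂ ℂ ((1 : ℂ), (0 : ℂ))).analyticAt _).comp hf.fderiv

theorem analyticAt_dY {f : ℂ × ℂ → ℂ} {p : ℂ × ℂ} (hf : AnalyticAt ℂ f p) :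
    AnalyticAt ℂ (dY f) p :=
  ((ContinuousLinearMap.apply ℂ ℂ ((0 : ℂ), (1 : ℂ))).analyticAt _).comp hf.fderiv

theorem continuous_conj2 : Continuous conj2 := by
  unfold conj2
  fun_prop

theorem eventually_dX_conj {f : ℂ × ℂ → ℂ} (hf : AnalyticAt ℂ f 0)
    (hreal : ∀ᶠ p in 𝓝 (0 : ℂ × ℂ), f (conj2 p) = conj (f p)) :
    ∀ᶠ p in 𝓝 (0 : ℂ × ℂ), dX f (conj2 p) = conj (dX f p) ∧ dY f (conj2 p) = conj (dY f p) := by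
  have h0 : Tendsto conj2 (𝓝 0) (𝓝 0) := continuous_conj2.tendsto' _ _ (by simp [conj2])
  filter_upwards [hreal.eventually_nhds, hf.eventually_analyticAt,
    h0.eventually hf.eventually_analyticAt, h0.eventually hreal.eventually_nhds]
    with p hp hp1 hp2 hp3
  constructor
  · have h1 := (dX_eq_deriv hp1.differentiableAt).conj_conj
    have h2 := dX_eq_deriv hp2.differentiableAt
    refine h2.unique (h1.congr_of_eventuallyEq ?_)
    have hc : Tendsto (fun t => (t, (conj2 p).2)) (𝓝 (conj2 p).1) (𝓝 (conj2 p)) :=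
      (Continuous.tendsto (by fun_prop) _)
    filter_upwards [hc.eventually hp3] with t ht
    have := congrArg conj ht
    simpa [conj2] using this.symm
  · have h1 := (dY_eq_deriv hp1.differentiableAt).conj_conj
    have h2 := dY_eq_deriv hp2.differentiableAt
    refine h2.unique (h1.congr_of_eventuallyEq ?_)
    have hc : Tendsto (fun t => ((conj2 p).1, t)) (𝓝 (conj2 p).2) (𝓝 (conj2 p)) :=
      (Continuous.tendsto (by fun_prop) _)
    filter_upwards [hc.eventually hp3] with t ht
    have := congrArg conj ht
    simpa [conj2] using this.symm

end Saddle

/-! ### The normal form of the foliation near a hyperbolic saddle -/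

namespace Saddle

/-- Symmetry of the second derivative; it yields `a(0) = b(0)`, hence slope `1` at the origin for `ε
= 0`. -/
theorem dX_dY_comm {f : ℂ × ℂ → ℂ} (hf : AnalyticAt ℂ f 0) : dX (dY f) 0 = dY (dX f) 0 := by
  have hsymm : IsSymmSndFDerivAt ℂ f 0 :=
    (hf.contDiffAt (n := ⊤)).isSymmSndFDerivAt (by simp)
  have hd : DifferentiableAt ℂ (fderiv ℂ f) 0 := hf.fderiv.differentiableAt
  have key : ∀ v w : ℂ × ℂ, fderiv ℂ (fun p => fderiv ℂ f p v) 0 w =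
      fderiv ℂ (fderiv ℂ f) 0 w v := by
    intro v w
    have := (ContinuousLinearMap.apply ℂ ℂ v).hasFDerivAt.comp (0 : ℂ × ℂ) hd.hasFDerivAt
    have h2 := this.fderiv
    exact congrArg (fun L : ℂ × ℂ →L[ℂ] ℂ => L w) h2
  change fderiv ℂ (fun p => fderiv ℂ f p (0, 1)) 0 (1, 0) =
    fderiv ℂ (fun p => fderiv ℂ f p (1, 0)) 0 (0, 1)
  rw [key, key]
  exact hsymm _ _

/-- Invariance of the axes makes the `dx`-coefficient vanish on `{y = 0}` and the `dy`-coefficient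
on `{x = 0}`. At the origin both quotients equal the mixed second derivative of `f`. It is real,
nonzero because `f_xx(0) = 0` and the Hessian determinant is negative, and positive because `f` is
positive in the first quadrant. -/
theorem exists_isFactored {f : ℂ × ℂ → ℂ} {P Q : ℂ × ℂ × ℂ → ℂ} (hf : IsHyperbolicMorse f)
    (hP : IsRealAnalytic P) (hQ : IsRealAnalytic Q) (hsep : AxesAreSeparatrices f P Q)
    (hpos : PositiveOnFirstQuadrant f) : ∃ a b R, IsFactored f P Q a b R := by
  have hproj : Tendsto (fun p : ℂ × ℂ × ℂ => (p.1, p.2.1)) (𝓝 0) (𝓝 (0 : ℂ × ℂ)) :=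
    Continuous.tendsto' (by fun_prop) _ _ (by simp)
  have hswap : Tendsto (fun p : ℂ × ℂ × ℂ => (p.2.1, p.1, p.2.2)) (𝓝 0) (𝓝 (0 : ℂ × ℂ × ℂ)) :=
    Continuous.tendsto' (by fun_prop) _ _ (by simp)
  have hpa : AnalyticAt ℂ (fun p : ℂ × ℂ × ℂ => (p.1, p.2.1)) 0 :=
    analyticAt_fst.prod (analyticAt_fst.comp analyticAt_snd)
  have hsa : AnalyticAt ℂ (fun p : ℂ × ℂ × ℂ => (p.2.1, p.1, p.2.2)) 0 :=
    (analyticAt_fst.comp analyticAt_snd).prod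
      (analyticAt_fst.prod (analyticAt_snd.comp analyticAt_snd))
  have hεa : AnalyticAt ℂ (fun p : ℂ × ℂ × ℂ => p.2.2) 0 := analyticAt_snd.comp analyticAt_snd
  have hconj := eventually_dX_conj hf.analytic hf.real
  have hAan : AnalyticAt ℂ (fun p : ℂ × ℂ × ℂ => dX f (p.1, p.2.1) + p.2.2 * P p) 0 :=
    (AnalyticAt.comp (g := dX f) (f := fun p : ℂ × ℂ × ℂ => (p.1, p.2.1)) (x := 0)
      (analyticAt_dX hf.analytic) hpa).add (hεa.mul hP.analytic)
  have hBan : AnalyticAt ℂ (fun p : ℂ × ℂ × ℂ => dY f (p.1, p.2.1) + p.2.2 * Q p) 0 :=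
    (AnalyticAt.comp (g := dY f) (f := fun p : ℂ × ℂ × ℂ => (p.1, p.2.1)) (x := 0)
      (analyticAt_dY hf.analytic) hpa).add (hεa.mul hQ.analytic)
  have hBan' : AnalyticAt ℂ (fun p : ℂ × ℂ × ℂ =>
      dY f (p.2.1, p.1) + p.2.2 * Q (p.2.1, p.1, p.2.2)) 0 :=
    AnalyticAt.comp (g := fun p : ℂ × ℂ × ℂ => dY f (p.1, p.2.1) + p.2.2 * Q p)
      (f := fun p : ℂ × ℂ × ℂ => (p.2.1, p.1, p.2.2)) hBan hsa
  have hBreal : ∀ᶠ p in 𝓝 (0 : ℂ × ℂ × ℂ), dY f (conj p.1, conj p.2.1) +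
      conj p.2.2 * Q (conj p.1, conj p.2.1, conj p.2.2) =
      conj (dY f (p.1, p.2.1) + p.2.2 * Q p) := by
    filter_upwards [hproj.eventually hconj, hQ.real] with p h1 h2
    rw [map_add, map_mul, h2, ← h1.2]
    rfl
  obtain ⟨R₁, hR₁, a, had, hamul, hareal, ha0⟩ := exists_eq_snd_mul hAan
    (hsep.mono fun q hq => hq.2) (by
      filter_upwards [hproj.eventually hconj, hP.real] with p h1 h2
      rw [map_add, map_mul, h2, ← h1.1]
      rfl)
  -- The same division lemma is applied after exchanging the coordinates, so `b` has swapped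
  -- arguments until `b'` is introduced.
  obtain ⟨R₂, hR₂, b, hbd, hbmul, hbreal, hb0⟩ := exists_eq_snd_mul hBan'
    (hsep.mono fun q hq => hq.1) (by
      filter_upwards [hswap.eventually hBreal] with p h1
      exact h1)
  have ha0' : a 0 = dY (dX f) 0 := by
    rw [ha0]
    have h1 : HasDerivAt (fun t : ℂ => ((0 : ℂ), t, (0 : ℂ))) (0, 1, 0) 0 :=
      (hasDerivAt_const _ _).prodMk ((hasDerivAt_id _).prodMk (hasDerivAt_const _ _))
    have h2 := hAan.differentiableAt.hasFDerivAt.comp_hasDerivAt (0 : ℂ) h1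
    have h3 := dY_eq_deriv (p := 0) (analyticAt_dX hf.analytic).differentiableAt
    refine h2.unique (h3.congr_of_eventuallyEq (Eventually.of_forall fun t => ?_))
    simp
  have hb0' : b 0 = dX (dY f) 0 := by
    rw [hb0]
    have h1 : HasDerivAt (fun t : ℂ => ((0 : ℂ), t, (0 : ℂ))) (0, 1, 0) 0 :=
      (hasDerivAt_const _ _).prodMk ((hasDerivAt_id _).prodMk (hasDerivAt_const _ _))
    have h2 := hBan'.differentiableAt.hasFDerivAt.comp_hasDerivAt (0 : ℂ) h1
    have h3 := dX_eq_deriv (p := 0) (analyticAt_dY hf.analytic).differentiableAt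
    refine h2.unique (h3.congr_of_eventuallyEq (Eventually.of_forall fun t => ?_))
    simp
  have hab : a 0 = b 0 := by rw [ha0', hb0', dX_dY_comm hf.analytic]
  have hX0 : ∀ᶠ t in 𝓝 (0 : ℂ), dX f (t, 0) = 0 := by
    have ht : Tendsto (fun t : ℂ => ((0 : ℝ), t)) (𝓝 0) (𝓝 0) :=
      Continuous.tendsto' (by fun_prop) _ _ (by simp)
    filter_upwards [ht.eventually hsep] with t ht
    simpa [coeffX] using ht.2
  -- For `ε = 0` the separatrix condition says that `f_x` vanishes along the `x`-axis.
  have hXX : dX (dX f) 0 = 0 := by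
    have h3 := dX_eq_deriv (p := 0) (analyticAt_dX hf.analytic).differentiableAt
    refine h3.unique ((hasDerivAt_const (0 : ℂ) (0 : ℂ)).congr_of_eventuallyEq ?_)
    filter_upwards [hX0] with t ht
    exact ht
  have hbim : (b 0).im = 0 := by
    have := hbreal 0 (Metric.mem_ball_self hR₂)
    simp only [Prod.fst_zero, Prod.snd_zero, map_zero] at this
    exact Complex.conj_eq_iff_im.1 this.symm
  have hbne : (b 0).re ≠ 0 := by
    have := hf.hyperbolic
    rw [hXX, ← ha0', ← hb0', hab] at this
    simp [hbim] at this
    exact this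
  let b' : ℂ × ℂ × ℂ → ℂ := fun p => b (p.2.1, p.1, p.2.2)
  have hmemswap : ∀ {x y ε : ℂ} {R : ℝ}, (x, y, ε) ∈ Metric.ball (0 : ℂ × ℂ × ℂ) R →
      (y, x, ε) ∈ Metric.ball (0 : ℂ × ℂ × ℂ) R := by
    intro x y ε R h
    rw [mem_ball_prod_iff] at h ⊢
    exact ⟨h.2.1, h.1, h.2.2⟩
  have hbd' : DifferentiableOn ℂ b' (Metric.ball 0 R₂) :=
    hbd.comp (by fun_prop) fun p hp => hmemswap hp
  have hb'c : ContinuousAt b' 0 :=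
    (hbd'.differentiableAt (Metric.ball_mem_nhds 0 hR₂)).continuousAt
  have hac : ContinuousAt a 0 := (had.differentiableAt (Metric.ball_mem_nhds 0 hR₁)).continuousAt
  have hb'mul : ∀ x y ε : ℂ, (x, y, ε) ∈ Metric.ball (0 : ℂ × ℂ × ℂ) R₂ →
      dY f (x, y) + ε * Q (x, y, ε) = x * b' (x, y, ε) := by
    intro x y ε h
    exact hbmul _ (hmemswap h)
  have hbpos : 0 < (b 0).re := by
    rcases lt_or_gt_of_ne hbne with hneg | h
    -- If the mixed derivative were negative, then for small `x > 0` one would have `f(x, 0) = 0`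
    -- and `∂f/∂y = x b' < 0` on the vertical segment up to `(x, x)`; the mean value theorem would
    -- give `f(x, x) < 0`.
    · exfalso
      have hre : ∀ᶠ p in 𝓝 (0 : ℂ × ℂ × ℂ), (b' p).re < 0 ∧
          p ∈ Metric.ball (0 : ℂ × ℂ × ℂ) R₂ ∧ AnalyticAt ℂ f (p.1, p.2.1) := by
        refine (((Complex.continuous_re.continuousAt.comp hb'c).eventually
          (gt_mem_nhds hneg)).and (Metric.ball_mem_nhds 0 hR₂)).and ?_ |>.mono
            fun p hp => ⟨hp.1.1, hp.1.2, hp.2⟩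
        exact hproj.eventually hf.analytic.eventually_analyticAt
      obtain ⟨δ₁, hδ₁, h₁⟩ := Metric.eventually_nhds_iff_ball.1 hre
      obtain ⟨δ₂, hδ₂, h₂⟩ := Metric.eventually_nhds_iff_ball.1 hX0
      obtain ⟨δ₃, hδ₃, h₃⟩ := Metric.eventually_nhds_iff_ball.1 hpos
      obtain ⟨x, hx0, hx⟩ := exists_between (lt_min hδ₁ (lt_min hδ₂ hδ₃))
      have hx1 : x < δ₁ := hx.trans_le (min_le_left _ _)
      have hx2 : x < δ₂ := hx.trans_le ((min_le_right _ _).trans (min_le_left _ _))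
      have hx3 : x < δ₃ := hx.trans_le ((min_le_right _ _).trans (min_le_right _ _))
      have hnorm : ∀ t ∈ Icc 0 x, ‖(t : ℂ)‖ ≤ x := fun t ht => by
        rw [Complex.norm_real, Real.norm_eq_abs, abs_of_nonneg ht.1]
        exact ht.2
      have hxx : ∀ s ∈ Icc 0 x, ∀ t ∈ Icc 0 x,
          (((s : ℂ), (t : ℂ), (0 : ℂ)) : ℂ × ℂ × ℂ) ∈ Metric.ball 0 δ₁ := fun s hs t ht =>
        mem_ball_prod_iff.2 ⟨(hnorm s hs).trans_lt hx1, (hnorm t ht).trans_lt hx1, by simpa using hδ₁⟩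
      have hxI : x ∈ Icc 0 x := ⟨hx0.le, le_rfl⟩
      have h0I : (0 : ℝ) ∈ Icc 0 x := ⟨le_rfl, hx0.le⟩
      have d₁ : ∀ t ∈ Icc 0 x, HasDerivAt (fun t : ℝ => (f ((x : ℂ), (t : ℂ))).re)
          (x * (b' (x, t, 0)).re) t := by
        intro t ht
        obtain ⟨-, hb2, hb3⟩ := h₁ _ (hxx x hxI t ht)
        have e1 := dY_eq_deriv (p := ((x : ℂ), (t : ℂ))) hb3.differentiableAt
        have e2 := hb'mul x t 0 hb2
        rw [zero_mul, add_zero] at e2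
        rw [e2] at e1
        have := e1.real_of_complex
        simpa using this
      have d₂ : ∀ t ∈ Icc 0 x, HasDerivAt (fun t : ℝ => (f ((t : ℂ), 0)).re) 0 t := by
        intro t ht
        obtain ⟨-, hb2, hb3⟩ := h₁ _ (hxx t ht 0 h0I)
        have e1 := dX_eq_deriv (p := ((t : ℂ), ((0 : ℝ) : ℂ))) hb3.differentiableAt
        have e2 := h₂ t (by rw [mem_ball_zero_iff]; exact (hnorm t ht).trans_lt hx2)
        simp only [Complex.ofReal_zero] at e1
        rw [e2] at e1
        simpa using e1.real_of_complex
      obtain ⟨t₂, ht₂, e₂⟩ := exists_hasDerivAt_eq_slope _ (fun _ => 0) hx0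
        (fun t ht => (d₂ t ht).continuousAt.continuousWithinAt)
        (fun t ht => d₂ t (Ioo_subset_Icc_self ht))
      obtain ⟨t₁, ht₁, e₁⟩ := exists_hasDerivAt_eq_slope _ _ hx0
        (fun t ht => (d₁ t ht).continuousAt.continuousWithinAt)
        (fun t ht => d₁ t (Ioo_subset_Icc_self ht))
      have hf0 : f ((0 : ℂ), (0 : ℂ)) = 0 := hf.zero
      have hb1 := (h₁ _ (hxx x hxI t₁ (Ioo_subset_Icc_self ht₁))).1
      have hfx := h₃ (x, x) (by
        simp only [mem_ball_zero_iff, Prod.norm_def, Real.norm_eq_abs, abs_of_pos hx0, max_self]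
        exact hx3) hx0 hx0
      rw [eq_div_iff (by linarith)] at e₁ e₂
      simp only [Complex.ofReal_zero, hf0, Complex.zero_re, sub_zero, zero_mul] at e₁ e₂
      rw [← e₂, sub_zero] at e₁
      have : x * (b' (x, t₁, 0)).re * x < 0 := by
        have := mul_pos hx0 hx0
        nlinarith
      linarith
    · exact h
  have hev : ∀ᶠ p in 𝓝 (0 : ℂ × ℂ × ℂ), 0 < (a p).re ∧ 0 < (b' p).re :=
    ((Complex.continuous_re.continuousAt.comp hac).eventually
      (lt_mem_nhds (by rw [Function.comp_apply, hab]; exact hbpos))).and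
    ((Complex.continuous_re.continuousAt.comp hb'c).eventually (lt_mem_nhds hbpos))
  obtain ⟨R₃, hR₃, h₃⟩ := Metric.eventually_nhds_iff_ball.1 hev
  obtain ⟨R₄, hR₄, h₄⟩ := Metric.eventually_nhds_iff_ball.1 hf.analytic.eventually_analyticAt
  set R := min (min R₁ R₂) (min R₃ R₄)
  have hRpos : 0 < R := lt_min (lt_min hR₁ hR₂) (lt_min hR₃ hR₄)
  have s₁ : Metric.ball (0 : ℂ × ℂ × ℂ) R ⊆ Metric.ball 0 R₁ :=
    Metric.ball_subset_ball ((min_le_left _ _).trans (min_le_left _ _))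
  have s₂ : Metric.ball (0 : ℂ × ℂ × ℂ) R ⊆ Metric.ball 0 R₂ :=
    Metric.ball_subset_ball ((min_le_left _ _).trans (min_le_right _ _))
  have s₃ : Metric.ball (0 : ℂ × ℂ × ℂ) R ⊆ Metric.ball 0 R₃ :=
    Metric.ball_subset_ball ((min_le_right _ _).trans (min_le_left _ _))
  have s₄ : Metric.ball (0 : ℂ × ℂ) R ⊆ Metric.ball 0 R₄ :=
    Metric.ball_subset_ball ((min_le_right _ _).trans (min_le_right _ _))
  exact ⟨a, b', R, {
    R_pos := hRpos
    f_analytic := fun p hp => h₄ p (s₄ hp)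
    a_diff := had.mono s₁
    b_diff := hbd'.mono s₂
    a_re := fun p hp => (h₃ p (s₃ hp)).1
    b_re := fun p hp => (h₃ p (s₃ hp)).2
    a_real := fun p hp => hareal p (s₁ hp)
    b_real := fun p hp => hbreal _ (hmemswap (s₂ hp))
    coeffX_eq := fun ε x y h => hamul _ (s₁ h)
    coeffY_eq := fun ε x y h => hb'mul _ _ _ (s₂ h)
    eq_zero := hab }⟩

/-- The slope of a factored foliation satisfies the conditions under which the equation for the
leaves is solved. -/
theorem IsFactored.exists_isSlope {f : ℂ × ℂ → ℂ} {P Q a b : ℂ × ℂ × ℂ → ℂ} {R₀ : ℝ}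
    (h : IsFactored f P Q a b R₀) {B : ℝ} (hB : 1 ≤ B) {β : ℝ} (hβ : 0 < β) :
    ∃ R κ K r X : ℝ, R ≤ R₀ ∧ X + 1 ≤ Real.log R ∧ K * (1 + B) * (Real.exp X + 5 * r) ≤ β ∧
      (∀ p ∈ Metric.ball (0 : ℂ × ℂ × ℂ) R, ‖a p / b p - 1‖ ≤ β) ∧
      IsSlope (fun p => a p / b p) R κ K B r := by
  set c : ℂ × ℂ × ℂ → ℂ := fun p => a p / b p with hc
  have hbne : ∀ p ∈ Metric.ball (0 : ℂ × ℂ × ℂ) R₀, b p ≠ 0 := fun p hp h0 => by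
    have := h.b_re p hp
    simp [h0] at this
  have hcd : DifferentiableOn ℂ c (Metric.ball 0 R₀) := by
    simp only [hc, div_eq_mul_inv]
    exact h.a_diff.mul (h.b_diff.inv hbne)
  have hR₀ := h.R_pos
  have hc0 : c 0 = 1 := by
    simp only [hc, h.eq_zero]
    exact div_self (hbne 0 (Metric.mem_ball_self hR₀))
  obtain ⟨M, hM⟩ := (isCompact_closedBall (0 : ℂ × ℂ × ℂ) (R₀ / 2)).exists_bound_of_continuousOn
    (hcd.continuousOn.mono (Metric.closedBall_subset_ball (by linarith)))
  -- The order of choices matters: `κ` first, then `R` by continuity of the slope at the origin, and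
  -- `r` and `X` last, small relative to `K`.
  set κ := min (1 / (2 * (1 + B))) β with hκ
  have hκpos : 0 < κ := lt_min (by positivity) hβ
  have hev : ∀ᶠ p in 𝓝 (0 : ℂ × ℂ × ℂ), ‖c p - 1‖ < κ := by
    have hcc : ContinuousAt (fun p => ‖c p - 1‖) 0 :=
      ((hcd.differentiableAt (Metric.ball_mem_nhds 0 hR₀)).continuousAt.sub
        continuousAt_const).norm
    exact hcc.eventually (gt_mem_nhds (by simpa [hc0] using hκpos))
  obtain ⟨R₁, hR₁, h₁⟩ := Metric.eventually_nhds_iff_ball.1 hev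
  set R := min R₁ (R₀ / 4)
  have hR : 0 < R := lt_min hR₁ (by positivity)
  have hRR₀ : R ≤ R₀ / 4 := min_le_right _ _
  -- The Lipschitz constant comes from Cauchy's estimate on balls of radius `R₀ / 4`, hence does not
  -- depend on `R`.
  set K := 2 * M / (R₀ / 4)
  have hM0 : 0 ≤ M := (norm_nonneg _).trans (hM 0 (Metric.mem_closedBall_self (by positivity)))
  have hK : 0 ≤ K := by positivity
  have hlip : ∀ p ∈ Metric.ball (0 : ℂ × ℂ × ℂ) R, ∀ q ∈ Metric.ball (0 : ℂ × ℂ × ℂ) R,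
      ‖c p - c q‖ ≤ K * ‖p - q‖ := by
    intro p hp q hq
    have hs : ∀ w ∈ Metric.ball (0 : ℂ × ℂ × ℂ) R, Metric.ball w (R₀ / 4) ⊆
        Metric.closedBall 0 (R₀ / 2) := fun w hw =>
      (Metric.ball_subset_ball' (by
        have : dist w 0 < R := Metric.mem_ball.1 hw
        linarith)).trans Metric.ball_subset_closedBall
    have hs' : Metric.closedBall (0 : ℂ × ℂ × ℂ) (R₀ / 2) ⊆ Metric.ball 0 R₀ :=
      Metric.closedBall_subset_ball (by linarith)
    refine (convex_ball (0 : ℂ × ℂ × ℂ) R).norm_image_sub_le_of_norm_hasFDerivWithin_le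
      (f' := fun w => fderiv ℂ c w) (fun w hw => ?_) (fun w hw => ?_) hq hp
    · exact (hcd.differentiableAt (Metric.isOpen_ball.mem_nhds
        (Metric.ball_subset_ball (by linarith) hw))).hasFDerivAt.hasFDerivWithinAt
    · exact norm_fderiv_le_of_norm_le (by positivity) (hcd.mono ((hs w hw).trans hs'))
        fun q hq => hM q (hs w hw hq)
  obtain ⟨r, hr, hr'⟩ : ∃ r : ℝ, 0 < r ∧ 5 * r ≤ R ∧ K * (5 * (1 + B)) * r ≤ 1 / 2 ∧
      K * (1 + B) * (5 * r) ≤ β / 2 := by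
    have hB' : 0 < 1 + B := by linarith
    refine ⟨min (R / 5) (min (1 / 2 / (K * (5 * (1 + B)) + 1)) (β / 2 / (K * (5 * (1 + B)) + 1))),
      by positivity, ?_, ?_, ?_⟩
    · have : min (R / 5) (min (1 / 2 / (K * (5 * (1 + B)) + 1))
        (β / 2 / (K * (5 * (1 + B)) + 1))) ≤ R / 5 := min_le_left _ _
      linarith
    · have h1 : min (R / 5) (min (1 / 2 / (K * (5 * (1 + B)) + 1))
        (β / 2 / (K * (5 * (1 + B)) + 1))) ≤ 1 / 2 / (K * (5 * (1 + B)) + 1) :=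
        (min_le_right _ _).trans (min_le_left _ _)
      refine (mul_le_mul_of_nonneg_left h1 (by positivity)).trans ?_
      rw [mul_div_assoc', div_le_iff₀ (by positivity)]
      linarith
    · have h1 : min (R / 5) (min (1 / 2 / (K * (5 * (1 + B)) + 1))
        (β / 2 / (K * (5 * (1 + B)) + 1))) ≤ β / 2 / (K * (5 * (1 + B)) + 1) :=
        (min_le_right _ _).trans (min_le_right _ _)
      rw [show ∀ r, K * (1 + B) * (5 * r) = K * (5 * (1 + B)) * r from fun r => by ring]
      refine (mul_le_mul_of_nonneg_left h1 (by positivity)).trans ?_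
      rw [mul_div_assoc', div_le_iff₀ (by positivity)]
      nlinarith
  obtain ⟨X, hX, hX'⟩ : ∃ X : ℝ, X + 1 ≤ Real.log R ∧ K * (1 + B) * Real.exp X ≤ β / 2 := by
    have hB' : 0 < 1 + B := by linarith
    refine ⟨min (Real.log R - 1) (Real.log (β / 2 / (K * (1 + B) + 1))), ?_, ?_⟩
    · have := min_le_left (Real.log R - 1) (Real.log (β / 2 / (K * (1 + B) + 1)))
      linarith
    · have h1 : Real.exp (min (Real.log R - 1) (Real.log (β / 2 / (K * (1 + B) + 1)))) ≤
          β / 2 / (K * (1 + B) + 1) := by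
        rw [← Real.le_log_iff_exp_le (by positivity)]
        exact min_le_right _ _
      refine (mul_le_mul_of_nonneg_left h1 (by positivity)).trans ?_
      rw [mul_div_assoc', div_le_iff₀ (by positivity)]
      nlinarith
  have hone : ∀ p ∈ Metric.ball (0 : ℂ × ℂ × ℂ) R, ‖c p - 1‖ ≤ κ := fun p hp =>
    (h₁ p (Metric.ball_subset_ball (min_le_left _ _) hp)).le
  have hsub : Metric.ball (0 : ℂ × ℂ × ℂ) R ⊆ Metric.ball 0 R₀ :=
    Metric.ball_subset_ball (by linarith)
  refine ⟨R, κ, K, r, X, by linarith, hX, by linarith, fun p hp => (hone p hp).trans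
    (min_le_right _ _), ?_⟩
  exact {
    R_pos := hR
    r_pos := hr
    κ_nonneg := hκpos.le
    K_nonneg := hK
    one_le_B := hB
    diff := hcd.mono hsub
    near_one := hone
    lip := fun x y x' y' ε hp hq => (hlip _ hp _ hq).trans (by
      gcongr
      simp only [Prod.mk_sub_mk, sub_self, Prod.norm_def, norm_zero]
      have := norm_nonneg (x - x')
      have := norm_nonneg (y - y')
      refine max_le (by linarith) (max_le (by linarith) (by linarith)))
    real := fun p hp => by
      simp only [hc, h.a_real p (hsub hp), h.b_real p (hsub hp), map_div₀]
    κ_mul_le := by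
      have : κ ≤ 1 / (2 * (1 + B)) := min_le_left _ _
      have hB' : 0 < 1 + B := by linarith
      calc κ * (1 + B) ≤ 1 / (2 * (1 + B)) * (1 + B) := by gcongr
        _ = 1 / 2 := by field_simp
    r_le := hr'.1
    K_mul_le := hr'.2.1 }

end Saddle

/-! ### Division of analytic functions by powers of `ε` -/

namespace Saddle

/-- A holomorphic function that is `O(ε ^ d)` along the real axis is divisible by `ε ^ d`. -/
theorem exists_eventually_eq_pow_mul {g : ℂ → ℂ} (hg : AnalyticAt ℂ g 0) {d : ℕ}
    (hO : (fun ε : ℝ => g ε) =O[𝓝 0] fun ε : ℝ => ε ^ d) :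
    ∃ g₁, AnalyticAt ℂ g₁ 0 ∧ ∀ᶠ η in 𝓝 0, g η = η ^ d * g₁ η := by
  suffices h : (d : ℕ∞) ≤ analyticOrderAt g 0 by
    obtain ⟨g₁, h₁, h₂⟩ := (natCast_le_analyticOrderAt hg).1 h
    exact ⟨g₁, h₁, by simpa using h₂⟩
  -- If the order `m` were below `d`, the cofactor of `ε ^ m` would be `O(|ε| ^ (d - m))` along the
  -- reals and so vanish at `0`.
  by_contra! hlt
  obtain ⟨m, hm⟩ := ENat.ne_top_iff_exists.1 hlt.ne_top
  rw [← hm, Nat.cast_lt] at hlt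
  obtain ⟨g₁, h₁, h₀, h₂⟩ := (hg.analyticOrderAt_eq_natCast).1 hm.symm
  obtain ⟨C, hC⟩ := hO.bound
  have hre : Tendsto (fun ε : ℝ => (ε : ℂ)) (𝓝 0) (𝓝 0) :=
    Complex.continuous_ofReal.tendsto' _ _ (by simp)
  have hev : ∀ᶠ ε : ℝ in 𝓝[≠] 0, ‖g₁ ε‖ ≤ C * |ε| ^ (d - m) := by
    filter_upwards [nhdsWithin_le_nhds hC, nhdsWithin_le_nhds (hre.eventually h₂),
      self_mem_nhdsWithin] with ε h3 h4 h5
    have h5' : (0 : ℝ) < |ε| ^ m := pow_pos (abs_pos.2 h5) _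
    rw [h4, sub_zero, smul_eq_mul, norm_mul, norm_pow, norm_pow, Complex.norm_real,
      Real.norm_eq_abs, ← Nat.sub_add_cancel hlt.le, pow_add, ← mul_assoc, mul_comm] at h3
    exact le_of_mul_le_mul_right h3 h5'
  have hlim : Tendsto (fun ε : ℝ => C * |ε| ^ (d - m)) (𝓝[≠] 0) (𝓝 0) := by
    refine Tendsto.mono_left ?_ nhdsWithin_le_nhds
    refine Continuous.tendsto' (by fun_prop) _ _ ?_
    simp [Nat.sub_ne_zero_of_lt hlt]
  have hlim' : Tendsto (fun ε : ℝ => ‖g₁ ε‖) (𝓝[≠] 0) (𝓝 ‖g₁ 0‖) :=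
    (h₁.continuousAt.norm.tendsto.comp hre).mono_left nhdsWithin_le_nhds
  have := le_of_tendsto_of_tendsto hlim' hlim hev
  exact h₀ (norm_le_zero_iff.1 this)

/-- Division by `ε ^ d` of an analytic function of `(z, ε)`. -/
theorem exists_eq_pow_snd_mul {A : ℂ × ℂ → ℂ} (hA : AnalyticAt ℂ A 0) {d : ℕ}
    (hO : ∀ᶠ z in 𝓝 (0 : ℂ), (fun ε : ℝ => A (z, (ε : ℂ))) =O[𝓝 0] fun ε : ℝ => ε ^ d) :
    ∃ G : ℂ × ℂ → ℂ, AnalyticAt ℂ G 0 ∧ ∀ᶠ p in 𝓝 (0 : ℂ × ℂ), A p = p.2 ^ d * G p := by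
  obtain ⟨R₁, hR₁, h₁⟩ := Metric.eventually_nhds_iff_ball.1 hA.eventually_analyticAt
  obtain ⟨R₂, hR₂, h₂⟩ := Metric.eventually_nhds_iff_ball.1 hO
  set R := min R₁ R₂
  have hR : 0 < R := lt_min hR₁ hR₂
  have hAd : DifferentiableOn ℂ A (Metric.ball 0 R) := fun p hp =>
    (h₁ p (Metric.ball_subset_ball (min_le_left _ _) hp)).differentiableAt.differentiableWithinAt
  have hmem : ∀ {z η : ℂ}, ‖z‖ < R → ‖η‖ < R → ((z, η) : ℂ × ℂ) ∈ Metric.ball (0 : ℂ × ℂ) R :=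
    fun hz hη => by simpa [Prod.norm_def] using ⟨hz, hη⟩
  obtain ⟨C, hC⟩ := (isCompact_closedBall (0 : ℂ × ℂ) (R / 2)).exists_bound_of_continuousOn
    (hAd.continuousOn.mono (Metric.closedBall_subset_ball (by linarith)))
  have hC' : ∀ z η : ℂ, ‖z‖ ≤ R / 2 → ‖η‖ ≤ R / 2 → ‖A (z, η)‖ ≤ C := fun z η hz hη =>
    hC _ (by simpa [Prod.norm_def] using ⟨hz, hη⟩)
  have hdiff : ∀ z η : ℂ, ‖z‖ < R → ‖η‖ < R → DifferentiableAt ℂ A (z, η) := fun z η hz hη =>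
    hAd.differentiableAt (Metric.isOpen_ball.mem_nhds (hmem hz hη))
  -- The hypothesis is pointwise in `z`, so the quotient is bounded near `η = 0` only for each fixed
  -- `z`. That is enough: joint analyticity needs separate bounds and continuity on one torus, where
  -- `η` is away from zero.
  have hext := exists_analyticOnNhd_of_separately
    (G := fun z η => A (z, η) / η ^ d) (r := R / 4) (r' := R / 2) (ρ := R / 4) (ρ' := R / 2)
    (by linarith) (by linarith) (by linarith) (by linarith) ?_ ?_ ?_ ?_ ?_
  rotate_left
  · refine ContinuousOn.div (f := A) (g := fun p : ℂ × ℂ => p.2 ^ d) (hAd.continuousOn.mono ?_)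
      (by fun_prop) ?_
    · rintro ⟨z, η⟩ ⟨hz, hη⟩
      simp only [mem_sphere_zero_iff_norm] at hz hη
      exact hmem (by rw [hz]; linarith) (by rw [hη]; linarith)
    · rintro ⟨z, η⟩ ⟨hz, hη⟩
      have : η ≠ 0 := Metric.ne_of_mem_sphere hη (by linarith)
      exact pow_ne_zero _ this
  · intro η hη z hz
    have hη' : ‖η‖ = R / 4 := by simpa using hη
    have hz' : ‖z‖ < R / 2 := by simpa using hz.1
    refine DifferentiableAt.differentiableWithinAt ?_
    have := (hdiff z η (by linarith) (by linarith)).comp z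
      (f := fun z => (z, η)) (by fun_prop)
    exact this.div_const _
  · intro η hη
    refine ⟨C / (R / 4) ^ d, fun z hz => ?_⟩
    have hη' : ‖η‖ = R / 4 := by simpa using hη
    have hz' : ‖z‖ < R / 2 := by simpa using hz.1
    rw [norm_div, norm_pow, hη']
    gcongr
    exact hC' _ _ hz'.le (by rw [hη']; linarith)
  · intro z hz η hη
    have hη' : ‖η‖ < R / 2 := by simpa using hη.1
    have hz' : ‖z‖ < R / 4 := by simpa using hz.1
    refine DifferentiableAt.differentiableWithinAt ?_
    have := (hdiff z η (by linarith) (by linarith)).comp η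
      (f := fun η => (z, η)) (by fun_prop)
    exact this.div (by fun_prop) (pow_ne_zero _ hη.2)
  · intro z hz
    have hz' : ‖z‖ < R / 4 := by simpa using hz.1
    have han : AnalyticAt ℂ (fun η => A (z, η)) 0 := by
      have h3 : AnalyticAt ℂ A (z, 0) := h₁ _ (Metric.ball_subset_ball (min_le_left _ _)
        (hmem (by linarith) (by simpa using hR)))
      exact h3.comp (f := fun η => (z, η)) (analyticAt_const.prod analyticAt_id)
    obtain ⟨g₁, hg₁, hg₂⟩ := exists_eventually_eq_pow_mul han (d := d) (h₂ z (by
      rw [mem_ball_zero_iff]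
      have : R ≤ R₂ := min_le_right _ _
      linarith))
    obtain ⟨δ, hδ, hδ'⟩ := Metric.eventually_nhds_iff_ball.1
      (hg₂.and (hg₁.continuousAt.norm.eventually (gt_mem_nhds (lt_add_one ‖g₁ 0‖))))
    have hC0 : 0 ≤ C := (norm_nonneg _).trans (hC' 0 0 (by simp; linarith) (by simp; linarith))
    refine ⟨max (‖g₁ 0‖ + 1) (C / δ ^ d), fun η hη => ?_⟩
    have hη' : ‖η‖ < R / 2 := by simpa using hη.1
    rcases lt_or_ge ‖η‖ δ with h3 | h3
    · obtain ⟨h4, h5⟩ := hδ' η (by simpa using h3)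
      rw [h4, mul_div_cancel_left₀ _ (pow_ne_zero _ hη.2)]
      exact h5.le.trans (le_max_left _ _)
    · refine le_trans ?_ (le_max_right _ _)
      rw [norm_div, norm_pow]
      gcongr
      exact hC' _ _ (by linarith) hη'.le
  obtain ⟨G, hG, hGeq⟩ := hext
  refine ⟨G, hG 0 ⟨by simpa using hR, by simpa using hR⟩, ?_⟩
  have hball : Metric.ball (0 : ℂ × ℂ) (R / 4) ∈ 𝓝 0 := Metric.ball_mem_nhds _ (by linarith)
  have hsub : Metric.ball (0 : ℂ × ℂ) (R / 4) ⊆ Metric.ball 0 (R / 4) ×ˢ Metric.ball 0 (R / 4) := by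
    rintro ⟨z, η⟩ h
    simpa [Prod.norm_def] using h
  have hdense : Dense (({0}ᶜ : Set ℂ) ×ˢ ({0}ᶜ : Set ℂ)) :=
    (dense_compl_singleton 0).prod (dense_compl_singleton 0)
  have heq : EqOn A (fun p => p.2 ^ d * G p) (Metric.ball 0 (R / 4)) := by
    refine EqOn.of_subset_closure
      (s := Metric.ball (0 : ℂ × ℂ) (R / 4) ∩ ({0}ᶜ : Set ℂ) ×ˢ ({0}ᶜ : Set ℂ)) ?_
      (hAd.continuousOn.mono (Metric.ball_subset_ball (by linarith)))
      (ContinuousOn.mul (by fun_prop) (hG.continuousOn.mono hsub)) inter_subset_left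
      (hdense.open_subset_closure_inter Metric.isOpen_ball)
    rintro ⟨z, η⟩ ⟨hp, hz, hη⟩
    have hp' := hsub hp
    change A (z, η) = η ^ d * G (z, η)
    rw [hGeq z ⟨hp'.1, hz⟩ η ⟨hp'.2, hη⟩, mul_div_cancel₀]
    exact pow_ne_zero _ hη
  filter_upwards [hball] with p hp using heq hp

/-- Division by `ε ^ d`, with the value of the quotient on `ε = 0`. -/
theorem exists_eq_pow_snd_mul_of_isBigO {A : ℂ × ℂ → ℂ} (hA : AnalyticAt ℂ A 0) {d : ℕ} {M : ℂ → ℂ}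
    (hO : ∀ᶠ z in 𝓝 (0 : ℂ),
      (fun ε : ℝ => A (z, (ε : ℂ)) - (ε : ℂ) ^ d * M z) =O[𝓝 0] fun ε : ℝ => ε ^ (d + 1)) :
    ∃ G : ℂ × ℂ → ℂ, AnalyticAt ℂ G 0 ∧ (∀ᶠ p in 𝓝 (0 : ℂ × ℂ), A p = p.2 ^ d * G p) ∧
      ∀ᶠ z in 𝓝 (0 : ℂ), G (z, 0) = M z := by
  obtain ⟨G, hG, hAG⟩ := exists_eq_pow_snd_mul hA (d := d) (by
    filter_upwards [hO] with z hz
    have h1 : (fun ε : ℝ => ε ^ (d + 1)) =O[𝓝 0] fun ε : ℝ => ε ^ d := by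
      have := ((continuous_id (X := ℝ)).tendsto 0).isBigO_one ℝ |>.mul
        (isBigO_refl (fun ε : ℝ => ε ^ d) (𝓝 0))
      simpa [pow_succ'] using this
    have h2 : (fun ε : ℝ => (ε : ℂ) ^ d * M z) =O[𝓝 0] fun ε : ℝ => ε ^ d := by
      refine IsBigO.of_bound ‖M z‖ (Eventually.of_forall fun ε => ?_)
      simp [mul_comm]
    simpa using (hz.trans h1).add h2)
  refine ⟨G, hG, hAG, ?_⟩
  have ht : Tendsto (fun z : ℂ => (z, (0 : ℂ))) (𝓝 0) (𝓝 0) :=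
    Continuous.tendsto' (by fun_prop) _ _ (by simp)
  filter_upwards [hO, ht.eventually hAG.eventually_nhds,
    ht.eventually hG.eventually_analyticAt] with z h1 h2 h3
  have ht' : Tendsto (fun ε : ℝ => (z, (ε : ℂ))) (𝓝 0) (𝓝 (z, 0)) :=
    Continuous.tendsto' (by fun_prop) _ _ (by simp)
  obtain ⟨C, hC⟩ := h1.bound
  -- Cancelling `ε ^ d` in the expansion leaves `G(z, ε) - M z = O(ε)` for real `ε ≠ 0`.
  have hev : ∀ᶠ ε : ℝ in 𝓝[≠] 0, ‖G (z, (ε : ℂ)) - M z‖ ≤ C * |ε| := by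
    filter_upwards [nhdsWithin_le_nhds hC, nhdsWithin_le_nhds (ht'.eventually h2),
      self_mem_nhdsWithin] with ε h4 h5 h6
    have h6' : (0 : ℝ) < |ε| ^ d := pow_pos (abs_pos.2 h6) _
    rw [h5, ← mul_sub, norm_mul, norm_pow, norm_pow, Complex.norm_real, Real.norm_eq_abs,
      pow_succ, mul_left_comm] at h4
    exact le_of_mul_le_mul_left h4 h6'
  have l1 : Tendsto (fun ε : ℝ => ‖G (z, (ε : ℂ)) - M z‖) (𝓝[≠] 0) (𝓝 ‖G (z, 0) - M z‖) :=
    ((h3.continuousAt.tendsto.comp ht').sub_const _).norm.mono_left nhdsWithin_le_nhds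
  have l2 : Tendsto (fun ε : ℝ => C * |ε|) (𝓝[≠] 0) (𝓝 0) :=
    (Continuous.tendsto' (by fun_prop) _ _ (by simp)).mono_left nhdsWithin_le_nhds
  exact sub_eq_zero.1 (norm_le_zero_iff.1 (le_of_tendsto_of_tendsto l1 l2 hev))

end Saddle

/-! ### Logarithmic lifts of Dulac maps, axiomatically -/

namespace Saddle

/-- The half-strip of `ζ = log z`, times a disc of parameters. -/
def liftStrip (N b e : ℝ) : Set (ℂ × ℂ) := {p | p.1.re < -N ∧ |p.1.im| < b ∧ ‖p.2‖ < e}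

theorem isOpen_liftStrip (N b e : ℝ) : IsOpen (liftStrip N b e) := by
  have h1 : Continuous fun q : ℂ × ℂ => q.1.re := by fun_prop
  have h2 : Continuous fun q : ℂ × ℂ => |q.1.im| := by fun_prop
  have h3 : Continuous fun q : ℂ × ℂ => ‖q.2‖ := by fun_prop
  exact (isOpen_lt h1 continuous_const).inter ((isOpen_lt h2 continuous_const).inter
    (isOpen_lt h3 continuous_const))

theorem liftStrip_subset {N N' b b' e e' : ℝ} (hN : N' ≤ N) (hb : b ≤ b') (he : e ≤ e') :
    liftStrip N b e ⊆ liftStrip N' b' e' := fun _ hp =>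
  ⟨hp.1.trans_le (neg_le_neg hN), hp.2.1.trans_le hb, hp.2.2.trans_le he⟩

/-- `D` is a logarithmic lift of a family of Dulac maps with holonomy family `H`: the value of the
Dulac map at `exp ζ` is `exp (D (ζ, ε))`. -/
structure IsDulacLift (D H : ℂ × ℂ → ℂ) (N e : ℝ) : Prop where
  e_pos : 0 < e
  diff : DifferentiableOn ℂ D (liftStrip N 20 e)
  near_id : ∀ ζ ζ' ε : ℂ, (ζ, ε) ∈ liftStrip N 20 e → (ζ', ε) ∈ liftStrip N 20 e →
    ‖D (ζ, ε) - D (ζ', ε) - (ζ - ζ')‖ ≤ 1 / 10 * ‖ζ - ζ'‖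
  real : ∀ p ∈ liftStrip N 20 e, D (conj p.1, conj p.2) = conj (D p)
  at_zero : ∀ ζ : ℂ, (ζ, (0 : ℂ)) ∈ liftStrip N 20 e → D (ζ, 0) = ζ
  H_analytic : AnalyticAt ℂ H 0
  H_zero : ∀ᶠ ε in 𝓝 (0 : ℂ), H (0, ε) = 0
  translate : ∀ ζ ε : ℂ, (ζ, ε) ∈ liftStrip N 20 e →
    (ζ - 2 * Real.pi * Complex.I, ε) ∈ liftStrip N 20 e →
    Complex.exp (D (ζ - 2 * Real.pi * Complex.I, ε)) = H (Complex.exp (D (ζ, ε)), ε)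

namespace IsDulacLift

variable {D H : ℂ × ℂ → ℂ} {N e : ℝ}

theorem mono (h : IsDulacLift D H N e) {N' e' : ℝ} (hN : N ≤ N') (he' : 0 < e') (he : e' ≤ e) :
    IsDulacLift D H N' e' := by
  have hsub := liftStrip_subset (b := 20) hN le_rfl he
  exact {
    e_pos := he'
    diff := h.diff.mono hsub
    near_id := fun ζ ζ' ε h1 h2 => h.near_id ζ ζ' ε (hsub h1) (hsub h2)
    real := fun p hp => h.real p (hsub hp)
    at_zero := fun ζ hζ => h.at_zero ζ (hsub hζ)
    H_analytic := h.H_analytic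
    H_zero := h.H_zero
    translate := fun ζ ε h1 h2 => h.translate ζ ε (hsub h1) (hsub h2) }

theorem norm_sub_le (h : IsDulacLift D H N e) {ζ ζ' ε : ℂ} (hζ : (ζ, ε) ∈ liftStrip N 20 e)
    (hζ' : (ζ', ε) ∈ liftStrip N 20 e) : ‖ζ - ζ'‖ ≤ 10 / 9 * ‖D (ζ, ε) - D (ζ', ε)‖ := by
  have h1 := h.near_id ζ ζ' ε hζ hζ'
  have h2 := norm_sub_norm_le (ζ - ζ') (D (ζ, ε) - D (ζ', ε))
  rw [norm_sub_rev (ζ - ζ')] at h2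
  linarith

theorem injective (h : IsDulacLift D H N e) {ζ ζ' ε : ℂ} (hζ : (ζ, ε) ∈ liftStrip N 20 e)
    (hζ' : (ζ', ε) ∈ liftStrip N 20 e) (heq : D (ζ, ε) = D (ζ', ε)) : ζ = ζ' := by
  have := h.norm_sub_le hζ hζ'
  rw [heq, sub_self, norm_zero, mul_zero] at this
  exact sub_eq_zero.1 (norm_le_zero_iff.1 this)

/-- The Dulac maps are uniformly small near `z = 0`. -/
theorem exists_re_lt (h : IsDulacLift D H N e) (C : ℝ) : ∃ N' e' : ℝ, N ≤ N' ∧ 0 < e' ∧ e' ≤ e ∧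
    ∀ p ∈ liftStrip N' 20 e', (D p).re < C := by
  set ζ₀ : ℂ := ((-(N + 1) : ℝ) : ℂ) with hζ₀
  have hmem : ∀ ε : ℂ, ‖ε‖ < e → (ζ₀, ε) ∈ liftStrip N 20 e := fun ε hε =>
    ⟨by simp [hζ₀], by simp [hζ₀], hε⟩
  have hcont : ContinuousAt (fun ε => (D (ζ₀, ε)).re) 0 := by
    have h1 : DifferentiableAt ℂ D (ζ₀, 0) := h.diff.differentiableAt
      ((isOpen_liftStrip _ _ _).mem_nhds (hmem 0 (by simpa using h.e_pos)))
    exact Complex.continuous_re.continuousAt.comp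
      (h1.continuousAt.comp (f := fun ε => (ζ₀, ε)) (by fun_prop))
  obtain ⟨e₁, he₁, h₁⟩ := Metric.eventually_nhds_iff_ball.1
    (hcont.eventually (gt_mem_nhds (lt_add_one _)))
  set A := (D (ζ₀, 0)).re + 1
  -- By `near_id`, `Re D` drops at rate at least `9/10` as `Re ζ` decreases; the strip's imaginary
  -- part costs at most `20/10 < 3`.
  set N' := max (N + 1) ((A + 3 + 9 / 10 * (N + 1) - C) / (9 / 10))
  refine ⟨N', min e e₁, ?_, lt_min h.e_pos he₁, min_le_left _ _, ?_⟩
  · exact (by linarith : N ≤ N + 1).trans (le_max_left _ _)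
  rintro ⟨ζ, ε⟩ ⟨h2, h3, h4⟩
  simp only at h2 h3 h4
  have hN1 : N + 1 ≤ N' := le_max_left _ _
  have hN2 : (A + 3 + 9 / 10 * (N + 1) - C) ≤ N' * (9 / 10) :=
    (div_le_iff₀ (by norm_num)).1 (le_max_right _ _)
  have hε : ‖ε‖ < e := h4.trans_le (min_le_left _ _)
  have h5 := h₁ ε (by simpa using h4.trans_le (min_le_right _ _))
  have h6 := h.near_id ζ ζ₀ ε ⟨by simp only; linarith, h3, hε⟩ (hmem ε hε)
  have h7 := (Complex.re_le_norm _).trans h6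
  have h8 := Complex.norm_le_abs_re_add_abs_im (ζ - ζ₀)
  simp only [Complex.sub_re, Complex.sub_im, hζ₀, Complex.ofReal_re, Complex.ofReal_im,
    sub_zero] at h7 h8
  rw [abs_of_neg (by linarith)] at h8
  rw [← hζ₀] at h7 h8
  have h9 : (D (ζ₀, ε)).re < A := h5
  linarith

theorem exp_mem (h : IsDulacLift D H N e) {δ : ℝ} (hδ : 0 < δ) : ∃ N' e' : ℝ, N ≤ N' ∧ 0 < e' ∧
    e' ≤ e ∧ ∀ p ∈ liftStrip N' 20 e', ‖Complex.exp (D p)‖ < δ := by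
  obtain ⟨N', e', h1, h2, h3, h4⟩ := h.exists_re_lt (Real.log δ)
  refine ⟨N', e', h1, h2, h3, fun p hp => ?_⟩
  rw [Complex.norm_exp, ← Real.lt_log_iff_exp_lt hδ]
  exact h4 p hp

/-- For `ε = 0` the lift is the identity, so `translate` at `ζ = log w` reads `H(w, 0) = exp(log w -
2πi) = w`. -/
theorem eventually_H_zero_right (h : IsDulacLift D H N e) : ∀ᶠ w in 𝓝 (0 : ℂ), H (w, 0) = w := by
  filter_upwards [Metric.ball_mem_nhds (0 : ℂ) (Real.exp_pos (-N))] with w hw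
  rcases eq_or_ne w 0 with rfl | hw0
  · exact h.H_zero.self_of_nhds
  have hpi := Real.pi_lt_d2
  have hpi0 := Real.pi_pos
  have him := Complex.abs_im_le_norm
  have h1 : (Complex.log w).re < -N := by
    rw [Complex.log_re, Real.log_lt_iff_lt_exp (norm_pos_iff.2 hw0)]
    simpa using hw
  have h2 : |(Complex.log w).im| ≤ Real.pi := by
    rw [Complex.log_im]
    exact Complex.abs_arg_le_pi w
  have m1 : (Complex.log w, (0 : ℂ)) ∈ liftStrip N 20 e :=
    ⟨h1, by simp only; linarith, by simpa using h.e_pos⟩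
  have m2 : (Complex.log w - 2 * Real.pi * Complex.I, (0 : ℂ)) ∈ liftStrip N 20 e := by
    refine ⟨by simpa using h1, ?_, by simpa using h.e_pos⟩
    have := abs_sub (Complex.log w).im (2 * Real.pi)
    rw [abs_of_pos (by linarith : 0 < 2 * Real.pi)] at this
    simp
    linarith
  have := h.translate _ _ m1 m2
  rw [h.at_zero _ m1, h.at_zero _ m2, Complex.exp_log hw0, Complex.exp_sub,
    Complex.exp_two_pi_mul_I, Complex.exp_log hw0, div_one] at this
  exact this.symm

/-- The derivative of `H` in `w` at the origin is `1`, and strict differentiability keeps the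
increments in `w` within a factor `1/2` of it, uniformly for small `ε`. -/
theorem exists_H_injective (h : IsDulacLift D H N e) : ∃ δ > 0, ∀ w w' ε : ℂ, ‖w‖ < δ → ‖w'‖ < δ →
    ‖ε‖ < δ → H (w, ε) = H (w', ε) → w = w' := by
  have hst := h.H_analytic.hasStrictFDerivAt
  have hone : fderiv ℂ H 0 (1, 0) = 1 := by
    have h1 := dX_eq_deriv (p := 0) h.H_analytic.differentiableAt
    refine h1.unique ((hasDerivAt_id (0 : ℂ)).congr_of_eventuallyEq ?_)
    filter_upwards [h.eventually_H_zero_right] with w hw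
    exact hw
  have hb := hst.isLittleO.bound (c := 1 / 2) (by norm_num)
  obtain ⟨δ, hδ, h2⟩ := Metric.eventually_nhds_iff_ball.1 hb
  refine ⟨δ, hδ, fun w w' ε hw hw' hε heq => ?_⟩
  have h3 := h2 ((w, ε), (w', ε)) (by
    simp [Prod.dist_eq, hw, hw', hε])
  have h4 : fderiv ℂ H 0 (w - w', 0) = w - w' := by
    have : ((w - w', 0) : ℂ × ℂ) = (w - w') • ((1 : ℂ), (0 : ℂ)) := by simp
    rw [this, map_smul, hone, smul_eq_mul, mul_one]
  simp only [heq, sub_self, zero_sub, norm_neg, Prod.mk_sub_mk, h4, Prod.norm_def, norm_zero] at h3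
  rw [max_eq_left (norm_nonneg _)] at h3
  have : ‖w - w'‖ ≤ 0 := by linarith
  exact sub_eq_zero.1 (norm_le_zero_iff.1 this)

end IsDulacLift

end Saddle

/-! ### The conjugate `k` of the holonomy by the Dulac map, and why it is single-valued -/

namespace Saddle

theorem norm_two_pi_I : ‖(2 * Real.pi * Complex.I : ℂ)‖ = 2 * Real.pi := by
  simp [abs_of_pos Real.pi_pos]

/-- `ℓ` is a logarithmic lift of the conjugate `k = d⁻¹ ∘ h ∘ d` of the holonomy by the Dulac
map. -/
structure IsReturnLift (D ℓ : ℂ × ℂ → ℂ) (N e : ℝ) : Prop where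
  diff : DifferentiableOn ℂ ℓ (liftStrip (N + 1) 12 e)
  norm_sub_le_one : ∀ p ∈ liftStrip (N + 1) 12 e, ‖ℓ p - p.1‖ ≤ 1
  eq : ∀ p ∈ liftStrip (N + 1) 12 e,
    D (ℓ p, p.2) = D (p.1 - 2 * Real.pi * Complex.I, p.2) + 2 * Real.pi * Complex.I

variable {D H : ℂ × ℂ → ℂ} {N e : ℝ}

/-- The strips of half-widths `12`, `13` and `20` leave room for a displacement by at most `1` and
then for a shift by `2π < 7`. -/
theorem mem_liftStrip_of_norm_sub_le {p : ℂ × ℂ} (hp : p ∈ liftStrip (N + 1) 12 e) {v : ℂ}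
    (hv : ‖v - p.1‖ ≤ 1) : (v, p.2) ∈ liftStrip N 13 e := by
  have h1 := (Complex.abs_re_le_norm (v - p.1)).trans hv
  have h2 := (Complex.abs_im_le_norm (v - p.1)).trans hv
  obtain ⟨h3, h4, h5⟩ := hp
  rw [abs_le] at h1 h2
  rw [abs_lt] at h4
  simp only [Complex.sub_re, Complex.sub_im] at h1 h2
  exact ⟨by simp only; linarith, abs_lt.2 ⟨by simp only; linarith, by simp only; linarith⟩, h5⟩

theorem sub_mem_liftStrip {p : ℂ × ℂ} (hp : p ∈ liftStrip N 13 e) :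
    (p.1 - 2 * Real.pi * Complex.I, p.2) ∈ liftStrip N 20 e := by
  obtain ⟨h3, h4, h5⟩ := hp
  have := Real.pi_lt_d2
  have := Real.pi_pos
  rw [abs_lt] at h4
  refine ⟨by simpa using h3, ?_, h5⟩
  simp [abs_lt]
  constructor <;> linarith

theorem add_mem_liftStrip {p : ℂ × ℂ} (hp : p ∈ liftStrip N 13 e) :
    (p.1 + 2 * Real.pi * Complex.I, p.2) ∈ liftStrip N 20 e := by
  obtain ⟨h3, h4, h5⟩ := hp
  have := Real.pi_lt_d2
  have := Real.pi_pos
  rw [abs_lt] at h4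
  refine ⟨by simpa using h3, ?_, h5⟩
  simp [abs_lt]
  constructor <;> linarith

theorem liftStrip_inner_subset : liftStrip (N + 1) 12 e ⊆ liftStrip N 13 e :=
  liftStrip_subset (by linarith) (by norm_num) le_rfl

theorem liftStrip_middle_subset : liftStrip N 13 e ⊆ liftStrip N 20 e :=
  liftStrip_subset le_rfl (by norm_num) le_rfl

namespace IsDulacLift

theorem norm_translate_le (h : IsDulacLift D H N e) {p : ℂ × ℂ} (hp : p ∈ liftStrip N 13 e) :
    ‖D (p.1 - 2 * Real.pi * Complex.I, p.2) + 2 * Real.pi * Complex.I - D p‖ ≤ 2 / 3 := by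
  have h1 := h.near_id _ _ _ (sub_mem_liftStrip hp) (liftStrip_middle_subset hp)
  rw [sub_sub_cancel_left, norm_neg, norm_two_pi_I, sub_neg_eq_add] at h1
  have := Real.pi_lt_d2
  rw [add_sub_right_comm]
  exact h1.trans (by linarith)

/-- Solving `D(v) = D(ζ - 2πi) + 2πi` amounts to a fixed point of `v ↦ v - D(v) + target`. This map
contracts with constant `1/10` by `near_id` and preserves the unit ball about `ζ`, since `2/3 + 1/10
≤ 1`. -/
theorem exists_isReturnLift (h : IsDulacLift D H N e) : ∃ ℓ, IsReturnLift D ℓ N e := by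
  have hU := isOpen_liftStrip (N + 1) 12 e
  have hfix := exists_holomorphic_fixedPoint hU (m := fun p => p.1)
    (T := fun p v => v + (D (p.1 - 2 * Real.pi * Complex.I, p.2) + 2 * Real.pi * Complex.I) -
      D (v, p.2)) (by fun_prop) ?_ ?_ ?_
  · obtain ⟨ℓ, h1, h2⟩ := hfix
    refine ⟨ℓ, h1, fun p hp => (h2 p hp).1, fun p hp => ?_⟩
    have := (h2 p hp).2
    linear_combination -this
  · intro p hp v hv
    have m1 := liftStrip_middle_subset (mem_liftStrip_of_norm_sub_le hp hv)
    have m2 := liftStrip_inner_subset hp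
    have e1 := h.near_id _ _ _ m1 (liftStrip_middle_subset m2)
    have e2 := h.norm_translate_le m2
    have e3 : v + (D (p.1 - 2 * Real.pi * Complex.I, p.2) + 2 * Real.pi * Complex.I) -
        D (v, p.2) - p.1 = (D (p.1 - 2 * Real.pi * Complex.I, p.2) + 2 * Real.pi * Complex.I - D p) -
          (D (v, p.2) - D (p.1, p.2) - (v - p.1)) := by ring
    rw [e3]
    refine (_root_.norm_sub_le _ _).trans ?_
    linarith
  · intro p hp v v' hv hv'
    have m1 := liftStrip_middle_subset (mem_liftStrip_of_norm_sub_le hp hv)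
    have m2 := liftStrip_middle_subset (mem_liftStrip_of_norm_sub_le hp hv')
    have e1 := h.near_id _ _ _ m1 m2
    have e3 : v + (D (p.1 - 2 * Real.pi * Complex.I, p.2) + 2 * Real.pi * Complex.I) -
        D (v, p.2) - (v' + (D (p.1 - 2 * Real.pi * Complex.I, p.2) + 2 * Real.pi * Complex.I) -
        D (v', p.2)) = -(D (v, p.2) - D (v', p.2) - (v - v')) := by ring
    rw [e3, norm_neg]
    have := norm_nonneg (v - v')
    linarith
  · intro g hg hgm
    have d1 : DifferentiableOn ℂ (fun p : ℂ × ℂ => D (p.1 - 2 * Real.pi * Complex.I, p.2))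
        (liftStrip (N + 1) 12 e) :=
      h.diff.comp (f := fun p : ℂ × ℂ => (p.1 - 2 * Real.pi * Complex.I, p.2)) (by fun_prop)
        fun p hp => sub_mem_liftStrip (liftStrip_inner_subset hp)
    have d2 : DifferentiableOn ℂ (fun p : ℂ × ℂ => D (g p, p.2)) (liftStrip (N + 1) 12 e) :=
      h.diff.comp (f := fun p : ℂ × ℂ => (g p, p.2)) (by fun_prop)
        fun p hp => liftStrip_middle_subset (mem_liftStrip_of_norm_sub_le hp (hgm p hp))
    exact (hg.add (d1.add_const _)).sub d2

end IsDulacLift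

/-- The holonomies are injective on the image of the Dulac maps. -/
def InjectiveOnImage (D H : ℂ × ℂ → ℂ) (N e : ℝ) : Prop :=
  ∀ ζ ζ' ε : ℂ, (ζ, ε) ∈ liftStrip N 20 e → (ζ', ε) ∈ liftStrip N 20 e →
    H (Complex.exp (D (ζ, ε)), ε) = H (Complex.exp (D (ζ', ε)), ε) →
    Complex.exp (D (ζ, ε)) = Complex.exp (D (ζ', ε))

namespace IsReturnLift

variable {ℓ : ℂ × ℂ → ℂ}

theorem mem (hℓ : IsReturnLift D ℓ N e) {p : ℂ × ℂ} (hp : p ∈ liftStrip (N + 1) 12 e) :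
    (ℓ p, p.2) ∈ liftStrip N 13 e :=
  mem_liftStrip_of_norm_sub_le hp (hℓ.norm_sub_le_one p hp)

theorem eq_of_eq (hℓ : IsReturnLift D ℓ N e) (h : IsDulacLift D H N e) {p : ℂ × ℂ}
    (hp : p ∈ liftStrip (N + 1) 12 e) {v : ℂ} (hv : (v, p.2) ∈ liftStrip N 20 e)
    (heq : D (v, p.2) = D (p.1 - 2 * Real.pi * Complex.I, p.2) + 2 * Real.pi * Complex.I) :
    ℓ p = v :=
  h.injective (liftStrip_middle_subset (hℓ.mem hp)) hv (by rw [hℓ.eq p hp, heq])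

/-- Let `v = ℓ(ζ)`. By `translate`, `H` sends `exp D(v + 2πi)` to `exp D(v) = exp D(ζ - 2πi)`, which
is also the image of `exp D(ζ)`. Injectivity of `H` gives `D(v + 2πi) = D(ζ) + 2πi n`, and closeness
to the identity forces `n = 1`. That is the defining equation of `ℓ(ζ + 2πi)`, so `exp ∘ ℓ` depends
only on `exp ζ`. -/
theorem add_period (hℓ : IsReturnLift D ℓ N e) (h : IsDulacLift D H N e)
    (hinj : InjectiveOnImage D H N e) {ζ ε : ℂ} (hp : (ζ, ε) ∈ liftStrip (N + 1) 12 e)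
    (hp' : (ζ + 2 * Real.pi * Complex.I, ε) ∈ liftStrip (N + 1) 12 e) :
    ℓ (ζ + 2 * Real.pi * Complex.I, ε) = ℓ (ζ, ε) + 2 * Real.pi * Complex.I := by
  set v := ℓ (ζ, ε) with hv
  have mζ := liftStrip_middle_subset (liftStrip_inner_subset hp)
  have mv := hℓ.mem hp
  have mv' := add_mem_liftStrip mv
  simp only [← hv] at mv mv'
  have e1 : Complex.exp (D (v + 2 * Real.pi * Complex.I, ε)) = Complex.exp (D (ζ, ε)) := by
    refine hinj _ _ _ mv' mζ ?_
    rw [← h.translate _ _ mv' (by rw [add_sub_cancel_right]; exact liftStrip_middle_subset mv),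
      ← h.translate _ _ mζ (sub_mem_liftStrip (liftStrip_inner_subset hp)), add_sub_cancel_right,
      hℓ.eq _ hp, Complex.exp_periodic]
  obtain ⟨n, hn⟩ := Complex.exp_eq_exp_iff_exists_int.1 e1
  have e2 := h.near_id _ _ _ mv' mζ
  have e3 := hℓ.norm_sub_le_one _ hp
  simp only [← hv] at e3
  have hpi := Real.pi_lt_d2
  have hpi' := Real.pi_gt_d2
  have e4 : ‖v + 2 * Real.pi * Complex.I - ζ‖ ≤ 1 + 2 * Real.pi := by
    rw [add_sub_right_comm]
    refine (norm_add_le _ _).trans ?_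
    rw [norm_two_pi_I]
    linarith
  -- The bound is `(1 + 2π)/10 + 1 < 2`, which is less than one period `2π`.
  have e5 : ‖((n - 1 : ℤ) : ℂ) * (2 * Real.pi * Complex.I)‖ < 2 := by
    have : ((n - 1 : ℤ) : ℂ) * (2 * Real.pi * Complex.I) =
        (D (v + 2 * Real.pi * Complex.I, ε) - D (ζ, ε) - (v + 2 * Real.pi * Complex.I - ζ)) +
          (v - ζ) := by
      rw [hn]
      push_cast
      ring
    rw [this]
    refine (norm_add_le _ _).trans_lt ?_
    linarith
  have hn1 : n = 1 := by
    by_contra hne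
    have h1 : (1 : ℝ) ≤ |((n - 1 : ℤ) : ℝ)| := by
      rw [← Int.cast_abs]
      exact_mod_cast Int.one_le_abs (sub_ne_zero.2 hne)
    rw [norm_mul, norm_two_pi_I, Complex.norm_intCast] at e5
    nlinarith
  refine hℓ.eq_of_eq h hp' mv' ?_
  rw [hn, hn1]
  simp

theorem add_nsmul_period (hℓ : IsReturnLift D ℓ N e) (h : IsDulacLift D H N e)
    (hinj : InjectiveOnImage D H N e) {ζ ε : ℂ} (hp : (ζ, ε) ∈ liftStrip (N + 1) 12 e) (n : ℕ)
    (hp' : (ζ + n * (2 * Real.pi * Complex.I), ε) ∈ liftStrip (N + 1) 12 e) :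
    ℓ (ζ + n * (2 * Real.pi * Complex.I), ε) = ℓ (ζ, ε) + n * (2 * Real.pi * Complex.I) := by
  induction n with
  | zero => simp
  | succ n ih =>
    have hm : (ζ + n * (2 * Real.pi * Complex.I), ε) ∈ liftStrip (N + 1) 12 e := by
      obtain ⟨h1, h2, h3⟩ := hp
      obtain ⟨h4, h5, h6⟩ := hp'
      refine ⟨by simpa using h1, ?_, h3⟩
      simp [abs_lt] at h2 h5 ⊢
      have hpi := Real.pi_pos
      have hn : (0 : ℝ) ≤ n := n.cast_nonneg
      constructor <;> nlinarith
    have e1 : ζ + ((n + 1 : ℕ) : ℂ) * (2 * Real.pi * Complex.I) =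
        ζ + n * (2 * Real.pi * Complex.I) + 2 * Real.pi * Complex.I := by
      push_cast
      ring
    rw [e1] at hp' ⊢
    rw [hℓ.add_period h hinj hm hp', ih hm]
    push_cast
    ring

theorem exp_eq_exp (hℓ : IsReturnLift D ℓ N e) (h : IsDulacLift D H N e)
    (hinj : InjectiveOnImage D H N e) {ζ ζ' ε : ℂ} (hp : (ζ, ε) ∈ liftStrip (N + 1) 12 e)
    (hp' : (ζ', ε) ∈ liftStrip (N + 1) 12 e) (heq : Complex.exp ζ = Complex.exp ζ') :
    Complex.exp (ℓ (ζ, ε)) = Complex.exp (ℓ (ζ', ε)) := by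
  obtain ⟨n, hn⟩ := Complex.exp_eq_exp_iff_exists_int.1 heq
  obtain ⟨m, rfl | rfl⟩ := n.eq_nat_or_neg
  · rw [Int.cast_natCast] at hn
    rw [hn] at hp ⊢
    rw [hℓ.add_nsmul_period h hinj hp' m hp]
    exact Complex.exp_periodic.nat_mul m _
  · have hn' : ζ' = ζ + m * (2 * Real.pi * Complex.I) := by
      rw [hn]
      push_cast
      ring
    rw [hn'] at hp' ⊢
    rw [hℓ.add_nsmul_period h hinj hp m hp']
    exact (Complex.exp_periodic.nat_mul m _).symm

/-- The conjugate of the holonomy by the Dulac map, as a function of `z`. -/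
noncomputable def returnMap (ℓ : ℂ × ℂ → ℂ) (p : ℂ × ℂ) : ℂ := Complex.exp (ℓ (Complex.log p.1, p.2))

theorem log_mem {z ε : ℂ} (hz : z ≠ 0) (hz' : ‖z‖ < Real.exp (-(N + 1))) (hε : ‖ε‖ < e) :
    (Complex.log z, ε) ∈ liftStrip (N + 1) 5 e := by
  refine ⟨?_, ?_, hε⟩
  · simp only
    rwa [Complex.log_re, Real.log_lt_iff_lt_exp (norm_pos_iff.2 hz)]
  · simp only [Complex.log_im]
    have := Complex.abs_arg_le_pi z
    linarith [Real.pi_lt_d2]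

theorem returnMap_exp (hℓ : IsReturnLift D ℓ N e) (h : IsDulacLift D H N e)
    (hinj : InjectiveOnImage D H N e) {ζ ε : ℂ} (hp : (ζ, ε) ∈ liftStrip (N + 1) 12 e) :
    returnMap ℓ (Complex.exp ζ, ε) = Complex.exp (ℓ (ζ, ε)) := by
  refine hℓ.exp_eq_exp h hinj ?_ hp (Complex.exp_log (Complex.exp_ne_zero _))
  refine liftStrip_subset le_rfl (by norm_num) le_rfl
    (log_mem (Complex.exp_ne_zero _) ?_ hp.2.2)
  rw [Complex.norm_exp, Real.exp_lt_exp]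
  exact hp.1

theorem differentiableAt_returnMap (hℓ : IsReturnLift D ℓ N e) (h : IsDulacLift D H N e)
    (hinj : InjectiveOnImage D H N e) {z ε : ℂ} (hz : z ≠ 0) (hz' : ‖z‖ < Real.exp (-(N + 1)))
    (hε : ‖ε‖ < e) : DifferentiableAt ℂ (returnMap ℓ) (z, ε) := by
  have hd : ∀ p ∈ liftStrip (N + 1) 12 e, DifferentiableAt ℂ ℓ p := fun p hp =>
    hℓ.diff.differentiableAt ((isOpen_liftStrip _ _ _).mem_nhds hp)
  have hsub : liftStrip (N + 1) 5 e ⊆ liftStrip (N + 1) 12 e :=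
    liftStrip_subset le_rfl (by norm_num) le_rfl
  by_cases hs : z ∈ Complex.slitPlane
  · have h1 : DifferentiableAt ℂ (fun p : ℂ × ℂ => (Complex.log p.1, p.2)) (z, ε) :=
      (DifferentiableAt.clog differentiableAt_fst hs).prodMk differentiableAt_snd
    exact ((hd _ (hsub (log_mem hz hz' hε))).comp (z, ε) h1).cexp
  -- Across the cut of the principal logarithm the branch `log(-z) + πi` is used; periodicity of `ℓ`
  -- makes the two expressions for `k` agree.
  · have hs' : -z ∈ Complex.slitPlane := by
      rw [Complex.mem_slitPlane_iff] at hs ⊢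
      push Not at hs
      left
      rcases lt_or_eq_of_le hs.1 with h1 | h1
      · simpa using h1
      · exact absurd (Complex.ext h1 hs.2) hz
    have h1 : DifferentiableAt ℂ (fun p : ℂ × ℂ => (Complex.log (-p.1) + Real.pi * Complex.I, p.2))
        (z, ε) :=
      ((DifferentiableAt.clog differentiableAt_fst.neg hs').add_const _).prodMk
        differentiableAt_snd
    have hm : ∀ {z ε : ℂ}, z ≠ 0 → ‖z‖ < Real.exp (-(N + 1)) → ‖ε‖ < e →
        (Complex.log (-z) + Real.pi * Complex.I, ε) ∈ liftStrip (N + 1) 12 e := by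
      intro z ε hz hz' hε
      obtain ⟨h2, h3, h4⟩ := log_mem (e := e) (neg_ne_zero.2 hz) (by simpa using hz') hε
      have := Real.pi_pos
      have := Real.pi_lt_d2
      refine ⟨by simpa using h2, ?_, h4⟩
      simp [abs_lt] at h3 ⊢
      constructor <;> linarith
    refine ((hd _ (hm hz hz' hε)).comp (z, ε) h1).cexp.congr_of_eventuallyEq ?_
    have c1 : ∀ᶠ p : ℂ × ℂ in 𝓝 (z, ε), p.1 ≠ 0 := continuousAt_fst.eventually_ne hz
    have c2 : ∀ᶠ p : ℂ × ℂ in 𝓝 (z, ε), ‖p.1‖ < Real.exp (-(N + 1)) :=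
      continuousAt_fst.norm.eventually (gt_mem_nhds hz')
    have c3 : ∀ᶠ p : ℂ × ℂ in 𝓝 (z, ε), ‖p.2‖ < e :=
      continuousAt_snd.norm.eventually (gt_mem_nhds hε)
    filter_upwards [c1, c2, c3] with p h2 h3 h4
    refine hℓ.exp_eq_exp h hinj (hsub (log_mem h2 h3 h4)) (hm h2 h3 h4) ?_
    rw [Complex.exp_log h2, Complex.exp_add, Complex.exp_log (neg_ne_zero.2 h2),
      Complex.exp_pi_mul_I]
    ring

end IsReturnLift

end Saddle

/-! ### Size and leading coefficient of the displacement `k - z` -/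

namespace Saddle

/-- The quadratic remainder satisfies `|exp w - 1 - w| ≤ |w|² ≤ (2/3) |w|`. -/
theorem norm_le_three_mul_norm_exp_sub_one {w : ℂ} (hw : ‖w‖ ≤ 2 / 3) :
    ‖w‖ ≤ 3 * ‖Complex.exp w - 1‖ := by
  have h1 := Complex.norm_exp_sub_one_sub_id_le (x := w) (by linarith)
  have h2 := norm_sub_norm_le w (Complex.exp w - 1)
  rw [norm_sub_rev w] at h2
  nlinarith [norm_nonneg w]

variable {D H G ℓ : ℂ × ℂ → ℂ} {N e δ C : ℝ} {d : ℕ}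

namespace IsReturnLift

/-- The difference `D(ℓ(ζ)) - D(ζ)` is a logarithm of `H(w)/w` at `w = exp D(ζ)`, so the relative
displacement of `H` controls the displacement of `ℓ`. The constant comes from `10/9 · 3 ≤ 4`. -/
theorem norm_sub_le (hℓ : IsReturnLift D ℓ N e) (h : IsDulacLift D H N e)
    (hδ : ∀ p ∈ liftStrip N 20 e, ‖Complex.exp (D p)‖ < δ)
    (hH : ∀ w ε : ℂ, ‖w‖ < δ → ‖ε‖ < e → ‖H (w, ε) - w‖ ≤ C * ‖w‖ * ‖ε‖ ^ d) {p : ℂ × ℂ}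
    (hp : p ∈ liftStrip (N + 1) 12 e) : ‖ℓ p - p.1‖ ≤ 4 * C * ‖p.2‖ ^ d := by
  have mp := liftStrip_inner_subset hp
  have mp' := liftStrip_middle_subset mp
  have e1 := h.norm_sub_le (liftStrip_middle_subset (hℓ.mem hp)) mp'
  rw [hℓ.eq p hp] at e1
  have e2 := norm_le_three_mul_norm_exp_sub_one (h.norm_translate_le mp)
  set w := Complex.exp (D p) with hw
  have hw0 : 0 < ‖w‖ := norm_pos_iff.2 (Complex.exp_ne_zero _)
  have e3 : Complex.exp (D (p.1 - 2 * Real.pi * Complex.I, p.2) + 2 * Real.pi * Complex.I - D p) - 1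
      = (H (w, p.2) - w) / w := by
    rw [Complex.exp_sub, Complex.exp_periodic, h.translate _ _ mp' (sub_mem_liftStrip mp), ← hw,
      sub_div, div_self (Complex.exp_ne_zero _)]
  have e4 : ‖(H (w, p.2) - w) / w‖ ≤ C * ‖p.2‖ ^ d := by
    rw [norm_div, div_le_iff₀ hw0]
    refine (hH w p.2 (hδ p mp') hp.2.2).trans_eq (by ring)
  rw [e3] at e2
  have hC := (norm_nonneg _).trans e4
  change ‖ℓ p - p.1‖ ≤ _ * ‖_ - D p‖ at e1
  linarith

theorem norm_returnMap_sub_le (hℓ : IsReturnLift D ℓ N e) (h : IsDulacLift D H N e)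
    (hδ : ∀ p ∈ liftStrip N 20 e, ‖Complex.exp (D p)‖ < δ)
    (hH : ∀ w ε : ℂ, ‖w‖ < δ → ‖ε‖ < e → ‖H (w, ε) - w‖ ≤ C * ‖w‖ * ‖ε‖ ^ d) {z ε : ℂ}
    (hz : z ≠ 0) (hz' : ‖z‖ < Real.exp (-(N + 1))) (hε : ‖ε‖ < e) :
    ‖returnMap ℓ (z, ε) - z‖ ≤ 8 * C * ‖z‖ * ‖ε‖ ^ d := by
  have hm : (Complex.log z, ε) ∈ liftStrip (N + 1) 12 e :=
    liftStrip_subset le_rfl (by norm_num) le_rfl (log_mem hz hz' hε)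
  have h1 := hℓ.norm_sub_le h hδ hH hm
  have h2 := Complex.norm_exp_sub_one_le (hℓ.norm_sub_le_one _ hm)
  have h3 : returnMap ℓ (z, ε) - z =
      z * (Complex.exp (ℓ (Complex.log z, ε) - Complex.log z) - 1) := by
    rw [Complex.exp_sub, Complex.exp_log hz, returnMap]
    field_simp
  rw [h3, norm_mul]
  calc ‖z‖ * _ ≤ ‖z‖ * (2 * (4 * C * ‖ε‖ ^ d)) := by
        gcongr
        exact h2.trans (by gcongr)
    _ = _ := by ring

/-- The difference `Φ_ε = exp D(·, ε) - exp` tends to `0` uniformly on the unit ball about `ζ = log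
z`, so its increment from `ζ` to `ℓ(ζ)` is `o(1) ‖ℓ(ζ) - ζ‖ = o(ε^d)`. That increment is exactly
`ε^d G(exp D(ζ), ε) - (k(z) - z)`. -/
theorem tendsto_returnMap_sub_div (hℓ : IsReturnLift D ℓ N e) (h : IsDulacLift D H N e)
    (hδ : ∀ p ∈ liftStrip N 20 e, ‖Complex.exp (D p)‖ < δ)
    (hH : ∀ w ε : ℂ, ‖w‖ < δ → ‖ε‖ < e → ‖H (w, ε) - w‖ ≤ C * ‖w‖ * ‖ε‖ ^ d)
    (hG : ∀ w ε : ℂ, ‖w‖ < δ → ‖ε‖ < e → H (w, ε) - w = ε ^ d * G (w, ε)) {z : ℂ} (hz : z ≠ 0)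
    (hz' : ‖z‖ < Real.exp (-(N + 1))) (hGc : ContinuousAt G (z, 0)) (hd : d ≠ 0) :
    Tendsto (fun ε => (returnMap ℓ (z, ε) - z) / ε ^ d) (𝓝[≠] 0) (𝓝 (G (z, 0))) := by
  have he := h.e_pos
  set ζ := Complex.log z with hζ
  have hm : ∀ ε : ℂ, ‖ε‖ < e → (ζ, ε) ∈ liftStrip (N + 1) 12 e := fun ε hε =>
    liftStrip_subset le_rfl (by norm_num) le_rfl (log_mem hz hz' hε)
  have hball : ∀ ε : ℂ, ‖ε‖ < e → ∀ v ∈ Metric.closedBall ζ 1, (v, ε) ∈ liftStrip N 13 e :=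
    fun ε hε v hv => mem_liftStrip_of_norm_sub_le (hm ε hε) (mem_closedBall_iff_norm.1 hv)
  have h0 : ‖(0 : ℂ)‖ < e := by simpa using he
  have hDc : ∀ v ∈ Metric.closedBall ζ 1, ContinuousAt D (v, 0) := fun v hv =>
    (h.diff.differentiableAt ((isOpen_liftStrip _ _ _).mem_nhds
      (liftStrip_middle_subset (hball 0 h0 v hv)))).continuousAt
  set Φ : ℂ → ℂ → ℂ := fun ε v => Complex.exp (D (v, ε)) - Complex.exp v with hΦ
  have hsmall : ∀ κ > 0, ∀ᶠ ε in 𝓝 (0 : ℂ), ∀ v ∈ Metric.closedBall ζ 1, ‖Φ ε v‖ < κ := by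
    intro κ hκ
    refine (isCompact_closedBall ζ 1).eventually_forall_of_forall_eventually fun v hv => ?_
    have hc : ContinuousAt (fun q : ℂ × ℂ => ‖Φ q.1 q.2‖) (0, v) := by
      have h1 : ContinuousAt (fun q : ℂ × ℂ => D (q.2, q.1)) (0, v) :=
        ContinuousAt.comp (g := D) (f := fun q : ℂ × ℂ => (q.2, q.1)) (x := (0, v)) (hDc v hv)
          (by fun_prop)
      exact (h1.cexp.sub (by fun_prop)).norm
    refine hc.eventually (gt_mem_nhds ?_)
    simp only [hΦ, h.at_zero v (liftStrip_middle_subset (hball 0 h0 v hv)), sub_self, norm_zero]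
    exact hκ
  have hlim : Tendsto (fun ε => G (Complex.exp (D (ζ, ε)), ε)) (𝓝[≠] 0) (𝓝 (G (z, 0))) := by
    refine Tendsto.mono_left ?_ nhdsWithin_le_nhds
    refine hGc.tendsto.comp ?_
    have h1 : ContinuousAt (fun ε => (Complex.exp (D (ζ, ε)), ε)) 0 :=
      (ContinuousAt.comp (g := D) (f := fun ε => (ζ, ε)) (x := 0)
        (hDc ζ (Metric.mem_closedBall_self zero_le_one)) (by fun_prop)).cexp.prodMk continuousAt_id
    have h2 := h1.tendsto
    rwa [h.at_zero ζ (liftStrip_middle_subset (liftStrip_inner_subset (hm 0 h0))), hζ,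
      Complex.exp_log hz, ← hζ] at h2
  have hC : 0 ≤ C := by
    obtain ⟨t, ht0, ht⟩ := exists_between (lt_min he (Real.exp_pos (-(N + 1))))
    have h1 := hℓ.norm_sub_le h hδ hH (hm t (by
      rw [Complex.norm_real, Real.norm_eq_abs, abs_of_pos ht0]
      exact ht.trans_le (min_le_left _ _)))
    have h2 := (norm_nonneg _).trans h1
    have h3 : 0 < ‖(t : ℂ)‖ ^ d := by simp; positivity
    simp only at h2
    nlinarith
  suffices hdiff : Tendsto (fun ε => (returnMap ℓ (z, ε) - z) / ε ^ d -
      G (Complex.exp (D (ζ, ε)), ε)) (𝓝[≠] 0) (𝓝 0) by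
    simpa using hdiff.add hlim
  rw [Metric.tendsto_nhds]
  intro κ hκ
  -- The oscillation `2 · κ/(8C + 1)` times the displacement bound `4C ‖ε‖^d` stays below `κ ‖ε‖^d`.
  have hκ' : 0 < κ / (8 * C + 1) := by positivity
  have hpow : ∀ᶠ ε in 𝓝 (0 : ℂ), 4 * C * ‖ε‖ ^ d < 1 := by
    have : ContinuousAt (fun ε : ℂ => 4 * C * ‖ε‖ ^ d) 0 := by fun_prop
    exact this.eventually (gt_mem_nhds (by simp [hd]))
  filter_upwards [nhdsWithin_le_nhds (hsmall _ hκ'), nhdsWithin_le_nhds hpow,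
    nhdsWithin_le_nhds (Metric.ball_mem_nhds (0 : ℂ) he), self_mem_nhdsWithin] with ε h1 h2 h3 h4
  have hε : ‖ε‖ < e := by simpa using h3
  have hε0 : ε ≠ 0 := h4
  have mp := hm ε hε
  have mp' := liftStrip_inner_subset mp
  have mp'' := liftStrip_middle_subset mp'
  have h5 := hℓ.norm_sub_le h hδ hH mp
  simp only at h5
  have hlip := Complex.dist_le_div_mul_dist_of_mapsTo_ball (f := Φ ε) (c := ζ)
    (z := ℓ (ζ, ε)) (R₁ := 1) (R₂ := 2 * (κ / (8 * C + 1))) (by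
      refine DifferentiableOn.sub (DifferentiableOn.cexp ?_) (by fun_prop)
      exact h.diff.comp (f := fun v => (v, ε)) (by fun_prop) fun v hv =>
        liftStrip_middle_subset (hball ε hε v (Metric.ball_subset_closedBall hv)))
    (fun v hv => by
      rw [mem_closedBall_iff_norm]
      have h6 := h1 v (Metric.ball_subset_closedBall hv)
      have h7 := h1 ζ (Metric.mem_closedBall_self zero_le_one)
      exact (_root_.norm_sub_le _ _).trans (by linarith))
    (by rw [mem_ball_iff_norm]; exact h5.trans_lt h2)
  rw [dist_eq_norm, dist_eq_norm] at hlip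
  have e1 : Φ ε (ℓ (ζ, ε)) - Φ ε ζ =
      ε ^ d * G (Complex.exp (D (ζ, ε)), ε) - (returnMap ℓ (z, ε) - z) := by
    rw [← hG _ _ (hδ _ mp'') hε, ← h.translate _ _ mp'' (sub_mem_liftStrip mp')]
    simp only [hΦ, returnMap]
    have := hℓ.eq _ mp
    simp only at this
    rw [this, Complex.exp_periodic, ← hζ, hζ, Complex.exp_log hz]
    ring
  have hεd : 0 < ‖ε‖ ^ d := by
    have := norm_pos_iff.2 hε0
    positivity
  have e2 : (returnMap ℓ (z, ε) - z) / ε ^ d - G (Complex.exp (D (ζ, ε)), ε) =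
      -((Φ ε (ℓ (ζ, ε)) - Φ ε ζ) / ε ^ d) := by
    rw [e1]
    field_simp
    ring
  rw [dist_zero_right, e2, norm_neg, norm_div, norm_pow, div_lt_iff₀ hεd]
  calc _ ≤ 2 * (κ / (8 * C + 1)) / 1 * ‖ℓ (ζ, ε) - ζ‖ := hlip
    _ ≤ 2 * (κ / (8 * C + 1)) / 1 * (4 * C * ‖ε‖ ^ d) := by gcongr
    _ = κ * ‖ε‖ ^ d * (8 * C / (8 * C + 1)) := by ring
    _ < κ * ‖ε‖ ^ d * 1 := by
      gcongr
      rw [div_lt_one (by positivity)]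
      linarith
    _ = _ := mul_one _

end IsReturnLift

end Saddle

/-! ### Extension of the displacement function across `z = 0` and `ε = 0` -/

namespace Saddle

/-- `n` is the displacement function `(k(z, ε) - z) / ε ^ d` of the conjugate `k` of the holonomy
by the Dulac map, extended to the axes. -/
structure IsDisplacement (ℓ n : ℂ × ℂ → ℂ) (M : ℂ → ℂ) (d : ℕ) (C r : ℝ) : Prop where
  analytic : AnalyticOnNhd ℂ n (Metric.ball 0 r ×ˢ Metric.ball 0 r)
  returnMap_eq : ∀ z ε : ℂ, z ≠ 0 → ‖z‖ < r → ‖ε‖ < r →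
    IsReturnLift.returnMap ℓ (z, ε) = z + ε ^ d * n (z, ε)
  norm_le : ∀ z ε : ℂ, ‖z‖ < r → ‖ε‖ < r → ‖n (z, ε)‖ ≤ C * ‖z‖
  at_zero : ∀ z : ℂ, ‖z‖ < r → n (z, 0) = M z

theorem exists_norm_le_of_zero {G : ℂ × ℂ → ℂ} (hG : AnalyticAt ℂ G 0)
    (h0 : ∀ᶠ ε in 𝓝 (0 : ℂ), G (0, ε) = 0) :
    ∃ C : ℝ, 0 ≤ C ∧ ∀ᶠ p in 𝓝 (0 : ℂ × ℂ), ‖G p‖ ≤ C * ‖p.1‖ := by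
  obtain ⟨K, s, hs, hK⟩ := hG.hasStrictFDerivAt.exists_lipschitzOnWith
  have ht : Tendsto (fun p : ℂ × ℂ => ((0 : ℂ), p.2)) (𝓝 0) (𝓝 0) :=
    Continuous.tendsto' (by fun_prop) _ _ (by simp)
  have ht' : Tendsto (fun p : ℂ × ℂ => p.2) (𝓝 0) (𝓝 0) :=
    Continuous.tendsto' (by fun_prop) _ _ (by simp)
  refine ⟨K, K.2, ?_⟩
  filter_upwards [hs, ht.eventually hs, ht'.eventually h0] with p h1 h2 h3
  have := hK.dist_le_mul p h1 (0, p.2) h2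
  rw [h3, dist_zero_right, Prod.dist_eq, dist_self, max_eq_left dist_nonneg] at this
  simpa using this

variable {D H : ℂ × ℂ → ℂ} {N e : ℝ} {d : ℕ} {M : ℂ → ℂ}

/-- Off the axes the quotient `(k - z)/ε^d` is bounded by a multiple of `|z|`, so it extends to a
bidisc as a jointly analytic function, and the bound persists by density. On `ε = 0` its value is
the limit computed in `tendsto_returnMap_sub_div`. -/
theorem IsDulacLift.exists_isDisplacement (h : IsDulacLift D H N e) (hd : d ≠ 0)
    (hM : ∀ᶠ z in 𝓝 (0 : ℂ), (fun ε : ℝ => H (z, (ε : ℂ)) - z - (ε : ℂ) ^ d * M z) =O[𝓝 0]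
      fun ε : ℝ => ε ^ (d + 1)) :
    ∃ (N' e' C r : ℝ) (ℓ n : ℂ × ℂ → ℂ), N ≤ N' ∧ 0 < e' ∧ e' ≤ e ∧ InjectiveOnImage D H N' e' ∧
      IsReturnLift D ℓ N' e' ∧ 0 < r ∧ r ≤ Real.exp (-(N' + 1)) ∧ r ≤ e' ∧ 0 ≤ C ∧
      IsDisplacement ℓ n M d C r := by
  obtain ⟨G, hG, hHG, hGM⟩ := exists_eq_pow_snd_mul_of_isBigO (A := fun p => H p - p.1)
    (h.H_analytic.sub analyticAt_fst) hM
  -- The holonomy fixes `z = 0`, so `G(0, ε)` vanishes for `ε ≠ 0`; at `ε = 0` this follows by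
  -- continuity.
  have hG0 : ∀ᶠ ε in 𝓝 (0 : ℂ), G (0, ε) = 0 := by
    have ht : Tendsto (fun ε : ℂ => ((0 : ℂ), ε)) (𝓝 0) (𝓝 0) :=
      Continuous.tendsto' (by fun_prop) _ _ (by simp)
    have h1 : ∀ᶠ ε in 𝓝 (0 : ℂ), ε ≠ 0 → G (0, ε) = 0 := by
      filter_upwards [ht.eventually hHG, h.H_zero] with ε h2 h3 h4
      simp only [h3, sub_zero] at h2
      exact (mul_eq_zero.1 h2.symm).resolve_left (pow_ne_zero _ h4)
    have hc : Tendsto (fun ε => G (0, ε)) (𝓝[≠] 0) (𝓝 (G 0)) :=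
      (hG.continuousAt.tendsto.comp ht).mono_left nhdsWithin_le_nhds
    have h00 : G (0, 0) = 0 := by
      refine tendsto_nhds_unique hc (tendsto_const_nhds.congr' ?_)
      filter_upwards [nhdsWithin_le_nhds h1, self_mem_nhdsWithin] with ε h2 h3
      exact (h2 h3).symm
    filter_upwards [h1] with ε h2
    rcases eq_or_ne ε 0 with rfl | h3
    · exact h00
    · exact h2 h3
  obtain ⟨C, hC0, hC⟩ := exists_norm_le_of_zero hG hG0
  obtain ⟨δ₁, hδ₁, hinj⟩ := h.exists_H_injective
  obtain ⟨δ₂, hδ₂, h₂⟩ := Metric.eventually_nhds_iff_ball.1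
    ((hHG.and hC).and hG.eventually_analyticAt)
  obtain ⟨δ₃, hδ₃, h₃⟩ := Metric.eventually_nhds_iff_ball.1 hGM
  set δ := min δ₁ (min δ₂ δ₃)
  have hδ : 0 < δ := lt_min hδ₁ (lt_min hδ₂ hδ₃)
  obtain ⟨N', e₁, hN', he₁, he₁e, hexp⟩ := h.exp_mem hδ
  set e' := min e₁ δ
  have he' : 0 < e' := lt_min he₁ hδ
  have he'e : e' ≤ e := (min_le_left _ _).trans he₁e
  have hδ₁' : δ ≤ δ₁ := min_le_left _ _
  have hδ₂' : δ ≤ δ₂ := (min_le_right _ _).trans (min_le_left _ _)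
  have hδ₃' : δ ≤ δ₃ := (min_le_right _ _).trans (min_le_right _ _)
  have h' := h.mono hN' he' he'e
  have hexp' : ∀ p ∈ liftStrip N' 20 e', ‖Complex.exp (D p)‖ < δ := fun p hp =>
    hexp p (liftStrip_subset le_rfl le_rfl (min_le_left _ _) hp)
  have hεδ : ∀ {ε : ℂ}, ‖ε‖ < e' → ‖ε‖ < δ := fun hε => hε.trans_le (min_le_right _ _)
  have hinj' : InjectiveOnImage D H N' e' := fun ζ ζ' ε h1 h2 heq =>
    hinj _ _ ε ((hexp' _ h1).trans_le hδ₁') ((hexp' _ h2).trans_le hδ₁')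
      ((hεδ h1.2.2).trans_le hδ₁') heq
  have hmem : ∀ w ε : ℂ, ‖w‖ < δ → ‖ε‖ < e' → (w, ε) ∈ Metric.ball (0 : ℂ × ℂ) δ₂ :=
    fun w ε hw hε => by
      simpa [Prod.norm_def] using ⟨hw.trans_le hδ₂', (hεδ hε).trans_le hδ₂'⟩
  have hHG' : ∀ w ε : ℂ, ‖w‖ < δ → ‖ε‖ < e' → H (w, ε) - w = ε ^ d * G (w, ε) :=
    fun w ε hw hε => (h₂ _ (hmem w ε hw hε)).1.1
  have hH' : ∀ w ε : ℂ, ‖w‖ < δ → ‖ε‖ < e' → ‖H (w, ε) - w‖ ≤ C * ‖w‖ * ‖ε‖ ^ d := by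
    intro w ε hw hε
    rw [hHG' w ε hw hε, norm_mul, norm_pow, mul_comm]
    gcongr
    exact (h₂ _ (hmem w ε hw hε)).1.2
  obtain ⟨ℓ, hℓ⟩ := h'.exists_isReturnLift
  -- Halved so that all estimates hold on the radius `2r`, while Cauchy's formula is used on circles
  -- of radius `r`.
  set r := min (Real.exp (-(N' + 1))) (min e' δ) / 2 with hr
  have hr0 : 0 < min (Real.exp (-(N' + 1))) (min e' δ) :=
    lt_min (Real.exp_pos _) (lt_min he' hδ)
  have hrpos : 0 < r := by positivity
  have hr1 : 2 * r ≤ Real.exp (-(N' + 1)) := by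
    rw [hr, mul_div_cancel₀ _ two_ne_zero]; exact min_le_left _ _
  have hr2 : 2 * r ≤ e' := by
    rw [hr, mul_div_cancel₀ _ two_ne_zero]; exact (min_le_right _ _).trans (min_le_left _ _)
  have hr3 : 2 * r ≤ δ := by
    rw [hr, mul_div_cancel₀ _ two_ne_zero]; exact (min_le_right _ _).trans (min_le_right _ _)
  have hdiff : ∀ z ε : ℂ, z ≠ 0 → ‖z‖ < 2 * r → ‖ε‖ < 2 * r →
      DifferentiableAt ℂ (IsReturnLift.returnMap ℓ) (z, ε) := fun z ε hz hz' hε =>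
    hℓ.differentiableAt_returnMap h' hinj' hz (hz'.trans_le hr1) (hε.trans_le hr2)
  have hbound : ∀ z ε : ℂ, z ≠ 0 → ‖z‖ < 2 * r → ‖ε‖ < 2 * r →
      ‖IsReturnLift.returnMap ℓ (z, ε) - z‖ ≤ 8 * C * ‖z‖ * ‖ε‖ ^ d := fun z ε hz hz' hε =>
    hℓ.norm_returnMap_sub_le h' hexp' hH' hz (hz'.trans_le hr1) (hε.trans_le hr2)
  have hquot : ∀ z ε : ℂ, z ≠ 0 → ε ≠ 0 → ‖z‖ < 2 * r → ‖ε‖ < 2 * r →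
      ‖(IsReturnLift.returnMap ℓ (z, ε) - z) / ε ^ d‖ ≤ 8 * C * ‖z‖ := by
    intro z ε hz hε0 hz' hε
    rw [norm_div, norm_pow, div_le_iff₀ (pow_pos (norm_pos_iff.2 hε0) _)]
    exact hbound z ε hz hz' hε
  have hext := exists_analyticOnNhd_of_separately
    (G := fun z ε => (IsReturnLift.returnMap ℓ (z, ε) - z) / ε ^ d) (r := r) (r' := 2 * r)
    (ρ := r) (ρ' := 2 * r) hrpos (by linarith) hrpos (by linarith) ?_ ?_ ?_ ?_ ?_
  rotate_left
  · rintro ⟨z, ε⟩ ⟨hz, hε⟩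
    simp only [mem_sphere_zero_iff_norm] at hz hε
    have hz0 : z ≠ 0 := norm_pos_iff.1 (by linarith)
    have hε0 : ε ≠ 0 := norm_pos_iff.1 (by linarith)
    refine ContinuousAt.continuousWithinAt ?_
    exact ((hdiff z ε hz0 (by linarith) (by linarith)).continuousAt.sub continuousAt_fst).div
      (by fun_prop) (pow_ne_zero _ hε0)
  · intro ε hε z hz
    have hε' : ‖ε‖ = r := by simpa using hε
    have hz' : ‖z‖ < 2 * r := by simpa using hz.1
    have := (hdiff z ε hz.2 hz' (by linarith)).comp z (f := fun z => (z, ε)) (by fun_prop)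
    exact ((this.sub differentiableAt_id).div_const _).differentiableWithinAt
  · intro ε hε
    have hε' : ‖ε‖ = r := by simpa using hε
    refine ⟨8 * C * (2 * r), fun z hz => ?_⟩
    have hz' : ‖z‖ < 2 * r := by simpa using hz.1
    refine (hquot z ε hz.2 (norm_pos_iff.1 (by linarith)) hz' (by linarith)).trans ?_
    gcongr
  · intro z hz ε hε
    have hz' : ‖z‖ < r := by simpa using hz.1
    have hε' : ‖ε‖ < 2 * r := by simpa using hε.1
    have := (hdiff z ε hz.2 (by linarith) hε').comp ε (f := fun ε => (z, ε)) (by fun_prop)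
    have hpow : ε ^ d ≠ 0 := pow_ne_zero _ hε.2
    exact ((this.sub_const _).div (differentiableAt_pow d) hpow).differentiableWithinAt
  · intro z hz
    have hz' : ‖z‖ < r := by simpa using hz.1
    refine ⟨8 * C * ‖z‖, fun ε hε => ?_⟩
    have hε' : ‖ε‖ < 2 * r := by simpa using hε.1
    exact hquot z ε hz.2 hε.2 (by linarith) hε'
  obtain ⟨n, hn, hneq⟩ := hext
  have hneq' : ∀ z ε : ℂ, z ≠ 0 → ε ≠ 0 → ‖z‖ < r → ‖ε‖ < r →
      n (z, ε) = (IsReturnLift.returnMap ℓ (z, ε) - z) / ε ^ d := fun z ε hz hε hz' hε' =>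
    hneq z ⟨by simpa using hz', hz⟩ ε ⟨by simpa using hε', hε⟩
  have hnorm : ∀ z ε : ℂ, ‖z‖ < r → ‖ε‖ < r → ‖n (z, ε)‖ ≤ 8 * C * ‖z‖ := by
    have hdense : Dense (({0}ᶜ : Set ℂ) ×ˢ ({0}ᶜ : Set ℂ)) :=
      (dense_compl_singleton 0).prod (dense_compl_singleton 0)
    have hopen : IsOpen (Metric.ball (0 : ℂ) r ×ˢ Metric.ball (0 : ℂ) r) :=
      Metric.isOpen_ball.prod Metric.isOpen_ball
    intro z ε hz hε
    have hcl := hdense.open_subset_closure_inter hopen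
      (show (z, ε) ∈ _ from ⟨by simpa using hz, by simpa using hε⟩)
    have hc : ContinuousAt (fun p : ℂ × ℂ => ‖n p‖) (z, ε) :=
      (hn (z, ε) ⟨by simpa using hz, by simpa using hε⟩).continuousAt.norm
    have := mem_closure_iff_nhdsWithin_neBot.1 hcl
    have hc2 : ContinuousAt (fun p : ℂ × ℂ => 8 * C * ‖p.1‖) (z, ε) := by fun_prop
    refine le_of_tendsto_of_tendsto (b := 𝓝[(Metric.ball (0 : ℂ) r ×ˢ Metric.ball (0 : ℂ) r) ∩
      (({0}ᶜ : Set ℂ) ×ˢ ({0}ᶜ : Set ℂ))] (z, ε)) (hc.mono_left nhdsWithin_le_nhds)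
      (hc2.mono_left nhdsWithin_le_nhds) ?_
    filter_upwards [self_mem_nhdsWithin] with p hp
    obtain ⟨⟨h1, h2⟩, h3, h4⟩ := hp
    have h1' : ‖p.1‖ < r := by simpa using h1
    have h2' : ‖p.2‖ < r := by simpa using h2
    have := hneq' p.1 p.2 h3 h4 h1' h2'
    rw [Prod.mk.eta] at this
    rw [this]
    exact hquot p.1 p.2 h3 h4 (by linarith) (by linarith)
  refine ⟨N', e', 8 * C, r, ℓ, n, hN', he', he'e, hinj', hℓ, hrpos, by linarith, by linarith,
    by positivity, hn, ?_, hnorm, ?_⟩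
  · intro z ε hz hz' hε
    rcases eq_or_ne ε 0 with rfl | hε0
    · have := hbound z 0 hz (by linarith) (by linarith)
      rw [norm_zero, zero_pow hd, mul_zero] at this
      rw [zero_pow hd, zero_mul, add_zero]
      exact sub_eq_zero.1 (norm_le_zero_iff.1 this)
    · rw [hneq' z ε hz hε0 hz' hε, mul_div_cancel₀ _ (pow_ne_zero _ hε0)]
      ring
  · intro z hz
    have hMz : G (z, 0) = M z := h₃ z (by simpa using hz.trans_le (by linarith))
    rw [← hMz]
    have hzδ : ‖z‖ < δ := by linarith
    rcases eq_or_ne z 0 with rfl | hz0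
    · have h1 := hnorm 0 0 hz hz
      rw [norm_zero, mul_zero] at h1
      rw [norm_le_zero_iff.1 h1]
      exact hG0.self_of_nhds.symm
    · have hGc : ContinuousAt G (z, 0) :=
        (h₂ _ (hmem z 0 hzδ (by simpa using he'))).2.continuousAt
      have l1 := hℓ.tendsto_returnMap_sub_div h' hexp' hH' hHG' hz0 (by linarith) hGc hd
      have hnc : ContinuousAt n (z, 0) :=
        (hn (z, 0) ⟨by simpa using hz, by simpa using hrpos⟩).continuousAt
      have l2 : Tendsto (fun ε => n (z, ε)) (𝓝[≠] 0) (𝓝 (n (z, 0))) :=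
        (ContinuousAt.comp (g := n) (f := fun ε => (z, ε)) (x := 0) hnc
          (by fun_prop)).tendsto.mono_left nhdsWithin_le_nhds
      refine tendsto_nhds_unique l2 (l1.congr' ?_)
      filter_upwards [nhdsWithin_le_nhds (Metric.ball_mem_nhds (0 : ℂ) hrpos),
        self_mem_nhdsWithin] with ε h1 h2
      exact (hneq' z ε hz0 h2 hz (by simpa using h1)).symm

end Saddle

/-! ### The equation `n(u - i ε^d ν, ε) = 2iν` and the reality of its solution -/

namespace Saddle

theorem conj_two_pi_I : conj (2 * Real.pi * Complex.I : ℂ) = -(2 * Real.pi * Complex.I) := by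
  apply Complex.ext <;> simp

/-- The solution `ν` of the equation `2 i ν = n(u - i ε ^ d ν, ε)`. -/
structure IsCurve (n ν : ℂ × ℂ → ℂ) (d : ℕ) (s : ℝ) : Prop where
  diff : DifferentiableOn ℂ ν (Metric.ball 0 s)
  norm_le_one : ∀ p ∈ Metric.ball (0 : ℂ × ℂ) s, ‖ν p‖ ≤ 1
  eq : ∀ p ∈ Metric.ball (0 : ℂ × ℂ) s,
    n (p.1 - Complex.I * (p.2 ^ d * ν p), p.2) = 2 * Complex.I * ν p
  unique : ∀ p ∈ Metric.ball (0 : ℂ × ℂ) s, ∀ v : ℂ, ‖v‖ ≤ 1 →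
    n (p.1 - Complex.I * (p.2 ^ d * v), p.2) = 2 * Complex.I * v → v = ν p

variable {D H ℓ n : ℂ × ℂ → ℂ} {N e C r : ℝ} {d : ℕ} {M : ℂ → ℂ}

/-- Since `d ≥ 1`, the unknown enters `n` multiplied by the small factor `ε^d`, and `v ↦ n(u - i ε^d
v, ε)/(2i)` contracts the unit ball. -/
theorem IsDisplacement.exists_isCurve (hn : IsDisplacement ℓ n M d C r) (hd : d ≠ 0) (hr : 0 < r)
    (hC : 0 ≤ C) : ∃ ν s, 0 < s ∧ s ≤ r / 8 ∧ C * s ≤ 1 ∧ IsCurve n ν d s := by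
  -- The function `n` is `4C`-Lipschitz in its first variable and `|ε^d| ≤ s`, so the contraction
  -- constant is `4Cs/2 ≤ 1/2`.
  set s := min (min 1 (r / 8)) (1 / (4 * C + 4)) with hs
  have hs0 : 0 < s := by positivity
  have hs1 : s ≤ 1 := (min_le_left _ _).trans (min_le_left _ _)
  have hs2 : s ≤ r / 8 := (min_le_left _ _).trans (min_le_right _ _)
  have hs3 : 4 * C * s ≤ 1 := by
    have : s ≤ 1 / (4 * C + 4) := min_le_right _ _
    rw [le_div_iff₀ (by positivity)] at this
    nlinarith
  have hmem : ∀ p ∈ Metric.ball (0 : ℂ × ℂ) s, ‖p.1‖ < s ∧ ‖p.2‖ < s := by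
    intro p hp
    rw [mem_ball_zero_iff, Prod.norm_def, max_lt_iff] at hp
    exact hp
  have hpow : ∀ p ∈ Metric.ball (0 : ℂ × ℂ) s, ‖p.2 ^ d‖ ≤ s := by
    intro p hp
    have h1 := (hmem p hp).2.le
    rw [norm_pow]
    exact (pow_le_of_le_one (norm_nonneg _) (h1.trans hs1) hd).trans h1
  have harg : ∀ p ∈ Metric.ball (0 : ℂ × ℂ) s, ∀ v : ℂ, ‖v‖ ≤ 1 →
      ‖p.1 - Complex.I * (p.2 ^ d * v)‖ < 2 * s := by
    intro p hp v hv
    refine (norm_sub_le _ _).trans_lt ?_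
    rw [norm_mul, norm_mul, Complex.norm_I, one_mul]
    have h1 := (hmem p hp).1
    have h2 : ‖p.2 ^ d‖ * ‖v‖ ≤ s * 1 := by
      gcongr
      exact hpow p hp
    linarith
  have hball : ∀ {w ε : ℂ}, ‖w‖ < r → ‖ε‖ < r →
      ((w, ε) : ℂ × ℂ) ∈ Metric.ball (0 : ℂ) r ×ˢ Metric.ball (0 : ℂ) r :=
    fun hw hε => ⟨by simpa using hw, by simpa using hε⟩
  have hlipn : ∀ ε w w' : ℂ, ‖ε‖ < s → ‖w‖ < 2 * s → ‖w'‖ < 2 * s →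
      ‖n (w, ε) - n (w', ε)‖ ≤ 4 * C * ‖w - w'‖ := by
    intro ε w w' hε hw hw'
    have hsub : ∀ v ∈ Metric.ball w' (r / 2), ‖v‖ < r := by
      intro v hv
      rw [mem_ball_iff_norm] at hv
      have := norm_add_le (v - w') w'
      rw [sub_add_cancel] at this
      linarith
    have hb : ∀ v : ℂ, ‖v‖ < r → ‖n (v, ε)‖ ≤ C * r := fun v hv =>
      (hn.norm_le v ε hv (by linarith)).trans (by gcongr)
    have := Complex.dist_le_div_mul_dist_of_mapsTo_ball (f := fun v => n (v, ε)) (c := w')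
      (z := w) (R₁ := r / 2) (R₂ := 2 * (C * r))
      (hn.analytic.differentiableOn.comp (f := fun v => (v, ε)) (by fun_prop) fun v hv =>
        hball (hsub v hv) (by linarith))
      (fun v hv => by
        rw [mem_closedBall_iff_norm]
        have h1 := hb v (hsub v hv)
        have h2 := hb w' (by linarith)
        exact (norm_sub_le _ _).trans (by linarith))
      (by
        rw [mem_ball_iff_norm]
        have := norm_sub_le w w'
        linarith)
    rw [dist_eq_norm, dist_eq_norm] at this
    refine this.trans_eq ?_
    field_simp
    ring
  set T : ℂ × ℂ → ℂ → ℂ := fun p v =>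
    n (p.1 - Complex.I * (p.2 ^ d * v), p.2) / (2 * Complex.I) with hT
  have hTlip : ∀ p ∈ Metric.ball (0 : ℂ × ℂ) s, ∀ v v', ‖v‖ ≤ 1 → ‖v'‖ ≤ 1 →
      ‖T p v - T p v'‖ ≤ 1 / 2 * ‖v - v'‖ := by
    intro p hp v v' hv hv'
    have h1 := hlipn p.2 _ _ (hmem p hp).2 (harg p hp v hv) (harg p hp v' hv')
    have h2 : p.1 - Complex.I * (p.2 ^ d * v) - (p.1 - Complex.I * (p.2 ^ d * v')) =
        -(Complex.I * (p.2 ^ d * (v - v'))) := by ring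
    rw [h2, norm_neg, norm_mul, norm_mul, Complex.norm_I, one_mul] at h1
    rw [hT]
    simp only
    rw [← sub_div, norm_div, norm_mul, Complex.norm_I, mul_one, Complex.norm_ofNat]
    have h3 : ‖p.2 ^ d‖ * ‖v - v'‖ ≤ s * ‖v - v'‖ := by
      gcongr
      exact hpow p hp
    have h4 : 4 * C * (‖p.2 ^ d‖ * ‖v - v'‖) ≤ 4 * C * s * ‖v - v'‖ := by
      rw [mul_assoc (4 * C)]
      gcongr
    have h5 : 4 * C * s * ‖v - v'‖ ≤ 1 * ‖v - v'‖ := by gcongr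
    linarith
  have hfix := exists_holomorphic_fixedPoint Metric.isOpen_ball (T := T) (m := fun _ => 0)
    (U := Metric.ball (0 : ℂ × ℂ) s) (by fun_prop) ?_ ?_ ?_
  · obtain ⟨ν, h1, h2⟩ := hfix
    simp only [sub_zero] at h2
    have hI : (2 * Complex.I : ℂ) ≠ 0 := by simp
    refine ⟨ν, s, hs0, hs2, by nlinarith, h1, fun p hp => (h2 p hp).1, fun p hp => ?_,
      fun p hp v hv heq => ?_⟩
    · have := (h2 p hp).2
      rw [div_eq_iff hI] at this
      rw [this, mul_comm]
    · have h3 : T p v = v := by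
        simp only [hT]
        rw [heq, mul_div_cancel_left₀ _ hI]
      have h4 := hTlip p hp v (ν p) hv (h2 p hp).1
      rw [h3, (h2 p hp).2] at h4
      have : ‖v - ν p‖ ≤ 0 := by linarith
      exact sub_eq_zero.1 (norm_le_zero_iff.1 this)
  · intro p hp v hv
    rw [sub_zero] at hv ⊢
    rw [hT]
    simp only
    rw [norm_div, norm_mul, Complex.norm_I, mul_one, Complex.norm_ofNat]
    have h1 := harg p hp v hv
    have h2 := hn.norm_le _ p.2 (h1.trans_le (by linarith)) ((hmem p hp).2.trans_le (by linarith))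
    have h3 : C * ‖p.1 - Complex.I * (p.2 ^ d * v)‖ ≤ C * (2 * s) := by gcongr
    linarith
  · intro p hp v v' hv hv'
    rw [sub_zero] at hv hv'
    exact hTlip p hp v v' hv hv'
  · intro g hg hgm
    simp only [sub_zero] at hgm
    have := hn.analytic.differentiableOn.comp
      (f := fun p : ℂ × ℂ => (p.1 - Complex.I * (p.2 ^ d * g p), p.2))
      (s := Metric.ball (0 : ℂ × ℂ) s) (by fun_prop) fun p hp => hball
        ((harg p hp _ (hgm p hp)).trans_le (by linarith)) ((hmem p hp).2.trans_le (by linarith))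
    simp only [hT, div_eq_mul_inv]
    exact this.mul_const _

/-- The lift `D` commutes with conjugation, which exchanges the shifts by `2πi` and `-2πi`.
Conjugating the defining equation of `v = ℓ(ζ)` therefore gives the defining equation of `ℓ` at `v̄
+ 2πi`, with value `ζ̄ + 2πi`. In terms of `k`: conjugation turns `k` into its inverse. -/
theorem IsReturnLift.returnMap_conj (hℓ : IsReturnLift D ℓ N e) (h : IsDulacLift D H N e)
    (hinj : InjectiveOnImage D H N e) {w : ℂ} {ε : ℝ} (hw : w ≠ 0)
    (hw' : ‖w‖ < Real.exp (-(N + 1))) (hε : ‖(ε : ℂ)‖ < e)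
    (hk : ‖returnMap ℓ (w, ε)‖ < Real.exp (-(N + 1))) :
    returnMap ℓ (conj (returnMap ℓ (w, ε)), ε) = conj w := by
  set ζ := Complex.log w with hζ
  have mζ5 : (ζ, (ε : ℂ)) ∈ liftStrip (N + 1) 5 e := log_mem hw hw' hε
  have mζ : (ζ, (ε : ℂ)) ∈ liftStrip (N + 1) 12 e :=
    liftStrip_subset le_rfl (by norm_num) le_rfl mζ5
  set v := ℓ (ζ, ε) with hv
  have hkv : returnMap ℓ (w, ε) = Complex.exp v := rfl
  have hpi := Real.pi_pos
  have hpi' := Real.pi_lt_d2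
  have h1 := hℓ.norm_sub_le_one _ mζ
  have h2 := (Complex.abs_im_le_norm _).trans h1
  have mζim : |ζ.im| ≤ Real.pi := by
    rw [hζ, Complex.log_im]
    exact Complex.abs_arg_le_pi w
  simp only [← hv, Complex.sub_im] at h2
  rw [abs_le] at mζim h2
  have mv : (conj v + 2 * Real.pi * Complex.I, (ε : ℂ)) ∈ liftStrip (N + 1) 12 e := by
    refine ⟨?_, ?_, hε⟩
    · rw [hkv, Complex.norm_exp, Real.exp_lt_exp] at hk
      simpa using hk
    · simp [abs_lt]
      constructor <;> linarith
  have mζ' : (conj ζ + 2 * Real.pi * Complex.I, (ε : ℂ)) ∈ liftStrip N 20 e := by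
    refine add_mem_liftStrip (p := (conj ζ, (ε : ℂ))) ⟨?_, ?_, hε⟩
    · have := mζ.1
      simp only [Complex.conj_re] at this ⊢
      linarith
    · simp [abs_lt]
      constructor <;> linarith
  have e1 : D (conj ζ + 2 * Real.pi * Complex.I, ε) = conj (D (ζ - 2 * Real.pi * Complex.I, ε)) := by
    rw [← h.real _ (sub_mem_liftStrip (liftStrip_inner_subset mζ))]
    simp only [map_sub, conj_two_pi_I, sub_neg_eq_add, Complex.conj_ofReal]
  have e2 : D (conj v, ε) = conj (D (v, ε)) := by
    rw [← h.real _ (liftStrip_middle_subset (hℓ.mem mζ))]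
    simp only [Complex.conj_ofReal, hv]
  have e3 : ℓ (conj v + 2 * Real.pi * Complex.I, ε) = conj ζ + 2 * Real.pi * Complex.I := by
    refine hℓ.eq_of_eq h mv mζ' ?_
    simp only [add_sub_cancel_right]
    have := hℓ.eq _ mζ
    simp only at this
    rw [e1, e2, this, map_add, conj_two_pi_I, neg_add_cancel_right]
  have e4 := hℓ.returnMap_exp h hinj mv
  rw [e3, Complex.exp_periodic, Complex.exp_periodic] at e4
  rw [hkv, ← Complex.exp_conj, e4, Complex.exp_conj, hζ, Complex.exp_log hw]

/-- The curve is real. -/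
theorem IsCurve.im_eq_zero {ν : ℂ × ℂ → ℂ} {s : ℝ} (hν : IsCurve n ν d s)
    (hn : IsDisplacement ℓ n M d C r) (hℓ : IsReturnLift D ℓ N e) (h : IsDulacLift D H N e)
    (hinj : InjectiveOnImage D H N e) (hd : d ≠ 0) (hs1 : s ≤ 1) (hs : s ≤ r / 8)
    (hr1 : r ≤ Real.exp (-(N + 1))) (hr2 : r ≤ e) {u ε : ℝ} (hu : |u| < s) (hε : |ε| < s) :
    (ν (u, ε)).im = 0 := by
  have hmem : ∀ ε : ℝ, |ε| < s → ((u : ℂ), (ε : ℂ)) ∈ Metric.ball (0 : ℂ × ℂ) s := by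
    intro ε hε
    simpa [Prod.norm_def] using ⟨hu, hε⟩
  have hne : ∀ ε : ℝ, |ε| < s → ε ≠ 0 → (ν (u, ε)).im = 0 := by
    intro ε hε hε0
    have hεc : (ε : ℂ) ^ d ≠ 0 := pow_ne_zero _ (by exact_mod_cast hε0)
    have hεn : ‖(ε : ℂ)‖ < s := by simpa using hε
    have hpow : ‖(ε : ℂ) ^ d‖ ≤ s := by
      rw [norm_pow]
      exact (pow_le_of_le_one (norm_nonneg _) (hεn.le.trans hs1) hd).trans hεn.le
    set v := ν (u, ε) with hv
    have h1 := hν.norm_le_one _ (hmem ε hε)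
    have h2 := hν.eq _ (hmem ε hε)
    simp only [← hv] at h1 h2
    set w : ℂ := u - Complex.I * ((ε : ℂ) ^ d * v) with hw
    set w' : ℂ := u + Complex.I * ((ε : ℂ) ^ d * v) with hw'
    have hIv : ‖Complex.I * ((ε : ℂ) ^ d * v)‖ ≤ s := by
      rw [norm_mul, Complex.norm_I, one_mul, norm_mul]
      exact (mul_le_of_le_one_right (norm_nonneg _) h1).trans hpow
    have hun : ‖(u : ℂ)‖ < s := by simpa using hu
    have hwn : ‖w‖ < r := by
      refine (norm_sub_le _ _).trans_lt ?_
      have := (norm_nonneg _).trans_lt hun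
      linarith
    have hwn' : ‖w'‖ < r := by
      refine (norm_add_le _ _).trans_lt ?_
      have := (norm_nonneg _).trans_lt hun
      linarith
    have hεr : ‖(ε : ℂ)‖ < r := by
      have := (norm_nonneg _).trans_lt hun
      linarith
    -- The formula for `k` is available off `z = 0` only; at `w = 0` the function `n` vanishes and
    -- so does `v`.
    rcases eq_or_ne w 0 with hw0 | hw0
    · have h3 := hn.norm_le w ε hwn hεr
      rw [hw0, norm_zero, mul_zero] at h3
      rw [hw0, norm_le_zero_iff.1 h3] at h2
      have : v = 0 := by simpa using h2.symm
      rw [this, Complex.zero_im]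
    have h3 : IsReturnLift.returnMap ℓ (w, ε) = w' := by
      rw [hn.returnMap_eq w ε hw0 hwn hεr, h2, hw, hw']
      ring
    have h4 := hℓ.returnMap_conj h hinj hw0 (hwn.trans_le hr1) (hεr.trans_le hr2)
      (by rw [h3]; exact hwn'.trans_le hr1)
    rw [h3] at h4
    have hw'0 : conj w' ≠ 0 := by
      rw [← h3]
      simp [IsReturnLift.returnMap]
    rw [hn.returnMap_eq _ ε hw'0 (by simpa using hwn') hεr] at h4
    have hcw : conj w = u + Complex.I * ((ε : ℂ) ^ d * conj v) := by
      simp [hw]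
    have hcw' : conj w' = u - Complex.I * ((ε : ℂ) ^ d * conj v) := by
      simp [hw']
      ring
    rw [hcw, hcw'] at h4
    -- The map `k` sends `u - i ε^d v` to `u + i ε^d v`, so by the symmetry it sends `u - i ε^d v̄`
    -- to `u + i ε^d v̄`. Hence `v̄` solves the same equation, and uniqueness gives `v̄ = v`.
    have h5 := hν.unique _ (hmem ε hε) (conj v) (by simpa using h1) (by
      refine mul_left_cancel₀ hεc ?_
      simp only
      linear_combination h4)
    exact Complex.conj_eq_iff_im.1 h5
  -- The argument divides by `ε^d`; the value at `ε = 0` is real by continuity.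
  rcases eq_or_ne ε 0 with rfl | hε0
  · have hc : ContinuousAt (fun ε : ℝ => (ν (u, ε)).im) 0 := by
      have h1 : ContinuousAt ν ((u : ℂ), ((0 : ℝ) : ℂ)) :=
        (hν.diff.differentiableAt (Metric.isOpen_ball.mem_nhds (hmem 0 hε))).continuousAt
      exact Complex.continuous_im.continuousAt.comp
        (h1.comp (f := fun ε : ℝ => ((u : ℂ), (ε : ℂ))) (by fun_prop))
    refine tendsto_nhds_unique (hc.tendsto.mono_left (nhdsWithin_le_nhds (s := {0}ᶜ)))
      (tendsto_const_nhds.congr' ?_)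
    have h0s : 0 < s := (abs_nonneg _).trans_lt hu
    filter_upwards [nhdsWithin_le_nhds (Metric.ball_mem_nhds (0 : ℝ) h0s),
      self_mem_nhdsWithin] with η h1 h2
    exact (hne η (by simpa using h1) h2).symm
  · exact hne ε hε hε0

end Saddle

/-! ### The zero locus in terms of `D`, of `k` and of the curve -/

namespace Saddle

variable {D H ℓ n : ℂ × ℂ → ℂ} {N e C r : ℝ} {d : ℕ} {M : ℂ → ℂ}

theorem IsDulacLift.im_ofReal (h : IsDulacLift D H N e) {x ε : ℝ}
    (hm : ((x : ℂ), (ε : ℂ)) ∈ liftStrip N 20 e) : (D (x, ε)).im = 0 := by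
  have := h.real _ hm
  simp only [Complex.conj_ofReal] at this
  exact Complex.conj_eq_iff_im.1 this.symm

/-- Comparison with the real point `x` puts `Im D` within `φ/10` of `φ`, hence strictly between `0`
and `2π`, where the sine vanishes only at `π`. As `D` at the conjugate point is conjugate, `Im D =
π` is the stated equation. -/
theorem IsDulacLift.im_exp_eq_zero_iff (h : IsDulacLift D H N e) {x φ ε : ℝ} (hx : x < -N)
    (hφ : φ ∈ Ioo 0 (3 * Real.pi / 2)) (hε : ‖(ε : ℂ)‖ < e) :
    (Complex.exp (D (x + φ * Complex.I, ε))).im = 0 ↔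
      D (x + φ * Complex.I, ε) = D (x - φ * Complex.I, ε) + 2 * Real.pi * Complex.I := by
  have hpi := Real.pi_pos
  have hpi' := Real.pi_lt_d2
  have m0 : ((x : ℂ), (ε : ℂ)) ∈ liftStrip N 20 e := ⟨by simpa using hx, by simp, hε⟩
  have m1 : (x + φ * Complex.I, (ε : ℂ)) ∈ liftStrip N 20 e := by
    refine ⟨by simpa using hx, ?_, hε⟩
    simp [abs_of_pos hφ.1]
    linarith [hφ.2]
  have h1 := (Complex.abs_im_le_norm _).trans (h.near_id _ _ _ m1 m0)
  simp [h.im_ofReal m0, abs_of_pos hφ.1] at h1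
  rw [abs_le] at h1
  have e1 : D (x - φ * Complex.I, ε) = conj (D (x + φ * Complex.I, ε)) := by
    rw [← h.real _ m1]
    simp [sub_eq_add_neg]
  set y := (D (x + φ * Complex.I, ε)).im with hy
  have e2 : (Complex.exp (D (x + φ * Complex.I, ε))).im = 0 ↔ y = Real.pi := by
    rw [Complex.exp_im, mul_eq_zero, or_iff_right (Real.exp_pos _).ne', ← hy]
    have := Real.sin_eq_zero_iff_of_lt_of_lt (x := y - Real.pi) (by linarith [hφ.1])
      (by linarith [hφ.2])
    rw [Real.sin_sub_pi, neg_eq_zero, sub_eq_zero] at this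
    exact this
  rw [e2, e1]
  constructor
  · intro h2
    apply Complex.ext
    · simp
    · simp [← hy, h2]
      ring
  · intro h2
    have := congrArg Complex.im h2
    simp [← hy] at this
    linarith

/-- With `ζ' = ζ̄ + 2πi` the equation is `ℓ(ζ') = ζ`, whose exponential is `k(z̄) = z`. Conversely
`k(z̄) = z` determines `ℓ(ζ')` only up to `2πi m`. The bound `‖ℓ(ζ') - ζ'‖ ≤ 1` gives `|2φ - 2π +
2πm| ≤ 1`, and `Re z < 0`, that is `φ > π/2`, excludes all `m ≠ 0`; in particular it discards
solutions near the positive axis, where `m = 1`. -/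
theorem IsReturnLift.eq_iff (hℓ : IsReturnLift D ℓ N e) (h : IsDulacLift D H N e)
    (hinj : InjectiveOnImage D H N e) {x φ ε : ℝ} (hx : x < -(N + 1))
    (hφ : φ ∈ Ioo 0 (3 * Real.pi / 2)) (hε : ‖(ε : ℂ)‖ < e) :
    D (x + φ * Complex.I, ε) = D (x - φ * Complex.I, ε) + 2 * Real.pi * Complex.I ↔
      (Complex.exp (x + φ * Complex.I)).re < 0 ∧
        returnMap ℓ (Complex.exp (x - φ * Complex.I), ε) = Complex.exp (x + φ * Complex.I) := by
  have hpi := Real.pi_gt_d2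
  have hpi' := Real.pi_lt_d2
  set ζ : ℂ := x + φ * Complex.I with hζ
  set ζ' : ℂ := x - φ * Complex.I + 2 * Real.pi * Complex.I with hζ'
  have mζ : (ζ, (ε : ℂ)) ∈ liftStrip N 20 e := by
    refine ⟨by simp [hζ]; linarith, ?_, hε⟩
    simp [hζ, abs_of_pos hφ.1]
    linarith [hφ.2]
  have mζ' : (ζ', (ε : ℂ)) ∈ liftStrip (N + 1) 12 e := by
    refine ⟨by simp [hζ']; linarith, ?_, hε⟩
    simp [hζ', abs_lt]
    constructor <;> linarith [hφ.1, hφ.2]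
  have hcancel : ζ' - 2 * Real.pi * Complex.I = x - φ * Complex.I := add_sub_cancel_right _ _
  have e1 : D (ζ, ε) = D (x - φ * Complex.I, ε) + 2 * Real.pi * Complex.I ↔ ℓ (ζ', ε) = ζ := by
    constructor
    · intro h1
      exact hℓ.eq_of_eq h mζ' mζ (by simp only [hcancel, h1])
    · intro h1
      have := hℓ.eq _ mζ'
      simp only [hcancel, h1] at this
      exact this
  have e2 : returnMap ℓ (Complex.exp (x - φ * Complex.I), ε) = Complex.exp (ℓ (ζ', ε)) := by
    rw [← hℓ.returnMap_exp h hinj mζ', hζ', Complex.exp_periodic]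
  have hre : (Complex.exp ζ).re = Real.exp x * Real.cos φ := by
    rw [Complex.exp_re]
    simp [hζ]
  have h2 := hℓ.norm_sub_le_one _ mζ'
  simp only at h2
  rw [e1, e2, hre]
  constructor
  · intro h1
    refine ⟨?_, by rw [h1]⟩
    rw [h1] at h2
    have h3 := (Complex.abs_im_le_norm _).trans h2
    simp [hζ, hζ', abs_le] at h3
    exact mul_neg_of_pos_of_neg (Real.exp_pos _)
      (Real.cos_neg_of_pi_div_two_lt_of_lt (by linarith [h3.1]) (by linarith [hφ.2]))
  · rintro ⟨h1, h3⟩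
    have h4 : Real.pi / 2 < φ := by
      by_contra! h5
      have := Real.cos_nonneg_of_mem_Icc (x := φ) ⟨by linarith [hφ.1], h5⟩
      have := mul_nonneg (Real.exp_pos x).le this
      linarith
    obtain ⟨m, hm⟩ := Complex.exp_eq_exp_iff_exists_int.1 h3
    rw [hm] at h2 ⊢
    have h5 := (Complex.abs_im_le_norm _).trans h2
    have h6 : (ζ + m * (2 * Real.pi * Complex.I) - ζ').im =
        2 * φ - 2 * Real.pi + m * (2 * Real.pi) := by
      simp [hζ, hζ']
      ring
    rw [h6, abs_le] at h5
    have hm0 : m = 0 := by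
      by_contra hne
      rcases lt_or_gt_of_ne hne with h7 | h7
      · have : (m : ℝ) ≤ -1 := by exact_mod_cast (by omega : m ≤ -1)
        nlinarith [hφ.2]
      · have : (1 : ℝ) ≤ m := by exact_mod_cast h7
        nlinarith
    simp [hm0]

/-- The condition `k(z̄) = z` describes the curve. -/
theorem IsCurve.returnMap_eq_iff {ν : ℂ × ℂ → ℂ} {s : ℝ} (hν : IsCurve n ν d s)
    (hn : IsDisplacement ℓ n M d C r) (hd : d ≠ 0) (hs : s ≤ r / 8) (hC : 0 ≤ C) (hCs : C * s ≤ 1)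
    {u v ε : ℝ} (hz0 : (u + v * Complex.I : ℂ) ≠ 0) (hz : ‖(u + v * Complex.I : ℂ)‖ < s)
    (hε : |ε| < s) (hreal : (ν (u, ε)).im = 0) :
    IsReturnLift.returnMap ℓ ((u - v * Complex.I : ℂ), ε) = u + v * Complex.I ↔
      v = ε ^ d * (ν (u, ε)).re := by
  have hconj : (u - v * Complex.I : ℂ) = conj (u + v * Complex.I : ℂ) := by
    simp [sub_eq_add_neg]
  have hn' : ‖(u - v * Complex.I : ℂ)‖ < s := by
    rw [hconj, Complex.norm_conj]
    exact hz
  have hs0 : 0 < s := (norm_nonneg _).trans_lt hz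
  have hεn : ‖(ε : ℂ)‖ < s := by simpa using hε
  have hu : ‖(u : ℂ)‖ < s := by
    have h1 := (Complex.abs_re_le_norm _).trans_lt hz
    simpa using h1
  have hne : (u - v * Complex.I : ℂ) ≠ 0 := by
    rw [hconj]
    exact (map_ne_zero _).2 hz0
  rw [hn.returnMap_eq _ _ hne (by linarith) (by linarith)]
  rcases eq_or_ne ε 0 with rfl | hε0
  · simp only [Complex.ofReal_zero, zero_pow hd, zero_mul, add_zero]
    constructor
    · intro h1
      have := congrArg Complex.im h1
      simp at this
      linarith
    · rintro rfl
      simp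
  have hεc : (ε : ℂ) ^ d ≠ 0 := pow_ne_zero _ (by exact_mod_cast hε0)
  have hp : ((u : ℂ), (ε : ℂ)) ∈ Metric.ball (0 : ℂ × ℂ) s := by
    rw [mem_ball_zero_iff, Prod.norm_def, max_lt_iff]
    exact ⟨hu, hεn⟩
  constructor
  · intro h1
    have h2 : n (u - v * Complex.I, ε) = 2 * Complex.I * (v / (ε : ℂ) ^ d) := by
      refine mul_left_cancel₀ hεc ?_
      field_simp
      linear_combination h1
    have h3 := hn.norm_le (u - v * Complex.I) ε (by linarith) (by linarith)
    -- The equation itself bounds the quotient: `2 |v/ε^d| = |n| ≤ C s ≤ 1`. So `v/ε^d` lies in the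
    -- ball where `ν` is the only solution.
    have h4 : ‖(v / (ε : ℂ) ^ d : ℂ)‖ ≤ 1 := by
      rw [h2, norm_mul, norm_mul, Complex.norm_I, mul_one, Complex.norm_ofNat] at h3
      have : C * ‖(u - v * Complex.I : ℂ)‖ ≤ C * s := by gcongr
      linarith [norm_nonneg (v / (ε : ℂ) ^ d : ℂ)]
    have h5 := hν.unique _ hp (v / (ε : ℂ) ^ d) h4 (by
      simp only
      rw [mul_div_cancel₀ _ hεc, ← h2, mul_comm Complex.I])
    rw [div_eq_iff hεc] at h5
    have h6 : ν (u, ε) = ((ν (u, ε)).re : ℂ) := by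
      apply Complex.ext
      · simp
      · simp [hreal]
    rw [h6, ← Complex.ofReal_pow, ← Complex.ofReal_mul, Complex.ofReal_inj, mul_comm] at h5
    exact h5
  · intro h1
    have h6 : ν (u, ε) = ((ν (u, ε)).re : ℂ) := by
      apply Complex.ext
      · simp
      · simp [hreal]
    have h2 := hν.eq _ hp
    simp only at h2
    have h3 : (v : ℂ) = (ε : ℂ) ^ d * ν (u, ε) := by
      rw [h6, ← Complex.ofReal_pow, ← Complex.ofReal_mul, ← h1]
    rw [← h3, mul_comm Complex.I] at h2
    rw [h2]
    linear_combination (-2 * Complex.I) * h3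

/-- The zero locus of the imaginary part of a family of Dulac maps. -/
theorem IsDulacLift.exists_zeroLocus (h : IsDulacLift D H N e) (hd : d ≠ 0)
    (hM : ∀ᶠ z in 𝓝 (0 : ℂ), (fun ε : ℝ => H (z, (ε : ℂ)) - z - (ε : ℂ) ^ d * M z) =O[𝓝 0]
      fun ε : ℝ => ε ^ (d + 1)) :
    ∃ s > 0, ∃ R V : ℝ × ℝ → ℝ,
      AnalyticOnNhd ℝ R (Ioo (-s) s ×ˢ Ioo (-s) s) ∧
      AnalyticOnNhd ℝ V (Ioo (-s) s ×ˢ Ioo (-s) s) ∧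
      (∀ u ∈ Ioo (-s) s, ∀ ε ∈ Ioo (-s) s,
        (V (u, ε) : ℂ) = (ε : ℂ) ^ d / (2 * Complex.I) * M u + (ε : ℂ) ^ (d + 1) * R (u, ε)) ∧
      (∀ ε ∈ Ioo (-s) s, V (0, ε) = 0) ∧
      ∀ ε ∈ Ioo (-s) s, ∀ x φ : ℝ, Real.exp x < s → φ ∈ Ioo 0 (3 * Real.pi / 2) →
        ((Complex.exp (D (x + φ * Complex.I, ε))).im = 0 ↔
          (Complex.exp (x + φ * Complex.I)).re < 0 ∧ (Complex.exp (x + φ * Complex.I)).im =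
            V ((Complex.exp (x + φ * Complex.I)).re, ε)) := by
  obtain ⟨N', e', C, r, ℓ, n, hN', he', he'e, hinj, hℓ, hr0, hr1, hr2, hC, hn⟩ :=
    h.exists_isDisplacement hd hM
  have h' := h.mono hN' he' he'e
  obtain ⟨ν, s₀, hs₀, hs₀r, hCs, hν⟩ := hn.exists_isCurve hd hr0 hC
  have hνan : AnalyticAt ℂ ν 0 :=
    analyticAt_zero_of_differentiableOn (Metric.ball_mem_nhds _ hs₀) hν.diff
  -- The remainder `R` is `(ν(u, ε) - ν(u, 0))/ε`, analytic by division with exponent `1`.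
  obtain ⟨Q, hQ, hQeq⟩ := exists_eq_pow_snd_mul (A := fun p => ν p - ν (p.1, 0)) (d := 1) (by
      refine hνan.sub (AnalyticAt.fun_comp (g := ν) (f := fun p : ℂ × ℂ => (p.1, (0 : ℂ))) ?_
        (analyticAt_fst.prod analyticAt_const))
      exact hνan) (by
    filter_upwards [Metric.ball_mem_nhds (0 : ℂ) hs₀] with z hz
    have h1 : DifferentiableAt ℂ (fun ε : ℂ => ν (z, ε)) 0 := by
      refine DifferentiableAt.comp (g := ν) (f := fun ε : ℂ => (z, ε)) (0 : ℂ) ?_ (by fun_prop)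
      refine hν.diff.differentiableAt (Metric.isOpen_ball.mem_nhds ?_)
      simpa [Prod.norm_def, hs₀] using hz
    have h2 := h1.isBigO_sub
    have ht : Tendsto (fun ε : ℝ => (ε : ℂ)) (𝓝 0) (𝓝 0) :=
      Complex.continuous_ofReal.tendsto' _ _ (by simp)
    have h3 := h2.comp_tendsto ht
    refine h3.trans (IsBigO.of_bound 1 (Eventually.of_forall fun ε => ?_))
    simp)
  obtain ⟨s₁, hs₁, h₁⟩ := Metric.eventually_nhds_iff_ball.1
    ((hνan.eventually_analyticAt.and hQ.eventually_analyticAt).and hQeq)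
  set s := min (min s₀ 1) s₁
  have hs : 0 < s := by positivity
  have hss₀ : s ≤ s₀ := (min_le_left _ _).trans (min_le_left _ _)
  have hs1 : s ≤ 1 := (min_le_left _ _).trans (min_le_right _ _)
  have hss₁ : s ≤ s₁ := min_le_right _ _
  have habs : ∀ {u : ℝ}, u ∈ Ioo (-s) s → |u| < s := fun hu => abs_lt.2 hu
  have hball : ∀ {u ε : ℝ}, |u| < s → |ε| < s → ∀ s', s ≤ s' →
      ((u : ℂ), (ε : ℂ)) ∈ Metric.ball (0 : ℂ × ℂ) s' := by
    intro u ε hu hε s' hs'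
    simpa [Prod.norm_def] using ⟨hu.trans_le hs', hε.trans_le hs'⟩
  have hν' : IsCurve n ν d s := by
    have hsub := Metric.ball_subset_ball (x := (0 : ℂ × ℂ)) hss₀
    exact ⟨hν.diff.mono hsub, fun p hp => hν.norm_le_one p (hsub hp),
      fun p hp => hν.eq p (hsub hp), fun p hp => hν.unique p (hsub hp)⟩
  have hreal : ∀ {u ε : ℝ}, |u| < s → |ε| < s → (ν (u, ε)).im = 0 := fun hu hε =>
    hν'.im_eq_zero hn hℓ h' hinj hd hs1 (hss₀.trans hs₀r) hr1 hr2 hu hε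
  have hre : ∀ {u ε : ℝ}, |u| < s → |ε| < s → ν (u, ε) = ((ν (u, ε)).re : ℂ) := by
    intro u ε hu hε
    apply Complex.ext
    · simp
    · simp [hreal hu hε]
  have hanre : ∀ {g : ℂ × ℂ → ℂ} {p : ℝ × ℝ}, AnalyticAt ℂ g ((p.1 : ℂ), (p.2 : ℂ)) →
      AnalyticAt ℝ (fun p : ℝ × ℝ => (g ((p.1 : ℂ), (p.2 : ℂ))).re) p := by
    intro g p hg
    have h1 : AnalyticAt ℝ g ((p.1 : ℂ), (p.2 : ℂ)) := hg.restrictScalars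
    have h2 : AnalyticAt ℝ (fun p : ℝ × ℝ => ((p.1 : ℂ), (p.2 : ℂ))) p :=
      ((Complex.ofRealCLM.analyticAt _).comp analyticAt_fst).prod
        ((Complex.ofRealCLM.analyticAt _).comp analyticAt_snd)
    have h3 : AnalyticAt ℝ (fun p : ℝ × ℝ => g ((p.1 : ℂ), (p.2 : ℂ))) p :=
      AnalyticAt.comp (g := g) (f := fun p : ℝ × ℝ => ((p.1 : ℂ), (p.2 : ℂ))) h1 h2
    exact (Complex.reCLM.analyticAt _).comp h3
  refine ⟨s, hs, fun p => (Q (p.1, p.2)).re, fun p => p.2 ^ d * (ν (p.1, p.2)).re, ?_, ?_, ?_, ?_,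
    ?_⟩
  · rintro ⟨u, ε⟩ ⟨hu, hε⟩
    exact hanre (h₁ _ (hball (habs hu) (habs hε) _ hss₁)).1.2
  · rintro ⟨u, ε⟩ ⟨hu, hε⟩
    exact (analyticAt_snd.pow d).mul (hanre (h₁ _ (hball (habs hu) (habs hε) _ hss₁)).1.1)
  · intro u hu ε hε
    have hu' := habs hu
    have hε' := habs hε
    have h0' : |(0 : ℝ)| < s := by simpa using hs
    have hM' : M u = 2 * Complex.I * ν (u, 0) := by
      rw [← hn.at_zero u (by
        rw [Complex.norm_real, Real.norm_eq_abs]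
        linarith)]
      have := hν'.eq _ (hball hu' h0' s le_rfl)
      simpa [zero_pow hd] using this
    have hI : (2 * Complex.I : ℂ) ≠ 0 := by simp
    have h3 : (ε : ℂ) ^ d / (2 * Complex.I) * M u = (ε : ℂ) ^ d * ν (u, 0) := by
      rw [hM']
      field_simp
    rw [h3]
    push_cast
    rw [← hre hu' hε']
    rcases eq_or_ne ε 0 with rfl | hε0
    · simp [zero_pow hd]
    have h4 := (h₁ _ (hball hu' hε' _ hss₁)).2
    simp only [pow_one] at h4
    have hε0' : (ε : ℂ) ≠ 0 := by exact_mod_cast hε0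
    -- For real `ε ≠ 0`, `Q` is a difference quotient of the real function `ν`, so taking its real
    -- part loses nothing.
    have hQre : Q (u, ε) = ((Q (u, ε)).re : ℂ) := by
      have h5 : Q (u, ε) = (((ν (u, ε)).re - (ν (u, (0 : ℝ))).re) / ε : ℝ) := by
        have h6 := hre hu' h0'
        rw [Complex.ofReal_zero] at h6
        push_cast
        rw [← hre hu' hε', ← h6, h4, mul_div_cancel_left₀ _ hε0']
      rw [h5, Complex.ofReal_re]
    rw [← hQre, pow_succ]
    linear_combination (ε : ℂ) ^ d * h4
  · intro ε hε
    have hε' := habs hε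
    have h0' : |(0 : ℝ)| < s := by simpa using hs
    have hp := hball h0' hε' s le_rfl
    have h1 := hn.norm_le 0 ε (by simpa using hr0) (by
      rw [Complex.norm_real, Real.norm_eq_abs]
      linarith)
    rw [norm_zero, mul_zero] at h1
    have h2 := hν'.unique _ hp 0 (by simp) (by simpa using norm_le_zero_iff.1 h1)
    simp only [Complex.ofReal_zero] at h2 ⊢
    simp [← h2]
  · intro ε hε x φ hx hφ
    have hε' := habs hε
    have hεn : ‖(ε : ℂ)‖ < e' := by
      rw [Complex.norm_real, Real.norm_eq_abs]
      linarith
    have hx' : x < -(N' + 1) := by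
      rw [← Real.exp_lt_exp]
      linarith
    rw [h'.im_exp_eq_zero_iff (by linarith) hφ hεn, hℓ.eq_iff h' hinj hx' hφ hεn]
    refine and_congr_right fun _ => ?_
    set z := Complex.exp (x + φ * Complex.I) with hz
    have hzc : Complex.exp (x - φ * Complex.I) = z.re - z.im * Complex.I := by
      have : (x - φ * Complex.I : ℂ) = conj (x + φ * Complex.I : ℂ) := by simp [sub_eq_add_neg]
      rw [this, Complex.exp_conj, ← hz]
      apply Complex.ext <;> simp
    have hze : z = z.re + z.im * Complex.I := (Complex.re_add_im z).symm
    have hzn : ‖z‖ < s := by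
      rw [hz, Complex.norm_exp]
      simpa using hx
    have hzre : |z.re| < s := (Complex.abs_re_le_norm z).trans_lt hzn
    have key := hν'.returnMap_eq_iff hn hd (hss₀.trans hs₀r) hC (by nlinarith)
      (u := z.re) (v := z.im) (by rw [← hze]; exact Complex.exp_ne_zero _) (by rw [← hze]; exact hzn)
      hε' (hreal hzre hε')
    rw [hzc]
    rwa [← hze] at key

end Saddle

/-! ### Leaf paths and the first integral -/

namespace Saddle

/-- A domain of the factored foliation on which the first integral is defined and controlled. -/
structure IsChart (f : ℂ × ℂ → ℂ) (P Q a b : ℂ × ℂ × ℂ → ℂ) (R κ K r X : ℝ) : Prop where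
  fact : IsFactored f P Q a b R
  slope : IsSlope (fun p => a p / b p) R κ K 40 r
  X_le : X + 1 ≤ Real.log R
  bound : K * (1 + 40) * (Real.exp X + 5 * r) ≤ 1 / 200
  near : ∀ p ∈ Metric.ball (0 : ℂ × ℂ × ℂ) R, ‖a p / b p - 1‖ ≤ 1 / 200

theorem IsFactored.mono {f : ℂ × ℂ → ℂ} {P Q a b : ℂ × ℂ × ℂ → ℂ} {R R' : ℝ}
    (h : IsFactored f P Q a b R) (hR' : 0 < R') (hle : R' ≤ R) : IsFactored f P Q a b R' := by
  have h2 := Metric.ball_subset_ball (x := (0 : ℂ × ℂ)) hle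
  have h3 := Metric.ball_subset_ball (x := (0 : ℂ × ℂ × ℂ)) hle
  exact ⟨hR', h.f_analytic.mono h2, h.a_diff.mono h3, h.b_diff.mono h3,
    fun p hp => h.a_re p (h3 hp), fun p hp => h.b_re p (h3 hp), fun p hp => h.a_real p (h3 hp),
    fun p hp => h.b_real p (h3 hp), fun ε x y hp => h.coeffX_eq ε x y (h3 hp),
    fun ε x y hp => h.coeffY_eq ε x y (h3 hp), h.eq_zero⟩

/-- The value `B = 40` leaves room for the strips of half-width `25` used later and for a turn by
`2π`; the tolerance `1/200` makes the errors in `lift_near_id` add up to less than `1/10`. -/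
theorem exists_isChart {f : ℂ × ℂ → ℂ} {P Q : ℂ × ℂ × ℂ → ℂ} (hf : IsHyperbolicMorse f)
    (hP : IsRealAnalytic P) (hQ : IsRealAnalytic Q) (hsep : AxesAreSeparatrices f P Q)
    (hpos : PositiveOnFirstQuadrant f) : ∃ a b R κ K r X, IsChart f P Q a b R κ K r X := by
  obtain ⟨a, b, R₀, h⟩ := exists_isFactored hf hP hQ hsep hpos
  obtain ⟨R, κ, K, r, X, h1, h2, h3, h4, h5⟩ :=
    h.exists_isSlope (B := 40) (by norm_num) (β := 1 / 200) (by norm_num)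
  exact ⟨a, b, R, κ, K, r, X, h.mono h5.R_pos h1, h5, h2, h3, h4⟩

namespace IsChart

variable {f : ℂ × ℂ → ℂ} {P Q a b : ℂ × ℂ × ℂ → ℂ} {R κ K r X : ℝ}

theorem b_ne_zero (h : IsChart f P Q a b R κ K r X) {p : ℂ × ℂ × ℂ}
    (hp : p ∈ Metric.ball (0 : ℂ × ℂ × ℂ) R) : b p ≠ 0 := fun h0 => by
  have := h.fact.b_re p hp
  simp [h0] at this

theorem r_lt_R (h : IsChart f P Q a b R κ K r X) : r < R := by
  have := h.slope.r_le
  have := h.slope.r_pos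
  linarith

theorem exp_lt_R (h : IsChart f P Q a b R κ K r X) {ξ : ℂ} (hξ : ξ.re < X + 1) :
    ‖Complex.exp ξ‖ < R := by
  rw [Complex.norm_exp, ← Real.lt_log_iff_exp_lt h.slope.R_pos]
  exact hξ.trans_le h.X_le

/-- The solutions of the equation for the leaves are leaf paths. -/
theorem isLeafPath_flow (h : IsChart f P Q a b R κ K r X) {ξ Δ y : ℂ} {ε : ℝ}
    (hp : (ξ, Δ, y, (ε : ℂ)) ∈ flowDomain R 40 r) :
    IsLeafPath f P Q ε fun s =>
      (Complex.exp (ξ + s * Δ), h.slope.flowY (ξ, Δ, y, (ε : ℂ)) s) := by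
  set Y := h.slope.flowY (ξ, Δ, y, (ε : ℂ)) with hY
  have hxd : ∀ s : ℝ, HasDerivAt (fun s : ℝ => Complex.exp (ξ + s * Δ))
      (Complex.exp (ξ + s * Δ) * Δ) s := by
    intro s
    have := ((Complex.ofRealCLM.hasDerivAt (x := s)).mul_const Δ).const_add ξ
    simpa using this.cexp
  have hYd : ∀ s ∈ Icc (0 : ℝ) 1, HasDerivWithinAt Y
      (-(Y s * (a (Complex.exp (ξ + s * Δ), Y s, ε) / b (Complex.exp (ξ + s * Δ), Y s, ε)) * Δ))
      (Icc 0 1) s := fun s hs => h.slope.hasDerivWithinAt_flowY hp hs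
  have hd : ∀ s ∈ Icc (0 : ℝ) 1, HasDerivWithinAt (fun s : ℝ => (Complex.exp (ξ + s * Δ), Y s))
      (Complex.exp (ξ + s * Δ) * Δ,
        -(Y s * (a (Complex.exp (ξ + s * Δ), Y s, ε) / b (Complex.exp (ξ + s * Δ), Y s, ε)) * Δ))
      (Icc 0 1) s := fun s hs => (hxd s).hasDerivWithinAt.prodMk (hYd s hs)
  have huniq := uniqueDiffOn_Icc (zero_lt_one (α := ℝ))
  have hball : ∀ s ∈ Icc (0 : ℝ) 1,
      (Complex.exp (ξ + s * Δ), Y s, (ε : ℂ)) ∈ Metric.ball (0 : ℂ × ℂ × ℂ) R := fun s hs =>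
    h.slope.flowPoint_mem_ball hp hs ((h.slope.admissible_sol hp).2 s hs)
  have hYc : ContinuousOn Y (Icc 0 1) := fun s hs => (hYd s hs).continuousWithinAt
  have hgc : ContinuousOn (fun s : ℝ => (Complex.exp (ξ + s * Δ), Y s, (ε : ℂ))) (Icc 0 1) := by
    fun_prop
  have hcc := h.slope.diff.continuousOn.comp hgc hball
  refine ⟨?_, fun s hs => ?_⟩
  · rw [contDiffOn_one_iff_derivWithin huniq]
    refine ⟨fun s hs => (hd s hs).differentiableWithinAt, ?_⟩
    refine ContinuousOn.congr ?_ fun s hs => (hd s hs).derivWithin (huniq s hs)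
    refine ContinuousOn.prodMk (by fun_prop) ?_
    exact ((hYc.mul hcc).mul continuousOn_const).neg
  · rw [(hd s hs).derivWithin (huniq s hs), h.fact.coeffX_eq _ _ _ (hball s hs),
      h.fact.coeffY_eq _ _ _ (hball s hs)]
    have := h.b_ne_zero (hball s hs)
    field_simp
    ring

/-- The first integral is constant along leaf paths. -/
theorem firstInt_eq_of_isLeafPath (h : IsChart f P Q a b R κ K r X) {γ : ℝ → ℂ × ℂ} {ε : ℝ}
    (hγ : IsLeafPath f P Q ε γ) {ξ : ℝ → ℂ} (hξ : DifferentiableOn ℝ ξ (Icc 0 1))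
    (hexp : ∀ s ∈ Icc (0 : ℝ) 1, Complex.exp (ξ s) = (γ s).1)
    (hmem : ∀ s ∈ Icc (0 : ℝ) 1, (ξ s, (γ s).2, (ε : ℂ)) ∈ intDomain X 40 r R)
    (hre : ∀ s ∈ Icc (0 : ℝ) 1, (ξ s).re < X) :
    h.slope.firstInt X (ξ 1, (γ 1).2, ε) = h.slope.firstInt X (ξ 0, (γ 0).2, ε) := by
  have huniq := uniqueDiffOn_Icc (zero_lt_one (α := ℝ))
  refine h.slope.firstInt_eq_of_leaf h.X_le (ξ' := derivWithin ξ (Icc 0 1))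
    (y := fun s => (γ s).2) hmem (fun s hs heq => ?_)
    (fun s hs => (hξ s hs).hasDerivWithinAt) fun s hs => ?_
  · have := hre s hs
    rw [heq, Complex.ofReal_re] at this
    exact lt_irrefl _ this
  · have hγd : HasDerivWithinAt γ (derivWithin γ (Icc 0 1) s) (Icc 0 1) s :=
      (hγ.contDiffOn.differentiableOn one_ne_zero s hs).hasDerivWithinAt
    have h1 : HasDerivWithinAt (fun s => (γ s).1) (derivWithin γ (Icc 0 1) s).1 (Icc 0 1) s :=
      (ContinuousLinearMap.fst ℝ ℂ ℂ).hasFDerivAt.comp_hasDerivWithinAt s hγd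
    have h2 : HasDerivWithinAt (fun s => (γ s).2) (derivWithin γ (Icc 0 1) s).2 (Icc 0 1) s :=
      (ContinuousLinearMap.snd ℝ ℂ ℂ).hasFDerivAt.comp_hasDerivWithinAt s hγd
    have h3 : HasDerivWithinAt (fun s => (γ s).1)
        (Complex.exp (ξ s) * derivWithin ξ (Icc 0 1) s) (Icc 0 1) s :=
      ((hξ s hs).hasDerivWithinAt.cexp).congr (fun t ht => (hexp t ht).symm) (hexp s hs).symm
    have h4 := (huniq s hs).eq_deriv _ h1 h3
    have hball : ((γ s).1, (γ s).2, (ε : ℂ)) ∈ Metric.ball (0 : ℂ × ℂ × ℂ) R := by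
      rw [mem_ball_prod_iff, ← hexp s hs]
      exact ⟨h.exp_lt_R (hmem s hs).1, (hmem s hs).2.2.1.trans h.r_lt_R, (hmem s hs).2.2.2⟩
    have h5 := hγ.tangent s hs
    rw [← Prod.mk.eta (p := γ s), h.fact.coeffX_eq _ _ _ hball, h.fact.coeffY_eq _ _ _ hball,
      h4] at h5
    refine h2.congr_deriv ?_
    rw [hexp s hs]
    rw [hexp s hs] at h5
    have hb := h.b_ne_zero hball
    have hx : (γ s).1 ≠ 0 := by
      rw [← hexp s hs]
      exact Complex.exp_ne_zero _
    -- Tangency with `dx = x dξ` substituted; cancelling `x = exp ξ ≠ 0` leaves the equation in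
    -- logarithmic time.
    have h6 : (γ s).1 * (b ((γ s).1, (γ s).2, (ε : ℂ)) * (derivWithin γ (Icc 0 1) s).2 +
        (γ s).2 * a ((γ s).1, (γ s).2, (ε : ℂ)) * derivWithin ξ (Icc 0 1) s) = 0 := by
      linear_combination h5
    have h7 := (mul_eq_zero.1 h6).resolve_left hx
    field_simp
    linear_combination h7

/-- For `ε = 0` the function `f` is constant along the leaves. -/
theorem apply_firstInt (h : IsChart f P Q a b R κ K r X) {ξ y : ℂ}
    (hq : (ξ, y, (0 : ℂ)) ∈ intDomain X 40 r R) :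
    f (Complex.exp X, h.slope.firstInt X (ξ, y, 0)) = f (Complex.exp ξ, y) := by
  have hp := toSection_mem h.X_le hq
  have hleaf := h.isLeafPath_flow (ξ := ξ) (Δ := X - ξ) (y := y) (ε := 0)
    (by simpa [toSection] using hp)
  rw [Complex.ofReal_zero] at hleaf
  set γ : ℝ → ℂ × ℂ := fun s => (Complex.exp (ξ + s * (X - ξ)),
    h.slope.flowY (ξ, X - ξ, y, 0) s) with hγ
  have hball : ∀ s ∈ Icc (0 : ℝ) 1,
      ((γ s).1, (γ s).2, (((0 : ℝ) : ℂ))) ∈ Metric.ball (0 : ℂ × ℂ × ℂ) R := fun s hs => by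
    rw [Complex.ofReal_zero]
    exact h.slope.flowPoint_mem_ball hp hs ((h.slope.admissible_sol hp).2 s hs)
  have huniq := uniqueDiffOn_Icc (zero_lt_one (α := ℝ))
  have hder : ∀ s ∈ Icc (0 : ℝ) 1, HasDerivWithinAt (fun s => f (γ s)) 0 (Icc 0 1) s := by
    intro s hs
    have hγd : HasDerivWithinAt γ (derivWithin γ (Icc 0 1) s) (Icc 0 1) s :=
      (hleaf.contDiffOn.differentiableOn one_ne_zero s hs).hasDerivWithinAt
    have hb := mem_ball_prod_iff.1 (hball s hs)
    have hfa : AnalyticAt ℂ f (γ s) := h.fact.f_analytic _ (by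
      rw [mem_ball_zero_iff, Prod.norm_def, max_lt_iff]
      exact ⟨hb.1, hb.2.1⟩)
    have h1 := (hfa.differentiableAt.hasFDerivAt.restrictScalars ℝ).comp_hasDerivWithinAt s hγd
    refine h1.congr_deriv ?_
    have h2 := hleaf.tangent s hs
    simp only [coeffX, coeffY, Complex.ofReal_zero, zero_mul, add_zero] at h2
    rw [← h2]
    set w := derivWithin γ (Icc 0 1) s
    have hw : w = w.1 • ((1 : ℂ), (0 : ℂ)) + w.2 • ((0 : ℂ), (1 : ℂ)) := by simp
    rw [ContinuousLinearMap.coe_restrictScalars', hw, map_add, map_smul, map_smul]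
    simp [dX, dY, mul_comm]
  have := constant_of_derivWithin_zero (f := fun s => f (γ s))
    (fun s hs => (hder s hs).differentiableWithinAt) (fun s hs => by
      have hs' := Ico_subset_Icc_self hs
      exact (hder s hs').derivWithin (huniq s hs')) 1 (right_mem_Icc.2 zero_le_one)
  have h0 : h.slope.flowY (ξ, X - ξ, y, 0) 0 = y := h.slope.flowY_zero hp
  have h1 : h.slope.flowY (ξ, X - ξ, y, 0) 1 = h.slope.firstInt X (ξ, y, 0) :=
    (h.slope.firstInt_eq_flowY (X := X) (ξ, y, 0)).symm
  simpa [hγ, h0, h1] using this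

end IsChart

end Saddle

/-! ### Logarithmic coordinates on the cross-sections -/

namespace Saddle

theorem eventually_eq_exp_log {g : ℂ → ℂ} (hg : AnalyticAt ℂ g 0)
    (hreal : ∀ᶠ z in 𝓝 (0 : ℂ), g (conj z) = conj (g z)) {t : ℝ} (ht : 0 < t) (h0 : g 0 = t) :
    ∃ A : ℂ → ℂ, AnalyticAt ℂ A 0 ∧ (∀ᶠ z in 𝓝 (0 : ℂ), A (conj z) = conj (A z)) ∧
      A 0 = Real.log t ∧ ∀ᶠ z in 𝓝 (0 : ℂ), g z = Complex.exp (A z) := by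
  have hs : g 0 ∈ Complex.slitPlane := by
    rw [h0]
    exact Complex.ofReal_mem_slitPlane.2 ht
  have hev : ∀ᶠ z in 𝓝 (0 : ℂ), g z ∈ Complex.slitPlane :=
    hg.continuousAt.eventually (Complex.isOpen_slitPlane.mem_nhds hs)
  refine ⟨fun z => Complex.log (g z), hg.clog hs, ?_, ?_, ?_⟩
  · filter_upwards [hev, hreal] with z h1 h2
    rw [h2, Complex.log_conj _ (Complex.slitPlane_arg_ne_pi h1)]
  · simp only [h0]
    exact (Complex.ofReal_log ht.le).symm
  · filter_upwards [hev] with z h1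
    exact (Complex.exp_log (Complex.slitPlane_ne_zero h1)).symm

/-- The quotient `g(z)/z` extends by the derivative `t > 0`, so it has a real analytic logarithm. -/
theorem eventually_eq_mul_exp_log {g : ℂ → ℂ} (hg : AnalyticAt ℂ g 0)
    (hreal : ∀ᶠ z in 𝓝 (0 : ℂ), g (conj z) = conj (g z)) {t : ℝ} (ht : 0 < t) (h0 : g 0 = 0)
    (hd : HasDerivAt g t 0) :
    ∃ A : ℂ → ℂ, AnalyticAt ℂ A 0 ∧ (∀ᶠ z in 𝓝 (0 : ℂ), A (conj z) = conj (A z)) ∧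
      ∀ᶠ z in 𝓝 (0 : ℂ), g z = z * Complex.exp (A z) := by
  have hds : AnalyticAt ℂ (dslope g 0) 0 := by
    obtain ⟨p, hp⟩ := hg
    exact hp.has_fpower_series_dslope_fslope.analyticAt
  have h1 : dslope g 0 0 = t := by rw [dslope_same, hd.deriv]
  have hne : ∀ z, z ≠ 0 → dslope g 0 z = g z / z := by
    intro z hz
    rw [dslope_of_ne _ hz, slope_def_field, h0, sub_zero, sub_zero]
  obtain ⟨A, hA, hAr, -, hAe⟩ := eventually_eq_exp_log hds (by
    filter_upwards [hreal] with z hz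
    rcases eq_or_ne z 0 with rfl | hz0
    · rw [map_zero, h1, Complex.conj_ofReal]
    · rw [hne z hz0, hne _ ((map_ne_zero _).2 hz0), hz, map_div₀]) ht h1
  refine ⟨A, hA, hAr, ?_⟩
  filter_upwards [hAe] with z hz
  rw [← hz]
  rcases eq_or_ne z 0 with rfl | hz0
  · rw [zero_mul, h0]
  · rw [hne z hz0, mul_div_cancel₀ _ hz0]

/-- `A` is holomorphic on the disc of radius `ρ`, commutes with complex conjugation, and varies by
less than `η`. -/
structure IsRealDisc (A : ℂ → ℂ) (ρ η : ℝ) : Prop where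
  diff : DifferentiableOn ℂ A (Metric.ball 0 ρ)
  real : ∀ z : ℂ, ‖z‖ < ρ → A (conj z) = conj (A z)
  osc : ∀ z : ℂ, ‖z‖ < ρ → ‖A z - A 0‖ < η

theorem exists_isRealDisc {A : ℂ → ℂ} (hA : AnalyticAt ℂ A 0)
    (hreal : ∀ᶠ z in 𝓝 (0 : ℂ), A (conj z) = conj (A z)) {η : ℝ} (hη : 0 < η) :
    ∃ ρ > 0, ∀ ρ' ≤ ρ, IsRealDisc A ρ' η := by
  have h1 : ∀ᶠ z in 𝓝 (0 : ℂ), ‖A z - A 0‖ < η :=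
    (hA.continuousAt.sub continuousAt_const).norm.eventually (gt_mem_nhds (by simpa using hη))
  obtain ⟨ρ, hρ, h⟩ := Metric.eventually_nhds_iff_ball.1
    ((hA.eventually_analyticAt.and hreal).and h1)
  refine ⟨ρ, hρ, fun ρ' hρ' => ⟨fun z hz => ?_, fun z hz => ?_, fun z hz => ?_⟩⟩
  · exact (h z (Metric.ball_subset_ball hρ' hz)).1.1.differentiableAt.differentiableWithinAt
  · exact (h z (by simpa using hz.trans_le hρ')).1.2
  · exact (h z (by simpa using hz.trans_le hρ')).2

/-- Logarithmic coordinates on the two cross-sections. -/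
structure IsLogSections (f : ℂ × ℂ → ℂ) (σ τ : ℂ → ℂ × ℂ) (x₀ y₀ : ℝ) (α υ ξ ω : ℂ → ℂ)
    (ρ η : ℝ) : Prop where
  ρ_pos : 0 < ρ
  α_disc : IsRealDisc α ρ η
  υ_disc : IsRealDisc υ ρ η
  ξ_disc : IsRealDisc ξ ρ η
  ω_disc : IsRealDisc ω ρ η
  υ_zero : υ 0 = Real.log y₀
  ξ_zero : ξ 0 = Real.log x₀
  σ_eq : ∀ z : ℂ, ‖z‖ < ρ → σ z = (z * Complex.exp (α z), Complex.exp (υ z))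
  τ_eq : ∀ w : ℂ, ‖w‖ < ρ → τ w = (Complex.exp (ξ w), w * Complex.exp (ω w))
  f_σ : ∀ z : ℂ, ‖z‖ < ρ → f (σ z) = z
  f_τ : ∀ w : ℂ, ‖w‖ < ρ → f (τ w) = w

variable {f : ℂ × ℂ → ℂ} {P Q a b : ℂ × ℂ × ℂ → ℂ} {R κ K r X x₀ y₀ : ℝ} {σ τ : ℂ → ℂ × ℂ}

/-- On the `y`-axis `f_y = 0` and `f_x = y₀ a` with `a` real and positive, so differentiating `f(σ
z) = z` gives the derivative `1/(y₀ a)`. -/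
theorem IsFactored.hasDerivAt_fst (h : IsFactored f P Q a b R) (hy : 0 < y₀) (hyR : y₀ < R)
    (hσ : IsCrossSection f (0, (y₀ : ℂ)) σ) :
    ∃ t : ℝ, 0 < t ∧ HasDerivAt (fun z => (σ z).1) t 0 := by
  have hb : ((0 : ℂ), (y₀ : ℂ), (((0 : ℝ) : ℂ))) ∈ Metric.ball (0 : ℂ × ℂ × ℂ) R := by
    rw [mem_ball_prod_iff]
    simpa [abs_of_pos hy] using ⟨h.R_pos, hyR, h.R_pos⟩
  have hX := h.coeffX_eq 0 0 y₀ hb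
  have hY := h.coeffY_eq 0 0 y₀ hb
  simp only [coeffX, coeffY, Complex.ofReal_zero, zero_mul, add_zero] at hX hY
  set A := a (0, y₀, 0) with hA
  have hAre := h.a_re _ hb
  have hAim := h.a_real _ hb
  simp only [map_zero, Complex.conj_ofReal, Complex.ofReal_zero, ← hA] at hAre hAim
  have hAeq : A = (A.re : ℂ) := (Complex.conj_eq_iff_re.1 hAim.symm).symm
  have hσd := hσ.analytic.differentiableAt.hasDerivAt
  have hfa : AnalyticAt ℂ f (σ 0) := h.f_analytic _ (by
    rw [hσ.base, mem_ball_zero_iff, Prod.norm_def]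
    simpa [abs_of_pos hy] using ⟨h.R_pos, hyR⟩)
  have h1 : HasDerivAt (fun z => f (σ z)) (fderiv ℂ f (σ 0) (deriv σ 0)) 0 :=
    hfa.differentiableAt.hasFDerivAt.comp_hasDerivAt 0 hσd
  have h2 : HasDerivAt (fun z => f (σ z)) 1 0 :=
    (hasDerivAt_id (0 : ℂ)).congr_of_eventuallyEq hσ.param
  have h3 := h1.unique h2
  set w := deriv σ 0
  have hw : w = w.1 • ((1 : ℂ), (0 : ℂ)) + w.2 • ((0 : ℂ), (1 : ℂ)) := by simp
  have h4 : w.1 * (y₀ * A) = 1 := by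
    rw [hw, map_add, map_smul, map_smul, hσ.base] at h3
    change w.1 • dX f (0, (y₀ : ℂ)) + w.2 • dY f (0, (y₀ : ℂ)) = 1 at h3
    rwa [hX, hY, smul_zero, add_zero, smul_eq_mul] at h3
  refine ⟨(y₀ * A.re)⁻¹, by positivity, ?_⟩
  have h5 : HasDerivAt (fun z => (σ z).1) w.1 0 :=
    (ContinuousLinearMap.fst ℂ ℂ ℂ).hasFDerivAt.comp_hasDerivAt 0 hσd
  refine h5.congr_deriv ?_
  push_cast
  rw [← hAeq]
  exact eq_inv_of_mul_eq_one_left h4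

theorem IsFactored.hasDerivAt_snd (h : IsFactored f P Q a b R) (hx : 0 < x₀) (hxR : x₀ < R)
    (hτ : IsCrossSection f ((x₀ : ℂ), 0) τ) :
    ∃ t : ℝ, 0 < t ∧ HasDerivAt (fun z => (τ z).2) t 0 := by
  have hb : ((x₀ : ℂ), (0 : ℂ), (((0 : ℝ) : ℂ))) ∈ Metric.ball (0 : ℂ × ℂ × ℂ) R := by
    rw [mem_ball_prod_iff]
    simpa [abs_of_pos hx] using ⟨hxR, h.R_pos⟩
  have hX := h.coeffX_eq 0 x₀ 0 hb
  have hY := h.coeffY_eq 0 x₀ 0 hb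
  simp only [coeffX, coeffY, Complex.ofReal_zero, zero_mul, add_zero] at hX hY
  set A := b (x₀, 0, 0) with hA
  have hAre := h.b_re _ hb
  have hAim := h.b_real _ hb
  simp only [map_zero, Complex.conj_ofReal, Complex.ofReal_zero, ← hA] at hAre hAim
  have hAeq : A = (A.re : ℂ) := (Complex.conj_eq_iff_re.1 hAim.symm).symm
  have hτd := hτ.analytic.differentiableAt.hasDerivAt
  have hfa : AnalyticAt ℂ f (τ 0) := h.f_analytic _ (by
    rw [hτ.base, mem_ball_zero_iff, Prod.norm_def]
    simpa [abs_of_pos hx] using ⟨hxR, h.R_pos⟩)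
  have h1 : HasDerivAt (fun z => f (τ z)) (fderiv ℂ f (τ 0) (deriv τ 0)) 0 :=
    hfa.differentiableAt.hasFDerivAt.comp_hasDerivAt 0 hτd
  have h2 : HasDerivAt (fun z => f (τ z)) 1 0 :=
    (hasDerivAt_id (0 : ℂ)).congr_of_eventuallyEq hτ.param
  have h3 := h1.unique h2
  set w := deriv τ 0
  have hw : w = w.1 • ((1 : ℂ), (0 : ℂ)) + w.2 • ((0 : ℂ), (1 : ℂ)) := by simp
  have h4 : w.2 * (x₀ * A) = 1 := by
    rw [hw, map_add, map_smul, map_smul, hτ.base] at h3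
    change w.1 • dX f ((x₀ : ℂ), 0) + w.2 • dY f ((x₀ : ℂ), 0) = 1 at h3
    rwa [hX, hY, smul_zero, zero_add, smul_eq_mul] at h3
  refine ⟨(x₀ * A.re)⁻¹, by positivity, ?_⟩
  have h5 : HasDerivAt (fun z => (τ z).2) w.2 0 :=
    (ContinuousLinearMap.snd ℂ ℂ ℂ).hasFDerivAt.comp_hasDerivAt 0 hτd
  refine h5.congr_deriv ?_
  push_cast
  rw [← hAeq]
  exact eq_inv_of_mul_eq_one_left h4

theorem IsFactored.exists_isLogSections (h : IsFactored f P Q a b R) (hx : 0 < x₀) (hxR : x₀ < R)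
    (hy : 0 < y₀) (hyR : y₀ < R) (hσ : IsCrossSection f (0, (y₀ : ℂ)) σ)
    (hτ : IsCrossSection f ((x₀ : ℂ), 0) τ) {η : ℝ} (hη : 0 < η) :
    ∃ α υ ξ ω ρ, IsLogSections f σ τ x₀ y₀ α υ ξ ω ρ η := by
  obtain ⟨t, ht, htd⟩ := h.hasDerivAt_fst hy hyR hσ
  obtain ⟨t', ht', htd'⟩ := h.hasDerivAt_snd hx hxR hτ
  have hσ1 : AnalyticAt ℂ (fun z => (σ z).1) 0 := analyticAt_fst.comp hσ.analytic
  have hσ2 : AnalyticAt ℂ (fun z => (σ z).2) 0 := analyticAt_snd.comp hσ.analytic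
  have hτ1 : AnalyticAt ℂ (fun z => (τ z).1) 0 := analyticAt_fst.comp hτ.analytic
  have hτ2 : AnalyticAt ℂ (fun z => (τ z).2) 0 := analyticAt_snd.comp hτ.analytic
  obtain ⟨α, hα, hαr, hαe⟩ := eventually_eq_mul_exp_log hσ1
    (hσ.real.mono fun z hz => by rw [hz]; rfl) ht (by simp [hσ.base]) htd
  obtain ⟨υ, hυ, hυr, hυ0, hυe⟩ := eventually_eq_exp_log hσ2
    (hσ.real.mono fun z hz => by rw [hz]; rfl) hy (by simp [hσ.base])
  obtain ⟨ξ, hξ, hξr, hξ0, hξe⟩ := eventually_eq_exp_log hτ1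
    (hτ.real.mono fun z hz => by rw [hz]; rfl) hx (by simp [hτ.base])
  obtain ⟨ω, hω, hωr, hωe⟩ := eventually_eq_mul_exp_log hτ2
    (hτ.real.mono fun z hz => by rw [hz]; rfl) ht' (by simp [hτ.base]) htd'
  obtain ⟨ρ₁, hρ₁, d₁⟩ := exists_isRealDisc hα hαr hη
  obtain ⟨ρ₂, hρ₂, d₂⟩ := exists_isRealDisc hυ hυr hη
  obtain ⟨ρ₃, hρ₃, d₃⟩ := exists_isRealDisc hξ hξr hη
  obtain ⟨ρ₄, hρ₄, d₄⟩ := exists_isRealDisc hω hωr hη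
  obtain ⟨ρ₅, hρ₅, d₅⟩ := Metric.eventually_nhds_iff_ball.1
    ((hαe.and hυe).and ((hξe.and hωe).and (hσ.param.and hτ.param)))
  have l₁ : min (min ρ₁ ρ₂) (min (min ρ₃ ρ₄) ρ₅) ≤ min ρ₁ ρ₂ := min_le_left _ _
  have l₂ : min (min ρ₁ ρ₂) (min (min ρ₃ ρ₄) ρ₅) ≤ min (min ρ₃ ρ₄) ρ₅ := min_le_right _ _
  have l₃ : min (min ρ₃ ρ₄) ρ₅ ≤ min ρ₃ ρ₄ := min_le_left _ _
  have hb : ∀ z : ℂ, ‖z‖ < min (min ρ₁ ρ₂) (min (min ρ₃ ρ₄) ρ₅) → z ∈ Metric.ball (0 : ℂ) ρ₅ :=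
    fun z hz => by simpa using hz.trans_le (l₂.trans (min_le_right _ _))
  refine ⟨α, υ, ξ, ω, min (min ρ₁ ρ₂) (min (min ρ₃ ρ₄) ρ₅), by positivity,
    d₁ _ (l₁.trans (min_le_left _ _)), d₂ _ (l₁.trans (min_le_right _ _)),
    d₃ _ (l₂.trans (l₃.trans (min_le_left _ _))), d₄ _ (l₂.trans (l₃.trans (min_le_right _ _))),
    hυ0, hξ0, fun z hz => ?_, fun z hz => ?_, fun z hz => (d₅ z (hb z hz)).2.2.1,
    fun z hz => (d₅ z (hb z hz)).2.2.2⟩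
  · exact Prod.ext (d₅ z (hb z hz)).1.1 (d₅ z (hb z hz)).1.2
  · exact Prod.ext (d₅ z (hb z hz)).2.1.1 (d₅ z (hb z hz)).2.1.2

end Saddle

/-! ### The first integral on the sections `σ` and `τ` -/

namespace Saddle

/-- A chart of the foliation together with logarithmic coordinates on two cross-sections that
lie well inside of its domain. -/
structure IsTransit (f : ℂ × ℂ → ℂ) (P Q a b : ℂ × ℂ × ℂ → ℂ) (R κ K r X : ℝ) (σ τ : ℂ → ℂ × ℂ)
    (x₀ y₀ : ℝ) (α υ ξ ω : ℂ → ℂ) (ρ A : ℝ) : Prop where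
  chart : IsChart f P Q a b R κ K r X
  sec : IsLogSections f σ τ x₀ y₀ α υ ξ ω ρ (1 / 200)
  A_pos : 0 < A
  A_le_exp : A ≤ Real.exp (X - 2)
  A_le_r : A ≤ r / 10
  ξ_re : ∀ w : ℂ, ‖w‖ < ρ → (ξ w).re < Real.log A
  υ_norm : ∀ z : ℂ, ‖z‖ < ρ → ‖Complex.exp (υ z)‖ < A
  τ_norm : ∀ w : ℂ, ‖w‖ < ρ → ‖w * Complex.exp (ω w)‖ < A

theorem IsRealDisc.mono {A : ℂ → ℂ} {ρ ρ' η η' : ℝ} (h : IsRealDisc A ρ η) (hρ : ρ' ≤ ρ)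
    (hη : η ≤ η') : IsRealDisc A ρ' η' :=
  ⟨h.diff.mono (Metric.ball_subset_ball hρ), fun z hz => h.real z (hz.trans_le hρ),
    fun z hz => (h.osc z (hz.trans_le hρ)).trans_le hη⟩

theorem IsLogSections.mono {f : ℂ × ℂ → ℂ} {σ τ : ℂ → ℂ × ℂ} {x₀ y₀ : ℝ} {α υ ξ ω : ℂ → ℂ}
    {ρ ρ' η η' : ℝ} (h : IsLogSections f σ τ x₀ y₀ α υ ξ ω ρ η) (hρ' : 0 < ρ') (hρ : ρ' ≤ ρ)
    (hη : η ≤ η') : IsLogSections f σ τ x₀ y₀ α υ ξ ω ρ' η' :=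
  ⟨hρ', h.α_disc.mono hρ hη, h.υ_disc.mono hρ hη, h.ξ_disc.mono hρ hη, h.ω_disc.mono hρ hη,
    h.υ_zero, h.ξ_zero, fun z hz => h.σ_eq z (hz.trans_le hρ), fun z hz => h.τ_eq z (hz.trans_le hρ),
    fun z hz => h.f_σ z (hz.trans_le hρ), fun z hz => h.f_τ z (hz.trans_le hρ)⟩

variable {f : ℂ × ℂ → ℂ} {P Q a b : ℂ × ℂ × ℂ → ℂ} {R κ K r X x₀ y₀ : ℝ} {σ τ : ℂ → ℂ × ℂ}
  {α υ ξ ω : ℂ → ℂ} {ρ A : ℝ}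

theorem IsChart.exists_isTransit (h : IsChart f P Q a b R κ K r X) (hA : 0 < A)
    (hA₁ : A ≤ Real.exp (X - 2)) (hA₂ : A ≤ r / 10) (hx : x₀ ∈ Ioo 0 A) (hy : y₀ ∈ Ioo 0 A)
    (hσ : IsCrossSection f (0, (y₀ : ℂ)) σ) (hτ : IsCrossSection f ((x₀ : ℂ), 0) τ) :
    ∃ α υ ξ ω ρ, IsTransit f P Q a b R κ K r X σ τ x₀ y₀ α υ ξ ω ρ A := by
  have hAR : A < R := by
    have := h.r_lt_R
    have := h.slope.r_pos
    linarith
  -- The tolerance also keeps `|x|` on `τ` and `|y|` on `σ` below `A`, given that the base points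
  -- are.
  have hη : 0 < min (1 / 200) (min (Real.log A - Real.log x₀) (Real.log A - Real.log y₀)) := by
    have h1 := Real.log_lt_log hx.1 hx.2
    have h2 := Real.log_lt_log hy.1 hy.2
    refine lt_min (by norm_num) (lt_min (by linarith) (by linarith))
  set η := min (1 / 200) (min (Real.log A - Real.log x₀) (Real.log A - Real.log y₀))
  obtain ⟨α, υ, ξ, ω, ρ, hs⟩ := h.fact.exists_isLogSections hx.1 (hx.2.trans hAR) hy.1
    (hy.2.trans hAR) hσ hτ hη
  have hη₁ : η ≤ 1 / 200 := min_le_left _ _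
  have hη₂ : η ≤ Real.log A - Real.log x₀ := (min_le_right _ _).trans (min_le_left _ _)
  have hη₃ : η ≤ Real.log A - Real.log y₀ := (min_le_right _ _).trans (min_le_right _ _)
  set ρ' := min ρ (A / Real.exp ((ω 0).re + 1))
  have hρ'1 : ρ' ≤ ρ := min_le_left _ _
  have hρ'2 : ρ' ≤ A / Real.exp ((ω 0).re + 1) := min_le_right _ _
  have hρ'0 : 0 < ρ' := lt_min hs.ρ_pos (by positivity)
  refine ⟨α, υ, ξ, ω, ρ', h, hs.mono hρ'0 hρ'1 hη₁, hA, hA₁, hA₂, ?_, ?_, ?_⟩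
  · intro w hw
    have h1 := (Complex.re_le_norm _).trans_lt (hs.ξ_disc.osc w (hw.trans_le hρ'1))
    rw [hs.ξ_zero, Complex.sub_re, Complex.ofReal_re] at h1
    linarith
  · intro z hz
    have h1 := (Complex.re_le_norm _).trans_lt (hs.υ_disc.osc z (hz.trans_le hρ'1))
    rw [hs.υ_zero, Complex.sub_re, Complex.ofReal_re] at h1
    rw [Complex.norm_exp, ← Real.lt_log_iff_exp_lt hA]
    linarith
  · intro w hw
    have h1 := (Complex.re_le_norm _).trans_lt (hs.ω_disc.osc w (hw.trans_le hρ'1))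
    rw [Complex.sub_re] at h1
    rw [norm_mul, Complex.norm_exp]
    have h2 : Real.exp (ω w).re ≤ Real.exp ((ω 0).re + 1) := Real.exp_le_exp.2 (by linarith)
    have h3 := hw.trans_le hρ'2
    rw [lt_div_iff₀ (Real.exp_pos _)] at h3
    exact (mul_le_mul_of_nonneg_left h2 (norm_nonneg _)).trans_lt h3

namespace IsTransit

/-- Logarithm of the ratio of the first integral to the parameter, on the section `τ`; the
summand `j` selects the branch of `log x`. -/
noncomputable def tauLog (T : IsTransit f P Q a b R κ K r X σ τ x₀ y₀ α υ ξ ω ρ A) (j : ℂ)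
    (p : ℂ × ℂ) : ℂ :=
  ω p.1 - (X - (ξ p.1 + j)) + T.chart.slope.dev X (ξ p.1 + j, p.1 * Complex.exp (ω p.1), p.2)

/-- Logarithm of the first integral on the section `σ`, as a function of `log z`. -/
noncomputable def sigmaLog (T : IsTransit f P Q a b R κ K r X σ τ x₀ y₀ α υ ξ ω ρ A)
    (p : ℂ × ℂ) : ℂ :=
  υ (Complex.exp p.1) - (X - (p.1 + α (Complex.exp p.1))) +
    T.chart.slope.dev X (p.1 + α (Complex.exp p.1), Complex.exp (υ (Complex.exp p.1)), p.2)

theorem firstInt_tau (T : IsTransit f P Q a b R κ K r X σ τ x₀ y₀ α υ ξ ω ρ A) (j w ε : ℂ) :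
    T.chart.slope.firstInt X (ξ w + j, w * Complex.exp (ω w), ε) =
      w * Complex.exp (T.tauLog j (w, ε)) := by
  rw [IsSlope.firstInt, tauLog, mul_assoc, ← Complex.exp_add]
  congr 2
  ring

theorem firstInt_sigma (T : IsTransit f P Q a b R κ K r X σ τ x₀ y₀ α υ ξ ω ρ A) (ζ ε : ℂ) :
    T.chart.slope.firstInt X (ζ + α (Complex.exp ζ), Complex.exp (υ (Complex.exp ζ)), ε) =
      Complex.exp (T.sigmaLog (ζ, ε)) := by
  rw [IsSlope.firstInt, sigmaLog, ← Complex.exp_add]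
  congr 1
  ring

theorem log_A_le (T : IsTransit f P Q a b R κ K r X σ τ x₀ y₀ α υ ξ ω ρ A) :
    Real.log A ≤ X - 2 := by
  rw [Real.log_le_iff_le_exp T.A_pos]
  exact T.A_le_exp

theorem abs_im_ξ_le (T : IsTransit f P Q a b R κ K r X σ τ x₀ y₀ α υ ξ ω ρ A) {w : ℂ}
    (hw : ‖w‖ < ρ) : |(ξ w).im| < 1 / 200 := by
  have h1 := (Complex.abs_im_le_norm _).trans_lt (T.sec.ξ_disc.osc w hw)
  rwa [T.sec.ξ_zero, Complex.sub_im, Complex.ofReal_im, sub_zero] at h1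

theorem tau_mem (T : IsTransit f P Q a b R κ K r X σ τ x₀ y₀ α υ ξ ω ρ A) {j w ε : ℂ}
    (hj : j.re = 0) (hj' : |j.im| < 39) (hw : ‖w‖ < ρ) (hε : ‖ε‖ < R) :
    (ξ w + j, w * Complex.exp (ω w), ε) ∈ intDomain X 40 r R := by
  have h1 := T.ξ_re w hw
  have h2 := T.log_A_le
  have h3 := T.abs_im_ξ_le hw
  have h4 := T.τ_norm w hw
  have h5 := T.A_le_r
  have h6 := T.chart.slope.r_pos
  refine ⟨by simp [hj]; linarith, ?_, by simp only; linarith, hε⟩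
  simp only [Complex.add_im]
  have := abs_add_le (ξ w).im j.im
  linarith

theorem differentiableAt_tauLog (T : IsTransit f P Q a b R κ K r X σ τ x₀ y₀ α υ ξ ω ρ A) {j w ε : ℂ}
    (hj : j.re = 0) (hj' : |j.im| < 39) (hw : ‖w‖ < ρ) (hε : ‖ε‖ < R) :
    DifferentiableAt ℂ (T.tauLog j) (w, ε) := by
  have hξ : DifferentiableAt ℂ (fun p : ℂ × ℂ => ξ p.1) (w, ε) :=
    (T.sec.ξ_disc.diff.differentiableAt (Metric.isOpen_ball.mem_nhds (by simpa using hw))).comp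
      (w, ε) differentiableAt_fst
  have hω : DifferentiableAt ℂ (fun p : ℂ × ℂ => ω p.1) (w, ε) :=
    (T.sec.ω_disc.diff.differentiableAt (Metric.isOpen_ball.mem_nhds (by simpa using hw))).comp
      (w, ε) differentiableAt_fst
  have hdev : DifferentiableAt ℂ (T.chart.slope.dev X) (ξ w + j, w * Complex.exp (ω w), ε) :=
    (T.chart.slope.differentiableOn_dev T.chart.X_le).differentiableAt
      ((isOpen_intDomain _ _ _ _).mem_nhds (T.tau_mem hj hj' hw hε))
  have hc : DifferentiableAt ℂ (fun p : ℂ × ℂ => T.chart.slope.dev X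
      (ξ p.1 + j, p.1 * Complex.exp (ω p.1), p.2)) (w, ε) :=
    DifferentiableAt.comp (g := T.chart.slope.dev X)
      (f := fun p : ℂ × ℂ => (ξ p.1 + j, p.1 * Complex.exp (ω p.1), p.2)) (w, ε) hdev
      ((hξ.add_const j).prodMk ((differentiableAt_fst.mul hω.cexp).prodMk differentiableAt_snd))
  exact (hω.sub ((hξ.add_const j).const_sub _)).add hc

theorem tauLog_conj (T : IsTransit f P Q a b R κ K r X σ τ x₀ y₀ α υ ξ ω ρ A) {w ε : ℂ}
    (hw : ‖w‖ < ρ) (hε : ‖ε‖ < R) : T.tauLog 0 (conj w, conj ε) = conj (T.tauLog 0 (w, ε)) := by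
  have h1 := T.chart.slope.dev_conj T.chart.X_le
    (T.tau_mem (j := 0) (by simp) (by simp) hw hε)
  simp only [tauLog, T.sec.ξ_disc.real w hw, T.sec.ω_disc.real w hw, add_zero, map_add, map_sub,
    Complex.conj_ofReal] at h1 ⊢
  rw [← h1, map_mul, ← Complex.exp_conj]

/-- Half-strips on which the first integral of the points of `σ` is controlled. -/
def IsDeep (_T : IsTransit f P Q a b R κ K r X σ τ x₀ y₀ α υ ξ ω ρ A) (N : ℝ) : Prop :=
  Real.exp (-N) ≤ ρ ∧ -N + ‖α 0‖ + 1 ≤ X - 2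

theorem norm_exp_lt (T : IsTransit f P Q a b R κ K r X σ τ x₀ y₀ α υ ξ ω ρ A) {N : ℝ}
    (hN : T.IsDeep N) {ζ : ℂ} (hζ : ζ.re < -N) : ‖Complex.exp ζ‖ < ρ := by
  rw [Complex.norm_exp]
  exact (Real.exp_lt_exp.2 hζ).trans_le hN.1

theorem norm_α_le (T : IsTransit f P Q a b R κ K r X σ τ x₀ y₀ α υ ξ ω ρ A) {z : ℂ}
    (hz : ‖z‖ < ρ) : ‖α z‖ ≤ ‖α 0‖ + 1 / 200 := by
  have h1 := (T.sec.α_disc.osc z hz).le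
  have h2 := norm_sub_norm_le (α z) (α 0)
  linarith

theorem im_α_zero (T : IsTransit f P Q a b R κ K r X σ τ x₀ y₀ α υ ξ ω ρ A) : (α 0).im = 0 := by
  have := T.sec.α_disc.real 0 (by simpa using T.sec.ρ_pos)
  rw [map_zero] at this
  exact Complex.conj_eq_iff_im.1 this.symm

theorem sigma_re_le (T : IsTransit f P Q a b R κ K r X σ τ x₀ y₀ α υ ξ ω ρ A) {N : ℝ}
    (hN : T.IsDeep N) {ζ : ℂ} (hζ : ζ.re < -N) : (ζ + α (Complex.exp ζ)).re ≤ X - 2 := by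
  have h1 := (Complex.re_le_norm _).trans (T.norm_α_le (T.norm_exp_lt hN hζ))
  have h2 := hN.2
  rw [Complex.add_re]
  linarith

theorem sigma_im_lt (T : IsTransit f P Q a b R κ K r X σ τ x₀ y₀ α υ ξ ω ρ A) {N : ℝ}
    (hN : T.IsDeep N) {ζ : ℂ} (hζ : ζ.re < -N) :
    |(ζ + α (Complex.exp ζ)).im| < |ζ.im| + 1 / 200 := by
  have h1 := (Complex.abs_im_le_norm _).trans_lt (T.sec.α_disc.osc _ (T.norm_exp_lt hN hζ))
  rw [Complex.sub_im, T.im_α_zero, sub_zero] at h1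
  rw [Complex.add_im]
  have := abs_add_le ζ.im (α (Complex.exp ζ)).im
  linarith

theorem sigma_mem (T : IsTransit f P Q a b R κ K r X σ τ x₀ y₀ α υ ξ ω ρ A) {N : ℝ}
    (hN : T.IsDeep N) {ζ ε : ℂ} (hζ : ζ.re < -N) (hζ' : |ζ.im| < 39) (hε : ‖ε‖ < R) :
    (ζ + α (Complex.exp ζ), Complex.exp (υ (Complex.exp ζ)), ε) ∈ intDomain X 40 r R := by
  have h1 := T.sigma_re_le hN hζ
  have h2 := T.sigma_im_lt hN hζ
  have h4 := T.υ_norm _ (T.norm_exp_lt hN hζ)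
  have h5 := T.A_le_r
  have h6 := T.chart.slope.r_pos
  exact ⟨by simp only; linarith, by simp only; linarith, by simp only; linarith, hε⟩

theorem differentiableAt_sigmaLog (T : IsTransit f P Q a b R κ K r X σ τ x₀ y₀ α υ ξ ω ρ A) {N : ℝ}
    (hN : T.IsDeep N) {ζ ε : ℂ} (hζ : ζ.re < -N) (hζ' : |ζ.im| < 39) (hε : ‖ε‖ < R) :
    DifferentiableAt ℂ T.sigmaLog (ζ, ε) := by
  have hz := T.norm_exp_lt hN hζ
  have hα : DifferentiableAt ℂ (fun p : ℂ × ℂ => α (Complex.exp p.1)) (ζ, ε) :=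
    DifferentiableAt.comp (g := α) (f := fun p : ℂ × ℂ => Complex.exp p.1) (ζ, ε)
      (T.sec.α_disc.diff.differentiableAt (Metric.isOpen_ball.mem_nhds (by simpa using hz)))
      (by fun_prop)
  have hυ : DifferentiableAt ℂ (fun p : ℂ × ℂ => υ (Complex.exp p.1)) (ζ, ε) :=
    DifferentiableAt.comp (g := υ) (f := fun p : ℂ × ℂ => Complex.exp p.1) (ζ, ε)
      (T.sec.υ_disc.diff.differentiableAt (Metric.isOpen_ball.mem_nhds (by simpa using hz)))
      (by fun_prop)
  have hdev : DifferentiableAt ℂ (T.chart.slope.dev X)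
      (ζ + α (Complex.exp ζ), Complex.exp (υ (Complex.exp ζ)), ε) :=
    (T.chart.slope.differentiableOn_dev T.chart.X_le).differentiableAt
      ((isOpen_intDomain _ _ _ _).mem_nhds (T.sigma_mem hN hζ hζ' hε))
  have hc : DifferentiableAt ℂ (fun p : ℂ × ℂ => T.chart.slope.dev X
      (p.1 + α (Complex.exp p.1), Complex.exp (υ (Complex.exp p.1)), p.2)) (ζ, ε) :=
    DifferentiableAt.comp (g := T.chart.slope.dev X)
      (f := fun p : ℂ × ℂ => (p.1 + α (Complex.exp p.1), Complex.exp (υ (Complex.exp p.1)), p.2))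
      (ζ, ε) hdev ((differentiableAt_fst.add hα).prodMk (hυ.cexp.prodMk differentiableAt_snd))
  exact (hυ.sub ((differentiableAt_fst.add hα).const_sub _)).add hc

theorem sigmaLog_conj (T : IsTransit f P Q a b R κ K r X σ τ x₀ y₀ α υ ξ ω ρ A) {N : ℝ}
    (hN : T.IsDeep N) {ζ ε : ℂ} (hζ : ζ.re < -N) (hζ' : |ζ.im| < 39) (hε : ‖ε‖ < R) :
    T.sigmaLog (conj ζ, conj ε) = conj (T.sigmaLog (ζ, ε)) := by
  have hz := T.norm_exp_lt hN hζ
  have h1 := T.chart.slope.dev_conj T.chart.X_le (T.sigma_mem hN hζ hζ' hε)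
  simp only [sigmaLog, Complex.exp_conj, T.sec.α_disc.real _ hz, T.sec.υ_disc.real _ hz, map_add,
    map_sub, Complex.conj_ofReal] at h1 ⊢
  rw [← h1, ← Complex.exp_conj]

/-- The difference of `sigmaLog` and the linear function `c(0, 0, ε) ζ` is nearly constant. -/
theorem norm_sigmaLog_sub_le (T : IsTransit f P Q a b R κ K r X σ τ x₀ y₀ α υ ξ ω ρ A) {N : ℝ}
    (hN : T.IsDeep N) {ζ ε : ℂ} (hζ : ζ.re < -N) (hζ' : |ζ.im| < 39) (hε : ‖ε‖ < R) :
    ‖T.sigmaLog (ζ, ε) - a (0, 0, ε) / b (0, 0, ε) * (ζ + α 0 - X) - υ 0‖ ≤ 4 / 250 := by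
  have hz := T.norm_exp_lt hN hζ
  have h1 := T.chart.slope.norm_dev_add_le T.chart.X_le (T.sigma_mem hN hζ hζ' hε)
    (by have := T.sigma_re_le hN hζ; simp only; linarith)
  have h2 := h1.trans T.chart.bound
  simp only at h2
  have h3 := (T.sec.α_disc.osc _ hz).le
  have h4 := (T.sec.υ_disc.osc _ hz).le
  have h5 := T.chart.near (0, 0, ε) (mem_ball_prod_iff.2
    ⟨by simpa using T.chart.slope.R_pos, by simpa using T.chart.slope.R_pos, hε⟩)
  set c := a (0, 0, ε) / b (0, 0, ε) with hc
  set dv := T.chart.slope.dev X (ζ + α (Complex.exp ζ), Complex.exp (υ (Complex.exp ζ)), ε)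
  -- The four summands are the error of the linear approximation, the oscillations of `υ` and `α`,
  -- and a product of two small terms: `3/200 + 1/200² ≤ 4/250`.
  have e1 : T.sigmaLog (ζ, ε) - c * (ζ + α 0 - X) - υ 0 =
      (dv + (c - 1) * (X - (ζ + α (Complex.exp ζ)))) + (υ (Complex.exp ζ) - υ 0) +
        (α (Complex.exp ζ) - α 0) + (c - 1) * (α (Complex.exp ζ) - α 0) := by
    simp only [sigmaLog]
    change _ + dv - _ - _ = _
    ring
  rw [e1]
  refine (norm_add₄_le).trans ?_
  have h6 : ‖(c - 1) * (α (Complex.exp ζ) - α 0)‖ ≤ 1 / 200 * (1 / 200) := by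
    rw [norm_mul]
    gcongr
  linarith

end IsTransit

end Saddle

/-! ### Construction of the holonomy from two branches of the first integral -/

namespace Saddle

theorem exists_lipschitz_fst {F : ℂ × ℂ → ℂ} (hF : AnalyticAt ℂ F 0) :
    ∃ C : ℝ, 0 ≤ C ∧ ∃ s > 0, ∀ w w' ε : ℂ, ‖w‖ < s → ‖w'‖ < s → ‖ε‖ < s →
      ‖F (w, ε) - F (w', ε)‖ ≤ C * ‖w - w'‖ := by
  obtain ⟨C, U, hU, hC⟩ := hF.hasStrictFDerivAt.exists_lipschitzOnWith
  obtain ⟨s, hs, hsub⟩ := Metric.mem_nhds_iff.1 hU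
  refine ⟨C, C.2, s, hs, fun w w' ε hw hw' hε => ?_⟩
  have h1 := hC.dist_le_mul (w, ε) (hsub (by simpa [Prod.norm_def] using ⟨hw, hε⟩)) (w', ε)
    (hsub (by simpa [Prod.norm_def] using ⟨hw', hε⟩))
  rwa [Prod.dist_eq, dist_self, max_eq_left dist_nonneg, dist_eq_norm, dist_eq_norm] at h1

/-- The equation gives `w - w' = w' (exp(g w' - g w) - 1)`, of norm at most `2Cs ‖w - w'‖`, and `2Cs
< 1`. -/
theorem eq_of_mul_exp_eq {g : ℂ → ℂ} {C s : ℝ} (hCs : C * s ≤ 1 / 100) {w w' : ℂ}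
    (hw : ‖w‖ < s) (hw' : ‖w'‖ < s) (hg : ‖g w - g w'‖ ≤ C * ‖w - w'‖)
    (heq : w * Complex.exp (g w) = w' * Complex.exp (g w')) : w = w' := by
  by_contra hne
  have hpos : 0 < ‖w - w'‖ := norm_pos_iff.2 (sub_ne_zero.2 hne)
  have hC : 0 ≤ C := by
    have := (norm_nonneg _).trans hg
    by_contra! h1
    nlinarith
  have h1 : ‖w - w'‖ ≤ 2 * s := (norm_sub_le _ _).trans (by linarith)
  have h2 : ‖g w' - g w‖ ≤ 1 := by
    rw [norm_sub_rev]
    refine hg.trans ?_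
    nlinarith
  have h3 : w - w' = w' * (Complex.exp (g w' - g w) - 1) := by
    rw [Complex.exp_sub]
    have := Complex.exp_ne_zero (g w)
    field_simp
    linear_combination heq
  have h4 : ‖w - w'‖ ≤ s * (2 * (C * ‖w - w'‖)) := by
    conv_lhs => rw [h3, norm_mul]
    have h5 := Complex.norm_exp_sub_one_le h2
    rw [norm_sub_rev] at hg
    have h6 : ‖Complex.exp (g w' - g w) - 1‖ ≤ 2 * (C * ‖w - w'‖) := by linarith
    have hs : 0 ≤ s := (norm_nonneg _).trans hw.le
    gcongr
  nlinarith

variable {f : ℂ × ℂ → ℂ} {P Q a b : ℂ × ℂ × ℂ → ℂ} {R κ K r X x₀ y₀ : ℝ} {σ τ : ℂ → ℂ × ℂ}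
  {α υ ξ ω : ℂ → ℂ} {ρ A : ℝ}

namespace IsTransit

/-- A scale on which the functions `tauLog` are Lipschitz with small oscillation. -/
structure IsScale (T : IsTransit f P Q a b R κ K r X σ τ x₀ y₀ α υ ξ ω ρ A) (C M s : ℝ) : Prop where
  s_pos : 0 < s
  s_le_ρ : s ≤ ρ
  s_le_R : s ≤ R
  C_nonneg : 0 ≤ C
  C_mul_le : C * s ≤ 1 / 100
  lip : ∀ w w' ε : ℂ, ‖w‖ < s → ‖w'‖ < s → ‖ε‖ < s →
    ‖T.tauLog 0 (w, ε) - T.tauLog 0 (w', ε)‖ ≤ C * ‖w - w'‖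
  lip' : ∀ w w' ε : ℂ, ‖w‖ < s → ‖w'‖ < s → ‖ε‖ < s →
    ‖T.tauLog (2 * Real.pi * Complex.I) (w, ε) - T.tauLog (2 * Real.pi * Complex.I) (w', ε)‖ ≤
      C * ‖w - w'‖
  bound : ∀ ε : ℂ, ‖ε‖ < s → ‖T.tauLog 0 (0, ε)‖ ≤ M
  bound' : ∀ w ε : ℂ, ‖w‖ < s → ‖ε‖ < s →
    ‖T.tauLog 0 (w, ε) - T.tauLog (2 * Real.pi * Complex.I) (0, ε)‖ ≤ M

theorem abs_im_two_pi_I_lt : |(2 * Real.pi * Complex.I : ℂ).im| < 39 := by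
  have := Real.pi_lt_d2
  have := Real.pi_pos
  simp [abs_of_pos Real.pi_pos]
  linarith

theorem re_two_pi_I : (2 * Real.pi * Complex.I : ℂ).re = 0 := by simp

theorem analyticAt_tauLog (T : IsTransit f P Q a b R κ K r X σ τ x₀ y₀ α υ ξ ω ρ A) {j : ℂ}
    (hj : j.re = 0) (hj' : |j.im| < 39) : AnalyticAt ℂ (T.tauLog j) 0 := by
  refine analyticAt_zero_of_differentiableOn
    (U := Metric.ball (0 : ℂ × ℂ) (min ρ R))
    (Metric.ball_mem_nhds _ (lt_min T.sec.ρ_pos T.chart.slope.R_pos)) fun p hp => ?_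
  rw [mem_ball_zero_iff, Prod.norm_def, max_lt_iff] at hp
  exact (T.differentiableAt_tauLog hj hj' (hp.1.trans_le (min_le_left _ _))
    (hp.2.trans_le (min_le_right _ _))).differentiableWithinAt

theorem exists_isScale (T : IsTransit f P Q a b R κ K r X σ τ x₀ y₀ α υ ξ ω ρ A) :
    ∃ C M s, T.IsScale C M s := by
  have a0 := T.analyticAt_tauLog (j := 0) (by simp) (by simp)
  have a1 := T.analyticAt_tauLog re_two_pi_I abs_im_two_pi_I_lt
  obtain ⟨C₀, hC₀, s₀, hs₀, h₀⟩ := exists_lipschitz_fst a0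
  obtain ⟨C₁, hC₁, s₁, hs₁, h₁⟩ := exists_lipschitz_fst a1
  have hproj : Tendsto (fun p : ℂ × ℂ => ((0 : ℂ), p.2)) (𝓝 0) (𝓝 0) :=
    Continuous.tendsto' (by fun_prop) _ _ (by simp)
  have c0 : Tendsto (fun p : ℂ × ℂ => ‖T.tauLog 0 (0, p.2)‖) (𝓝 0) (𝓝 ‖T.tauLog 0 0‖) :=
    (a0.continuousAt.tendsto.comp hproj).norm
  have c1 : Tendsto (fun p : ℂ × ℂ => ‖T.tauLog 0 p - T.tauLog (2 * Real.pi * Complex.I) (0, p.2)‖)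
      (𝓝 0) (𝓝 ‖T.tauLog 0 0 - T.tauLog (2 * Real.pi * Complex.I) 0‖) :=
    (a0.continuousAt.tendsto.sub (a1.continuousAt.tendsto.comp hproj)).norm
  set M := max (‖T.tauLog 0 0‖ + 1) (‖T.tauLog 0 0 - T.tauLog (2 * Real.pi * Complex.I) 0‖ + 1)
  obtain ⟨s₂, hs₂, h₂⟩ := Metric.eventually_nhds_iff_ball.1
    ((c0.eventually (gt_mem_nhds (lt_add_one _))).and
      (c1.eventually (gt_mem_nhds (lt_add_one _))))
  set C := max C₀ C₁
  have hC : 0 ≤ C := hC₀.trans (le_max_left _ _)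
  set s := min (min (min s₀ s₁) (min s₂ (1 / 100 / (C + 1)))) (min ρ R)
  have hs : 0 < s := by
    have := T.sec.ρ_pos
    have := T.chart.slope.R_pos
    positivity
  have l1 : s ≤ min (min s₀ s₁) (min s₂ (1 / 100 / (C + 1))) := min_le_left _ _
  have l2 : s ≤ min s₀ s₁ := l1.trans (min_le_left _ _)
  have l3 : s ≤ min s₂ (1 / 100 / (C + 1)) := l1.trans (min_le_right _ _)
  have l4 : s ≤ s₀ := l2.trans (min_le_left _ _)
  have l5 : s ≤ s₁ := l2.trans (min_le_right _ _)
  have l6 : s ≤ s₂ := l3.trans (min_le_left _ _)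
  have l7 : s ≤ 1 / 100 / (C + 1) := l3.trans (min_le_right _ _)
  refine ⟨C, M, s, hs, (min_le_right _ _).trans (min_le_left _ _),
    (min_le_right _ _).trans (min_le_right _ _), hC, ?_, ?_, ?_, ?_, ?_⟩
  · rw [le_div_iff₀ (by positivity)] at l7
    nlinarith
  · intro w w' ε hw hw' hε
    refine (h₀ w w' ε (hw.trans_le l4) (hw'.trans_le l4) (hε.trans_le l4)).trans ?_
    gcongr
    exact le_max_left _ _
  · intro w w' ε hw hw' hε
    refine (h₁ w w' ε (hw.trans_le l5) (hw'.trans_le l5) (hε.trans_le l5)).trans ?_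
    gcongr
    exact le_max_right _ _
  · intro ε hε
    have := (h₂ (0, ε) (by simpa [Prod.norm_def, hs₂] using hε.trans_le l6)).1
    exact this.le.trans (le_max_left _ _)
  · intro w ε hw hε
    have := (h₂ (w, ε) (by simpa [Prod.norm_def] using ⟨hw.trans_le l6, hε.trans_le l6⟩)).2
    exact this.le.trans (le_max_right _ _)

theorem IsScale.injective {T : IsTransit f P Q a b R κ K r X σ τ x₀ y₀ α υ ξ ω ρ A} {C M s : ℝ}
    (hs : T.IsScale C M s) {w w' ε : ℂ} (hw : ‖w‖ < s) (hw' : ‖w'‖ < s) (hε : ‖ε‖ < s)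
    (heq : w * Complex.exp (T.tauLog 0 (w, ε)) = w' * Complex.exp (T.tauLog 0 (w', ε))) : w = w' :=
  eq_of_mul_exp_eq (g := fun w => T.tauLog 0 (w, ε)) hs.C_mul_le hw hw' (hs.lip w w' ε hw hw' hε) heq

theorem IsScale.injective' {T : IsTransit f P Q a b R κ K r X σ τ x₀ y₀ α υ ξ ω ρ A} {C M s : ℝ}
    (hs : T.IsScale C M s) {w w' ε : ℂ} (hw : ‖w‖ < s) (hw' : ‖w'‖ < s) (hε : ‖ε‖ < s)
    (heq : w * Complex.exp (T.tauLog (2 * Real.pi * Complex.I) (w, ε)) =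
      w' * Complex.exp (T.tauLog (2 * Real.pi * Complex.I) (w', ε))) : w = w' :=
  eq_of_mul_exp_eq (g := fun w => T.tauLog (2 * Real.pi * Complex.I) (w, ε)) hs.C_mul_le hw hw'
    (hs.lip' w w' ε hw hw' hε) heq

/-- Construction of the holonomy. -/
theorem IsScale.exists_holonomy {T : IsTransit f P Q a b R κ K r X σ τ x₀ y₀ α υ ξ ω ρ A}
    {C M s : ℝ} (hs : T.IsScale C M s) :
    ∃ H : ℂ × ℂ → ℂ, AnalyticAt ℂ H 0 ∧ (∀ ε, H (0, ε) = 0) ∧ ∀ᶠ p in 𝓝 (0 : ℂ × ℂ), ‖H p‖ < s ∧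
      H p * Complex.exp (T.tauLog (2 * Real.pi * Complex.I) (H p, p.2)) =
        p.1 * Complex.exp (T.tauLog 0 p) := by
  have hspos := hs.s_pos
  -- The unknown `v` will have real part at most `M + 1`; the smaller disc keeps `w exp v` within
  -- the scale `s`.
  set s' := min s (s / Real.exp (M + 1)) with hs'
  have hs'0 : 0 < s' := by positivity
  have hs's : s' ≤ s := min_le_left _ _
  have hs'e : s' * Real.exp (M + 1) ≤ s := by
    rw [← le_div_iff₀ (Real.exp_pos _)]
    exact min_le_right _ _
  have hmem : ∀ p ∈ Metric.ball (0 : ℂ × ℂ) s', ‖p.1‖ < s' ∧ ‖p.2‖ < s' := by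
    intro p hp
    rwa [mem_ball_zero_iff, Prod.norm_def, max_lt_iff] at hp
  set m : ℂ × ℂ → ℂ := fun p => T.tauLog 0 p - T.tauLog (2 * Real.pi * Complex.I) (0, p.2) with hm
  have hre : ∀ p ∈ Metric.ball (0 : ℂ × ℂ) s', ∀ v : ℂ, ‖v - m p‖ ≤ 1 → v.re ≤ M + 1 := by
    intro p hp v hv
    have h1 := hs.bound' p.1 p.2 ((hmem p hp).1.trans_le hs's) ((hmem p hp).2.trans_le hs's)
    have h2 := (Complex.re_le_norm _).trans hv
    have h3 := (Complex.re_le_norm _).trans h1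
    rw [Complex.sub_re] at h2
    simp only [hm, Prod.mk.eta] at h2 h3
    linarith
  have hexp : ∀ p ∈ Metric.ball (0 : ℂ × ℂ) s', ∀ v : ℂ, ‖v - m p‖ ≤ 1 →
      ‖p.1 * Complex.exp v‖ < s := by
    intro p hp v hv
    rw [norm_mul, Complex.norm_exp]
    have h1 := (hmem p hp).1
    have h2 : Real.exp v.re ≤ Real.exp (M + 1) := Real.exp_le_exp.2 (hre p hp v hv)
    calc ‖p.1‖ * Real.exp v.re ≤ ‖p.1‖ * Real.exp (M + 1) := by gcongr
      _ < s' * Real.exp (M + 1) := by gcongr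
      _ ≤ s := hs'e
  have hd1 : ∀ w ε : ℂ, ‖w‖ < s → ‖ε‖ < s →
      DifferentiableAt ℂ (T.tauLog (2 * Real.pi * Complex.I)) (w, ε) := fun w ε hw hε =>
    T.differentiableAt_tauLog re_two_pi_I abs_im_two_pi_I_lt (hw.trans_le hs.s_le_ρ)
      (hε.trans_le hs.s_le_R)
  have hd0 : DifferentiableOn ℂ (T.tauLog 0) (Metric.ball 0 s') := fun p hp =>
    (T.differentiableAt_tauLog (by simp) (by simp)
      (((hmem p hp).1.trans_le hs's).trans_le hs.s_le_ρ)
      (((hmem p hp).2.trans_le hs's).trans_le hs.s_le_R)).differentiableWithinAt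
  -- The unknown is the logarithm of `H(w)/w`. Writing `H = w exp g` makes the equation regular at
  -- `w = 0` and gives `H(0, ε) = 0`.
  have hfix := exists_holomorphic_fixedPoint (U := Metric.ball (0 : ℂ × ℂ) s') Metric.isOpen_ball
    (T := fun p v => T.tauLog 0 p -
      T.tauLog (2 * Real.pi * Complex.I) (p.1 * Complex.exp v, p.2)) (m := m) ?_ ?_ ?_ ?_
  rotate_left
  · refine hd0.sub fun p hp => ?_
    exact (DifferentiableAt.comp (g := T.tauLog (2 * Real.pi * Complex.I))
      (f := fun p : ℂ × ℂ => ((0 : ℂ), p.2)) p (hd1 0 p.2 (by simpa using hspos)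
      ((hmem p hp).2.trans_le hs's)) (by fun_prop)).differentiableWithinAt
  · intro p hp v hv
    have h1 := hs.lip' 0 (p.1 * Complex.exp v) p.2 (by simpa using hspos) (hexp p hp v hv)
      ((hmem p hp).2.trans_le hs's)
    rw [zero_sub, norm_neg] at h1
    have h2 := hexp p hp v hv
    have h3 := hs.C_mul_le
    have h4 := hs.C_nonneg
    simp only [hm, sub_sub_sub_cancel_left]
    refine h1.trans ?_
    nlinarith
  · intro p hp v v' hv hv'
    have h1 := hs.lip' (p.1 * Complex.exp v') (p.1 * Complex.exp v) p.2 (hexp p hp v' hv')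
      (hexp p hp v hv) ((hmem p hp).2.trans_le hs's)
    rw [← mul_sub, norm_mul] at h1
    have h2 := norm_exp_sub_exp_le (hre p hp v' hv') (hre p hp v hv)
    rw [sub_sub_sub_cancel_left]
    refine h1.trans ?_
    have h3 : ‖p.1‖ * ‖Complex.exp v' - Complex.exp v‖ ≤ s * ‖v - v'‖ := by
      calc _ ≤ s' * (Real.exp (M + 1) * ‖v' - v‖) := by
            gcongr
            exact (hmem p hp).1.le
        _ = s' * Real.exp (M + 1) * ‖v - v'‖ := by rw [norm_sub_rev]; ring
        _ ≤ _ := by gcongr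
    have h4 := hs.C_nonneg
    calc _ ≤ C * (s * ‖v - v'‖) := by gcongr
      _ = C * s * ‖v - v'‖ := by ring
      _ ≤ 1 / 100 * ‖v - v'‖ := by
        gcongr
        exact hs.C_mul_le
      _ ≤ _ := by
        gcongr
        norm_num
  · intro g hg hgm
    refine hd0.sub fun p hp => ?_
    have hgp := hg.differentiableAt (Metric.isOpen_ball.mem_nhds hp)
    exact (DifferentiableAt.comp (g := T.tauLog (2 * Real.pi * Complex.I))
      (f := fun p : ℂ × ℂ => (p.1 * Complex.exp (g p), p.2)) p (hd1 _ p.2 (hexp p hp _ (hgm p hp))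
      ((hmem p hp).2.trans_le hs's)) ((differentiableAt_fst.mul hgp.cexp).prodMk
        differentiableAt_snd)).differentiableWithinAt
  obtain ⟨g, hg, hg'⟩ := hfix
  refine ⟨fun p => p.1 * Complex.exp (g p), ?_, by simp, ?_⟩
  · exact analyticAt_zero_of_differentiableOn (Metric.ball_mem_nhds _ hs'0)
      (differentiableOn_fst.mul hg.cexp)
  · filter_upwards [Metric.ball_mem_nhds (0 : ℂ × ℂ) hs'0] with p hp
    refine ⟨hexp p hp _ (hg' p hp).1, ?_⟩
    rw [mul_assoc, ← Complex.exp_add]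
    congr 2
    have := (hg' p hp).2
    linear_combination -this

end IsTransit

end Saddle

/-! ### Construction of the lift of the Dulac map -/

namespace Saddle

variable {f : ℂ × ℂ → ℂ} {P Q a b : ℂ × ℂ × ℂ → ℂ} {R κ K r X x₀ y₀ : ℝ} {σ τ : ℂ → ℂ × ℂ}
  {α υ ξ ω : ℂ → ℂ} {ρ A : ℝ}

namespace IsTransit

/-- Up to a bounded error, `sigmaLog` is `c(0, 0, ε) ζ` plus a constant depending on `ε`, with `|c -
1| ≤ 1/200`; on a strip of bounded height its real part tends to `-∞` with `Re ζ`, uniformly in `ε`.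
The factor `200/199` in `N` inverts the rate `1 - 1/200`. -/
theorem exists_re_sigmaLog_lt (T : IsTransit f P Q a b R κ K r X σ τ x₀ y₀ α υ ξ ω ρ A) (L : ℝ) :
    ∃ N, T.IsDeep N ∧ ∀ ζ ε : ℂ, ζ.re < -N → |ζ.im| < 39 → ‖ε‖ < R →
      (T.sigmaLog (ζ, ε)).re < L := by
  set N := max (-Real.log ρ) (max (‖α 0‖ + 3 - X)
    (‖α 0‖ - X + 200 / 199 * (‖υ 0‖ + |L| + 1)))
  have n1 : -Real.log ρ ≤ N := le_max_left _ _
  have n2 : ‖α 0‖ + 3 - X ≤ N := (le_max_left _ _).trans (le_max_right _ _)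
  have n3 : ‖α 0‖ - X + 200 / 199 * (‖υ 0‖ + |L| + 1) ≤ N :=
    (le_max_right _ _).trans (le_max_right _ _)
  have hN : T.IsDeep N := by
    refine ⟨?_, by linarith⟩
    rw [← Real.le_log_iff_exp_le T.sec.ρ_pos]
    linarith
  refine ⟨N, hN, fun ζ ε hζ hζ' hε => ?_⟩
  have h1 := (Complex.re_le_norm _).trans (T.norm_sigmaLog_sub_le hN hζ hζ' hε)
  have h5 := T.chart.near (0, 0, ε) (mem_ball_prod_iff.2
    ⟨by simpa using T.chart.slope.R_pos, by simpa using T.chart.slope.R_pos, hε⟩)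
  set c := a (0, 0, ε) / b (0, 0, ε) with hc
  set u := ζ + α 0 - X with hu
  have h2 : (c * u).re ≤ u.re + 1 / 200 * ‖u‖ := by
    have e1 : c * u = u + (c - 1) * u := by ring
    rw [e1, Complex.add_re]
    have := (Complex.re_le_norm ((c - 1) * u)).trans_eq (norm_mul _ _)
    have h6 : ‖c - 1‖ * ‖u‖ ≤ 1 / 200 * ‖u‖ := by gcongr
    linarith
  have h3 := Complex.norm_le_abs_re_add_abs_im u
  have h4 : u.im = ζ.im := by simp [hu, T.im_α_zero]
  have h6 : u.re ≤ ζ.re + ‖α 0‖ - X := by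
    simp only [hu, Complex.sub_re, Complex.add_re, Complex.ofReal_re]
    linarith [Complex.re_le_norm (α 0)]
  have h7 : u.re < 0 := by linarith
  rw [abs_of_neg h7, h4] at h3
  rw [Complex.sub_re, Complex.sub_re] at h1
  have h8 := Complex.re_le_norm (υ 0)
  have h9 := neg_abs_le L
  nlinarith

/-- On `Re v ≤ log s` the exponential is `s`-Lipschitz, so the map is a perturbation of the identity
with constant `C s ≤ 1/100`. -/
theorem IsScale.log_injective {T : IsTransit f P Q a b R κ K r X σ τ x₀ y₀ α υ ξ ω ρ A}
    {C M s : ℝ} (hs : T.IsScale C M s) {v v' ε : ℂ} (hv : ‖Complex.exp v‖ < s)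
    (hv' : ‖Complex.exp v'‖ < s) (hε : ‖ε‖ < s)
    (heq : v + T.tauLog 0 (Complex.exp v, ε) = v' + T.tauLog 0 (Complex.exp v', ε)) : v = v' := by
  have h1 := hs.lip _ _ ε hv' hv hε
  have e1 : v - v' = T.tauLog 0 (Complex.exp v', ε) - T.tauLog 0 (Complex.exp v, ε) := by
    linear_combination heq
  rw [← e1] at h1
  rw [Complex.norm_exp, ← Real.lt_log_iff_exp_lt hs.s_pos] at hv hv'
  have h2 := norm_exp_sub_exp_le hv'.le hv.le
  rw [Real.exp_log hs.s_pos, norm_sub_rev v' v] at h2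
  have h3 := mul_le_mul_of_nonneg_left h2 hs.C_nonneg
  have h4 := mul_le_mul_of_nonneg_right hs.C_mul_le (norm_nonneg (v - v'))
  have : ‖v - v'‖ ≤ 0 := by
    have := norm_nonneg (v - v')
    linarith
  exact sub_eq_zero.1 (norm_le_zero_iff.1 this)

/-- Construction of the logarithmic lift of the Dulac maps. -/
theorem IsScale.exists_lift {T : IsTransit f P Q a b R κ K r X σ τ x₀ y₀ α υ ξ ω ρ A}
    {C M s : ℝ} (hs : T.IsScale C M s) {s₁ : ℝ} (hs₁ : 0 < s₁) (hs₁s : s₁ ≤ s) :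
    ∃ (D : ℂ × ℂ → ℂ) (N : ℝ), T.IsDeep N ∧ DifferentiableOn ℂ D (liftStrip N 25 s₁) ∧
      ∀ p ∈ liftStrip N 25 s₁, ‖Complex.exp (D p)‖ < s₁ ∧
        D p + T.tauLog 0 (Complex.exp (D p), p.2) = T.sigmaLog p := by
  obtain ⟨N, hN, hre⟩ := T.exists_re_sigmaLog_lt (Real.log s₁ - M - 1)
  have hmem : ∀ p ∈ liftStrip N 25 s₁, p.1.re < -N ∧ |p.1.im| < 39 ∧ ‖p.2‖ < s := fun p hp =>
    ⟨hp.1, hp.2.1.trans (by norm_num), hp.2.2.trans_le hs₁s⟩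
  have hspos := hs.s_pos
  set m : ℂ × ℂ → ℂ := fun p => T.sigmaLog p - T.tauLog 0 (0, p.2) with hm
  have hvre : ∀ p ∈ liftStrip N 25 s₁, ∀ v : ℂ, ‖v - m p‖ ≤ 1 → v.re < Real.log s₁ := by
    intro p hp v hv
    obtain ⟨h1, h2, h3⟩ := hmem p hp
    have h4 := hre p.1 p.2 h1 h2 (h3.trans_le hs.s_le_R)
    have h5 := (Complex.re_le_norm _).trans hv
    have h6 := (Complex.abs_re_le_norm _).trans (hs.bound p.2 h3)
    simp only [hm, Complex.sub_re] at h5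
    have h7 := neg_abs_le (T.tauLog 0 (0, p.2)).re
    rw [Prod.mk.eta] at h4
    linarith
  have hexp : ∀ p ∈ liftStrip N 25 s₁, ∀ v : ℂ, ‖v - m p‖ ≤ 1 → ‖Complex.exp v‖ < s₁ := by
    intro p hp v hv
    rw [Complex.norm_exp, ← Real.lt_log_iff_exp_lt hs₁]
    exact hvre p hp v hv
  have hd0 : ∀ w ε : ℂ, ‖w‖ < s → ‖ε‖ < s → DifferentiableAt ℂ (T.tauLog 0) (w, ε) :=
    fun w ε hw hε => T.differentiableAt_tauLog (by simp) (by simp) (hw.trans_le hs.s_le_ρ)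
      (hε.trans_le hs.s_le_R)
  have hdσ : DifferentiableOn ℂ T.sigmaLog (liftStrip N 25 s₁) := fun p hp => by
    obtain ⟨h1, h2, h3⟩ := hmem p hp
    exact (T.differentiableAt_sigmaLog hN h1 h2 (h3.trans_le hs.s_le_R)).differentiableWithinAt
  -- Equality of the first integrals at `τ(exp v)` and `σ(exp ζ)`, in logarithms, solved for `v`.
  have hfix := exists_holomorphic_fixedPoint (isOpen_liftStrip N 25 s₁)
    (T := fun p v => T.sigmaLog p - T.tauLog 0 (Complex.exp v, p.2)) (m := m) ?_ ?_ ?_ ?_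
  rotate_left
  · refine hdσ.sub fun p hp => ?_
    exact (DifferentiableAt.comp (g := T.tauLog 0) (f := fun p : ℂ × ℂ => ((0 : ℂ), p.2)) p
      (hd0 0 p.2 (by simpa using hspos) (hmem p hp).2.2) (by fun_prop)).differentiableWithinAt
  · intro p hp v hv
    have h2 := (hexp p hp v hv).trans_le hs₁s
    have h1 := hs.lip 0 (Complex.exp v) p.2 (by simpa using hspos) h2 (hmem p hp).2.2
    rw [zero_sub, norm_neg] at h1
    have h3 := hs.C_mul_le
    have h4 := hs.C_nonneg
    simp only [hm, sub_sub_sub_cancel_left]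
    refine h1.trans ?_
    nlinarith
  · intro p hp v v' hv hv'
    have h1 := hs.lip (Complex.exp v') (Complex.exp v) p.2 ((hexp p hp v' hv').trans_le hs₁s)
      ((hexp p hp v hv).trans_le hs₁s) (hmem p hp).2.2
    have h2 := norm_exp_sub_exp_le (hvre p hp v' hv').le (hvre p hp v hv).le
    rw [Real.exp_log hs₁, norm_sub_rev v' v] at h2
    rw [sub_sub_sub_cancel_left]
    have h4 := hs.C_nonneg
    calc _ ≤ C * ‖Complex.exp v' - Complex.exp v‖ := h1
      _ ≤ C * (s₁ * ‖v - v'‖) := by gcongr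
      _ ≤ C * (s * ‖v - v'‖) := by gcongr
      _ = C * s * ‖v - v'‖ := by ring
      _ ≤ 1 / 100 * ‖v - v'‖ := by
        gcongr
        exact hs.C_mul_le
      _ ≤ _ := by
        gcongr
        norm_num
  · intro g hg hgm
    refine hdσ.sub fun p hp => ?_
    have hgp := hg.differentiableAt ((isOpen_liftStrip _ _ _).mem_nhds hp)
    exact (DifferentiableAt.comp (g := T.tauLog 0) (f := fun p : ℂ × ℂ => (Complex.exp (g p), p.2)) p
      (hd0 _ p.2 ((hexp p hp _ (hgm p hp)).trans_le hs₁s) (hmem p hp).2.2)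
      (hgp.cexp.prodMk differentiableAt_snd)).differentiableWithinAt
  obtain ⟨D, hD, hD'⟩ := hfix
  refine ⟨D, N, hN, hD, fun p hp => ⟨hexp p hp _ (hD' p hp).1, ?_⟩⟩
  have := (hD' p hp).2
  linear_combination -this

section Lift

variable {D : ℂ × ℂ → ℂ} {C M s s₁ N : ℝ}

theorem IsScale.lift_real {T : IsTransit f P Q a b R κ K r X σ τ x₀ y₀ α υ ξ ω ρ A}
    (hs : T.IsScale C M s) (hs₁s : s₁ ≤ s) (hN : T.IsDeep N)
    (hD : ∀ p ∈ liftStrip N 25 s₁, ‖Complex.exp (D p)‖ < s₁ ∧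
        D p + T.tauLog 0 (Complex.exp (D p), p.2) = T.sigmaLog p) {p : ℂ × ℂ}
    (hp : p ∈ liftStrip N 25 s₁) : D (conj p.1, conj p.2) = conj (D p) := by
  have hp' : (conj p.1, conj p.2) ∈ liftStrip N 25 s₁ :=
    ⟨by simpa using hp.1, by simpa using hp.2.1, by simpa using hp.2.2⟩
  obtain ⟨h1, h2⟩ := hD p hp
  obtain ⟨h3, h4⟩ := hD _ hp'
  have hε := hp.2.2.trans_le hs₁s
  refine hs.log_injective (ε := conj p.2) (h3.trans_le hs₁s) ?_ (by simpa using hε) ?_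
  · rw [Complex.exp_conj, Complex.norm_conj]
    exact h1.trans_le hs₁s
  · simp only at h4
    rw [h4, Complex.exp_conj, T.tauLog_conj ((h1.trans_le hs₁s).trans_le hs.s_le_ρ)
      (hε.trans_le hs.s_le_R), T.sigmaLog_conj hN hp.1 (hp.2.1.trans (by norm_num))
      (hε.trans_le hs.s_le_R), ← map_add, h2]

/-- The function `W = D - cζ` varies by at most `1/15`, so Cauchy's estimate on unit discs bounds
its derivative, and the mean value inequality applies on the convex half-strip. The term `(c - 1)(ζ
- ζ')` costs another `1/200`. Passing from `N, 25` to `N + 1, 20` makes room for the discs. -/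
theorem IsScale.lift_near_id {T : IsTransit f P Q a b R κ K r X σ τ x₀ y₀ α υ ξ ω ρ A}
    (hs : T.IsScale C M s) (hs₁s : s₁ ≤ s) (hN : T.IsDeep N)
    (hDd : DifferentiableOn ℂ D (liftStrip N 25 s₁))
    (hD : ∀ p ∈ liftStrip N 25 s₁, ‖Complex.exp (D p)‖ < s₁ ∧
        D p + T.tauLog 0 (Complex.exp (D p), p.2) = T.sigmaLog p) {ζ ζ' ε : ℂ}
    (hζ : (ζ, ε) ∈ liftStrip (N + 1) 20 s₁) (hζ' : (ζ', ε) ∈ liftStrip (N + 1) 20 s₁) :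
    ‖D (ζ, ε) - D (ζ', ε) - (ζ - ζ')‖ ≤ 1 / 10 * ‖ζ - ζ'‖ := by
  have hε : ‖ε‖ < s := hζ.2.2.trans_le hs₁s
  have h5 := T.chart.near (0, 0, ε) (mem_ball_prod_iff.2
    ⟨by simpa using T.chart.slope.R_pos, by simpa using T.chart.slope.R_pos,
      hε.trans_le hs.s_le_R⟩)
  set c := a (0, 0, ε) / b (0, 0, ε) with hc
  set W : ℂ → ℂ := fun ζ => D (ζ, ε) - c * ζ with hW
  set U : Set ℂ := {ζ : ℂ | ζ.re < -(N + 1) ∧ |ζ.im| < 20} with hU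
  have hconv : Convex ℝ U := by
    have h1 : U = {ζ : ℂ | ζ.re < -(N + 1)} ∩ ({ζ : ℂ | ζ.im < 20} ∩ {ζ : ℂ | -20 < ζ.im}) := by
      ext ζ
      simp only [hU, mem_ofPred_eq, mem_inter_iff, abs_lt]
      tauto
    rw [h1]
    exact (convex_halfSpace_re_lt _).inter
      ((convex_halfSpace_im_lt _).inter (convex_halfSpace_im_gt _))
  have hball : ∀ v ∈ U, ∀ w ∈ Metric.ball v 1, (w, ε) ∈ liftStrip N 25 s₁ := by
    intro v hv w hw
    rw [mem_ball_iff_norm] at hw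
    have h1 := (Complex.abs_re_le_norm _).trans_lt hw
    have h2 := (Complex.abs_im_le_norm _).trans_lt hw
    obtain ⟨h3, h4⟩ := hv
    rw [abs_lt] at h1 h2 h4
    simp only [Complex.sub_re, Complex.sub_im] at h1 h2
    exact ⟨by simp only; linarith, abs_lt.2 ⟨by simp only; linarith, by simp only; linarith⟩,
      hζ.2.2⟩
  have hWd : ∀ v, (v, ε) ∈ liftStrip N 25 s₁ → DifferentiableAt ℂ W v := by
    intro v hv
    have h1 := DifferentiableAt.comp (g := D) (f := fun v => (v, ε)) v
      (hDd.differentiableAt ((isOpen_liftStrip _ _ _).mem_nhds hv)) (by fun_prop)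
    exact h1.sub (by fun_prop)
  have hosc : ∀ v w, (v, ε) ∈ liftStrip N 25 s₁ → (w, ε) ∈ liftStrip N 25 s₁ →
      ‖W w - W v‖ ≤ 1 / 15 := by
    intro v w hv hw
    obtain ⟨d1, d2⟩ := hD _ hv
    obtain ⟨d3, d4⟩ := hD _ hw
    simp only at d2 d4
    have e1 := T.norm_sigmaLog_sub_le hN hv.1 (hv.2.1.trans (by norm_num)) (hε.trans_le hs.s_le_R)
    have e2 := T.norm_sigmaLog_sub_le hN hw.1 (hw.2.1.trans (by norm_num)) (hε.trans_le hs.s_le_R)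
    have e3 := hs.lip _ _ ε (d1.trans_le hs₁s) (d3.trans_le hs₁s) hε
    have e4 : ‖Complex.exp (D (v, ε)) - Complex.exp (D (w, ε))‖ ≤ 2 * s :=
      (norm_sub_le _ _).trans (by linarith)
    have e5 : W w - W v =
        (T.sigmaLog (w, ε) - c * (w + α 0 - X) - υ 0) -
        (T.sigmaLog (v, ε) - c * (v + α 0 - X) - υ 0) +
        (T.tauLog 0 (Complex.exp (D (v, ε)), ε) - T.tauLog 0 (Complex.exp (D (w, ε)), ε)) := by
      rw [← d2, ← d4]
      simp only [hW]
      ring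
    have e6 := hs.C_mul_le
    have e7 := mul_le_mul_of_nonneg_left e4 hs.C_nonneg
    rw [e5]
    refine (norm_add_le _ _).trans ?_
    have e8 := norm_sub_le (T.sigmaLog (w, ε) - c * (w + α 0 - X) - υ 0)
      (T.sigmaLog (v, ε) - c * (v + α 0 - X) - υ 0)
    linarith
  have hder : ∀ v ∈ U, ‖deriv W v‖ ≤ 1 / 15 := by
    intro v hv
    have hvv := hball v hv v (Metric.mem_ball_self one_pos)
    have := Complex.norm_deriv_le_div_of_mapsTo_ball (f := W) (c := v) (R₁ := 1) (R₂ := 1 / 15)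
      (fun w hw => (hWd w (hball v hv w hw)).differentiableWithinAt)
      (fun w hw => by
        rw [mem_closedBall_iff_norm]
        exact hosc v w hvv (hball v hv w hw)) one_pos
    simpa using this
  have hmv := hconv.norm_image_sub_le_of_norm_deriv_le (f := W)
    (fun v hv => hWd v (hball v hv v (Metric.mem_ball_self one_pos))) hder
    (x := ζ') (y := ζ) ⟨hζ'.1, hζ'.2.1⟩ ⟨hζ.1, hζ.2.1⟩
  have e1 : D (ζ, ε) - D (ζ', ε) - (ζ - ζ') = (W ζ - W ζ') + (c - 1) * (ζ - ζ') := by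
    simp only [hW]
    ring
  rw [e1]
  refine (norm_add_le _ _).trans ?_
  rw [norm_mul]
  have e2 := mul_le_mul_of_nonneg_right h5 (norm_nonneg (ζ - ζ'))
  have := norm_nonneg (ζ - ζ')
  linarith

end Lift

end IsTransit

end Saddle

/-! ### The lift and the holonomy satisfy the axioms -/

namespace Saddle

variable {f : ℂ × ℂ → ℂ} {P Q a b : ℂ × ℂ × ℂ → ℂ} {R κ K r X x₀ y₀ : ℝ} {σ τ : ℂ → ℂ × ℂ}
  {α υ ξ ω : ℂ → ℂ} {ρ A : ℝ}

namespace IsTransit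

theorem five_mul_lt (T : IsTransit f P Q a b R κ K r X σ τ x₀ y₀ α υ ξ ω ρ A) {t : ℝ} (ht : t < A) :
    5 * t < r := by
  have := T.A_le_r
  have := T.A_pos
  linarith

theorem f_firstInt_tau (T : IsTransit f P Q a b R κ K r X σ τ x₀ y₀ α υ ξ ω ρ A) {w : ℂ}
    (hw : ‖w‖ < ρ) : f (Complex.exp X, w * Complex.exp (T.tauLog 0 (w, 0))) = w := by
  rw [← T.firstInt_tau, T.chart.apply_firstInt
    (T.tau_mem (by simp) (by simp) hw (by simpa using T.chart.slope.R_pos)), add_zero,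
    ← T.sec.τ_eq w hw, T.sec.f_τ w hw]

theorem f_firstInt_sigma (T : IsTransit f P Q a b R κ K r X σ τ x₀ y₀ α υ ξ ω ρ A) {N : ℝ}
    (hN : T.IsDeep N) {ζ : ℂ} (hζ : ζ.re < -N) (hζ' : |ζ.im| < 39) :
    f (Complex.exp X, Complex.exp (T.sigmaLog (ζ, 0))) = Complex.exp ζ := by
  have hz := T.norm_exp_lt hN hζ
  rw [← T.firstInt_sigma, T.chart.apply_firstInt
    (T.sigma_mem hN hζ hζ' (by simpa using T.chart.slope.R_pos)), Complex.exp_add,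
    ← T.sec.σ_eq _ hz, T.sec.f_σ _ hz]

/-- Changing the branch of `log x` on `τ` acts on the first integral by the holonomy of the
section `log x = X`. -/
theorem firstInt_translate_tau (T : IsTransit f P Q a b R κ K r X σ τ x₀ y₀ α υ ξ ω ρ A) {w ε : ℂ}
    (hw : ‖w‖ < ρ) (hε : ‖ε‖ < R) :
    w * Complex.exp (T.tauLog (2 * Real.pi * Complex.I) (w, ε)) =
      T.chart.slope.firstInt X
        (X + 2 * Real.pi * Complex.I, w * Complex.exp (T.tauLog 0 (w, ε)), ε) := by
  have h1 := T.tau_mem (j := 0) (by simp) (by simp) hw hε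
  have h2 := T.tau_mem re_two_pi_I abs_im_two_pi_I_lt hw hε
  have h3 := T.ξ_re w hw
  have h4 := T.log_A_le
  have h5 := Real.pi_lt_d2
  have h6 := T.chart.slope.firstInt_translate T.chart.X_le h1 (by simp; linarith)
    (T.five_mul_lt (T.τ_norm w hw)) (by linarith) (by simpa using h2.2.1)
  simp only [add_zero] at h6
  rw [← T.firstInt_tau, h6, ← T.firstInt_tau, add_zero]

/-- A shift of `ζ` by `2πi` fixes the point `σ(exp ζ)` but changes its `log x` by `2πi`, so the
first integral changes by the self-map of the section. -/
theorem firstInt_translate_sigma (T : IsTransit f P Q a b R κ K r X σ τ x₀ y₀ α υ ξ ω ρ A) {N : ℝ}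
    (hN : T.IsDeep N) {ζ ε : ℂ} (hζ : ζ.re < -N) (hζ' : |ζ.im| < 39)
    (hζ'' : |(ζ - 2 * Real.pi * Complex.I).im| < 39) (hε : ‖ε‖ < R) :
    Complex.exp (T.sigmaLog (ζ, ε)) =
      T.chart.slope.firstInt X (X + 2 * Real.pi * Complex.I,
        Complex.exp (T.sigmaLog (ζ - 2 * Real.pi * Complex.I, ε)), ε) := by
  have hre : (ζ - 2 * Real.pi * Complex.I).re < -N := by simpa using hζ
  have h1 := T.sigma_mem hN hre hζ'' hε
  have h2 := T.sigma_mem hN hζ hζ' hε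
  have h3 := T.sigma_re_le hN hre
  have h4 := T.υ_norm _ (T.norm_exp_lt hN hre)
  have h5 := Real.pi_lt_d2
  have hper : Complex.exp (ζ - 2 * Real.pi * Complex.I) = Complex.exp ζ := by
    rw [Complex.exp_sub, Complex.exp_two_pi_mul_I, div_one]
  have h6 := T.chart.slope.firstInt_translate T.chart.X_le h1 (by simp only; linarith)
    (T.five_mul_lt h4) (by linarith) (by
      have := h2.2.1
      simp only [hper, Complex.add_im, Complex.sub_im] at this ⊢
      convert this using 2
      simp
      ring)
  rw [← T.firstInt_sigma, ← T.firstInt_sigma, ← h6]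
  simp only [hper]
  congr 2
  ring

section Lift

variable {D H : ℂ × ℂ → ℂ} {C M s s₁ N : ℝ}

theorem exp_lift {T : IsTransit f P Q a b R κ K r X σ τ x₀ y₀ α υ ξ ω ρ A}
    (hD : ∀ p ∈ liftStrip N 25 s₁, ‖Complex.exp (D p)‖ < s₁ ∧
        D p + T.tauLog 0 (Complex.exp (D p), p.2) = T.sigmaLog p) {p : ℂ × ℂ}
    (hp : p ∈ liftStrip N 25 s₁) :
    Complex.exp (D p) * Complex.exp (T.tauLog 0 (Complex.exp (D p), p.2)) =
      Complex.exp (T.sigmaLog p) := by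
  rw [← Complex.exp_add, (hD p hp).2]

/-- For `ε = 0` the leaves are level sets of `f`, and both sections are parameterized by `f`, so the
Dulac map is the identity. -/
theorem IsScale.exp_lift_zero {T : IsTransit f P Q a b R κ K r X σ τ x₀ y₀ α υ ξ ω ρ A}
    (hs : T.IsScale C M s) (hs₁s : s₁ ≤ s) (hN : T.IsDeep N)
    (hD : ∀ p ∈ liftStrip N 25 s₁, ‖Complex.exp (D p)‖ < s₁ ∧
        D p + T.tauLog 0 (Complex.exp (D p), p.2) = T.sigmaLog p) {ζ : ℂ}
    (hp : (ζ, (0 : ℂ)) ∈ liftStrip N 25 s₁) : Complex.exp (D (ζ, 0)) = Complex.exp ζ := by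
  have h1 := exp_lift hD hp
  have h2 := T.f_firstInt_tau (((hD _ hp).1.trans_le hs₁s).trans_le hs.s_le_ρ)
  rw [h1, T.f_firstInt_sigma hN hp.1 (hp.2.1.trans (by norm_num))] at h2
  exact h2.symm

/-- The lift of the Dulac map and the holonomy satisfy the abstract axioms. -/
theorem IsScale.isDulacLift {T : IsTransit f P Q a b R κ K r X σ τ x₀ y₀ α υ ξ ω ρ A}
    (hs : T.IsScale C M s) (hs₁ : 0 < s₁) (hs₁s : s₁ ≤ s) (hN : T.IsDeep N)
    (hDd : DifferentiableOn ℂ D (liftStrip N 25 s₁))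
    (hD : ∀ p ∈ liftStrip N 25 s₁, ‖Complex.exp (D p)‖ < s₁ ∧
        D p + T.tauLog 0 (Complex.exp (D p), p.2) = T.sigmaLog p)
    (hH : AnalyticAt ℂ H 0) (hH0 : ∀ ε, H (0, ε) = 0)
    (hHs : ∀ w ε : ℂ, ‖w‖ < s₁ → ‖ε‖ < s₁ → ‖H (w, ε)‖ < s ∧
      H (w, ε) * Complex.exp (T.tauLog (2 * Real.pi * Complex.I) (H (w, ε), ε)) =
        w * Complex.exp (T.tauLog 0 (w, ε))) : IsDulacLift D H (N + 1) s₁ := by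
  have hsub : liftStrip (N + 1) 20 s₁ ⊆ liftStrip N 25 s₁ :=
    liftStrip_subset (by linarith) (by norm_num) le_rfl
  refine ⟨hs₁, hDd.mono hsub, fun ζ ζ' ε h1 h2 => hs.lift_near_id hs₁s hN hDd hD h1 h2,
    fun p hp => hs.lift_real hs₁s hN hD (hsub hp), fun ζ hζ => ?_, hH, Eventually.of_forall hH0,
    fun ζ ε h1 h2 => ?_⟩
  -- Known so far is `D(ζ) = ζ + 2πi m`. On the real axis `D` is real, hence `m = 0`; elsewhere
  -- `near_id` relative to `Re ζ` bounds `2π|m|` by `|Im ζ|/10 < 2`.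
  · have hx : ((ζ.re : ℂ), (0 : ℂ)) ∈ liftStrip (N + 1) 20 s₁ :=
      ⟨by simpa using hζ.1, by simp, hζ.2.2⟩
    have e1 := hs.exp_lift_zero hs₁s hN hD (hsub hx)
    have e2 := hs.exp_lift_zero hs₁s hN hD (hsub hζ)
    have r1 := hs.lift_real hs₁s hN hD (hsub hx)
    simp only [Complex.conj_ofReal, map_zero] at r1
    have r2 : D (ζ.re, 0) = ((D (ζ.re, 0)).re : ℂ) := (Complex.conj_eq_iff_re.1 r1.symm).symm
    have e3 : D (ζ.re, 0) = ζ.re := by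
      rw [r2, ← Complex.ofReal_exp, ← Complex.ofReal_exp, Complex.ofReal_inj] at e1
      rw [r2, Real.exp_injective e1]
    have h4 := hs.lift_near_id hs₁s hN hDd hD hζ hx
    rw [e3] at h4
    have h5 : ζ - ζ.re = ζ.im * Complex.I := by
      rw [sub_eq_iff_eq_add']
      exact (Complex.re_add_im ζ).symm
    rw [sub_sub_sub_cancel_right, h5, norm_mul, Complex.norm_I, mul_one, Complex.norm_real,
      Real.norm_eq_abs] at h4
    obtain ⟨m, hm⟩ := Complex.exp_eq_exp_iff_exists_int.1 e2
    have h6 : m = 0 := by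
      by_contra hm0
      rw [hm, add_sub_cancel_left, norm_mul, norm_two_pi_I, Complex.norm_intCast] at h4
      have h7 : (1 : ℝ) ≤ |(m : ℝ)| := by exact_mod_cast Int.one_le_abs hm0
      have h8 := hζ.2.1
      simp only at h8
      have := Real.pi_gt_three
      nlinarith
    rw [hm, h6]
    simp
  · have m1 := hsub h1
    have m2 := hsub h2
    have hε : ‖ε‖ < s := h1.2.2.trans_le hs₁s
    obtain ⟨n1, n2⟩ := hHs _ ε (hD _ m1).1 h1.2.2
    have n3 := (hD _ m2).1.trans_le hs₁s
    -- Both candidates have the same first integral on `τ` for the branch `2πi`: one by the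
    -- definition of `H`, the other because a branch change acts by the same self-map on `σ` and on
    -- `τ`.
    refine hs.injective' n3 n1 hε ?_
    rw [n2, T.firstInt_translate_tau (n3.trans_le hs.s_le_ρ) (hε.trans_le hs.s_le_R)]
    have e1 := exp_lift hD m1
    have e2 := exp_lift hD m2
    simp only at e1 e2
    rw [e1, e2]
    exact (T.firstInt_translate_sigma hN m1.1 (m1.2.1.trans (by norm_num))
      (m2.2.1.trans (by norm_num)) (hε.trans_le hs.s_le_R)).symm

end Lift

end IsTransit

end Saddle

/-! ### Real orbits are the fibres of the first integral -/

namespace Saddle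

/-- By conjugation symmetry the deviation is real for real data, so `y` stays positive. For `Δ ≥ 1`
the weight is at most `1`, so `y` never exceeds its initial value and the orbit stays in the square.
-/
theorem IsSlope.exists_flowY_eq_ofReal {c : ℂ × ℂ × ℂ → ℂ} {R κ K B r : ℝ}
    (h : IsSlope c R κ K B r) {u Δ t ε : ℝ}
    (hp : ((u : ℂ), (Δ : ℂ), (t : ℂ), (ε : ℂ)) ∈ flowDomain R B r) (ht : 0 < t) (hΔ : 1 ≤ Δ)
    {s : ℝ} (hs : s ∈ Icc (0 : ℝ) 1) :
    ∃ y : ℝ, 0 < y ∧ y ≤ t ∧ h.flowY ((u : ℂ), (Δ : ℂ), (t : ℂ), (ε : ℂ)) s = y := by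
  set p : ℂ × ℂ × ℂ × ℂ := ((u : ℂ), (Δ : ℂ), (t : ℂ), (ε : ℂ)) with hpdef
  have h1 := h.sol_conj hp hs
  simp only [hpdef, Complex.conj_ofReal] at h1
  rw [← hpdef] at h1
  have h2 : h.sol p s = ((h.sol p s).re : ℂ) := (Complex.conj_eq_iff_re.1 h1.symm).symm
  have h3 : h.flowY p s = ((t * Real.exp (-(s * Δ) + (h.sol p s).re) : ℝ) : ℂ) := by
    rw [flowY, h2]
    simp [hpdef]
  have hpos : 0 < t * Real.exp (-(s * Δ) + (h.sol p s).re) := by positivity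
  refine ⟨_, hpos, ?_, h3⟩
  have h4 : ‖h.flowY p s‖ ≤ ‖p.2.2.1‖ * flowWeight κ p s :=
    norm_flowPoint_snd_le ((h.admissible_sol hp).2 s hs)
  have h5 := h.flowWeight_le_exp hp (by simpa [hpdef] using hΔ) hs.1
  have h6 : Real.exp (-(p.2.1.re / 2) * s) ≤ 1 :=
    Real.exp_le_one_iff.2 (by simp [hpdef]; nlinarith [hs.1])
  rw [h3, Complex.norm_real, Real.norm_of_nonneg hpos.le] at h4
  have h7 : ‖p.2.2.1‖ = t := by simp [hpdef, abs_of_pos ht]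
  rw [h7] at h4
  nlinarith

variable {f : ℂ × ℂ → ℂ} {P Q a b : ℂ × ℂ × ℂ → ℂ} {R κ K r X x₀ y₀ : ℝ} {σ τ : ℂ → ℂ × ℂ}
  {α υ ξ ω : ℂ → ℂ} {ρ A : ℝ}

/-- A solution ends at the point with the same value of the first integral. -/
theorem IsChart.flowY_one_eq (h : IsChart f P Q a b R κ K r X) {ξ₀ ξ₁ Δ η₀ η₁ ε : ℂ}
    (hp : (ξ₀, Δ, η₀, ε) ∈ flowDomain R 40 r) (hΔ : ξ₀ + Δ = ξ₁) (h₀ : ξ₀.re ≤ X - 1)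
    (h₁ : ξ₁.re ≤ X - 1) (i₀ : |ξ₀.im| < 40) (i₁ : |ξ₁.im| < 40) (hη₀ : 5 * ‖η₀‖ < r)
    (hη₁ : 4 * ‖η₁‖ < r) (hY : 4 * ‖h.slope.flowY (ξ₀, Δ, η₀, ε) 1‖ < r)
    (heq : h.slope.firstInt X (ξ₀, η₀, ε) = h.slope.firstInt X (ξ₁, η₁, ε)) :
    h.slope.flowY (ξ₀, Δ, η₀, ε) 1 = η₁ := by
  have hre : ∀ s ∈ Icc (0 : ℝ) 1, (ξ₀ + s * Δ).re ≤ X - 1 := by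
    intro s hs
    have e : (ξ₀ + s * Δ).re = (1 - s) * ξ₀.re + s * ξ₁.re := by
      rw [← hΔ]
      simp
      ring
    rw [e]
    nlinarith [hs.1, hs.2]
  have him : ∀ s ∈ Icc (0 : ℝ) 1, |(ξ₀ + s * Δ).im| < 40 := by
    intro s hs
    have e : (ξ₀ + s * Δ).im = (1 - s) * ξ₀.im + s * ξ₁.im := by
      rw [← hΔ]
      simp
      ring
    rw [abs_lt] at i₀ i₁
    rw [e, abs_lt]
    exact convex_Ioo (-40 : ℝ) 40 i₀ i₁ (sub_nonneg.2 hs.2) hs.1 (sub_add_cancel _ _)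
  have hconst := h.slope.firstInt_eq_of_leaf h.X_le (ξ := fun s : ℝ => ξ₀ + s * Δ)
    (ξ' := fun _ => Δ) (y := h.slope.flowY (ξ₀, Δ, η₀, ε)) (ε := ε) (fun s hs => ?_)
    (fun s hs => ?_) (fun s hs => ?_) (fun s hs => h.slope.hasDerivWithinAt_flowY hp hs)
  · simp only [Complex.ofReal_one, one_mul, hΔ, Complex.ofReal_zero, zero_mul, add_zero,
      h.slope.flowY_zero hp] at hconst
    exact h.slope.firstInt_injective h.X_le (h.bound.trans (by norm_num)) h₁ i₁ hp.2.2.2.2.2 hY hη₁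
      (hconst.trans heq)
  · have h1 := h.slope.norm_flowY_le hp hs
    have h2 := hre s hs
    exact ⟨by simp only; linarith, him s hs, by simp only at h1 ⊢; linarith, hp.2.2.2.2.2⟩
  · intro h0
    have h2 := hre s hs
    rw [h0, Complex.ofReal_re] at h2
    linarith
  · simpa using ((Complex.ofRealCLM.hasDerivAt (x := s)).mul_const Δ).const_add ξ₀
      |>.hasDerivWithinAt

theorem IsRealDisc.eq_ofReal {B : ℂ → ℂ} {ρ η : ℝ} (h : IsRealDisc B ρ η) {x : ℝ} (hx : |x| < ρ) :
    B x = ((B x).re : ℂ) := by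
  have := h.real x (by simpa using hx)
  rw [Complex.conj_ofReal] at this
  exact (Complex.conj_eq_iff_re.1 this.symm).symm

theorem log_exp_of_abs_im_lt {z : ℂ} (hz : |z.im| < 1) : Complex.log (Complex.exp z) = z := by
  have := Real.pi_gt_three
  rw [abs_lt] at hz
  exact Complex.log_exp (by linarith) (by linarith)

namespace IsTransit

section Lift

variable {D : ℂ × ℂ → ℂ} {C M s s₁ N : ℝ}

/-- Points of `σ` and `τ` on one real orbit have the same first integral. -/
theorem firstInt_eq_of_onSameRealOrbit (T : IsTransit f P Q a b R κ K r X σ τ x₀ y₀ α υ ξ ω ρ A)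
    (hN : T.IsDeep N) {u ε : ℝ} {w : ℂ} (hu : u < -N) (hε : ‖(ε : ℂ)‖ < R) (hw : ‖w‖ < ρ)
    (h : OnSameRealOrbit f P Q A ε (σ (Complex.exp u)) (τ w)) :
    w * Complex.exp (T.tauLog 0 (w, ε)) = Complex.exp (T.sigmaLog (u, ε)) := by
  obtain ⟨γ, hγ, h0, h1, hq⟩ := h
  have hz := T.norm_exp_lt hN (ζ := u) (by simpa using hu)
  have hpos : ∀ s ∈ Icc (0 : ℝ) 1, ∃ x : ℝ, x ∈ Ioo 0 A ∧ (γ s).1 = x ∧ ‖(γ s).2‖ < A := by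
    intro s hs
    obtain ⟨x, y, hx, hy, e⟩ := hq s hs
    refine ⟨x, hx, by rw [e], ?_⟩
    rw [e]
    simpa [abs_of_pos hy.1] using hy.2
  have hre : ∀ s ∈ Icc (0 : ℝ) 1,
      (Complex.log (γ s).1).re < X - 2 ∧ (Complex.log (γ s).1).im = 0 := by
    intro s hs
    obtain ⟨x, hx, e, -⟩ := hpos s hs
    rw [e, ← Complex.ofReal_log hx.1.le]
    exact ⟨(Real.log_lt_log hx.1 hx.2).trans_le T.log_A_le, by simp⟩
  have hAr := T.A_le_r
  have hr := T.chart.slope.r_pos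
  have key := T.chart.firstInt_eq_of_isLeafPath hγ (ξ := fun s => Complex.log (γ s).1)
    (fun s hs => ?_) (fun s hs => ?_) (fun s hs => ?_) (fun s hs => by linarith [(hre s hs).1])
  · simp only [h0, h1] at key
    rw [T.sec.τ_eq w hw, T.sec.σ_eq _ hz, ← Complex.exp_add] at key
    simp only at key
    have i1 := T.sigma_im_lt hN (ζ := u) (by simpa using hu)
    rw [log_exp_of_abs_im_lt ((T.abs_im_ξ_le hw).trans (by norm_num)),
      log_exp_of_abs_im_lt (i1.trans (by norm_num)), T.firstInt_sigma, ← add_zero (ξ w),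
      T.firstInt_tau] at key
    exact key
  · obtain ⟨x, hx, e, -⟩ := hpos s hs
    have hlog : DifferentiableAt ℝ Complex.log (γ s).1 :=
      (Complex.differentiableAt_log (by
        rw [e]
        exact Complex.ofReal_mem_slitPlane.2 hx.1)).restrictScalars ℝ
    exact hlog.comp_differentiableWithinAt s
      (hγ.contDiffOn.differentiableOn (by norm_num) s hs).fst
  · obtain ⟨x, hx, e, -⟩ := hpos s hs
    refine Complex.exp_log ?_
    rw [e]
    exact_mod_cast hx.1.ne'
  · obtain ⟨x, hx, e, hy⟩ := hpos s hs
    exact ⟨by simp only; linarith [(hre s hs).1], by simp [(hre s hs).2], by simp only; linarith, hε⟩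

/-- Points of `σ` and `τ` with the same first integral lie on one real orbit. -/
theorem onSameRealOrbit_of_firstInt_eq (T : IsTransit f P Q a b R κ K r X σ τ x₀ y₀ α υ ξ ω ρ A)
    (hN : T.IsDeep N) (hN' : -N + ‖α 0‖ + 4 ≤ Real.log x₀) {u ε y : ℝ} (hu : u < -N)
    (hε : ‖(ε : ℂ)‖ < R) (hy : |y| < ρ)
    (heq : y * Complex.exp (T.tauLog 0 (y, ε)) = Complex.exp (T.sigmaLog (u, ε))) :
    OnSameRealOrbit f P Q A ε (σ (Complex.exp u)) (τ y) := by
  have hur : (u : ℂ).re < -N := by simpa using hu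
  have hz := T.norm_exp_lt hN hur
  have hz' : |Real.exp u| < ρ := by simpa [Complex.norm_exp] using hz
  have hyn : ‖(y : ℂ)‖ < ρ := by simpa using hy
  obtain ⟨v, hv⟩ : ∃ v : ℝ, (u : ℂ) + α (Complex.exp u) = v :=
    ⟨u + (α (Real.exp u : ℝ)).re, by
      rw [← Complex.ofReal_exp, T.sec.α_disc.eq_ofReal hz']
      simp⟩
  obtain ⟨t, ht⟩ : ∃ t : ℝ, υ (Complex.exp u) = t :=
    ⟨(υ (Real.exp u : ℝ)).re, by
      rw [← Complex.ofReal_exp, ← T.sec.υ_disc.eq_ofReal hz']⟩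
  obtain ⟨e, he⟩ : ∃ e : ℝ, ξ y = e := ⟨_, T.sec.ξ_disc.eq_ofReal hy⟩
  have v1 : v ≤ u + ‖α 0‖ + 1 / 200 := by
    have h1 := (Complex.re_le_norm _).trans (T.norm_α_le hz)
    have h2 := congrArg Complex.re hv
    simp only [Complex.add_re, Complex.ofReal_re] at h2
    linarith
  have e1 : Real.log x₀ - 1 / 200 < e := by
    have h1 := (Complex.abs_re_le_norm _).trans_lt (T.sec.ξ_disc.osc y hyn)
    rw [he, T.sec.ξ_zero, Complex.sub_re, Complex.ofReal_re, Complex.ofReal_re, abs_lt] at h1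
    linarith
  have e2 : e < Real.log A := by simpa [he] using T.ξ_re y hyn
  have hLA := T.log_A_le
  have hXR := T.chart.X_le
  have hAr := T.A_le_r
  have hr := T.chart.slope.r_pos
  have tA : Real.exp t < A := by
    have := T.υ_norm _ hz
    rw [ht, Complex.norm_exp] at this
    simpa using this
  -- By `hN'` the start on `σ` lies far to the left of `τ` in `log x`, so the long-segment estimates
  -- apply.
  have hΔ : 1 ≤ e - v := by linarith
  have hp : ((v : ℂ), ((e - v : ℝ) : ℂ), ((Real.exp t : ℝ) : ℂ), (ε : ℂ)) ∈ flowDomain R 40 r := by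
    refine ⟨?_, ?_, ?_, by simp, ?_, hε⟩
    · simp only [Complex.ofReal_re]
      linarith
    · simp only [← Complex.ofReal_add, Complex.ofReal_re]
      linarith
    · simp only [Complex.ofReal_re]
      linarith
    · simp only [Complex.norm_real, Real.norm_eq_abs, Real.abs_exp]
      linarith
  have hY := fun s (hs : s ∈ Icc (0 : ℝ) 1) =>
    T.chart.slope.exists_flowY_eq_ofReal hp (Real.exp_pos t) hΔ hs
  have hτ := T.τ_norm y hyn
  have hend : T.chart.slope.flowY ((v : ℂ), ((e - v : ℝ) : ℂ), ((Real.exp t : ℝ) : ℂ), (ε : ℂ)) 1 =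
      y * Complex.exp (ω y) := by
    refine T.chart.flowY_one_eq hp (ξ₁ := e) (by push_cast; ring) ?_ ?_ (by simp) (by simp) ?_ ?_ ?_ ?_
    · simp only [Complex.ofReal_re]
      linarith
    · simp only [Complex.ofReal_re]
      linarith
    · simp only [Complex.norm_real, Real.norm_eq_abs, Real.abs_exp]
      linarith
    · linarith
    · obtain ⟨Y, hY0, hY1, hY2⟩ := hY 1 (right_mem_Icc.2 zero_le_one)
      rw [hY2, Complex.norm_real, Real.norm_of_nonneg hY0.le]
      linarith
    · have h1 := T.firstInt_sigma u ε
      have h2 := T.firstInt_tau 0 y ε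
      rw [hv, ht] at h1
      rw [he, add_zero] at h2
      rw [Complex.ofReal_exp, h1, h2, heq]
  refine ⟨_, T.chart.isLeafPath_flow hp, ?_, ?_, fun s hs => ?_⟩
  · rw [T.sec.σ_eq _ hz, ← Complex.exp_add, hv, ht, T.chart.slope.flowY_zero hp]
    simp
  · rw [T.sec.τ_eq _ hyn, hend, he]
    simp
  · obtain ⟨Y, hY0, hY1, hY2⟩ := hY s hs
    refine ⟨Real.exp (v + s * (e - v)), Y, ⟨Real.exp_pos _, ?_⟩, ⟨hY0, by linarith⟩, ?_⟩
    · rw [← Real.lt_log_iff_exp_lt T.A_pos]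
      nlinarith [hs.1, hs.2]
    · rw [hY2]
      push_cast
      rfl

/-- The lift determines the intersections of the real orbits with `τ`. -/
theorem IsScale.onSameRealOrbit_iff {T : IsTransit f P Q a b R κ K r X σ τ x₀ y₀ α υ ξ ω ρ A}
    (hs : T.IsScale C M s) (hs₁s : s₁ ≤ s) (hN : T.IsDeep N)
    (hD : ∀ p ∈ liftStrip N 25 s₁, ‖Complex.exp (D p)‖ < s₁ ∧
        D p + T.tauLog 0 (Complex.exp (D p), p.2) = T.sigmaLog p)
    {N' : ℝ} (hNN' : N ≤ N') (hN' : -N' + ‖α 0‖ + 4 ≤ Real.log x₀) {u ε y : ℝ} (hu : u < -N')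
    (hε : |ε| < s₁) (hy : |y| < s₁) :
    OnSameRealOrbit f P Q A ε (σ (Complex.exp u)) (τ y) ↔ (y : ℂ) = Complex.exp (D (u, ε)) := by
  have hdeep : T.IsDeep N' := ⟨(Real.exp_le_exp.2 (by linarith)).trans hN.1, by linarith [hN.2]⟩
  have hεs : ‖(ε : ℂ)‖ < s := by simpa using hε.trans_le hs₁s
  have hm : ((u : ℂ), (ε : ℂ)) ∈ liftStrip N 25 s₁ :=
    ⟨by simp; linarith, by simp, by simpa using hε⟩
  have hys : ‖(y : ℂ)‖ < s := by simpa using hy.trans_le hs₁s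
  have h1 := exp_lift hD hm
  refine ⟨fun h => ?_, fun h => ?_⟩
  · have h2 := T.firstInt_eq_of_onSameRealOrbit hdeep hu (hεs.trans_le hs.s_le_R)
      (hys.trans_le hs.s_le_ρ) h
    exact hs.injective hys ((hD _ hm).1.trans_le hs₁s) hεs (h2.trans h1.symm)
  · refine T.onSameRealOrbit_of_firstInt_eq hdeep hN' hu (hεs.trans_le hs.s_le_R)
      (by simpa using hys.trans_le hs.s_le_ρ) ?_
    rw [h]
    exact h1

end Lift

end IsTransit

end Saddle

/-! ### The holonomy along the circle -/

namespace Saddle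

variable {f : ℂ × ℂ → ℂ} {P Q a b : ℂ × ℂ × ℂ → ℂ} {R κ K r X x₀ y₀ : ℝ} {σ τ : ℂ → ℂ × ℂ}
  {α υ ξ ω : ℂ → ℂ} {ρ A : ℝ}

theorem IsRealDisc.continuousAt_zero {B : ℂ → ℂ} {ρ η : ℝ} (h : IsRealDisc B ρ η) (hρ : 0 < ρ) :
    ContinuousAt B 0 :=
  (h.diff.differentiableAt (Metric.ball_mem_nhds _ hρ)).continuousAt

namespace IsTransit

theorem two_pi_I_im : (2 * Real.pi * Complex.I : ℂ).im = 2 * Real.pi := by simp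

/-- Points of `τ` related by the first integral are joined by a leaf path close to the circle. -/
theorem exists_isLeafPath_of_firstInt_eq (T : IsTransit f P Q a b R κ K r X σ τ x₀ y₀ α υ ξ ω ρ A)
    (hx₀ : 0 < x₀) {η : ℝ} {z w : ℂ} {ε : ℝ} (hz : ‖z‖ < ρ) (hw : ‖w‖ < ρ) (hε : ‖(ε : ℂ)‖ < R)
    (hξz : A * ‖ξ z - Real.log x₀‖ < η) (hξw : A * ‖ξ w - Real.log x₀‖ < η)
    (hzη : 5 * ‖z * Complex.exp (ω z)‖ < η) (hzr : 20 * ‖z * Complex.exp (ω z)‖ < r)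
    (heq : w * Complex.exp (T.tauLog (2 * Real.pi * Complex.I) (w, ε)) =
      z * Complex.exp (T.tauLog 0 (z, ε))) :
    ∃ γ : ℝ → ℂ × ℂ, IsLeafPath f P Q ε γ ∧ γ 0 = τ z ∧ γ 1 = τ w ∧ ∀ s ∈ Icc (0 : ℝ) 1,
      ‖γ s - ((x₀ : ℂ) * Complex.exp (2 * Real.pi * s * Complex.I), 0)‖ < η := by
  -- The path lifts to the segment of the `log x`-plane from `ξ(z)` to `ξ(w) + 2πi`.
  set Δ : ℂ := ξ w - ξ z + 2 * Real.pi * Complex.I with hΔ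
  have hA := T.A_pos
  have hπ := Real.pi_lt_d2
  have hπ0 := Real.pi_pos
  have hAr := T.A_le_r
  have hLA := T.log_A_le
  have hXR := T.chart.X_le
  have hrez := T.ξ_re z hz
  have hrew := T.ξ_re w hw
  have himz := T.abs_im_ξ_le hz
  have himw := T.abs_im_ξ_le hw
  have hosc : |(ξ w - ξ z).re| < 1 / 100 := by
    refine (Complex.abs_re_le_norm _).trans_lt ?_
    have h1 := T.sec.ξ_disc.osc z hz
    have h2 := T.sec.ξ_disc.osc w hw
    have h3 := norm_sub_le (ξ w - ξ 0) (ξ z - ξ 0)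
    rw [sub_sub_sub_cancel_right] at h3
    linarith
  rw [abs_lt] at hosc himz himw
  have hΔre : Δ.re = (ξ w - ξ z).re := by rw [hΔ, Complex.add_re, re_two_pi_I, add_zero]
  have hΔim : Δ.im = (ξ w).im - (ξ z).im + 2 * Real.pi := by
    rw [hΔ, Complex.add_im, two_pi_I_im, Complex.sub_im]
  have hsum : ξ z + Δ = ξ w + 2 * Real.pi * Complex.I := by
    rw [hΔ]
    ring
  have hp : (ξ z, Δ, z * Complex.exp (ω z), (ε : ℂ)) ∈ flowDomain R 40 r := by
    refine ⟨by simp only; linarith, ?_, by simp only; linarith, ?_, ?_, hε⟩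
    · simp only [hsum, Complex.add_re, re_two_pi_I]
      linarith
    · simp only [hΔim]
      rw [abs_lt]
      constructor <;> linarith
    · simp only
      linarith [norm_nonneg (z * Complex.exp (ω z))]
  have hend : T.chart.slope.flowY (ξ z, Δ, z * Complex.exp (ω z), (ε : ℂ)) 1 =
      w * Complex.exp (ω w) := by
    refine T.chart.flowY_one_eq hp hsum (by linarith) ?_ ?_ ?_ ?_ ?_ ?_ ?_
    · rw [Complex.add_re, re_two_pi_I]
      linarith
    · rw [abs_lt]
      constructor <;> linarith
    · rw [Complex.add_im, two_pi_I_im, abs_lt]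
      constructor <;> linarith
    · linarith [norm_nonneg (z * Complex.exp (ω z))]
    · linarith [T.τ_norm w hw]
    · have := T.chart.slope.norm_flowY_le hp (right_mem_Icc.2 zero_le_one)
      simp only at this
      linarith
    · have h1 := T.firstInt_tau 0 z ε
      rw [add_zero] at h1
      rw [h1, T.firstInt_tau, heq]
  refine ⟨_, T.chart.isLeafPath_flow hp, ?_, ?_, fun s hs => ?_⟩
  · rw [T.sec.τ_eq z hz, T.chart.slope.flowY_zero hp]
    simp
  · rw [T.sec.τ_eq w hw, hend, Complex.ofReal_one, one_mul, hsum, Complex.exp_add,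
      Complex.exp_two_pi_mul_I, mul_one]
  · have hY := T.chart.slope.norm_flowY_le hp hs
    rw [Prod.mk_sub_mk, Prod.norm_mk, max_lt_iff, sub_zero]
    refine ⟨?_, hY.trans_lt hzη⟩
    have e1 : (x₀ : ℂ) * Complex.exp (2 * Real.pi * s * Complex.I) =
        Complex.exp (Real.log x₀ + 2 * Real.pi * s * Complex.I) := by
      rw [Complex.exp_add, ← Complex.ofReal_exp, Real.exp_log hx₀]
    -- The deviation from the lifted circle is the convex combination of its values at the two ends.
    have e2 : ξ z + s * Δ - (Real.log x₀ + 2 * Real.pi * s * Complex.I) =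
        (1 - s : ℝ) • (ξ z - Real.log x₀) + s • (ξ w - Real.log x₀) := by
      simp only [hΔ, Complex.real_smul]
      push_cast
      ring
    have hlog : Real.log x₀ ≤ Real.log A := by
      have := T.ξ_re 0 (by simpa using T.sec.ρ_pos)
      rw [T.sec.ξ_zero, Complex.ofReal_re] at this
      exact this.le
    have hre : (ξ z + s * Δ).re ≤ Real.log A := by
      rw [Complex.add_re, Complex.re_ofReal_mul, hΔre, Complex.sub_re]
      nlinarith [hs.1, hs.2]
    have h1 := norm_exp_sub_exp_le hre (b := Real.log x₀ + 2 * Real.pi * s * Complex.I)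
      (by simpa using hlog)
    rw [Real.exp_log hA, ← e1, e2] at h1
    refine h1.trans_lt ?_
    rw [← lt_div_iff₀' hA] at hξz hξw ⊢
    have := (convex_ball (0 : ℂ) (η / A)) (mem_ball_zero_iff.2 hξz) (mem_ball_zero_iff.2 hξw)
      (sub_nonneg.2 hs.2) hs.1 (sub_add_cancel _ _)
    exact mem_ball_zero_iff.1 this

/-- A leaf path close to the circle transports the first integral. -/
theorem firstInt_eq_of_isLeafPath_near_circle
    (T : IsTransit f P Q a b R κ K r X σ τ x₀ y₀ α υ ξ ω ρ A) (hx₀ : 0 < x₀) {η : ℝ}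
    (hη₁ : η ≤ x₀) (hη₂ : x₀ + η ≤ A) {z w : ℂ} {ε : ℝ} (hz : ‖z‖ < ρ) (hw : ‖w‖ < ρ)
    (hε : ‖(ε : ℂ)‖ < R) {γ : ℝ → ℂ × ℂ} (hγ : IsLeafPath f P Q ε γ) (h0 : γ 0 = τ z)
    (h1 : γ 1 = τ w) (hclose : ∀ s ∈ Icc (0 : ℝ) 1,
      ‖γ s - ((x₀ : ℂ) * Complex.exp (2 * Real.pi * s * Complex.I), 0)‖ < η) :
    w * Complex.exp (T.tauLog (2 * Real.pi * Complex.I) (w, ε)) =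
      z * Complex.exp (T.tauLog 0 (z, ε)) := by
  have hπ := Real.pi_lt_d2
  have hπ0 := Real.pi_pos
  have hx₀' : (x₀ : ℂ) ≠ 0 := by exact_mod_cast hx₀.ne'
  set c : ℝ → ℂ := fun s => Real.log x₀ + 2 * Real.pi * s * Complex.I with hc
  have hexpc : ∀ s, Complex.exp (c s) = x₀ * Complex.exp (2 * Real.pi * s * Complex.I) := by
    intro s
    rw [hc, Complex.exp_add, ← Complex.ofReal_exp, Real.exp_log hx₀]
  have hnorm : ∀ s, ‖Complex.exp (c s)‖ = x₀ := by
    intro s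
    rw [Complex.norm_exp]
    simp [hc, Real.exp_log hx₀]
  have hfst : ∀ s ∈ Icc (0 : ℝ) 1, ‖(γ s).1 - Complex.exp (c s)‖ < η := fun s hs => by
    rw [hexpc]
    exact (norm_fst_le _).trans_lt (hclose s hs)
  have hsnd : ∀ s ∈ Icc (0 : ℝ) 1, ‖(γ s).2‖ < η := fun s hs => by
    have := (norm_snd_le _).trans_lt (hclose s hs)
    simpa using this
  have hlt : ∀ s ∈ Icc (0 : ℝ) 1, ‖(γ s).1‖ < A := fun s hs => by
    have h2 := norm_sub_norm_le (γ s).1 (Complex.exp (c s))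
    rw [hnorm] at h2
    linarith [hfst s hs]
  have hslit : ∀ s ∈ Icc (0 : ℝ) 1, (γ s).1 * Complex.exp (-c s) ∈ Complex.slitPlane := by
    intro s hs
    have e1 : (γ s).1 * Complex.exp (-c s) =
        1 + ((γ s).1 - Complex.exp (c s)) * Complex.exp (-c s) := by
      rw [sub_mul, ← Complex.exp_add, add_neg_cancel, Complex.exp_zero]
      ring
    rw [e1]
    refine Complex.mem_slitPlane_of_norm_lt_one ?_
    rw [norm_mul, Complex.exp_neg, norm_inv, hnorm, ← div_eq_mul_inv, div_lt_one hx₀]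
    exact (hfst s hs).trans_le hη₁
  -- A continuous `log x` along the path: the lift of the circle corrected by the principal
  -- logarithm of the quotient, which stays within distance `1` of `1` because `η ≤ x₀`. The
  -- correction at the ends is `ξ - log x₀`, so `L` runs from `ξ(z)` to `ξ(w) + 2πi`.
  set L : ℝ → ℂ := fun s => c s + Complex.log ((γ s).1 * Complex.exp (-c s)) with hL
  have hexpL : ∀ s ∈ Icc (0 : ℝ) 1, Complex.exp (L s) = (γ s).1 := by
    intro s hs
    rw [hL, Complex.exp_add, Complex.exp_log (Complex.slitPlane_ne_zero (hslit s hs)),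
      mul_left_comm, ← Complex.exp_add, add_neg_cancel, Complex.exp_zero, mul_one]
  have hreL : ∀ s ∈ Icc (0 : ℝ) 1, (L s).re < X - 2 := by
    intro s hs
    have h2 := hlt s hs
    rw [← hexpL s hs, Complex.norm_exp, ← Real.lt_log_iff_exp_lt T.A_pos] at h2
    exact h2.trans_le T.log_A_le
  have hA := T.A_le_r
  have hr := T.chart.slope.r_pos
  have key := T.chart.firstInt_eq_of_isLeafPath hγ (ξ := L) (fun s hs => ?_) hexpL
    (fun s hs => ?_) (fun s hs => by linarith [hreL s hs])
  · have hend : ∀ v : ℂ, ‖v‖ < ρ → ∀ s, (γ s) = τ v → (s = 0 ∨ s = 1) →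
        L s = ξ v + 2 * Real.pi * s * Complex.I := by
      intro v hv s hs hs01
      have h3 := T.abs_im_ξ_le hv
      have e2 : Complex.exp (-c s) = Complex.exp (-Real.log x₀) := by
        rcases hs01 with rfl | rfl
        · simp [hc]
        · simp [hc, Complex.exp_add, Complex.exp_neg]
      simp only [hL]
      rw [hs, T.sec.τ_eq v hv, e2, ← Complex.exp_add, log_exp_of_abs_im_lt]
      · simp only [hc]
        ring
      · simp only [Complex.add_im, Complex.neg_im, Complex.ofReal_im]
        rw [neg_zero, add_zero]
        linarith
    rw [hend w hw 1 h1 (Or.inr rfl), hend z hz 0 h0 (Or.inl rfl), h0, h1, T.sec.τ_eq w hw,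
      T.sec.τ_eq z hz] at key
    simp only [Complex.ofReal_one, Complex.ofReal_zero, mul_one, mul_zero, zero_mul] at key
    rwa [T.firstInt_tau, T.firstInt_tau] at key
  · have hlog : DifferentiableAt ℝ Complex.log ((γ s).1 * Complex.exp (-c s)) :=
      (Complex.differentiableAt_log (hslit s hs)).restrictScalars ℝ
    have hcd : Differentiable ℝ c := by
      have : Differentiable ℝ (fun s : ℝ => (s : ℂ)) := Complex.ofRealCLM.differentiable
      simp only [hc]
      fun_prop
    have hγd := (hγ.contDiffOn.differentiableOn (by norm_num) s hs).fst
    have hexpd : DifferentiableAt ℝ (fun s => Complex.exp (-c s)) s := (hcd s).neg.cexp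
    have hmul : DifferentiableWithinAt ℝ (fun s => (γ s).1 * Complex.exp (-c s)) (Icc 0 1) s :=
      hγd.mul hexpd.differentiableWithinAt
    exact (hcd s).differentiableWithinAt.add
      (hlog.comp_differentiableWithinAt (f := fun s => (γ s).1 * Complex.exp (-c s)) s hmul)
  · refine ⟨by simp only; linarith [hreL s hs], ?_, ?_, hε⟩
    · have h2 := Complex.abs_arg_le_pi ((γ s).1 * Complex.exp (-c s))
      have h3 : (L s).im = 2 * Real.pi * s + Complex.arg ((γ s).1 * Complex.exp (-c s)) := by
        simp [hL, hc, Complex.log_im]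
      simp only [h3]
      rw [abs_le] at h2
      rw [abs_lt]
      constructor <;> nlinarith [hs.1, hs.2]
    · linarith [hsnd s hs, hη₂]

section Holonomy

variable {H : ℂ × ℂ → ℂ} {C M s : ℝ}

theorem tendsto_swap_ofReal :
    Tendsto (fun q : ℝ × ℂ => (q.2, (q.1 : ℂ))) (𝓝 0) (𝓝 (0 : ℂ × ℂ)) :=
  Continuous.tendsto' (by fun_prop) _ _ (by simp)

theorem IsScale.isHolonomy {T : IsTransit f P Q a b R κ K r X σ τ x₀ y₀ α υ ξ ω ρ A}
    (hs : T.IsScale C M s) (hx₀ : 0 < x₀) (hH : AnalyticAt ℂ H 0) (hH0 : ∀ ε, H (0, ε) = 0)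
    (hHs : ∀ᶠ p in 𝓝 (0 : ℂ × ℂ), ‖H p‖ < s ∧
      H p * Complex.exp (T.tauLog (2 * Real.pi * Complex.I) (H p, p.2)) =
        p.1 * Complex.exp (T.tauLog 0 p)) : IsHolonomy f P Q x₀ τ fun ε z => H (z, ε) := by
  intro η hη
  have hρ := T.sec.ρ_pos
  have hr := T.chart.slope.r_pos
  have hHt : Tendsto H (𝓝 0) (𝓝 0) := by
    have := hH.continuousAt.tendsto
    rwa [show H 0 = 0 from hH0 0] at this
  have hfst : Tendsto (Prod.fst : ℂ × ℂ → ℂ) (𝓝 0) (𝓝 0) := continuous_fst.tendsto' _ _ rfl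
  have hξ : ∀ᶠ z in 𝓝 (0 : ℂ), A * ‖ξ z - Real.log x₀‖ < η := by
    have h1 : ContinuousAt (fun z => A * ‖ξ z - Real.log x₀‖) 0 :=
      ((T.sec.ξ_disc.continuousAt_zero hρ).sub continuousAt_const).norm.const_mul A
    exact h1.eventually (gt_mem_nhds (by simpa [T.sec.ξ_zero] using hη))
  have hω : ∀ᶠ z in 𝓝 (0 : ℂ), ‖z * Complex.exp (ω z)‖ < min (η / 5) (r / 20) := by
    have h1 : ContinuousAt (fun z => ‖z * Complex.exp (ω z)‖) 0 :=
      (continuousAt_id.mul (T.sec.ω_disc.continuousAt_zero hρ).cexp).norm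
    exact h1.eventually (gt_mem_nhds (by simp; exact ⟨by linarith, by linarith⟩))
  have hball : ∀ t > 0, ∀ᶠ z in 𝓝 (0 : ℂ), ‖z‖ < t := fun t ht => by
    filter_upwards [Metric.ball_mem_nhds (0 : ℂ) ht] with z hz using mem_ball_zero_iff.1 hz
  have hsnd : Tendsto (Prod.snd : ℂ × ℂ → ℂ) (𝓝 0) (𝓝 0) := continuous_snd.tendsto' _ _ rfl
  refine tendsto_swap_ofReal.eventually (p := fun p => ‖H p‖ < η ∧ ∀ ε : ℝ, (ε : ℂ) = p.2 →
    ∃ γ : ℝ → ℂ × ℂ, IsLeafPath f P Q ε γ ∧ γ 0 = τ p.1 ∧ γ 1 = τ (H p) ∧ ∀ s ∈ Icc (0 : ℝ) 1,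
      ‖γ s - ((x₀ : ℂ) * Complex.exp (2 * Real.pi * s * Complex.I), 0)‖ < η) ?_ |>.mono
    fun q hq => ⟨hq.1, hq.2 q.1 rfl⟩
  filter_upwards [hHs, hHt.eventually (hball η hη), hHt.eventually hξ, hfst.eventually hξ,
    hfst.eventually hω, hfst.eventually (hball ρ hρ),
    hsnd.eventually (hball R T.chart.slope.R_pos)] with p h1 h2 h3 h4 h5 h6 h7
  refine ⟨h2, fun ε hε => ?_⟩
  have h8 := h5.trans_le (min_le_left _ _)
  have h9 := h5.trans_le (min_le_right _ _)
  refine T.exists_isLeafPath_of_firstInt_eq hx₀ h6 (h1.1.trans_le hs.s_le_ρ) (hε ▸ h7) h4 h3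
    (by linarith) (by linarith) ?_
  rw [hε]
  exact h1.2

/-- A leaf path close to the circle transports the first integral from one branch to the next, so
any holonomy satisfies the equation defining `H`; injectivity on the scale `s` identifies them. -/
theorem IsScale.eventually_eq_of_isHolonomy
    {T : IsTransit f P Q a b R κ K r X σ τ x₀ y₀ α υ ξ ω ρ A} (hs : T.IsScale C M s)
    (hx₀ : x₀ ∈ Ioo 0 A)
    (hHs : ∀ᶠ p in 𝓝 (0 : ℂ × ℂ), ‖H p‖ < s ∧
      H p * Complex.exp (T.tauLog (2 * Real.pi * Complex.I) (H p, p.2)) =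
        p.1 * Complex.exp (T.tauLog 0 p)) {h : ℝ → ℂ → ℂ} (hh : IsHolonomy f P Q x₀ τ h) :
    ∀ᶠ q in 𝓝 (0 : ℝ × ℂ), h q.1 q.2 = H (q.2, q.1) := by
  set η := min s (min x₀ (A - x₀))
  have hη : 0 < η := lt_min hs.s_pos (lt_min hx₀.1 (by linarith [hx₀.2]))
  have hη₀ : η ≤ s := min_le_left _ _
  have hη₁ : η ≤ x₀ := (min_le_right _ _).trans (min_le_left _ _)
  have hη₂ : η ≤ A - x₀ := (min_le_right _ _).trans (min_le_right _ _)
  have hball : ∀ᶠ p in 𝓝 (0 : ℂ × ℂ), ‖p‖ < s := by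
    filter_upwards [Metric.ball_mem_nhds (0 : ℂ × ℂ) hs.s_pos] with z hz using mem_ball_zero_iff.1 hz
  filter_upwards [hh η hη, tendsto_swap_ofReal.eventually hHs,
    tendsto_swap_ofReal.eventually hball] with q ⟨h1, γ, hγ, h0, hw, hc⟩ h2 h3
  rw [Prod.norm_mk, max_lt_iff] at h3
  have h4 := h1.trans_le hη₀
  have h5 := T.firstInt_eq_of_isLeafPath_near_circle hx₀.1 hη₁ (by linarith)
    (h3.1.trans_le hs.s_le_ρ) (h4.trans_le hs.s_le_ρ) (h3.2.trans_le hs.s_le_R) hγ h0 hw hc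
  exact hs.injective' h4 h2.1 h3.2 (h5.trans h2.2.symm)

end Holonomy

end IsTransit

theorem HasPoincarePontryagin.congr {h : ℝ → ℂ → ℂ} {H : ℂ × ℂ → ℂ} {d : ℕ} {M : ℂ → ℂ}
    (hM : HasPoincarePontryagin h d M) (hH : ∀ᶠ q in 𝓝 (0 : ℝ × ℂ), h q.1 q.2 = H (q.2, q.1)) :
    ∀ᶠ z in 𝓝 (0 : ℂ), (fun ε : ℝ => H (z, ε) - z - (ε : ℂ) ^ d * M z) =O[𝓝 0]
      fun ε : ℝ => ε ^ (d + 1) := by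
  have h1 : ∀ᶠ q in 𝓝 (0 : ℂ) ×ˢ 𝓝 (0 : ℝ), h q.2 q.1 = H (q.1, q.2) := by
    rw [Filter.eventually_swap_iff, ← nhds_prod_eq]
    exact hH
  filter_upwards [hM, h1.curry] with z h2 h3
  refine h2.congr' ?_ EventuallyEq.rfl
  filter_upwards [h3] with ε h4
  rw [h4]

end Saddle

/-! ### Return to the variable `z` and conclusion -/

namespace Saddle

/-- The branch of the logarithm with arguments in `(-π/4, 7π/4)`. -/
noncomputable def sectorLog (z : ℂ) : ℂ :=
  Complex.log (z * Complex.exp (-((3 * Real.pi / 4 : ℝ) * Complex.I))) +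
    (3 * Real.pi / 4 : ℝ) * Complex.I

theorem exp_mul_exp_neg (x φ θ : ℝ) :
    Complex.exp (x + φ * Complex.I) * Complex.exp (-(θ * Complex.I)) =
      Complex.exp (x + (φ - θ : ℝ) * Complex.I) := by
  rw [← Complex.exp_add]
  congr 1
  push_cast
  ring

theorem sectorLog_exp {x φ : ℝ} (hφ : φ ∈ Ico 0 (3 * Real.pi / 2)) :
    sectorLog (Complex.exp (x + φ * Complex.I)) = x + φ * Complex.I := by
  have hπ := Real.pi_pos
  rw [sectorLog, exp_mul_exp_neg, Complex.log_exp]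
  · push_cast
    ring
  · simp
    linarith [hφ.1]
  · simp
    linarith [hφ.2]

theorem exp_mul_mem_slitPlane {x φ : ℝ} (hφ : φ ∈ Ico 0 (3 * Real.pi / 2)) :
    Complex.exp (x + φ * Complex.I) * Complex.exp (-((3 * Real.pi / 4 : ℝ) * Complex.I)) ∈
      Complex.slitPlane := by
  have hπ := Real.pi_pos
  rw [exp_mul_exp_neg, Complex.mem_slitPlane_iff_arg]
  refine ⟨?_, Complex.exp_ne_zero _⟩
  rw [← Complex.log_im, Complex.log_exp]
  · simp
    linarith [hφ.2]
  · simp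
    linarith [hφ.1]
  · simp
    linarith [hφ.2]

theorem exists_eq_exp_of_mem_sector {ρ : ℝ → ℝ} {J : Set ℝ} {z : ℂ} (hz : z ∈ sector ρ J) :
    ∃ x φ : ℝ, φ ∈ J ∧ Real.exp x < ρ φ ∧ z = Complex.exp (x + φ * Complex.I) := by
  obtain ⟨t, φ, hφ, ht, htρ, rfl⟩ := hz
  refine ⟨Real.log t, φ, hφ, by rwa [Real.exp_log ht], ?_⟩
  rw [Complex.exp_add, ← Complex.ofReal_exp, Real.exp_log ht]

theorem IsDulacLift.analyticOnNhd_exp {D H : ℂ × ℂ → ℂ} {N e : ℝ} (h : IsDulacLift D H N e)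
    {ε : ℂ} (hε : ‖ε‖ < e) {ρ : ℝ → ℝ} (hρ : ∀ φ, ρ φ ≤ Real.exp (-N)) :
    AnalyticOnNhd ℂ (fun z => Complex.exp (D (sectorLog z, ε)))
      (sector ρ (Ico 0 (3 * Real.pi / 2))) := by
  intro z hz
  obtain ⟨x, φ, hφ, hx, rfl⟩ := exists_eq_exp_of_mem_sector hz
  have hπ := Real.pi_lt_d2
  have hlog : ∀ z : ℂ, z * Complex.exp (-((3 * Real.pi / 4 : ℝ) * Complex.I)) ∈ Complex.slitPlane →
      DifferentiableAt ℂ sectorLog z := fun z hz =>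
    ((differentiableAt_id.mul_const _).clog hz).add_const _
  have hslit := exp_mul_mem_slitPlane (x := x) hφ
  have hmem : (sectorLog (Complex.exp (x + φ * Complex.I)), ε) ∈ liftStrip N 20 e := by
    rw [sectorLog_exp hφ]
    refine ⟨?_, ?_, hε⟩
    · simpa using Real.exp_lt_exp.1 (hx.trans_le (hρ φ))
    · simp only [Complex.add_im, Complex.ofReal_im, Complex.mul_I_im, Complex.ofReal_re, zero_add]
      rw [abs_of_nonneg hφ.1]
      linarith [hφ.2]
  have hc : ContinuousAt (fun z => (sectorLog z, ε)) (Complex.exp (x + φ * Complex.I)) :=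
    (hlog _ hslit).continuousAt.prodMk continuousAt_const
  have hc' : ContinuousAt
      (fun z : ℂ => z * Complex.exp (-((3 * Real.pi / 4 : ℝ) * Complex.I)))
      (Complex.exp (x + φ * Complex.I)) := by fun_prop
  rw [Complex.analyticAt_iff_eventually_differentiableAt]
  filter_upwards [hc.eventually ((isOpen_liftStrip _ _ _).mem_nhds hmem),
    hc'.eventually (Complex.isOpen_slitPlane.mem_nhds hslit)] with w hw hw'
  have hD : DifferentiableAt ℂ D (sectorLog w, ε) :=
    h.diff.differentiableAt ((isOpen_liftStrip _ _ _).mem_nhds hw)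
  exact (DifferentiableAt.comp (g := D) (f := fun z => (sectorLog z, ε)) w hD
    ((hlog w hw').prodMk (differentiableAt_const _))).cexp

/-- The Dulac map is `exp ∘ D` composed with a branch of the logarithm defined on the whole sector,
and a constant `ρ` suffices. -/
theorem IsTransit.IsScale.exists_dulac {f : ℂ × ℂ → ℂ} {P Q a b : ℂ × ℂ × ℂ → ℂ}
    {R κ K r X x₀ y₀ : ℝ} {σ τ : ℂ → ℂ × ℂ} {α υ ξ ω : ℂ → ℂ} {ρ A C M' s : ℝ}
    {T : IsTransit f P Q a b R κ K r X σ τ x₀ y₀ α υ ξ ω ρ A} (hs : T.IsScale C M' s)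
    {H : ℂ × ℂ → ℂ} (hH : AnalyticAt ℂ H 0) (hH0 : ∀ ε, H (0, ε) = 0)
    (hHs : ∀ᶠ p in 𝓝 (0 : ℂ × ℂ), ‖H p‖ < s ∧
      H p * Complex.exp (T.tauLog (2 * Real.pi * Complex.I) (H p, p.2)) =
        p.1 * Complex.exp (T.tauLog 0 p)) {d : ℕ} (hd : d ≠ 0) {M : ℂ → ℂ}
    (hM : ∀ᶠ z in 𝓝 (0 : ℂ), (fun ε : ℝ => H (z, (ε : ℂ)) - z - (ε : ℂ) ^ d * M z) =O[𝓝 0]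
      fun ε : ℝ => ε ^ (d + 1)) :
    ∃ ε₀ : ℝ, 0 < ε₀ ∧ ∃ r : ℝ, 0 < r ∧ ∃ ρ : ℝ → ℝ, Continuous ρ ∧ (∀ φ, 0 < ρ φ ∧ ρ φ ≤ r) ∧
      ∃ D : ℝ → ℂ → ℂ,
        (∀ ε ∈ Ioo (-ε₀) ε₀, IsDulacMap f P Q A ε σ τ r ρ (D ε)) ∧
      ∃ R V : ℝ × ℝ → ℝ,
        AnalyticOnNhd ℝ R (Ioo (-r) r ×ˢ Ioo (-ε₀) ε₀) ∧
        AnalyticOnNhd ℝ V (Ioo (-r) r ×ˢ Ioo (-ε₀) ε₀) ∧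
        (∀ u ∈ Ioo (-r) r, ∀ ε ∈ Ioo (-ε₀) ε₀,
          (V (u, ε) : ℂ) = (ε : ℂ) ^ d / (2 * Complex.I) * M u + (ε : ℂ) ^ (d + 1) * R (u, ε)) ∧
        (∀ ε ∈ Ioo (-ε₀) ε₀, V (0, ε) = 0) ∧
        ∀ ε ∈ Ioo (-ε₀) ε₀,
          {z ∈ sector ρ (Ioo 0 (3 * Real.pi / 2)) | (D ε z).im = 0} =
          {z ∈ sector ρ (Ioo 0 (3 * Real.pi / 2)) | z.re < 0 ∧ z.im = V (z.re, ε)} := by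
  obtain ⟨δ, hδ, hHδ⟩ := Metric.eventually_nhds_iff_ball.1 hHs
  obtain ⟨s₁, hs₁, hs₁s, hs₁δ⟩ : ∃ s₁ > 0, s₁ ≤ s ∧ s₁ ≤ δ :=
    ⟨min s δ, lt_min hs.s_pos hδ, min_le_left _ _, min_le_right _ _⟩
  obtain ⟨D, N, hN, hDd, hD⟩ := hs.exists_lift hs₁ hs₁s
  have hL : IsDulacLift D H (N + 1) s₁ :=
    hs.isDulacLift hs₁ hs₁s hN hDd hD hH hH0 fun w ε hw hε =>
      hHδ (w, ε) (by
        rw [mem_ball_zero_iff, Prod.norm_mk]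
        exact max_lt (hw.trans_le hs₁δ) (hε.trans_le hs₁δ))
  obtain ⟨s₂, hs₂, R', V, hR', hV, hVR, hV0, hlocus⟩ := hL.exists_zeroLocus hd hM
  -- Since `r' ≤ s₁`, every parameter in `(0, r')` lies where the first integral is injective on
  -- `τ`; this gives uniqueness of the intersection. The strip is then deepened so that the values
  -- of the Dulac map stay below `r'`.
  obtain ⟨r', hr', hr's₁, hr's₂⟩ : ∃ r' > 0, r' ≤ s₁ ∧ r' ≤ s₂ :=
    ⟨min s₁ s₂, lt_min hs₁ hs₂, min_le_left _ _, min_le_right _ _⟩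
  obtain ⟨N', e', hNN', he', he's₁, hexp⟩ := hL.exp_mem hr'
  obtain ⟨N'', hN'', hN''x⟩ : ∃ N'', N' ≤ N'' ∧ ‖α 0‖ + 4 - Real.log x₀ ≤ N'' :=
    ⟨_, le_max_left _ _, le_max_right _ _⟩
  obtain ⟨ε₀, hε₀, hε₀e, hε₀s⟩ : ∃ ε₀ > 0, ε₀ ≤ e' ∧ ε₀ ≤ s₂ :=
    ⟨min e' s₂, lt_min he' hs₂, min_le_left _ _, min_le_right _ _⟩
  obtain ⟨t, ht, htr, htN⟩ : ∃ t > 0, t ≤ r' ∧ t ≤ Real.exp (-N'') :=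
    ⟨min r' (Real.exp (-N'')), lt_min hr' (Real.exp_pos _), min_le_left _ _, min_le_right _ _⟩
  have hsub : Ioo (-r') r' ×ˢ Ioo (-ε₀) ε₀ ⊆ Ioo (-s₂) s₂ ×ˢ Ioo (-s₂) s₂ :=
    prod_mono (Ioo_subset_Ioo (by linarith) hr's₂) (Ioo_subset_Ioo (by linarith) hε₀s)
  have hεs₂ : ∀ ε ∈ Ioo (-ε₀) ε₀, ε ∈ Ioo (-s₂) s₂ := Ioo_subset_Ioo (by linarith) hε₀s
  have hεe : ∀ ε ∈ Ioo (-ε₀) ε₀, |ε| < e' := fun ε hε => (abs_lt.2 hε).trans_le hε₀e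
  refine ⟨ε₀, hε₀, r', hr', fun _ => t, continuous_const, fun _ => ⟨ht, htr⟩,
    fun ε z => Complex.exp (D (sectorLog z, ε)), fun ε hε => ⟨?_, fun x hx => ?_⟩, R', V,
    hR'.mono hsub, hV.mono hsub, fun u hu ε hε => hVR u (Ioo_subset_Ioo (by linarith) hr's₂ hu) ε
      (hεs₂ ε hε), fun ε hε => hV0 ε (hεs₂ ε hε), fun ε hε => ?_⟩
  · exact (hL.mono hNN' he' he's₁).analyticOnNhd_exp (by simpa using hεe ε hε) fun _ =>
      htN.trans (Real.exp_le_exp.2 (by linarith))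
  · have hu : Real.log x < -N'' := by
      rw [Real.log_lt_iff_lt_exp hx.1]
      exact hx.2.trans_le htN
    have hexplog : Complex.exp (Real.log x) = x := by
      rw [← Complex.ofReal_exp, Real.exp_log hx.1]
    have hseclog : sectorLog x = Real.log x := by
      have := sectorLog_exp (x := Real.log x) (φ := 0) ⟨le_rfl, by positivity⟩
      rwa [Complex.ofReal_zero, zero_mul, add_zero, hexplog] at this
    have hm : ((Real.log x : ℂ), (ε : ℂ)) ∈ liftStrip N' 20 e' :=
      ⟨by simp only [Complex.ofReal_re]; linarith, by simp, by simpa using hεe ε hε⟩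
    have hre : D (Real.log x, ε) = ((D (Real.log x, ε)).re : ℂ) := by
      have := (hL.mono hNN' he' he's₁).im_ofReal hm
      exact Complex.ext (by simp) (by simpa using this)
    have hval : Complex.exp (D (Real.log x, ε)) =
        (Real.exp (D (Real.log x, ε)).re : ℝ) := by
      rw [hre, Complex.ofReal_exp, Complex.ofReal_re]
    refine ⟨Real.exp (D (Real.log x, ε)).re, ⟨Real.exp_pos _, ?_⟩, ?_, fun y hy => ?_⟩
    · have := hexp _ hm
      rwa [Complex.norm_exp] at this
    · simp only [hseclog, hval]
    · have := hs.onSameRealOrbit_iff hs₁s hN hD (N' := N'') (by linarith) (by linarith) hu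
        ((hεe ε hε).trans_le he's₁) (y := y) (by rw [abs_of_pos hy.1]; linarith [hy.2])
      rw [hexplog, hval, Complex.ofReal_inj] at this
      exact this
  · ext z
    refine and_congr_right fun hz => ?_
    obtain ⟨x, φ, hφ, hx, rfl⟩ := exists_eq_exp_of_mem_sector hz
    simp only [sectorLog_exp ⟨hφ.1.le, hφ.2⟩]
    exact hlocus ε (hεs₂ ε hε) x φ (by linarith) hφ

end Saddle

theorem lemma2 (f : ℂ × ℂ → ℂ) (P Q : ℂ × ℂ × ℂ → ℂ)
    (hf : Saddle.IsHyperbolicMorse f)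
    (hP : Saddle.IsRealAnalytic P) (hQ : Saddle.IsRealAnalytic Q)
    (hsep : Saddle.AxesAreSeparatrices f P Q)
    (hpos : Saddle.PositiveOnFirstQuadrant f) :
    ∃ a : ℝ, 0 < a ∧ ∀ x₀ ∈ Ioo (0 : ℝ) a, ∀ y₀ ∈ Ioo (0 : ℝ) a, ∀ σ τ : ℂ → ℂ × ℂ,
      Saddle.IsCrossSection f (0, (y₀ : ℂ)) σ → Saddle.IsCrossSection f ((x₀ : ℂ), 0) τ →
      (∃ h : ℝ → ℂ → ℂ, Saddle.IsHolonomy f P Q x₀ τ h) ∧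
      ∀ h : ℝ → ℂ → ℂ, Saddle.IsHolonomy f P Q x₀ τ h →
      ∀ (d : ℕ) (M : ℂ → ℂ), 1 ≤ d → Saddle.HasPoincarePontryagin h d M →
      ∃ ε₀ : ℝ, 0 < ε₀ ∧ ∃ r : ℝ, 0 < r ∧ ∃ ρ : ℝ → ℝ, Continuous ρ ∧ (∀ φ, 0 < ρ φ ∧ ρ φ ≤ r) ∧
      ∃ D : ℝ → ℂ → ℂ,
        (∀ ε ∈ Ioo (-ε₀) ε₀, Saddle.IsDulacMap f P Q a ε σ τ r ρ (D ε)) ∧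
      ∃ R V : ℝ × ℝ → ℝ,
        AnalyticOnNhd ℝ R (Ioo (-r) r ×ˢ Ioo (-ε₀) ε₀) ∧
        AnalyticOnNhd ℝ V (Ioo (-r) r ×ˢ Ioo (-ε₀) ε₀) ∧
        (∀ u ∈ Ioo (-r) r, ∀ ε ∈ Ioo (-ε₀) ε₀,
          (V (u, ε) : ℂ) = (ε : ℂ) ^ d / (2 * Complex.I) * M u + (ε : ℂ) ^ (d + 1) * R (u, ε)) ∧
        (∀ ε ∈ Ioo (-ε₀) ε₀, V (0, ε) = 0) ∧
        ∀ ε ∈ Ioo (-ε₀) ε₀,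
          {z ∈ Saddle.sector ρ (Ioo 0 (3 * Real.pi / 2)) | (D ε z).im = 0} =
          {z ∈ Saddle.sector ρ (Ioo 0 (3 * Real.pi / 2)) | z.re < 0 ∧ z.im = V (z.re, ε)} := by
  obtain ⟨a, b, R, κ, K, r, X, hchart⟩ := Saddle.exists_isChart hf hP hQ hsep hpos
  -- The square is chosen so that `log x` stays two units to the left of the section `log x = X` and
  -- `|y|` may grow by the factor `5` within radius `r`.
  have hA : 0 < min (Real.exp (X - 2)) (r / 10) :=
    lt_min (Real.exp_pos _) (div_pos hchart.slope.r_pos (by norm_num))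
  refine ⟨min (Real.exp (X - 2)) (r / 10), hA, fun x₀ hx₀ y₀ hy₀ σ τ hσ hτ => ?_⟩
  obtain ⟨α, υ, ξ, ω, ρ, T⟩ :=
    hchart.exists_isTransit hA (min_le_left _ _) (min_le_right _ _) hx₀ hy₀ hσ hτ
  obtain ⟨C, M', s, hs⟩ := T.exists_isScale
  obtain ⟨H, hH, hH0, hHs⟩ := hs.exists_holonomy
  refine ⟨⟨_, hs.isHolonomy hx₀.1 hH hH0 hHs⟩, fun h hh d M hd hM => ?_⟩
  exact hs.exists_dulac hH hH0 hHs (Nat.one_le_iff_ne_zero.1 hd)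
    (hM.congr (hs.eventually_eq_of_isHolonomy hx₀ hHs hh))
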